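/- Let $n\ge 0$, let $\theta>1$ be real, let $K\ge 1$ be an integer, and fix a norm on the space of real $2n\times 2n$ matrices. Identify $\mathbb R^{2n}$ with $\mathbb C^n$, write $\|z\|^2=\sum_{j=1}^n|z_j|^2$, let $J_{st}$ be the standard complex structure (multiplication by $i$) and let $\mathbb B=\{z\in\mathbb C^n:\|z\|<1\}$. Then there are constants $\lambda_0>0$ and $C>0$, depending only on $n$, $\theta$, $K$ and the chosen matrix norm, with the following property. Let $0<\lambda\le\lambda_0$ and let $J$ be a $\mathcal C^\infty$ almost complex structure on $\mathbb C^n$ (a smooth matrix-valued function with $J(z)^2=-I$ for all $z$), not necessarily integrable, such that, for all real multi-indices $\alpha\in\mathbb N^{2n}$ and all $z\in\mathbb C^n$, $$\|D^\alpha J(z)-D^\alpha J_{st}(z)\|\le\frac{\lambda}{1+\|z\|^{|\alpha|+\theta}}\quad\text{if }0\le|\alpha|\le 1,$$ $$\|D^\alpha J(z)-D^\alpha J_{st}(z)\|\le\frac{\lambda}{1+\|z\|^{|\alpha|}}\quad\text{if }2\le|\alpha|\le K.$$ Then for every $v\in\mathbb C^n$ with $\|v\|=1$ there is a $J$-complex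 line, that is, a $\mathcal C^\infty$ map $L_J^v:\mathbb C\to\mathbb C^n$ with $dL_J^v\circ J_{st}=J\circ dL_J^v$, such that $$\sup_{\zeta\in\mathbb C}\|L_J^v(\zeta)-\zeta v\|\le C\lambda,$$ and these lines can be chosen so that $$\mathbb C^n\setminus\mathbb B\subset\{L_J^v(\zeta):\ \|v\|=1,\ \zeta\in\mathbb C\}.$$ -/

import Mathlib

open scoped ContDiff

namespace JLines

/-- The space `ℂⁿ` with the norm `‖z‖² = ∑ |z_j|²`. -/
abbrev Cn (n : ℕ) : Type := EuclideanSpace ℂ (Fin n)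

/-- Real endomorphisms of `ℂⁿ = ℝ²ⁿ`, that is, real `2n × 2n` matrices. -/
abbrev EndR (n : ℕ) : Type := Cn n →L[ℝ] Cn n

/-- The standard complex structure `v ↦ i v`, as a real-linear map. -/
noncomputable def stdJ (V : Type*) [NormedAddCommGroup V] [NormedSpace ℂ V] [NormedSpace ℝ V]
    [IsScalarTower ℝ ℂ V] : V →L[ℝ] V :=
  (Complex.I • ContinuousLinearMap.id ℂ V).restrictScalars ℝ

/-- A smooth almost complex structure on `ℝ²ⁿ = ℂⁿ`, as a matrix-valued function. -/
structure IsAlmostComplex {n : ℕ} (J : Cn n → EndR n) : Prop where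
  smooth : ContDiff ℝ ∞ J
  sq : ∀ z, (J z).comp (J z) = -ContinuousLinearMap.id ℝ (Cn n)

/-- The `2n` real coordinate directions of `ℂⁿ`: `(j, 0)` is `∂/∂x_j`, `(j, 1)` is `∂/∂y_j`. -/
noncomputable def coordDir {n : ℕ} (c : Fin n × Fin 2) : Cn n :=
  EuclideanSpace.single c.1 (if c.2 = 0 then 1 else Complex.I)

/-- The iterated partial derivative of order `k` of a matrix-valued function along the real
coordinates `c 0, …, c (k-1)`. As `c` ranges over all `k`-tuples, these are, for smooth `F`,
all the `D^α F` with `|α| = k`. -/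
noncomputable def partialD {n k : ℕ} (c : Fin k → Fin n × Fin 2) (F : Cn n → EndR n) (z : Cn n) :
    EndR n :=
  iteratedFDeriv ℝ k F z (fun i => coordDir (c i))

/-- The decay conditions on `J - J_st`, with respect to the norm `N` on matrices. -/
structure DecayConditions {n : ℕ} (N : Seminorm ℝ (EndR n)) (θ : ℝ) (K : ℕ) (lam : ℝ)
    (J : Cn n → EndR n) : Prop where
  low : ∀ k : ℕ, k ≤ 1 → ∀ (c : Fin k → Fin n × Fin 2) (z : Cn n),
    N (partialD c J z - partialD c (fun _ => stdJ (Cn n)) z) ≤ lam / (1 + ‖z‖ ^ ((k : ℝ) + θ))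
  high : ∀ k : ℕ, 2 ≤ k → k ≤ K → ∀ (c : Fin k → Fin n × Fin 2) (z : Cn n),
    N (partialD c J z - partialD c (fun _ => stdJ (Cn n)) z) ≤ lam / (1 + ‖z‖ ^ k)

/-- A `J`-complex line: a smooth map `L : ℂ → ℂⁿ` with `dL ∘ J_st = J ∘ dL`. -/
structure IsComplexLine {n : ℕ} (J : Cn n → EndR n) (L : ℂ → Cn n) : Prop where
  smooth : ContDiff ℝ ∞ L
  holo : ∀ ζ, (fderiv ℝ L ζ).comp (stdJ ℂ) = (J (L ζ)).comp (fderiv ℝ L ζ)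

end JLines

open MeasureTheory Filter Topology Set
open scoped ContDiff ENNReal NNReal


/-! ### Kernel integrals in the plane. -/

namespace JLines

/-! When `J` is close to the standard structure, `Q = (i + J)⁻¹(i - J)` is a small complex
antilinear matrix field, and a map `L` is `J`-complex exactly when `∂̄L = Q(L) ∂L`. Put `L(ζ) = ζv +
u(ζ)` and `h = ∂u`. A decaying `u` is the Cauchy transform `T` of `g = ∂̄u`, and `h` is the Beurling
transform `S` of `g`. So the problem is the fixed point equation `(u, h) = (T g, S g)` with `g =
Q(ζv + u)(v + h)`. It is a contraction once `λ` is small, with a solution of size `O(λ)`.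

The function space must make `S` bounded and `T` bounded into continuous decaying functions. In
place of `Lᵖ` with `p > 2` and Calderón–Zygmund theory, `h` lives in a Morrey-type space: `k ∈ L²`
with `sup_a ‖(1 + |w - a|^{-s}) k‖₂` finite. The weight `|w - a|^{-s}` brings the kernel `|w -
a|⁻¹`, which just fails to be locally square integrable, into `L²`. The bound for `S` with this
weight is elementary: integration by parts compares weighted norms of `∂f` and `∂̄f` up to a
gradient term (`lintegral_weighted_energy_le`), and a Hardy inequality obtained from the
Cauchy–Pompeiu formula (`exists_hardy`) absorbs that term. This gives
`exists_lintegral_weighted_dz_le`, extended by density to `exists_wNorm_mw_beurling_le`.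

With `⟨w⟩ = (1 + |w|²)^{1/2}`, so that `jap α w = ⟨w⟩^{2α}`, choose `s` with `1 + 4s ≤ θ`. The decay
`⟨ζ⟩^{-(1+4s)}` of `Q` along the line is split as `⟨ζ⟩^{-3s} ⟨ζ⟩^{-(1+s)}`. The factor
`⟨ζ⟩^{-(1+s)}` places the constant `v` in the Morrey space, and `⟨ζ⟩^{-3s}` makes the Cauchy
transform decay like `⟨z⟩^{-s}` (`exists_norm_cauchyT_wt_le`).

Smoothness does not use an elliptic bootstrap. Deform the plane by `φ_t(ζ) = ζ + tχ(ζ)` with `χ` a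
bump equal to 1 at `ζ₀`. The increments `(L∘φ_t - L, h∘φ_t - h)` solve a fixed point equation that
is smooth in all variables, because superposition with the smooth `Q` is smooth on bounded
continuous functions (`contDiff_nem`). The implicit function theorem makes the increments smooth in
`t`, and evaluation at `ζ₀` makes `t ↦ L(ζ₀ + t)` smooth (`IsSol.contDiff_line`).

For the covering, let `r = ‖p‖ ≥ 1` and `v₀ = p/r`. Solutions depend on the direction with Lipschitz
constant 1/2, so `w = v₀ - r⁻¹ u_w(r)` has a solution `w` near `v₀`. The line of direction `w`
passes through `p` at `ζ = r`. Uniqueness of solutions identifies it, after rescaling `ζ`, with the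
line of the unit direction `w/‖w‖` (`IsSol.scale`, `exists_line_through`). -/

lemma rpow_neg_mul_rpow_neg_le {A B x y : ℝ} (hA : 0 < A) (hB : 0 < B) (hx : 0 ≤ x) (hy : 0 ≤ y) :
    A ^ (-x) * B ^ (-y) ≤ A ^ (-(x + y)) + B ^ (-(x + y)) := by
  have e1 : A ^ (-(x + y)) = A ^ (-x) * A ^ (-y) := by rw [← Real.rpow_add hA]; ring_nf
  have e2 : B ^ (-(x + y)) = B ^ (-x) * B ^ (-y) := by rw [← Real.rpow_add hB]; ring_nf
  rcases le_total A B with h | h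
  · have : B ^ (-y) ≤ A ^ (-y) := Real.rpow_le_rpow_of_nonpos hA h (by linarith)
    have h1 : A ^ (-x) * B ^ (-y) ≤ A ^ (-(x + y)) := by rw [e1]; gcongr
    have := Real.rpow_nonneg hB.le (-(x + y))
    linarith
  · have : A ^ (-x) ≤ B ^ (-x) := Real.rpow_le_rpow_of_nonpos hB h (by linarith)
    have h1 : A ^ (-x) * B ^ (-y) ≤ B ^ (-(x + y)) := by rw [e2]; gcongr
    have := Real.rpow_nonneg hA.le (-(x + y))
    linarith

lemma lintegral_ball_norm_rpow_lt_top {γ : ℝ} (hγ : γ < 2) :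
    ∫⁻ w : ℂ in Metric.ball 0 1, ENNReal.ofReal (‖w‖ ^ (-γ)) < ⊤ := by
  have : IntegrableOn (fun w : ℂ => ‖w‖ ^ (-γ)) (Metric.ball 0 1) := by
    refine integrableOn_ball_of_norm_le_rpow (C := 1) (α := γ) (by simp) (by simpa using hγ) ?_ ?_
    · refine Filter.Eventually.of_forall fun x => ?_
      rw [Real.norm_of_nonneg (by positivity), one_mul]
    · exact (measurable_norm.pow_const _).aestronglyMeasurable
  exact this.lintegral_lt_top

lemma lintegral_japanese_lt_top {q : ℝ} (hq : 2 < q) :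
    ∫⁻ w : ℂ, ENNReal.ofReal ((1 + ‖w‖ ^ 2) ^ (-q / 2)) < ⊤ :=
  (integrable_rpow_neg_one_add_norm_sq (E := ℂ) (by simpa using hq)).lintegral_lt_top

lemma norm_rpow_neg_le_japanese {c x γ : ℝ} (hγ : 0 ≤ γ) (hx : 0 < x) (hc : 0 < c)
    (h : 1 + x ^ 2 ≤ c * x ^ 2) : x ^ (-γ) ≤ c ^ (γ / 2) * (1 + x ^ 2) ^ (-γ / 2) := by
  have h1 : (c * x ^ 2) ^ (-γ / 2) ≤ (1 + x ^ 2) ^ (-γ / 2) :=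
    Real.rpow_le_rpow_of_nonpos (by positivity) h (by linarith)
  rw [Real.mul_rpow hc.le (by positivity), ← Real.rpow_natCast x 2, ← Real.rpow_mul hx.le] at h1
  have e : ((2 : ℕ) : ℝ) * (-γ / 2) = -γ := by push_cast; ring
  rw [e] at h1
  calc x ^ (-γ) = c ^ (γ / 2) * (c ^ (-γ / 2) * x ^ (-γ)) := by
        rw [← mul_assoc, ← Real.rpow_add hc]; ring_nf; simp
    _ ≤ _ := by
      rw [Real.rpow_natCast] at h1
      gcongr

/-- Two-centre kernel integrals are bounded uniformly in the second centre. -/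
lemma exists_lintegral_two_centre_le {α γ : ℝ} (hα : 0 ≤ α) (hγ : 0 ≤ γ) (hγ2 : γ < 2)
    (hαγ : 2 < α + γ) : ∃ C : ℝ≥0∞, C < ⊤ ∧ ∀ a : ℂ,
      ∫⁻ w : ℂ, ENNReal.ofReal ((1 + ‖w‖ ^ 2) ^ (-α / 2) * ‖w - a‖ ^ (-γ)) ≤ C := by
  set I₁ := ∫⁻ w : ℂ in Metric.ball 0 1, ENNReal.ofReal (‖w‖ ^ (-γ)) with hI₁
  set I₂ := ∫⁻ w : ℂ, ENNReal.ofReal ((1 + ‖w‖ ^ 2) ^ (-(α + γ) / 2)) with hI₂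
  set c : ℝ := 2 ^ (γ / 2)
  refine ⟨I₁ + ENNReal.ofReal c * (I₂ + I₂), ?_, fun a => ?_⟩
  · have h1 := lintegral_ball_norm_rpow_lt_top hγ2
    have h2 := lintegral_japanese_lt_top hαγ
    exact ENNReal.add_lt_top.2 ⟨h1, ENNReal.mul_lt_top ENNReal.ofReal_lt_top
      (ENNReal.add_lt_top.2 ⟨h2, h2⟩)⟩
  -- Within distance 1 of `a` only the singularity matters, and `γ < 2` makes it integrable. Farther
  -- away the product of two powers is at most the sum of the two powers of total order `α + γ > 2`,
  -- one around each centre. Translation invariance makes everything uniform in `a`.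
  have hpt : ∀ w : ℂ, ENNReal.ofReal ((1 + ‖w‖ ^ 2) ^ (-α / 2) * ‖w - a‖ ^ (-γ)) ≤
      (Metric.ball 0 1).indicator (fun w : ℂ => ENNReal.ofReal (‖w‖ ^ (-γ))) (w - a) +
      ENNReal.ofReal c * (ENNReal.ofReal ((1 + ‖w‖ ^ 2) ^ (-(α + γ) / 2)) +
        ENNReal.ofReal ((1 + ‖w - a‖ ^ 2) ^ (-(α + γ) / 2))) := by
    intro w
    by_cases hw : w - a ∈ Metric.ball (0 : ℂ) 1
    · rw [indicator_of_mem hw]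
      refine le_add_right (ENNReal.ofReal_le_ofReal ?_)
      have : (1 + ‖w‖ ^ 2) ^ (-α / 2) ≤ 1 :=
        Real.rpow_le_one_of_one_le_of_nonpos (by nlinarith [sq_nonneg ‖w‖]) (by linarith)
      exact mul_le_of_le_one_left (by positivity) this
    · rw [indicator_of_notMem hw, zero_add]
      have hw1 : 1 ≤ ‖w - a‖ := by simpa using hw
      rw [← ENNReal.ofReal_add (by positivity) (by positivity),
        ← ENNReal.ofReal_mul (by positivity)]
      refine ENNReal.ofReal_le_ofReal ?_
      have h1 := norm_rpow_neg_le_japanese (c := 2) (x := ‖w - a‖) hγ (by linarith) (by norm_num)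
        (by nlinarith)
      have h2 := rpow_neg_mul_rpow_neg_le (A := 1 + ‖w‖ ^ 2) (B := 1 + ‖w - a‖ ^ 2) (x := α / 2)
        (y := γ / 2) (by positivity) (by positivity) (by linarith) (by linarith)
      calc (1 + ‖w‖ ^ 2) ^ (-α / 2) * ‖w - a‖ ^ (-γ)
          ≤ (1 + ‖w‖ ^ 2) ^ (-α / 2) * (c * (1 + ‖w - a‖ ^ 2) ^ (-γ / 2)) := by gcongr
        _ = c * ((1 + ‖w‖ ^ 2) ^ (-(α / 2)) * (1 + ‖w - a‖ ^ 2) ^ (-(γ / 2))) := by ring_nf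
        _ ≤ _ := by
          refine mul_le_mul_of_nonneg_left (h2.trans (le_of_eq ?_)) (by positivity)
          ring_nf
  refine (lintegral_mono hpt).trans ?_
  rw [lintegral_add_right _ (by fun_prop), lintegral_const_mul _ (by fun_prop),
    lintegral_add_right _ (by fun_prop)]
  rw [lintegral_sub_right_eq_self
      (fun w : ℂ => (Metric.ball 0 1).indicator (fun w : ℂ => ENNReal.ofReal (‖w‖ ^ (-γ))) w) a,
    lintegral_indicator Metric.isOpen_ball.measurableSet,
    lintegral_sub_right_eq_self
      (fun w : ℂ => ENNReal.ofReal ((1 + ‖w‖ ^ 2) ^ (-(α + γ) / 2))) a]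

lemma lintegral_comp_real_smul (r : ℝ) (hr : 0 < r) (f : ℂ → ℝ≥0∞) (hf : Measurable f) :
    ∫⁻ w : ℂ, f w = ENNReal.ofReal (r ^ 2) * ∫⁻ w : ℂ, f (r • w) := by
  have h := Measure.map_addHaar_smul (volume : Measure ℂ) hr.ne'
  have h2 : ∫⁻ w : ℂ, f (r • w) = ∫⁻ w, f w ∂(Measure.map (fun x : ℂ => r • x) volume) := by
    rw [lintegral_map hf (by fun_prop)]
  rw [h2]
  have h' : Measure.map (fun x : ℂ => r • x) volume = Measure.map (r • ·) (volume : Measure ℂ) := rfl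
  rw [h', h, lintegral_smul_measure, smul_eq_mul, ← mul_assoc, ← ENNReal.ofReal_mul (by positivity)]
  have : r ^ 2 * |(r ^ Module.finrank ℝ ℂ)⁻¹| = 1 := by
    rw [Complex.finrank_real_complex, abs_of_pos (by positivity)]
    field_simp
  rw [this]; simp

/-- The Riesz composition estimate `∫ |w|⁻ᵖ |w - z|⁻¹ dw ≤ C |z|¹⁻ᵖ`. -/
lemma exists_lintegral_riesz_le {p : ℝ} (hp : 1 < p) (hp2 : p < 2) :
    ∃ C : ℝ≥0∞, C < ⊤ ∧ ∀ z : ℂ, z ≠ 0 →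
      ∫⁻ w : ℂ, ENNReal.ofReal (‖w‖ ^ (-p) * ‖w - z‖ ^ (-1 : ℝ)) ≤
        C * ENNReal.ofReal (‖z‖ ^ (1 - p)) := by
  obtain ⟨C₂, hC₂, hb₂⟩ := exists_lintegral_two_centre_le (α := p) (γ := 1) (by linarith)
    (by norm_num) (by norm_num) (by linarith)
  set I₁ := ∫⁻ w : ℂ in Metric.ball 0 1, ENNReal.ofReal (‖w‖ ^ (-p)) with hI₁
  have hI : I₁ < ⊤ := lintegral_ball_norm_rpow_lt_top hp2
  set c : ℝ := 5 ^ (p / 2)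
  -- By scaling only `|z| = 1` has to be treated. For `|w| < 1/2` the second factor is at most 2.
  -- Otherwise `1 + |w|² ≤ 5|w|²`, hence the constant `5 ^ (p / 2)`, and the two-centre estimate
  -- applies.
  have key : ∀ e : ℂ, ‖e‖ = 1 →
      ∫⁻ w : ℂ, ENNReal.ofReal (‖w‖ ^ (-p) * ‖w - e‖ ^ (-1 : ℝ)) ≤ 2 * I₁ + ENNReal.ofReal c * C₂ := by
    intro e he
    have hpt : ∀ w : ℂ, ENNReal.ofReal (‖w‖ ^ (-p) * ‖w - e‖ ^ (-1 : ℝ)) ≤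
        2 * (Metric.ball 0 1).indicator (fun w : ℂ => ENNReal.ofReal (‖w‖ ^ (-p))) w +
        ENNReal.ofReal c * ENNReal.ofReal ((1 + ‖w‖ ^ 2) ^ (-p / 2) * ‖w - e‖ ^ (-1 : ℝ)) := by
      intro w
      by_cases hw : ‖w‖ < 1 / 2
      · rw [indicator_of_mem (by simp; linarith)]
        refine le_add_right ?_
        have : (2 : ℝ≥0∞) = ENNReal.ofReal 2 := by simp
        rw [this, ← ENNReal.ofReal_mul (by norm_num)]
        refine ENNReal.ofReal_le_ofReal ?_
        rw [mul_comm]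
        gcongr
        have h1 : 1 / 2 ≤ ‖w - e‖ := by
          have := norm_sub_norm_le e w
          rw [norm_sub_rev] at this; linarith
        rw [Real.rpow_neg_one]
        calc ‖w - e‖⁻¹ ≤ (1 / 2 : ℝ)⁻¹ := by gcongr
          _ = 2 := by norm_num
      · refine le_add_left ?_
        rw [← ENNReal.ofReal_mul (by positivity)]
        refine ENNReal.ofReal_le_ofReal ?_
        rw [← mul_assoc]
        gcongr
        have : 1 / 2 ≤ ‖w‖ := by linarith
        exact norm_rpow_neg_le_japanese (by linarith) (by linarith) (by norm_num) (by nlinarith)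
    refine (lintegral_mono hpt).trans ?_
    rw [lintegral_add_right _ (by fun_prop), lintegral_const_mul' _ _ (by simp),
      lintegral_const_mul' _ _ (by simp), lintegral_indicator Metric.isOpen_ball.measurableSet]
    gcongr
    exact hb₂ e
  refine ⟨2 * I₁ + ENNReal.ofReal c * C₂, ?_, fun z hz => ?_⟩
  · exact ENNReal.add_lt_top.2 ⟨ENNReal.mul_lt_top (by simp) hI,
      ENNReal.mul_lt_top ENNReal.ofReal_lt_top hC₂⟩
  have hz' : 0 < ‖z‖ := norm_pos_iff.2 hz
  rw [lintegral_comp_real_smul ‖z‖ hz' _ (by fun_prop)]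
  have e1 : ∀ w : ℂ, ENNReal.ofReal (‖‖z‖ • w‖ ^ (-p) * ‖‖z‖ • w - z‖ ^ (-1 : ℝ)) =
      ENNReal.ofReal (‖z‖ ^ (-p - 1)) *
        ENNReal.ofReal (‖w‖ ^ (-p) * ‖w - ‖z‖⁻¹ • z‖ ^ (-1 : ℝ)) := by
    intro w
    rw [← ENNReal.ofReal_mul (by positivity)]
    congr 1
    have : ‖z‖ • w - z = ‖z‖ • (w - ‖z‖⁻¹ • z) := by
      rw [smul_sub, smul_smul, mul_inv_cancel₀ hz'.ne', one_smul]
    rw [this, norm_smul, norm_smul, Real.norm_of_nonneg hz'.le,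
      Real.mul_rpow hz'.le (norm_nonneg _), Real.mul_rpow hz'.le (norm_nonneg _),
      sub_eq_add_neg (-p), Real.rpow_add hz']
    ring
  simp_rw [e1]
  rw [lintegral_const_mul' _ _ (by simp), ← mul_assoc, ← ENNReal.ofReal_mul (by positivity),
    mul_comm]
  have e2 : ‖z‖ ^ 2 * ‖z‖ ^ (-p - 1) = ‖z‖ ^ (1 - p) := by
    rw [← Real.rpow_natCast, ← Real.rpow_add hz']; congr 1; push_cast; ring
  rw [e2]
  gcongr
  exact key _ (by rw [norm_smul, norm_inv, norm_norm, inv_mul_cancel₀ hz'.ne'])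

/-- Cauchy-Schwarz for lower integrals. -/
lemma lintegral_mul_sq_le {α : Type*} [MeasurableSpace α] (μ : Measure α) {f g : α → ℝ≥0∞}
    (hf : AEMeasurable f μ) (hg : AEMeasurable g μ) :
    (∫⁻ x, f x * g x ∂μ) ^ 2 ≤ (∫⁻ x, f x ^ 2 ∂μ) * ∫⁻ x, g x ^ 2 ∂μ := by
  have h := ENNReal.lintegral_mul_le_Lp_mul_Lq μ Real.HolderConjugate.two_two hf hg
  simp only [Pi.mul_apply, ENNReal.rpow_two] at h
  calc _ ≤ ((∫⁻ x, f x ^ 2 ∂μ) ^ (1 / 2 : ℝ) * (∫⁻ x, g x ^ 2 ∂μ) ^ (1 / 2 : ℝ)) ^ 2 := by gcongr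
    _ = _ := by
      rw [mul_pow, ← ENNReal.rpow_natCast, ← ENNReal.rpow_mul, ← ENNReal.rpow_natCast,
        ← ENNReal.rpow_mul]; simp

end JLines

/-! ### Wirtinger derivatives and the Cauchy–Pompeiu formula. -/

namespace JLines

section calculus
variable {E : Type*} [NormedAddCommGroup E] [NormedSpace ℝ E] [NormedSpace ℂ E]

/-- The Wirtinger derivative `∂f/∂ζ`. -/
noncomputable def dz (f : ℂ → E) (z : ℂ) : E :=
  (2⁻¹ : ℂ) • (fderiv ℝ f z 1 - Complex.I • fderiv ℝ f z Complex.I)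

/-- The Wirtinger derivative `∂f/∂ζ̄`. -/
noncomputable def dzb (f : ℂ → E) (z : ℂ) : E :=
  (2⁻¹ : ℂ) • (fderiv ℝ f z 1 + Complex.I • fderiv ℝ f z Complex.I)

/-- The Cauchy transform. -/
noncomputable def cauchyT (g : ℂ → E) (z : ℂ) : E :=
  ((Real.pi : ℂ)⁻¹) • ∫ w, (z - w)⁻¹ • g w

end calculus

variable {n : ℕ}

lemma fderiv_apply_eq (A : ℂ →L[ℝ] Cn n) (ζ : ℂ) :
    A ζ = ζ.re • A 1 + ζ.im • A Complex.I := by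
  conv_lhs => rw [show ζ = ζ.re • (1 : ℂ) + ζ.im • Complex.I by simp]
  rw [map_add, map_smul, map_smul]

lemma fderiv_eq_dz_dzb (f : ℂ → Cn n) (z ζ : ℂ) :
    fderiv ℝ f z ζ = ζ • dz f z + (starRingEnd ℂ ζ) • dzb f z := by
  rw [fderiv_apply_eq, dz, dzb]
  ext i
  simp only [PiLp.add_apply, PiLp.smul_apply, PiLp.sub_apply, smul_eq_mul, Complex.real_smul]
  set a := (fderiv ℝ f z 1) i
  set b := (fderiv ℝ f z Complex.I) i
  have h1 : ζ = ζ.re + ζ.im * Complex.I := (Complex.re_add_im ζ).symm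
  have h2 : (starRingEnd ℂ) ζ = ζ.re - ζ.im * Complex.I := by
    apply Complex.ext <;> simp
  rw [h2]; nth_rewrite 3 [h1]
  linear_combination (ζ.im * b) * Complex.I_sq

/-- In polar coordinates `r w⁻¹ ∂̄F` is half of the radial derivative plus `i/2` times the angular
derivative divided by `r`. Along each ray the radial part integrates to `-F(0)`, and the angular
part vanishes on each circle by periodicity. -/
lemma pompeiu_zero {F : ℂ → Cn n} (hF : ContDiff ℝ 1 F) (hc : HasCompactSupport F) :
    ∫ w : ℂ, w⁻¹ • dzb F w = -(Real.pi : ℂ) • F 0 := by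
  obtain ⟨R, hR, hsupp⟩ : ∃ R : ℝ, 0 < R ∧ ∀ w : ℂ, R < ‖w‖ → fderiv ℝ F w = 0 ∧ F w = 0 := by
    obtain ⟨R, hR, h⟩ := hc.isCompact.isBounded.exists_pos_norm_le
    refine ⟨R, hR, fun w hw => ?_⟩
    have hw' : w ∉ tsupport F := fun h' => absurd (h w h') (by linarith)
    exact ⟨image_eq_zero_of_notMem_tsupport
      (fun h' => hw' (tsupport_fderiv_subset ℝ h')), image_eq_zero_of_notMem_tsupport hw'⟩
  have hF' : Continuous (fderiv ℝ F) := hF.continuous_fderiv (by norm_num)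
  let e : ℝ → ℂ := fun θ => Complex.exp (θ * Complex.I)
  have he : Continuous e := by fun_prop
  have hen : ∀ θ, ‖e θ‖ = 1 := fun θ => Complex.norm_exp_ofReal_mul_I θ
  let G₁ : ℝ × ℝ → Cn n := fun p => fderiv ℝ F (p.1 * e p.2) (e p.2)
  let G₂ : ℝ × ℝ → Cn n := fun p => fderiv ℝ F (p.1 * e p.2) (Complex.I * e p.2)
  have hG₁c : Continuous G₁ := by
    refine Continuous.clm_apply (hF'.comp ?_) ?_ <;> fun_prop
  have hG₂c : Continuous G₂ := by
    refine Continuous.clm_apply (hF'.comp ?_) ?_ <;> fun_prop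
  have hinteg : ∀ G : ℝ × ℝ → Cn n, Continuous G → (∀ p : ℝ × ℝ, R < p.1 → G p = 0) →
      IntegrableOn G (Ioi (0 : ℝ) ×ˢ Ioo (-Real.pi) Real.pi) (volume.prod volume) := by
    intro G hG h0
    have h1 : IntegrableOn G (Icc (0 : ℝ) R ×ˢ Icc (-Real.pi) Real.pi) (volume.prod volume) :=
      hG.continuousOn.integrableOn_compact (isCompact_Icc.prod isCompact_Icc)
    refine IntegrableOn.of_forall_sdiff_eq_zero h1
      (measurableSet_Ioi.prod measurableSet_Ioo) ?_
    rintro ⟨r, θ⟩ ⟨⟨hr, hθ⟩, h2⟩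
    refine h0 _ ?_
    by_contra hcon
    exact h2 ⟨⟨le_of_lt hr, not_lt.1 hcon⟩, Ioo_subset_Icc_self hθ⟩
  have hG0 : ∀ p : ℝ × ℝ, R < p.1 → fderiv ℝ F (p.1 * e p.2) = 0 := by
    intro p hp
    refine (hsupp _ ?_).1
    rw [norm_mul, hen, mul_one, Complex.norm_real]
    exact hp.trans_le (le_abs_self _)
  have hi₁ := hinteg G₁ hG₁c (fun p hp => by simp [G₁, hG0 p hp])
  have hi₂ := hinteg G₂ hG₂c (fun p hp => by simp [G₂, hG0 p hp])
  have h₁ : ∫ p in Ioi (0 : ℝ) ×ˢ Ioo (-Real.pi) Real.pi, G₁ p = -(2 * Real.pi : ℂ) • F 0 := by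
    rw [Measure.volume_eq_prod, ← setIntegral_prod_swap, setIntegral_prod (fun z : ℝ × ℝ => G₁ z.swap) hi₁.swap]
    have : ∀ θ : ℝ, ∫ r in Ioi (0 : ℝ), G₁ (r, θ) = - F 0 := by
      intro θ
      have hd : ∀ r ∈ Ici (0:ℝ), HasDerivAt (fun r : ℝ => F (r * e θ)) (G₁ (r, θ)) r := by
        intro r _
        have h1 : HasDerivAt (fun r : ℝ => (r : ℂ) * e θ) (e θ) r := by
          simpa using (Complex.ofRealCLM.hasDerivAt (x := r)).mul_const (e θ)
        exact ((hF.differentiable (by norm_num)) (r * e θ)).hasFDerivAt.comp_hasDerivAt r h1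
      have hlim : Tendsto (fun r : ℝ => F (r * e θ)) atTop (𝓝 0) := by
        refine tendsto_const_nhds.congr' ?_
        filter_upwards [eventually_gt_atTop R] with r hr
        refine ((hsupp _ ?_).2).symm
        rw [norm_mul, hen, mul_one, Complex.norm_real]
        exact hr.trans_le (le_abs_self _)
      have hio : IntegrableOn (fun r => G₁ (r, θ)) (Ioi 0) := by
        have hc' : Continuous fun r => G₁ (r, θ) := by fun_prop
        refine IntegrableOn.of_forall_sdiff_eq_zero
          (hc'.continuousOn.integrableOn_compact (isCompact_Icc (a := 0) (b := R)))
          measurableSet_Ioi ?_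
        rintro r ⟨hr, h2⟩
        have : R < r := by
          by_contra hcon
          exact h2 ⟨le_of_lt hr, not_lt.1 hcon⟩
        simp [G₁, hG0 (r, θ) this]
      have := integral_Ioi_of_hasDerivAt_of_tendsto' hd hio hlim
      simpa using this
    simp only [Prod.swap_prod_mk, this]
    rw [setIntegral_const]
    simp only [Measure.real, Real.volume_Ioo]
    rw [ENNReal.toReal_ofReal (by linarith [Real.pi_pos])]
    rw [smul_neg, ← neg_smul, ← Complex.coe_smul]
    congr 1
    push_cast
    ring
  have h₂ : ∫ p in Ioi (0 : ℝ) ×ˢ Ioo (-Real.pi) Real.pi, G₂ p = 0 := by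
    rw [Measure.volume_eq_prod, setIntegral_prod _ hi₂]
    refine setIntegral_eq_zero_of_forall_eq_zero fun r hr => ?_
    have hr' : (0 : ℝ) < r := hr
    rw [← integral_Ioc_eq_integral_Ioo, ← intervalIntegral.integral_of_le (by linarith [Real.pi_pos])]
    have hd : ∀ θ ∈ uIcc (-Real.pi) Real.pi,
        HasDerivAt (fun θ : ℝ => r⁻¹ • F (r * e θ)) (G₂ (r, θ)) θ := by
      intro θ _
      have h1 : HasDerivAt (fun θ : ℝ => (r : ℂ) * e θ) (r * (Complex.I * e θ)) θ := by
        have := ((Complex.ofRealCLM.hasDerivAt (x := θ)).mul_const Complex.I).cexp.const_mul (r : ℂ)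
        simpa [e, mul_comm, mul_left_comm] using this
      have h2 := (((hF.differentiable (by norm_num)) (r * e θ)).hasFDerivAt.comp_hasDerivAt θ
        h1).const_smul r⁻¹
      convert! h2 using 1
      have : (r : ℂ) * (Complex.I * e θ) = r • (Complex.I * e θ) := by simp
      rw [this, map_smul, smul_smul, inv_mul_cancel₀ hr'.ne', one_smul]
    rw [intervalIntegral.integral_eq_sub_of_hasDerivAt hd
      (Continuous.intervalIntegrable (by fun_prop) _ _)]
    have : e Real.pi = e (-Real.pi) := by
      simp [e, Complex.exp_neg]
    rw [this, sub_self]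
  rw [← Complex.integral_comp_polarCoord_symm]
  have hpt : ∀ p ∈ Ioi (0 : ℝ) ×ˢ Ioo (-Real.pi) Real.pi,
      p.1 • ((Complex.polarCoord.symm p)⁻¹ • dzb F (Complex.polarCoord.symm p)) =
        (2⁻¹ : ℂ) • (G₁ p + Complex.I • G₂ p) := by
    rintro ⟨r, θ⟩ ⟨hr, -⟩
    have hr' : (r : ℂ) ≠ 0 := Complex.ofReal_ne_zero.2 (ne_of_gt hr)
    have hp : Complex.polarCoord.symm (r, θ) = r * e θ := by
      rw [Complex.polarCoord_symm_apply]
      simp [e, Complex.exp_mul_I]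
    have he0 : e θ ≠ 0 := Complex.exp_ne_zero _
    simp only [hp, G₁, G₂]
    have hconj : starRingEnd ℂ (e θ) = (e θ)⁻¹ := by
      simp [e, ← Complex.exp_conj, ← Complex.exp_neg]
    rw [fderiv_eq_dz_dzb, fderiv_eq_dz_dzb, map_mul, Complex.conj_I, hconj]
    ext i
    simp only [PiLp.add_apply, PiLp.smul_apply, smul_eq_mul, Complex.real_smul]
    field_simp
    linear_combination ((dzb F (r * e θ)) i - (e θ)^2 * (dz F (r * e θ)) i) * Complex.I_sq
  have hi₂' : Integrable (fun p => Complex.I • G₂ p)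
      (volume.restrict (Ioi (0 : ℝ) ×ˢ Ioo (-Real.pi) Real.pi)) := hi₂.smul Complex.I
  have hi₁' : Integrable G₁
      (volume.restrict (Ioi (0 : ℝ) ×ˢ Ioo (-Real.pi) Real.pi)) := hi₁
  rw [polarCoord_target, setIntegral_congr_fun (measurableSet_Ioi.prod measurableSet_Ioo) hpt,
    integral_smul, integral_add hi₁' hi₂', integral_smul, h₁, h₂]
  ext i; simp; ring

lemma dzb_comp_add {f : ℂ → Cn n} (z w : ℂ) : dzb (fun w => f (z + w)) w = dzb f (z + w) := by
  simp [dzb, fderiv_comp_add_left]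

/-- The Cauchy-Pompeiu formula for compactly supported functions. -/
lemma cauchyT_dzb {f : ℂ → Cn n} (hf : ContDiff ℝ 1 f) (hc : HasCompactSupport f) :
    cauchyT (dzb f) = f := by
  funext z
  have h := pompeiu_zero (F := fun w => f (z + w)) (hf.comp (by fun_prop))
    (hc.comp_homeomorph (Homeomorph.addLeft z))
  simp only [dzb_comp_add, add_zero] at h
  have h2 : ∫ w : ℂ, w⁻¹ • dzb f (z + w) = ∫ w : ℂ, (w - z)⁻¹ • dzb f w := by
    rw [← integral_sub_right_eq_self (fun w : ℂ => w⁻¹ • dzb f (z + w)) z]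
    simp
  rw [cauchyT]
  have h3 : ∫ w : ℂ, (z - w)⁻¹ • dzb f w = (Real.pi : ℂ) • f z := by
    have : ∀ w : ℂ, (z - w)⁻¹ • dzb f w = - ((w - z)⁻¹ • dzb f w) := by
      intro w; rw [← neg_sub w z, inv_neg, neg_smul]
    simp_rw [this]
    rw [integral_neg, ← h2, h, neg_smul, neg_neg]
  rw [h3, smul_smul, inv_mul_cancel₀ (by simp [Real.pi_ne_zero]), one_smul]

end JLines

/-! ### Regularity and decay of the Cauchy transform; cut-off functions. -/

namespace JLines

variable {n : ℕ}

lemma locallyIntegrable_inv : LocallyIntegrable (fun w : ℂ => w⁻¹) := by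
  obtain ⟨C, hC, hb⟩ := exists_lintegral_two_centre_le (α := 2) (γ := 1) (by norm_num)
    (by norm_num) (by norm_num) (by norm_num)
  have hinteg : Integrable (fun w : ℂ => ((1 + ‖w‖ ^ 2)⁻¹ : ℝ) • w⁻¹) := by
    refine ⟨(by fun_prop : Measurable _).aestronglyMeasurable, ?_⟩
    refine lt_of_le_of_lt (le_trans (le_of_eq ?_) (hb 0)) hC
    refine lintegral_congr fun w => ?_
    rw [← ofReal_norm, norm_smul, norm_inv, Real.norm_of_nonneg (by positivity), sub_zero,
      Real.rpow_neg_one]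
    norm_num [Real.rpow_neg_one]
  have h2 := hinteg.locallyIntegrable.continuous_smul (g := fun w : ℂ => (1 + ‖w‖ ^ 2 : ℝ)) (by fun_prop)
  refine h2.congr (Eventually.of_forall fun w => ?_)
  have : (1 + ‖w‖ ^ 2 : ℝ) ≠ 0 := by positivity
  simp only [smul_smul, mul_inv_cancel₀ this, one_smul]

lemma cauchyT_eq_convolution (g : ℂ → Cn n) (z : ℂ) :
    cauchyT g z = ((Real.pi : ℂ)⁻¹) •
      convolution (fun w : ℂ => w⁻¹) g (ContinuousLinearMap.lsmul ℝ ℂ) volume z := by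
  rw [cauchyT, convolution]
  congr 1
  rw [← integral_sub_left_eq_self _ _ z]
  simp

lemma contDiff_cauchyT {g : ℂ → Cn n} (hg : ContDiff ℝ ∞ g) (hc : HasCompactSupport g) :
    ContDiff ℝ ∞ (cauchyT g) := by
  have : cauchyT g = fun z => ((Real.pi : ℂ)⁻¹) •
      convolution (fun w : ℂ => w⁻¹) g (ContinuousLinearMap.lsmul ℝ ℂ) volume z :=
    funext (cauchyT_eq_convolution g)
  rw [this]
  exact (hc.contDiff_convolution_right _ locallyIntegrable_inv hg).const_smul _

/-- Derivatives of the convolution fall on `g`, so `∂̄` commutes with the Cauchy transform and the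
Pompeiu formula for `g` itself concludes. -/
lemma dzb_cauchyT {g : ℂ → Cn n} (hg : ContDiff ℝ ∞ g) (hc : HasCompactSupport g) :
    dzb (cauchyT g) = g := by
  have hg1 : ContDiff ℝ 1 g := hg.of_le (by exact_mod_cast le_top)
  conv_rhs => rw [← cauchyT_dzb hg1 hc]
  funext z
  have h := (hc.hasFDerivAt_convolution_right (ContinuousLinearMap.lsmul ℝ ℂ)
    locallyIntegrable_inv hg1 z).const_smul ((Real.pi : ℂ)⁻¹)
  have h2 : HasFDerivAt (cauchyT g) _ z :=
    h.congr_of_eventuallyEq (Eventually.of_forall fun z => cauchyT_eq_convolution g z)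
  have hcont := hg1.continuous_fderiv (by norm_num)
  have hcs := hc.fderiv (𝕜 := ℝ)
  have e : ∀ v : ℂ, fderiv ℝ (cauchyT g) z v = cauchyT (fun w => fderiv ℝ g w v) z := by
    intro v
    rw [h2.fderiv, cauchyT_eq_convolution, _root_.smul_apply,
      convolution_precompR_apply _ locallyIntegrable_inv hcs hcont]
  have hi : ∀ v : ℂ, Integrable (fun w => (z - w)⁻¹ • fderiv ℝ g w v) := by
    intro v
    have hcs' : HasCompactSupport (fun w => fderiv ℝ g w v) := hcs.comp_left (g := fun A : ℂ →L[ℝ] Cn n => A v) rfl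
    have := (hcs'.convolutionExists_right (ContinuousLinearMap.lsmul ℝ ℂ)
      (f := fun w : ℂ => w⁻¹) (μ := volume) locallyIntegrable_inv (by fun_prop)) z
    have h3 := this.integrable_swap
    simpa using h3
  have hi' := (hi Complex.I).smul Complex.I
  rw [dzb, e, e, cauchyT, cauchyT, cauchyT, smul_comm Complex.I, ← smul_add, ← integral_smul,
    ← integral_add (hi 1) (hi' : Integrable (fun w => Complex.I • (z - w)⁻¹ •
      fderiv ℝ g w Complex.I)), smul_comm, ← integral_smul]
  congr 1
  refine integral_congr_ae (Eventually.of_forall fun w => ?_)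
  simp only [dzb, smul_add]
  congr 1
  · rw [smul_comm]
  · rw [smul_comm Complex.I, smul_comm (2⁻¹ : ℂ)]

lemma cauchyT_decay {g : ℂ → Cn n} (hg : Continuous g) (hc : HasCompactSupport g) :
    ∃ C R : ℝ, 0 < R ∧ 0 ≤ C ∧ ∀ z : ℂ, R ≤ ‖z‖ → ‖cauchyT g z‖ ≤ C / ‖z‖ := by
  obtain ⟨R, hR, h⟩ := hc.isCompact.isBounded.exists_pos_norm_le
  refine ⟨‖(Real.pi : ℂ)⁻¹‖ * (2 * ∫ w, ‖g w‖), 2 * R, by linarith, by positivity, fun z hz => ?_⟩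
  have hgi : Integrable g := hg.integrable_of_hasCompactSupport hc
  rw [cauchyT, norm_smul, mul_div_assoc]
  gcongr
  have : ∀ w, ‖(z - w)⁻¹ • g w‖ ≤ 2 / ‖z‖ * ‖g w‖ := by
    intro w
    rw [norm_smul]
    by_cases hw : w ∈ tsupport g
    · have h1 := h w hw
      have h2 : ‖z‖ / 2 ≤ ‖z - w‖ := by
        have := norm_sub_norm_le z w; linarith
      gcongr
      rw [norm_inv]
      calc ‖z - w‖⁻¹ ≤ (‖z‖ / 2)⁻¹ := by
            apply inv_anti₀ _ h2; linarith
        _ = 2 / ‖z‖ := by rw [inv_div]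
    · rw [image_eq_zero_of_notMem_tsupport hw]; simp
  calc _ ≤ ∫ w, 2 / ‖z‖ * ‖g w‖ := norm_integral_le_of_norm_le (hgi.norm.const_mul _)
        (Eventually.of_forall this)
    _ = _ := by rw [integral_const_mul]; ring

lemma dz_smul {χ : ℂ → ℂ} {f : ℂ → Cn n} {z : ℂ} (hχ : DifferentiableAt ℝ χ z)
    (hf : DifferentiableAt ℝ f z) :
    dz (fun w => χ w • f w) z = χ z • dz f z + dz χ z • f z := by
  simp only [dz]
  rw [fderiv_fun_smul hχ hf]
  ext i
  simp
  ring

lemma dzb_smul {χ : ℂ → ℂ} {f : ℂ → Cn n} {z : ℂ} (hχ : DifferentiableAt ℝ χ z)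
    (hf : DifferentiableAt ℝ f z) :
    dzb (fun w => χ w • f w) z = χ z • dzb f z + dzb χ z • f z := by
  simp only [dzb]
  rw [fderiv_fun_smul hχ hf]
  ext i
  simp
  ring

section norms
variable {E : Type*} [NormedAddCommGroup E] [NormedSpace ℝ E] [NormedSpace ℂ E]

lemma norm_dz_le (f : ℂ → E) (z : ℂ) : ‖dz f z‖ ≤ ‖fderiv ℝ f z‖ := by
  have h1 : ‖fderiv ℝ f z 1‖ ≤ ‖fderiv ℝ f z‖ := by simpa using (fderiv ℝ f z).le_opNorm 1
  have h2 : ‖fderiv ℝ f z Complex.I‖ ≤ ‖fderiv ℝ f z‖ := by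
    simpa using (fderiv ℝ f z).le_opNorm Complex.I
  rw [dz, norm_smul, norm_inv, Complex.norm_two]
  have := norm_sub_le (fderiv ℝ f z 1) (Complex.I • fderiv ℝ f z Complex.I)
  rw [norm_smul, Complex.norm_I, one_mul] at this
  linarith

lemma norm_dzb_le (f : ℂ → E) (z : ℂ) : ‖dzb f z‖ ≤ ‖fderiv ℝ f z‖ := by
  have h1 : ‖fderiv ℝ f z 1‖ ≤ ‖fderiv ℝ f z‖ := by simpa using (fderiv ℝ f z).le_opNorm 1
  have h2 : ‖fderiv ℝ f z Complex.I‖ ≤ ‖fderiv ℝ f z‖ := by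
    simpa using (fderiv ℝ f z).le_opNorm Complex.I
  rw [dzb, norm_smul, norm_inv, Complex.norm_two]
  have := norm_add_le (fderiv ℝ f z 1) (Complex.I • fderiv ℝ f z Complex.I)
  rw [norm_smul, Complex.norm_I, one_mul] at this
  linarith

lemma continuous_dz {f : ℂ → E} (hf : ContDiff ℝ 1 f) : Continuous (dz f) := by
  have := hf.continuous_fderiv (by norm_num)
  unfold dz; fun_prop

lemma continuous_dzb {f : ℂ → E} (hf : ContDiff ℝ 1 f) : Continuous (dzb f) := by
  have := hf.continuous_fderiv (by norm_num)
  unfold dzb; fun_prop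

lemma hasCompactSupport_dz {f : ℂ → E} (hc : HasCompactSupport f) : HasCompactSupport (dz f) :=
  (hc.fderiv (𝕜 := ℝ)).comp_left
    (g := fun A : ℂ →L[ℝ] E => (2⁻¹ : ℂ) • (A 1 - Complex.I • A Complex.I)) (by simp)

lemma hasCompactSupport_dzb {f : ℂ → E} (hc : HasCompactSupport f) : HasCompactSupport (dzb f) :=
  (hc.fderiv (𝕜 := ℝ)).comp_left
    (g := fun A : ℂ →L[ℝ] E => (2⁻¹ : ℂ) • (A 1 + Complex.I • A Complex.I)) (by simp)

end norms

/-- A fixed smooth bump, equal to `1` on the unit disc and supported in the disc of radius `2`. -/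
noncomputable def stdBump : ContDiffBump (0 : ℂ) := ⟨1, 2, one_pos, one_lt_two⟩

/-- The bump rescaled to radius `R`. -/
noncomputable def cutoff (R : ℝ) (z : ℂ) : ℂ := (stdBump (R⁻¹ • z) : ℝ)

lemma contDiff_cutoff (R : ℝ) : ContDiff ℝ ∞ (cutoff R) := by
  have : ContDiff ℝ ∞ (fun z : ℂ => stdBump (R⁻¹ • z)) :=
    stdBump.contDiff.comp (contDiff_const_smul _)
  exact Complex.ofRealCLM.contDiff.comp this

lemma norm_cutoff_le (R : ℝ) (z : ℂ) : ‖cutoff R z‖ ≤ 1 := by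
  rw [cutoff, Complex.norm_real, Real.norm_of_nonneg (stdBump.nonneg)]
  exact stdBump.le_one

lemma cutoff_eq_one {R : ℝ} (hR : 0 < R) {z : ℂ} (hz : ‖z‖ ≤ R) : cutoff R z = 1 := by
  rw [cutoff, stdBump.one_of_mem_closedBall]; · simp
  simp only [stdBump, mem_closedBall_zero_iff, norm_smul, norm_inv, Real.norm_of_nonneg hR.le]
  rw [inv_mul_le_iff₀ hR]; linarith

lemma cutoff_eq_zero {R : ℝ} (hR : 0 < R) {z : ℂ} (hz : 2 * R ≤ ‖z‖) : cutoff R z = 0 := by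
  rw [cutoff, stdBump.zero_of_le_dist]; · simp
  simp only [stdBump, dist_zero_right, norm_smul, norm_inv, Real.norm_of_nonneg hR.le]
  rw [le_inv_mul_iff₀ hR]; linarith

lemma tsupport_cutoff_subset {R : ℝ} (hR : 0 < R) :
    tsupport (cutoff R) ⊆ Metric.closedBall 0 (2 * R) := by
  refine closure_minimal (fun z hz => ?_) Metric.isClosed_closedBall
  rw [mem_closedBall_zero_iff]
  by_contra h
  exact hz (cutoff_eq_zero hR (not_le.1 h).le)

lemma hasCompactSupport_cutoff {R : ℝ} (hR : 0 < R) : HasCompactSupport (cutoff R) :=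
  (isCompact_closedBall (0 : ℂ) (2 * R)).of_isClosed_subset (isClosed_tsupport _)
    (tsupport_cutoff_subset hR)

lemma exists_norm_fderiv_cutoff_le : ∃ C : ℝ, 0 ≤ C ∧ ∀ R : ℝ, 0 < R → ∀ z,
    ‖fderiv ℝ (cutoff R) z‖ ≤ C / R := by
  have h1 : ContDiff ℝ ∞ (cutoff 1) := contDiff_cutoff 1
  obtain ⟨C, hC⟩ := ((h1.continuous_fderiv (by simp)).bounded_above_of_compact_support
    ((hasCompactSupport_cutoff one_pos).fderiv (𝕜 := ℝ)))
  refine ⟨C, (norm_nonneg _).trans (hC 0), fun R hR z => ?_⟩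
  have : cutoff R = fun z => cutoff 1 (R⁻¹ • z) := by
    funext z; simp [cutoff]
  rw [this, fderiv_comp_smul, norm_smul, norm_inv, Real.norm_of_nonneg hR.le]
  rw [div_eq_inv_mul]
  gcongr
  exact hC _

lemma fderiv_cutoff_eq_zero {R : ℝ} (hR : 0 < R) {z : ℂ} (hz : ‖z‖ < R ∨ 2 * R < ‖z‖) :
    fderiv ℝ (cutoff R) z = 0 := by
  rcases hz with hz | hz
  · have : cutoff R =ᶠ[𝓝 z] fun _ => 1 := by
      filter_upwards [(continuous_norm.isOpen_preimage _ isOpen_Iio).mem_nhds hz] with w hw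
      exact cutoff_eq_one hR (le_of_lt hw)
    rw [this.fderiv_eq]; simp
  · have : cutoff R =ᶠ[𝓝 z] fun _ => 0 := by
      filter_upwards [(continuous_norm.isOpen_preimage _ isOpen_Ioi).mem_nhds hz] with w hw
      exact cutoff_eq_zero hR (le_of_lt hw)
    rw [this.fderiv_eq]; simp

end JLines

/-! ### The energy identity for `∂` and `∂̄`. -/

namespace JLines

variable {n : ℕ}

lemma real_inner_I_smul_left (x y : Cn n) :
    inner ℝ (Complex.I • x) y = - inner ℝ x (Complex.I • y) := by
  simp only [PiLp.inner_apply, PiLp.smul_apply, Complex.inner, ← Finset.sum_neg_distrib]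
  refine Finset.sum_congr rfl fun i _ => ?_
  simp; ring

/-- Expanding the squares leaves only the cross term. It is a null Lagrangian, so without a weight
it integrates to zero. -/
lemma norm_dz_sq_sub_norm_dzb_sq (f : ℂ → Cn n) (z : ℂ) :
    ‖dz f z‖ ^ 2 - ‖dzb f z‖ ^ 2 =
      - inner ℝ (fderiv ℝ f z 1) (Complex.I • fderiv ℝ f z Complex.I) := by
  rw [dz, dzb, norm_smul, norm_smul, mul_pow, mul_pow, norm_sub_sq_real, norm_add_sq_real,
    norm_inv, Complex.norm_two]
  ring

lemma integral_fderiv_apply_eq_zero {g : ℂ → ℝ} (hg : ContDiff ℝ 1 g) (hc : HasCompactSupport g)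
    (v : ℂ) : ∫ z, fderiv ℝ g z v = 0 := by
  have hcont := hg.continuous_fderiv (by norm_num)
  have h1 : Integrable (fun z => fderiv ℝ g z v) :=
    (by fun_prop : Continuous fun z => fderiv ℝ g z v).integrable_of_hasCompactSupport
      ((hc.fderiv (𝕜 := ℝ)).comp_left (g := fun A : ℂ →L[ℝ] ℝ => A v) rfl)
  have h2 : Integrable g := hg.continuous.integrable_of_hasCompactSupport hc
  have := integral_mul_fderiv_eq_neg_fderiv_mul_of_integrable (μ := (volume : Measure ℂ))
    (f := fun _ : ℂ => (1 : ℝ)) (g := g) (v := v) (by simp) (by simpa using h1) (by simpa using h2)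
    (by simp) (fun x _ => (hg.differentiable (by norm_num)) x)
  simpa using this

/-- The energy identity: weighted `L²` norms of `∂f` and `∂f/∂ζ̄` differ by a first-order term. -/
lemma integral_weighted_energy {f : ℂ → Cn n} (hf : ContDiff ℝ ∞ f) (hc : HasCompactSupport f)
    {ρ : ℂ → ℝ} (hρ : ContDiff ℝ ∞ ρ) (c : Cn n) :
    ∫ z, ρ z * (‖dz f z‖ ^ 2 - ‖dzb f z‖ ^ 2) = ∫ z, 2⁻¹ *
      (fderiv ℝ ρ z 1 * inner ℝ (f z - c) (Complex.I • fderiv ℝ f z Complex.I) -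
        fderiv ℝ ρ z Complex.I * inner ℝ (f z - c) (Complex.I • fderiv ℝ f z 1)) := by
  -- These are the components of the one-form `ρ⟨f - c, i df⟩`. In its exterior derivative the
  -- second derivatives of `f` cancel by symmetry; what remains is twice the weighted cross term and
  -- terms with `dρ`. The constant `c` is free and will be the value of `f` at the singular point of
  -- the weight.
  let P : ℂ → ℂ → ℝ := fun v z => ρ z * inner ℝ (f z - c) (Complex.I • fderiv ℝ f z v)
  have hf' : ContDiff ℝ 1 (fderiv ℝ f) := hf.fderiv_right (by norm_cast)
  have hf1 : ContDiff ℝ 1 f := hf.of_le (by exact_mod_cast le_top)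
  have hf2 : ContDiff ℝ 2 f := hf.of_le (by exact WithTop.coe_le_coe.2 le_top)
  have hρ1 : ContDiff ℝ 1 ρ := hρ.of_le (by exact_mod_cast le_top)
  have hP : ∀ v, ContDiff ℝ 1 (P v) := fun v =>
    hρ1.mul ((hf1.sub contDiff_const).inner ℝ ((hf'.clm_apply contDiff_const).const_smul Complex.I))
  have hPc : ∀ v, HasCompactSupport (P v) := by
    intro v
    refine (hc.fderiv (𝕜 := ℝ)).mono' fun z hz => ?_
    refine subset_tsupport _ ?_
    intro h0
    exact hz (by simp [P, h0])
  have hd : ∀ v u z, fderiv ℝ (P v) z u = fderiv ℝ ρ z u *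
      inner ℝ (f z - c) (Complex.I • fderiv ℝ f z v) +
      ρ z * (inner ℝ (f z - c) (Complex.I • fderiv ℝ (fderiv ℝ f) z u v) +
        inner ℝ (fderiv ℝ f z u) (Complex.I • fderiv ℝ f z v)) := by
    intro v u z
    have h1 := ((hρ1.differentiable (by norm_num)) z).hasFDerivAt
    have h2 := (((hf1.differentiable (by norm_num)) z).hasFDerivAt).sub_const c
    have h3 := ((((hf'.differentiable (by norm_num)) z).hasFDerivAt).clm_apply
      (hasFDerivAt_const v z)).const_smul Complex.I
    have h4 := h1.mul (h2.inner ℝ h3)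
    have h5 : HasFDerivAt (P v) _ z := h4
    rw [h5.fderiv]
    simp
    ring
  have hsym : ∀ z, fderiv ℝ (fderiv ℝ f) z Complex.I 1 = fderiv ℝ (fderiv ℝ f) z 1 Complex.I := by
    intro z
    exact (hf2.contDiffAt.isSymmSndFDerivAt (by simp)).eq _ _
  have hi : ∀ v u, Integrable (fun z => fderiv ℝ (P v) z u) := by
    intro v u
    have hcont := (hP v).continuous_fderiv (by norm_num)
    exact (by fun_prop : Continuous fun z => fderiv ℝ (P v) z u).integrable_of_hasCompactSupport
      (((hPc v).fderiv (𝕜 := ℝ)).comp_left (g := fun A : ℂ →L[ℝ] ℝ => A u) rfl)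
  have h0 : ∫ z, (fderiv ℝ (P Complex.I) z 1 - fderiv ℝ (P 1) z Complex.I) = 0 := by
    rw [integral_sub (hi _ _) (hi _ _), integral_fderiv_apply_eq_zero (hP _) (hPc _),
      integral_fderiv_apply_eq_zero (hP _) (hPc _), sub_zero]
  have hcf := hf1.continuous_fderiv (by norm_num)
  have hcρ := hρ1.continuous_fderiv (by norm_num)
  have hIr : Integrable (fun z => 2⁻¹ *
      (fderiv ℝ ρ z 1 * inner ℝ (f z - c) (Complex.I • fderiv ℝ f z Complex.I) -
        fderiv ℝ ρ z Complex.I * inner ℝ (f z - c) (Complex.I • fderiv ℝ f z 1))) := by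
    refine Continuous.integrable_of_hasCompactSupport ?_ ?_
    · have := hf1.continuous
      fun_prop
    · refine (hc.fderiv (𝕜 := ℝ)).mono' fun z hz => ?_
      refine subset_tsupport _ ?_
      intro h0
      exact hz (by simp [h0])
  have hIl : Integrable (fun z => 2⁻¹ *
      (fderiv ℝ (P Complex.I) z 1 - fderiv ℝ (P 1) z Complex.I)) :=
    ((hi _ _).sub (hi _ _)).const_mul _
  have h1 : ∀ z, ρ z * (‖dz f z‖ ^ 2 - ‖dzb f z‖ ^ 2) = 2⁻¹ *
      (fderiv ℝ ρ z 1 * inner ℝ (f z - c) (Complex.I • fderiv ℝ f z Complex.I) -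
        fderiv ℝ ρ z Complex.I * inner ℝ (f z - c) (Complex.I • fderiv ℝ f z 1)) -
      2⁻¹ * (fderiv ℝ (P Complex.I) z 1 - fderiv ℝ (P 1) z Complex.I) := by
    intro z
    rw [norm_dz_sq_sub_norm_dzb_sq, hd, hd, hsym]
    have := real_inner_I_smul_left (fderiv ℝ f z 1) (fderiv ℝ f z Complex.I)
    rw [real_inner_comm] at this
    linear_combination -ρ z / 2 * this
  simp_rw [h1]
  rw [integral_sub hIr hIl, integral_const_mul 2⁻¹
    (fun z => fderiv ℝ (P Complex.I) z 1 - fderiv ℝ (P 1) z Complex.I), h0, mul_zero, sub_zero]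

lemma norm_fderiv_one_le (f : ℂ → Cn n) (z : ℂ) : ‖fderiv ℝ f z 1‖ ≤ ‖dz f z‖ + ‖dzb f z‖ := by
  rw [fderiv_eq_dz_dzb]; simpa using norm_add_le (dz f z) (dzb f z)

lemma norm_fderiv_I_le (f : ℂ → Cn n) (z : ℂ) :
    ‖fderiv ℝ f z Complex.I‖ ≤ ‖dz f z‖ + ‖dzb f z‖ := by
  rw [fderiv_eq_dz_dzb]
  refine (norm_add_le _ _).trans (le_of_eq ?_)
  simp [norm_smul]

lemma lintegral_ofReal_add_le {α : Type*} [MeasurableSpace α] {μ : Measure α} {a b c : α → ℝ}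
    (ha : Integrable a μ) (hb : Integrable b μ) (hc : Integrable c μ) (ha0 : ∀ x, 0 ≤ a x)
    (hb0 : ∀ x, 0 ≤ b x) (hc0 : ∀ x, 0 ≤ c x) (h : ∫ x, a x ∂μ ≤ ∫ x, b x ∂μ + ∫ x, c x ∂μ) :
    ∫⁻ x, ENNReal.ofReal (a x) ∂μ ≤ ∫⁻ x, ENNReal.ofReal (b x) ∂μ +
      ∫⁻ x, ENNReal.ofReal (c x) ∂μ := by
  rw [← ofReal_integral_eq_lintegral_ofReal ha (Eventually.of_forall ha0),
    ← ofReal_integral_eq_lintegral_ofReal hb (Eventually.of_forall hb0),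
    ← ofReal_integral_eq_lintegral_ofReal hc (Eventually.of_forall hc0),
    ← ENNReal.ofReal_add (integral_nonneg hb0) (integral_nonneg hc0)]
  exact ENNReal.ofReal_le_ofReal h

/-- The energy inequality. -/
lemma lintegral_weighted_energy_le {f : ℂ → Cn n} (hf : ContDiff ℝ ∞ f) (hc : HasCompactSupport f)
    {ρ : ℂ → ℝ} (hρ : ContDiff ℝ ∞ ρ) (hρ0 : ∀ z, 0 ≤ ρ z) (c : Cn n) :
    ∫⁻ z, ENNReal.ofReal (ρ z * ‖dz f z‖ ^ 2) ≤ (∫⁻ z, ENNReal.ofReal (ρ z * ‖dzb f z‖ ^ 2)) +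
      ∫⁻ z, ENNReal.ofReal (‖fderiv ℝ ρ z‖ * (‖f z - c‖ * (‖dz f z‖ + ‖dzb f z‖))) := by
  have hf1 : ContDiff ℝ 1 f := hf.of_le (by exact_mod_cast le_top)
  have hρ1 : ContDiff ℝ 1 ρ := hρ.of_le (by exact_mod_cast le_top)
  have hcdz := continuous_dz hf1
  have hcdzb := continuous_dzb hf1
  have hcf := hf1.continuous_fderiv (by norm_num)
  have hcρ := hρ1.continuous_fderiv (by norm_num)
  have hcρ0 := hρ1.continuous
  have hcf0 := hf1.continuous
  have hsupp : ∀ g : ℂ → ℝ, Continuous g → (∀ z, fderiv ℝ f z = 0 → g z = 0) → Integrable g := by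
    intro g hg h0
    refine hg.integrable_of_hasCompactSupport ((hc.fderiv (𝕜 := ℝ)).mono' fun z hz => ?_)
    exact subset_tsupport _ fun h => hz (h0 z h)
  have i1 : Integrable (fun z => ρ z * ‖dz f z‖ ^ 2) :=
    hsupp _ (by fun_prop) fun z hz => by simp [dz, hz]
  have i2 : Integrable (fun z => ρ z * ‖dzb f z‖ ^ 2) :=
    hsupp _ (by fun_prop) fun z hz => by simp [dzb, hz]
  have i3 : Integrable (fun z => ‖fderiv ℝ ρ z‖ * (‖f z - c‖ * (‖dz f z‖ + ‖dzb f z‖))) :=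
    hsupp _ (by fun_prop) fun z hz => by simp [dz, dzb, hz]
  refine lintegral_ofReal_add_le i1 i2 i3 (fun z => mul_nonneg (hρ0 z) (by positivity))
    (fun z => mul_nonneg (hρ0 z) (by positivity)) (fun z => by positivity) ?_
  have h := integral_weighted_energy hf hc hρ c
  have e : ∀ z, ρ z * (‖dz f z‖ ^ 2 - ‖dzb f z‖ ^ 2) =
    ρ z * ‖dz f z‖ ^ 2 - ρ z * ‖dzb f z‖ ^ 2 := fun z => by ring
  simp_rw [e] at h
  rw [integral_sub i1 i2] at h
  have h2 : ∫ z, 2⁻¹ *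
      (fderiv ℝ ρ z 1 * inner ℝ (f z - c) (Complex.I • fderiv ℝ f z Complex.I) -
        fderiv ℝ ρ z Complex.I * inner ℝ (f z - c) (Complex.I • fderiv ℝ f z 1)) ≤
      ∫ z, ‖fderiv ℝ ρ z‖ * (‖f z - c‖ * (‖dz f z‖ + ‖dzb f z‖)) := by
    refine integral_mono (hsupp _ (by fun_prop) fun z hz => by simp [hz]) i3 fun z => ?_
    have b1 : |fderiv ℝ ρ z 1| ≤ ‖fderiv ℝ ρ z‖ := by simpa using (fderiv ℝ ρ z).le_opNorm 1
    have b2 : |fderiv ℝ ρ z Complex.I| ≤ ‖fderiv ℝ ρ z‖ := by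
      simpa using (fderiv ℝ ρ z).le_opNorm Complex.I
    have b3 : |inner ℝ (f z - c) (Complex.I • fderiv ℝ f z Complex.I)| ≤
        ‖f z - c‖ * (‖dz f z‖ + ‖dzb f z‖) := by
      refine (abs_real_inner_le_norm _ _).trans ?_
      rw [norm_smul, Complex.norm_I, one_mul]
      gcongr; exact norm_fderiv_I_le f z
    have b4 : |inner ℝ (f z - c) (Complex.I • fderiv ℝ f z 1)| ≤
        ‖f z - c‖ * (‖dz f z‖ + ‖dzb f z‖) := by
      refine (abs_real_inner_le_norm _ _).trans ?_
      rw [norm_smul, Complex.norm_I, one_mul]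
      gcongr; exact norm_fderiv_one_le f z
    have c1 := mul_le_mul b1 b3 (abs_nonneg _) (norm_nonneg _)
    have c2 := mul_le_mul b2 b4 (abs_nonneg _) (norm_nonneg _)
    rw [← abs_mul] at c1 c2
    have := (abs_le.1 c1).2
    have := (abs_le.1 c2).1
    simp only
    linarith
  linarith

/-- `∂` and `∂/∂ζ̄` have the same `L²` norm on test functions. -/
lemma lintegral_dz_sq_eq {f : ℂ → Cn n} (hf : ContDiff ℝ ∞ f) (hc : HasCompactSupport f) :
    ∫⁻ z, ENNReal.ofReal (‖dz f z‖ ^ 2) ≤ ∫⁻ z, ENNReal.ofReal (‖dzb f z‖ ^ 2) := by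
  have := lintegral_weighted_energy_le hf hc (ρ := fun _ => 1) contDiff_const (by simp) 0
  simpa using this

end JLines

/-! ### A weighted Hardy inequality. -/

namespace JLines

variable {n : ℕ}

lemma integrable_inv_smul {g : ℂ → Cn n} (hg : Continuous g) (hc : HasCompactSupport g) (z : ℂ) :
    Integrable (fun w => (z - w)⁻¹ • g w) := by
  have := (hc.convolutionExists_right (ContinuousLinearMap.lsmul ℝ ℂ)
    (f := fun w : ℂ => w⁻¹) (μ := volume) locallyIntegrable_inv hg) z
  simpa using this.integrable_swap

lemma exists_lintegral_riesz_le' {p : ℝ} (hp : 1 < p) (hp2 : p < 2) :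
    ∃ C : ℝ≥0∞, C < ⊤ ∧ ∀ a z : ℂ, z ≠ a →
      ∫⁻ w : ℂ, ENNReal.ofReal (‖w - a‖ ^ (-p) * ‖w - z‖ ^ (-1 : ℝ)) ≤
        C * ENNReal.ofReal (‖z - a‖ ^ (1 - p)) := by
  obtain ⟨C, hC, h⟩ := exists_lintegral_riesz_le hp hp2
  refine ⟨C, hC, fun a z hz => ?_⟩
  refine le_trans (le_of_eq ?_) (h (z - a) (sub_ne_zero.2 hz))
  rw [← lintegral_sub_right_eq_self
    (fun w : ℂ => ENNReal.ofReal (‖w‖ ^ (-p) * ‖w - (z - a)‖ ^ (-1 : ℝ))) a]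
  simp

lemma ae_ne_const (a : ℂ) : ∀ᵐ w : ℂ, w ≠ a :=
  compl_mem_ae_iff.2 (measure_singleton a)

/-- Subtract the Pompeiu formulas at `z` and at `a`. The difference of the two kernels is `(a -
z)/((z - w)(a - w))`, which produces the factor `|z - a|`. -/
lemma enorm_sub_le_lintegral {f : ℂ → Cn n} (hf : ContDiff ℝ ∞ f) (hc : HasCompactSupport f)
    (z a : ℂ) : ENNReal.ofReal ‖f z - f a‖ ≤ ENNReal.ofReal ‖z - a‖ *
      ∫⁻ w, ENNReal.ofReal (‖dzb f w‖ * (‖w - a‖ ^ (-1 : ℝ) * ‖w - z‖ ^ (-1 : ℝ))) := by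
  have hf1 : ContDiff ℝ 1 f := hf.of_le (by exact_mod_cast le_top)
  have hg := continuous_dzb hf1
  have hgc := hasCompactSupport_dzb hc
  have h1 : f z - f a = ((Real.pi : ℂ)⁻¹) •
      ∫ w, ((z - w)⁻¹ • dzb f w - (a - w)⁻¹ • dzb f w) := by
    rw [integral_sub (integrable_inv_smul hg hgc z) (integrable_inv_smul hg hgc a), smul_sub]
    conv_lhs => rw [← cauchyT_dzb hf1 hc]
    rfl
  rw [h1, norm_smul, ENNReal.ofReal_mul (norm_nonneg _)]
  have hpi : ENNReal.ofReal ‖(Real.pi : ℂ)⁻¹‖ ≤ 1 := by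
    rw [norm_inv, Complex.norm_real, Real.norm_of_nonneg Real.pi_pos.le]
    refine ENNReal.ofReal_le_one.2 (inv_le_one_of_one_le₀ ?_)
    linarith [Real.pi_gt_three]
  refine (mul_le_mul_left hpi _).trans ?_
  rw [one_mul, ofReal_norm]
  refine (enorm_integral_le_lintegral_enorm _).trans ?_
  rw [← lintegral_const_mul' _ _ ENNReal.ofReal_ne_top]
  refine lintegral_mono_ae ?_
  filter_upwards [ae_ne_const z, ae_ne_const a] with w hz ha
  rw [← sub_smul, ← ofReal_norm, norm_smul, ← ENNReal.ofReal_mul (norm_nonneg _)]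
  refine ENNReal.ofReal_le_ofReal (le_of_eq ?_)
  have hz' : z - w ≠ 0 := sub_ne_zero.2 hz.symm
  have ha' : a - w ≠ 0 := sub_ne_zero.2 ha.symm
  rw [inv_sub_inv hz' ha', norm_div, norm_mul, Real.rpow_neg_one, Real.rpow_neg_one,
    norm_sub_rev w a, norm_sub_rev w z, sub_sub_sub_cancel_right, norm_sub_rev a z]
  field_simp

/-- A weighted Hardy inequality for `∂/∂ζ̄`. -/
lemma exists_hardy {s : ℝ} (hs : 0 < s) (hs1 : s < 1) : ∃ C : ℝ≥0∞, C < ⊤ ∧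
    ∀ f : ℂ → Cn n, ContDiff ℝ ∞ f → HasCompactSupport f → ∀ a : ℂ,
      ∫⁻ z, ENNReal.ofReal (‖f z - f a‖ ^ 2 * ‖z - a‖ ^ (-2 - 2 * s)) ≤
        C * ∫⁻ z, ENNReal.ofReal (‖dzb f z‖ ^ 2 * ‖z - a‖ ^ (-2 * s)) := by
  -- A Schur test. Cauchy–Schwarz in `w` splits `|w - a|⁻¹` as `|w - a|^{-(2-s)/2} |w - a|^{-s/2}`.
  -- The exponent `2 - s` serves the resulting integral in `w`. The powers of `|z - a|` then add up
  -- to `-(1 + s)`, which is the second exponent, for the integral in `z` after Tonelli.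
  obtain ⟨C₁, hC₁, h₁⟩ := exists_lintegral_riesz_le' (p := 2 - s) (by linarith) (by linarith)
  obtain ⟨C₂, hC₂, h₂⟩ := exists_lintegral_riesz_le' (p := 1 + s) (by linarith) (by linarith)
  refine ⟨C₁ * C₂, ENNReal.mul_lt_top hC₁ hC₂, fun f hf hc a => ?_⟩
  have hf1 : ContDiff ℝ 1 f := hf.of_le (by exact_mod_cast le_top)
  have hgm : Measurable (dzb f) := (continuous_dzb hf1).measurable
  let B : ℂ → ℂ → ℝ≥0∞ := fun z w =>
    ENNReal.ofReal (‖dzb f w‖ ^ 2 * (‖w - a‖ ^ (-s) * ‖w - z‖ ^ (-1 : ℝ)))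
  have hstep : ∀ z, z ≠ a → ENNReal.ofReal (‖f z - f a‖ ^ 2 * ‖z - a‖ ^ (-2 - 2 * s)) ≤
      C₁ * (∫⁻ w, ENNReal.ofReal (‖z - a‖ ^ (-(1 + s))) * B z w) := by
    intro z hz
    have hza : 0 < ‖z - a‖ := norm_pos_iff.2 (sub_ne_zero.2 hz)
    have e1 : ∫⁻ w, ENNReal.ofReal (‖dzb f w‖ * (‖w - a‖ ^ (-1 : ℝ) * ‖w - z‖ ^ (-1 : ℝ))) =
        ∫⁻ w, ENNReal.ofReal (‖w - a‖ ^ (-(2 - s) / 2) * ‖w - z‖ ^ (-1 / 2 : ℝ)) *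
          ENNReal.ofReal (‖dzb f w‖ * (‖w - a‖ ^ (-s / 2) * ‖w - z‖ ^ (-1 / 2 : ℝ))) := by
      refine lintegral_congr_ae ?_
      filter_upwards [ae_ne_const z, ae_ne_const a] with w hwz hwa
      have hwz' : 0 < ‖w - z‖ := norm_pos_iff.2 (sub_ne_zero.2 hwz)
      have hwa' : 0 < ‖w - a‖ := norm_pos_iff.2 (sub_ne_zero.2 hwa)
      rw [← ENNReal.ofReal_mul (by positivity)]
      congr 1
      have x1 : ‖w - a‖ ^ (-1 : ℝ) = ‖w - a‖ ^ (-(2 - s) / 2) * ‖w - a‖ ^ (-s / 2) := by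
        rw [← Real.rpow_add hwa']; congr 1; ring
      have x2 : ‖w - z‖ ^ (-1 : ℝ) = ‖w - z‖ ^ (-1 / 2 : ℝ) * ‖w - z‖ ^ (-1 / 2 : ℝ) := by
        rw [← Real.rpow_add hwz']; congr 1; ring
      rw [x1, x2]; ring
    have hsq : ∀ {x : ℝ} (_ : 0 ≤ x) (y : ℝ), (x ^ (y / 2)) ^ 2 = x ^ y := by
      intro x hx y
      rw [← Real.rpow_natCast, ← Real.rpow_mul hx]; congr 1; push_cast; ring
    have e2 := lintegral_mul_sq_le (volume : Measure ℂ)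
      (f := fun w => ENNReal.ofReal (‖w - a‖ ^ (-(2 - s) / 2) * ‖w - z‖ ^ (-1 / 2 : ℝ)))
      (g := fun w => ENNReal.ofReal (‖dzb f w‖ * (‖w - a‖ ^ (-s / 2) * ‖w - z‖ ^ (-1 / 2 : ℝ))))
      (by fun_prop) (by fun_prop)
    rw [← e1] at e2
    have e3 : ∀ w, ENNReal.ofReal (‖w - a‖ ^ (-(2 - s) / 2) * ‖w - z‖ ^ (-1 / 2 : ℝ)) ^ 2 =
        ENNReal.ofReal (‖w - a‖ ^ (-(2 - s)) * ‖w - z‖ ^ (-1 : ℝ)) := by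
      intro w
      rw [← ENNReal.ofReal_pow (by positivity), mul_pow, hsq (norm_nonneg _), hsq (norm_nonneg _)]
    have e4 : ∀ w, ENNReal.ofReal (‖dzb f w‖ * (‖w - a‖ ^ (-s / 2) * ‖w - z‖ ^ (-1 / 2 : ℝ))) ^ 2 =
        B z w := by
      intro w
      rw [← ENNReal.ofReal_pow (by positivity), mul_pow, mul_pow, hsq (norm_nonneg _),
        hsq (norm_nonneg _)]
    simp_rw [e3, e4] at e2
    have e5 := enorm_sub_le_lintegral hf hc z a
    rw [lintegral_const_mul' _ _ ENNReal.ofReal_ne_top]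
    calc ENNReal.ofReal (‖f z - f a‖ ^ 2 * ‖z - a‖ ^ (-2 - 2 * s))
        = ENNReal.ofReal ‖f z - f a‖ ^ 2 * ENNReal.ofReal (‖z - a‖ ^ (-2 - 2 * s)) := by
          rw [ENNReal.ofReal_mul (by positivity), ENNReal.ofReal_pow (by positivity)]
      _ ≤ (ENNReal.ofReal ‖z - a‖ ^ 2 * ((C₁ * ENNReal.ofReal (‖z - a‖ ^ (1 - (2 - s)))) *
          ∫⁻ w, B z w)) * ENNReal.ofReal (‖z - a‖ ^ (-2 - 2 * s)) := by
          gcongr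
          refine (pow_le_pow_left₀ (by positivity) e5 2).trans ?_
          rw [mul_pow]
          gcongr
          refine e2.trans ?_
          gcongr
          exact h₁ a z hz
      _ = C₁ * ((ENNReal.ofReal ‖z - a‖ ^ 2 * ENNReal.ofReal (‖z - a‖ ^ (1 - (2 - s))) *
          ENNReal.ofReal (‖z - a‖ ^ (-2 - 2 * s))) * ∫⁻ w, B z w) := by ring
      _ = C₁ * (ENNReal.ofReal (‖z - a‖ ^ (-(1 + s))) * ∫⁻ w, B z w) := by
          rw [← ENNReal.ofReal_pow (by positivity), ← ENNReal.ofReal_mul (by positivity),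
            ← ENNReal.ofReal_mul (by positivity), ← Real.rpow_natCast, ← Real.rpow_add hza,
            ← Real.rpow_add hza]
          congr 4; push_cast; ring
  have hBm : Measurable (Function.uncurry fun z w : ℂ =>
      ENNReal.ofReal (‖z - a‖ ^ (-(1 + s))) * B z w) := by
    simp only [B]
    fun_prop
  calc ∫⁻ z, ENNReal.ofReal (‖f z - f a‖ ^ 2 * ‖z - a‖ ^ (-2 - 2 * s))
      ≤ ∫⁻ z, C₁ * (∫⁻ w, ENNReal.ofReal (‖z - a‖ ^ (-(1 + s))) * B z w) := by
        refine lintegral_mono_ae ?_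
        filter_upwards [ae_ne_const a] with z hz using hstep z hz
    _ = C₁ * ∫⁻ w, ∫⁻ z, ENNReal.ofReal (‖z - a‖ ^ (-(1 + s))) * B z w := by
        rw [lintegral_const_mul' _ _ hC₁.ne, lintegral_lintegral_swap hBm.aemeasurable]
    _ ≤ C₁ * ∫⁻ w, C₂ * ENNReal.ofReal (‖dzb f w‖ ^ 2 * ‖w - a‖ ^ (-2 * s)) := by
        gcongr C₁ * ?_
        refine lintegral_mono_ae ?_
        filter_upwards [ae_ne_const a] with w hw
        have hwa' : 0 < ‖w - a‖ := norm_pos_iff.2 (sub_ne_zero.2 hw)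
        have e : ∀ z, ENNReal.ofReal (‖z - a‖ ^ (-(1 + s))) * B z w =
            ENNReal.ofReal (‖dzb f w‖ ^ 2 * ‖w - a‖ ^ (-s)) *
              ENNReal.ofReal (‖z - a‖ ^ (-(1 + s)) * ‖z - w‖ ^ (-1 : ℝ)) := by
          intro z
          simp only [B]
          rw [← ENNReal.ofReal_mul (by positivity), ← ENNReal.ofReal_mul (by positivity),
            norm_sub_rev w z]
          congr 1; ring
        simp_rw [e]
        rw [lintegral_const_mul' _ _ ENNReal.ofReal_ne_top]
        calc _ ≤ ENNReal.ofReal (‖dzb f w‖ ^ 2 * ‖w - a‖ ^ (-s)) *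
              (C₂ * ENNReal.ofReal (‖w - a‖ ^ (1 - (1 + s)))) := by
              gcongr; exact h₂ a w hw
          _ = C₂ * (ENNReal.ofReal (‖dzb f w‖ ^ 2 * ‖w - a‖ ^ (-s)) *
              ENNReal.ofReal (‖w - a‖ ^ (1 - (1 + s)))) := by ring
          _ = _ := by
              rw [← ENNReal.ofReal_mul (by positivity), mul_assoc (‖dzb f w‖ ^ 2),
                ← Real.rpow_add hwa']
              congr 4; ring
    _ = _ := by rw [lintegral_const_mul' _ _ hC₂.ne, mul_assoc]

end JLines

/-! ### The weighted `L²` bound of `∂f` by `∂̄f`. -/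

namespace JLines

variable {n : ℕ}

/-- The regularised weight `(ε + |z - a|²)⁻ˢ`. -/
noncomputable def regWeight (s ε : ℝ) (a z : ℂ) : ℝ := (ε + ‖z - a‖ ^ 2) ^ (-s)

lemma contDiff_regWeight {s ε : ℝ} (hε : 0 < ε) (a : ℂ) : ContDiff ℝ ∞ (regWeight s ε a) := by
  have h1 : ContDiff ℝ ∞ (fun z : ℂ => ε + ‖z - a‖ ^ 2) :=
    contDiff_const.add ((contDiff_id.sub contDiff_const).norm_sq ℝ)
  exact h1.rpow_const_of_ne fun z => by positivity

lemma norm_fderiv_regWeight_le {s ε : ℝ} (hs : 0 ≤ s) (hε : 0 < ε) (a z : ℂ) (hz : z ≠ a) :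
    ‖fderiv ℝ (regWeight s ε a) z‖ ≤ 2 * s * regWeight s ε a z * ‖z - a‖⁻¹ := by
  have hza : 0 < ‖z - a‖ := norm_pos_iff.2 (sub_ne_zero.2 hz)
  have h1 : HasFDerivAt (fun z : ℂ => ε + ‖z - a‖ ^ 2) (2 • (innerSL ℝ (z - a))) z := by
    have := ((hasFDerivAt_id z).sub_const a).norm_sq.const_add ε
    simpa using this
  have h2 : HasFDerivAt (regWeight s ε a) _ z := h1.rpow_const (p := -s) (Or.inl (by positivity))
  rw [h2.fderiv, norm_smul, Real.norm_eq_abs, abs_mul, abs_neg, abs_of_nonneg hs,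
    abs_of_nonneg (by positivity)]
  have h3 : ‖2 • (innerSL ℝ (z - a))‖ ≤ 2 * ‖z - a‖ := by
    rw [← Nat.cast_smul_eq_nsmul ℝ, norm_smul, innerSL_apply_norm]; simp
  have hpos : 0 < ε + ‖z - a‖ ^ 2 := by positivity
  have h4 : (ε + ‖z - a‖ ^ 2) ^ (-s - 1) = regWeight s ε a z * (ε + ‖z - a‖ ^ 2)⁻¹ := by
    rw [regWeight, sub_eq_add_neg (-s), Real.rpow_add hpos, Real.rpow_neg_one]
  have h5 : (ε + ‖z - a‖ ^ 2)⁻¹ ≤ ‖z - a‖⁻¹ * ‖z - a‖⁻¹ := by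
    rw [← mul_inv, ← sq]
    exact inv_anti₀ (by positivity) (by linarith)
  have hr : 0 ≤ regWeight s ε a z := by unfold regWeight; positivity
  rw [h4]
  calc s * (regWeight s ε a z * (ε + ‖z - a‖ ^ 2)⁻¹) * ‖2 • (innerSL ℝ (z - a))‖
      ≤ s * (regWeight s ε a z * (‖z - a‖⁻¹ * ‖z - a‖⁻¹)) * (2 * ‖z - a‖) := by gcongr
    _ = _ := by field_simp

lemma regWeight_le {s ε : ℝ} (hs : 0 ≤ s) (hε : 0 < ε) (a z : ℂ) (hz : z ≠ a) :
    regWeight s ε a z ≤ ‖z - a‖ ^ (-2 * s) := by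
  have hza : 0 < ‖z - a‖ := norm_pos_iff.2 (sub_ne_zero.2 hz)
  have : ‖z - a‖ ^ (-2 * s) = (‖z - a‖ ^ 2) ^ (-s) := by
    rw [← Real.rpow_natCast, ← Real.rpow_mul hza.le]; congr 1; push_cast; ring
  rw [this, regWeight]
  exact Real.rpow_le_rpow_of_nonpos (by positivity) (by linarith) (by linarith)

/-- Half of `X` is moved to the left, which is legitimate because `X` is finite. This is why the
weight is regularised before the energy inequality is applied. -/
lemma absorb_half {s : ℝ} {X Y C : ℝ≥0∞} (hC : C ≠ ⊤) (hX : X ≠ ⊤)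
    (h : X ≤ Y + (ENNReal.ofReal 2⁻¹ * X + ENNReal.ofReal 2⁻¹ * Y +
      ENNReal.ofReal (4 * s ^ 2) * (C * Y))) :
    X ≤ (3 + ENNReal.ofReal (8 * s ^ 2) * C) * Y := by
  by_cases hYt : Y = ⊤
  · rw [hYt, ENNReal.mul_top]
    · exact le_top
    · simp
  lift X to ℝ≥0 using hX
  lift Y to ℝ≥0 using hYt
  lift C to ℝ≥0 using hC
  rw [ENNReal.ofReal, ENNReal.ofReal] at h
  rw [ENNReal.ofReal]
  norm_cast at h ⊢
  rw [← NNReal.coe_le_coe] at h ⊢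
  push_cast at h ⊢
  rw [Real.coe_toNNReal _ (by positivity), Real.coe_toNNReal _ (by positivity)] at h
  rw [Real.coe_toNNReal _ (by positivity)]
  linarith

/-- The weighted `L²` bound of `∂f` by `∂f/∂ζ̄` with power weight `|z - a|⁻²ˢ`. -/
lemma exists_lintegral_weighted_dz_le {s : ℝ} (hs : 0 < s) (hs1 : s < 1) :
    ∃ C : ℝ≥0∞, C < ⊤ ∧ ∀ f : ℂ → Cn n, ContDiff ℝ ∞ f → HasCompactSupport f → ∀ a : ℂ,
      ∫⁻ z, ENNReal.ofReal (‖dz f z‖ ^ 2 * ‖z - a‖ ^ (-2 * s)) ≤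
        C * ∫⁻ z, ENNReal.ofReal (‖dzb f z‖ ^ 2 * ‖z - a‖ ^ (-2 * s)) := by
  obtain ⟨C, hC, hH⟩ := exists_hardy (n := n) hs hs1
  refine ⟨3 + ENNReal.ofReal (8 * s ^ 2) * C, ?_, fun f hf hc a => ?_⟩
  · exact ENNReal.add_lt_top.2 ⟨by simp, ENNReal.mul_lt_top ENNReal.ofReal_lt_top hC⟩
  have hf1 : ContDiff ℝ 1 f := hf.of_le (by exact_mod_cast le_top)
  have hcdz := continuous_dz hf1
  have hcdzb := continuous_dzb hf1
  set Y := ∫⁻ z, ENNReal.ofReal (‖dzb f z‖ ^ 2 * ‖z - a‖ ^ (-2 * s)) with hY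
  have key : ∀ ε : ℝ, 0 < ε → ∫⁻ z, ENNReal.ofReal (regWeight s ε a z * ‖dz f z‖ ^ 2) ≤
      (3 + ENNReal.ofReal (8 * s ^ 2) * C) * Y := by
    intro ε hε
    have hρ := contDiff_regWeight (s := s) hε a
    have hρ0 : ∀ z, 0 ≤ regWeight s ε a z := fun z => by unfold regWeight; positivity
    have hρc := hρ.continuous
    have hE := lintegral_weighted_energy_le hf hc hρ hρ0 (f a)
    set X := ∫⁻ z, ENNReal.ofReal (regWeight s ε a z * ‖dz f z‖ ^ 2) with hX
    have hXfin : X ≠ ⊤ := by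
      have : Integrable (fun z => regWeight s ε a z * ‖dz f z‖ ^ 2) := by
        refine Continuous.integrable_of_hasCompactSupport (by fun_prop) ?_
        refine (hasCompactSupport_dz hc).mono' fun z hz => subset_tsupport _ fun h => hz ?_
        simp [h]
      exact this.lintegral_lt_top.ne
    have hYε : ∫⁻ z, ENNReal.ofReal (regWeight s ε a z * ‖dzb f z‖ ^ 2) ≤ Y := by
      refine lintegral_mono_ae ?_
      filter_upwards [ae_ne_const a] with z hz
      rw [mul_comm]
      gcongr
      exact regWeight_le hs.le hε a z hz
    have hlast : ∫⁻ z, ENNReal.ofReal (‖fderiv ℝ (regWeight s ε a) z‖ *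
        (‖f z - f a‖ * (‖dz f z‖ + ‖dzb f z‖))) ≤
        ENNReal.ofReal 2⁻¹ * X + ENNReal.ofReal 2⁻¹ * Y + ENNReal.ofReal (4 * s ^ 2) * (C * Y) := by
      calc _ ≤ ∫⁻ z, (ENNReal.ofReal 2⁻¹ * ENNReal.ofReal (regWeight s ε a z * ‖dz f z‖ ^ 2) +
            ENNReal.ofReal 2⁻¹ * ENNReal.ofReal (‖dzb f z‖ ^ 2 * ‖z - a‖ ^ (-2 * s)) +
            ENNReal.ofReal (4 * s ^ 2) *
              ENNReal.ofReal (‖f z - f a‖ ^ 2 * ‖z - a‖ ^ (-2 - 2 * s))) := by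
            refine lintegral_mono_ae ?_
            filter_upwards [ae_ne_const a] with z hz
            have hza : 0 < ‖z - a‖ := norm_pos_iff.2 (sub_ne_zero.2 hz)
            rw [← ENNReal.ofReal_mul (by positivity), ← ENNReal.ofReal_mul (by positivity),
              ← ENNReal.ofReal_mul (by positivity),
              ← ENNReal.ofReal_add (by have := hρ0 z; positivity) (by positivity),
              ← ENNReal.ofReal_add (by have := hρ0 z; positivity) (by positivity)]
            refine ENNReal.ofReal_le_ofReal ?_
            have b1 := norm_fderiv_regWeight_le hs.le hε a z hz
            have b2 := regWeight_le hs.le hε a z hz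
            have b3 : ‖z - a‖ ^ (-2 - 2 * s) = ‖z - a‖ ^ (-2 * s) * ‖z - a‖⁻¹ ^ 2 := by
              rw [← Real.rpow_neg_one, ← Real.rpow_natCast, ← Real.rpow_mul hza.le,
                ← Real.rpow_add hza]
              congr 1; push_cast; ring
            rw [b3]
            set ρ := regWeight s ε a z with hρd
            set W := ‖z - a‖ ^ (-2 * s)
            have hρ0' : 0 ≤ ρ := hρ0 z
            set i := ‖z - a‖⁻¹
            have hi : 0 ≤ i := by positivity
            set h := ‖f z - f a‖
            set A := ‖dz f z‖
            set B := ‖dzb f z‖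
            calc _ ≤ 2 * s * ρ * i * (h * (A + B)) := by gcongr
              _ = ρ * (2 * s * (h * i) * (A + B)) := by ring
              _ ≤ ρ * (2⁻¹ * A ^ 2 + 2⁻¹ * B ^ 2 + 4 * s ^ 2 * (h * i) ^ 2) := by
                gcongr
                -- Young's inequality, with the weights chosen so that exactly one half of the `∂f`
                -- energy appears and can be absorbed. The square of `h * i` is the left side of the
                -- Hardy inequality.
                nlinarith [sq_nonneg (A - 2 * s * (h * i)), sq_nonneg (B - 2 * s * (h * i))]
              _ = 2⁻¹ * (ρ * A ^ 2) + 2⁻¹ * (B ^ 2 * ρ) + 4 * s ^ 2 * (h ^ 2 * (ρ * i ^ 2)) := by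
                ring
              _ ≤ _ := by gcongr
        _ = _ + _ + ENNReal.ofReal (4 * s ^ 2) *
              ∫⁻ z, ENNReal.ofReal (‖f z - f a‖ ^ 2 * ‖z - a‖ ^ (-2 - 2 * s)) := by
            have := hf1.continuous
            rw [lintegral_add_right _ (by fun_prop), lintegral_add_right _ (by fun_prop),
              lintegral_const_mul' _ _ ENNReal.ofReal_ne_top,
              lintegral_const_mul' _ _ ENNReal.ofReal_ne_top,
              lintegral_const_mul' _ _ ENNReal.ofReal_ne_top]
        _ ≤ _ := by gcongr; exact hH f hf hc a
    exact absorb_half hC.ne hXfin (hE.trans (add_le_add hYε hlast))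
  -- The bound is uniform in `ε`, so Fatou's lemma along `ε = 1/(k+1)` removes the regularisation.
  have hlim : ∀ᵐ z : ℂ, ENNReal.ofReal (‖dz f z‖ ^ 2 * ‖z - a‖ ^ (-2 * s)) =
      liminf (fun k : ℕ => ENNReal.ofReal (regWeight s (1 / ((k : ℝ) + 1)) a z * ‖dz f z‖ ^ 2))
        atTop := by
    filter_upwards [ae_ne_const a] with z hz
    have hza : 0 < ‖z - a‖ := norm_pos_iff.2 (sub_ne_zero.2 hz)
    refine (Tendsto.liminf_eq ?_).symm
    refine (ENNReal.continuous_ofReal.tendsto _).comp ?_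
    rw [mul_comm]
    refine Tendsto.mul_const _ ?_
    have e : ‖z - a‖ ^ (-2 * s) = (0 + ‖z - a‖ ^ 2) ^ (-s) := by
      rw [zero_add, ← Real.rpow_natCast, ← Real.rpow_mul hza.le]; congr 1; push_cast; ring
    rw [e]
    exact ((tendsto_one_div_add_atTop_nhds_zero_nat (𝕜 := ℝ)).add_const _).rpow_const
      (Or.inl (by positivity))
  rw [lintegral_congr_ae hlim]
  refine (lintegral_liminf_le fun k => ?_).trans ?_
  · have := (contDiff_regWeight (s := s) (ε := 1 / ((k : ℝ) + 1)) (by positivity) a).continuous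
    fun_prop
  · refine liminf_le_of_le ?_ fun b hb => ?_
    · isBoundedDefault
    · obtain ⟨k, hk⟩ := hb.exists
      exact hk.trans (key _ (by positivity))

end JLines

/-! ### Weighted density of the range of `∂̄`, and the Beurling transform on `L²`. -/

namespace JLines

variable {n : ℕ}

lemma eLpNorm_two_sq {α F : Type*} [MeasurableSpace α] [NormedAddCommGroup F] (f : α → F)
    (μ : Measure α) : eLpNorm f 2 μ ^ 2 = ∫⁻ x, ‖f x‖ₑ ^ 2 ∂μ := by
  rw [eLpNorm_eq_lintegral_rpow_enorm_toReal (by norm_num) (by norm_num), ← ENNReal.rpow_natCast,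
    ← ENNReal.rpow_mul]
  simp

/-- The `L²` norm of `f` with weight `m`. -/
noncomputable def wNorm (m : ℂ → ℝ) (f : ℂ → Cn n) : ℝ≥0∞ :=
  eLpNorm (fun w => m w • f w) 2 volume

lemma wNorm_sq (m : ℂ → ℝ) (f : ℂ → Cn n) :
    wNorm m f ^ 2 = ∫⁻ w, ENNReal.ofReal (‖f w‖ ^ 2 * m w ^ 2) := by
  rw [wNorm, eLpNorm_two_sq]
  refine lintegral_congr fun w => ?_
  rw [← ofReal_norm, norm_smul, ← ENNReal.ofReal_pow (by positivity), mul_pow, Real.norm_eq_abs,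
    sq_abs, mul_comm]

lemma wNorm_congr_ae {m : ℂ → ℝ} {f g : ℂ → Cn n} (h : f =ᵐ[volume] g) : wNorm m f = wNorm m g := by
  refine eLpNorm_congr_ae ?_
  filter_upwards [h] with w hw
  rw [hw]

lemma wNorm_add_le {m : ℂ → ℝ} (hm : Measurable m) {f g : ℂ → Cn n}
    (hf : AEStronglyMeasurable f) (hg : AEStronglyMeasurable g) :
    wNorm m (f + g) ≤ wNorm m f + wNorm m g := by
  have : (fun w => m w • (f + g) w) = (fun w => m w • f w) + fun w => m w • g w := by
    funext w; simp [smul_add]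
  rw [wNorm, this]
  exact eLpNorm_add_le (hm.aestronglyMeasurable.smul hf) (hm.aestronglyMeasurable.smul hg)
    (by norm_num)

lemma wNorm_sub_le {m : ℂ → ℝ} (hm : Measurable m) {f g : ℂ → Cn n}
    (hf : AEStronglyMeasurable f) (hg : AEStronglyMeasurable g) :
    wNorm m (f - g) ≤ wNorm m f + wNorm m g := by
  have : (fun w => m w • (f - g) w) = (fun w => m w • f w) - fun w => m w • g w := by
    funext w; simp [smul_sub]
  rw [wNorm, this]
  exact eLpNorm_sub_le (hm.aestronglyMeasurable.smul hf) (hm.aestronglyMeasurable.smul hg)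
    (by norm_num)

lemma wNorm_mono {m m' : ℂ → ℝ} {f g : ℂ → Cn n} (h : ∀ᵐ w, ‖m w • f w‖ ≤ ‖m' w • g w‖) :
    wNorm m f ≤ wNorm m' g :=
  eLpNorm_mono_ae h

lemma wNorm_one (f : ℂ → Cn n) : wNorm (fun _ => 1) f = eLpNorm f 2 volume := by
  simp [wNorm]

/-- Smooth compactly supported maps. -/
def IsTest (f : ℂ → Cn n) : Prop := ContDiff ℝ ∞ f ∧ HasCompactSupport f

lemma IsTest.contDiff_one {f : ℂ → Cn n} (hf : IsTest f) : ContDiff ℝ 1 f :=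
  hf.1.of_le (by exact_mod_cast le_top)

lemma IsTest.differentiable {f : ℂ → Cn n} (hf : IsTest f) : Differentiable ℝ f :=
  hf.contDiff_one.differentiable (by norm_num)

lemma IsTest.continuous_dz {f : ℂ → Cn n} (hf : IsTest f) : Continuous (dz f) :=
  JLines.continuous_dz hf.contDiff_one

lemma IsTest.continuous_dzb {f : ℂ → Cn n} (hf : IsTest f) : Continuous (dzb f) :=
  JLines.continuous_dzb hf.contDiff_one

lemma IsTest.memLp_dz {f : ℂ → Cn n} (hf : IsTest f) : MemLp (dz f) 2 volume :=
  hf.continuous_dz.memLp_of_hasCompactSupport (hasCompactSupport_dz hf.2)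

lemma IsTest.memLp_dzb {f : ℂ → Cn n} (hf : IsTest f) : MemLp (dzb f) 2 volume :=
  hf.continuous_dzb.memLp_of_hasCompactSupport (hasCompactSupport_dzb hf.2)

/-- An admissible weight: locally square integrable, with moderate growth. -/
structure IsWeight (m : ℂ → ℝ) : Prop where
  meas : Measurable m
  loc : ∀ R : ℝ, ∫⁻ w in Metric.closedBall 0 R, ENNReal.ofReal (m w ^ 2) < ⊤
  growth : ∃ C R : ℝ, ∀ w : ℂ, R ≤ ‖w‖ → m w ^ 2 ≤ C * ‖w‖

lemma volume_closedBall_complex (r : ℝ) (hr : 0 ≤ r) :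
    volume (Metric.closedBall (0 : ℂ) r) = ENNReal.ofReal (Real.pi * r ^ 2) := by
  rw [Complex.volume_closedBall, ← ENNReal.ofReal_pow hr, mul_comm, ENNReal.ofReal_mul Real.pi_pos.le]
  congr 1
  rw [← NNReal.coe_real_pi, ENNReal.ofReal_coe_nnreal]

/-- Cut off the Cauchy transform of `g` at radius `R`. The error is supported in an annulus of area
`O(R²)`; both the transform and the gradient of the cut-off are `O(1/R)` there, and `m² = O(R)`. The
squared weighted error is `O(R⁻¹)`. -/
lemma exists_wNorm_sub_dzb_le_of_test {m : ℂ → ℝ} (hm : IsWeight m) {g : ℂ → Cn n}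
    (hg : IsTest g) {ε : ℝ} (hε : 0 < ε) :
    ∃ F : ℂ → Cn n, IsTest F ∧ wNorm m (g - dzb F) ≤ ENNReal.ofReal ε := by
  obtain ⟨C, R₀, hR₀, hC, hdec⟩ := cauchyT_decay hg.1.continuous hg.2
  obtain ⟨C₁, R₁, hgr⟩ := hm.growth
  obtain ⟨C₂, hC₂, hcut⟩ := exists_norm_fderiv_cutoff_le
  obtain ⟨R₂, hR₂, hsupp⟩ := hg.2.isCompact.isBounded.exists_pos_norm_le
  have hu := contDiff_cauchyT hg.1 hg.2
  have hud : Differentiable ℝ (cauchyT g) := hu.differentiable (by simp)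
  have htend : Tendsto (fun R : ℝ => (C / R) ^ 2 * (C₂ / R) ^ 2 * (|C₁| * (2 * R)) *
      (Real.pi * (2 * R) ^ 2)) atTop (𝓝 0) := by
    have : Tendsto (fun R : ℝ => (8 * C ^ 2 * C₂ ^ 2 * |C₁| * Real.pi) * R⁻¹) atTop (𝓝 0) := by
      have h := (tendsto_inv_atTop_zero (𝕜 := ℝ)).const_mul
        (8 * C ^ 2 * C₂ ^ 2 * |C₁| * Real.pi)
      rwa [mul_zero] at h
    refine this.congr' ?_
    filter_upwards [eventually_gt_atTop 0] with R hR
    field_simp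
    ring
  obtain ⟨R, hsmall, hRa, hRb, hRc⟩ := ((htend.eventually (gt_mem_nhds (by positivity : 0 < ε ^ 2))).and
    ((eventually_ge_atTop R₀).and ((eventually_ge_atTop R₁).and (eventually_ge_atTop R₂)))).exists
  have hR : 0 < R := by linarith
  refine ⟨fun z => cutoff R z • cauchyT g z, ⟨(contDiff_cutoff R).smul hu,
    (hasCompactSupport_cutoff hR).smul_right⟩, ?_⟩
  have hcd : Differentiable ℝ (cutoff R) := (contDiff_cutoff R).differentiable (by simp)
  have hdiff : ∀ z, (g - dzb (fun z => cutoff R z • cauchyT g z)) z =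
      - (dzb (cutoff R) z • cauchyT g z) := by
    intro z
    rw [Pi.sub_apply, dzb_smul (hcd z) (hud z), dzb_cauchyT hg.1 hg.2]
    by_cases hz : z ∈ tsupport g
    · rw [cutoff_eq_one hR ((hsupp z hz).trans hRc)]; simp
    · rw [image_eq_zero_of_notMem_tsupport hz]; simp
  have hb : ∀ z, ENNReal.ofReal (‖(g - dzb (fun z => cutoff R z • cauchyT g z)) z‖ ^ 2 * m z ^ 2) ≤
      (Metric.closedBall (0 : ℂ) (2 * R)).indicator
        (fun _ => ENNReal.ofReal ((C / R) ^ 2 * (C₂ / R) ^ 2 * (|C₁| * (2 * R)))) z := by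
    intro z
    rw [hdiff, norm_neg, norm_smul]
    by_cases h1 : ‖z‖ < R ∨ 2 * R < ‖z‖
    · have : dzb (cutoff R) z = 0 := by simp [dzb, fderiv_cutoff_eq_zero hR h1]
      simp [this]
    · push Not at h1
      rw [indicator_of_mem (by simpa using h1.2)]
      refine ENNReal.ofReal_le_ofReal ?_
      have b1 : ‖dzb (cutoff R) z‖ ≤ C₂ / R := (norm_dzb_le _ _).trans (hcut R hR z)
      have b2 : ‖cauchyT g z‖ ≤ C / R := (hdec z (by linarith)).trans (by gcongr; exact h1.1)
      have b3 : m z ^ 2 ≤ |C₁| * (2 * R) := (hgr z (by linarith)).trans (by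
        gcongr
        · exact le_abs_self _
        · exact h1.2)
      rw [mul_pow, mul_comm (‖dzb (cutoff R) z‖ ^ 2)]
      gcongr
  rw [← ENNReal.pow_le_pow_left_iff two_ne_zero, wNorm_sq]
  refine (lintegral_mono hb).trans ?_
  rw [lintegral_indicator Metric.isClosed_closedBall.measurableSet, setLIntegral_const,
    volume_closedBall_complex _ (by linarith), ← ENNReal.ofReal_mul (by positivity),
    ← ENNReal.ofReal_pow hε.le]
  exact ENNReal.ofReal_le_ofReal hsmall.le

/-- The weighted norm is the plain `L²` norm of the measure with density `m²`, which is finite on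
compact sets. Density of smooth compactly supported functions in `L²` of such a measure thus covers
all admissible weights. -/
lemma eLpNorm_withDensity {m : ℂ → ℝ} (hm : Measurable m) (f : ℂ → Cn n) :
    eLpNorm f 2 (volume.withDensity fun w => ENNReal.ofReal (m w ^ 2)) = wNorm m f := by
  rw [← (ENNReal.pow_right_strictMono two_ne_zero).injective.eq_iff, eLpNorm_two_sq, wNorm_sq,
    lintegral_withDensity_eq_lintegral_mul_non_measurable _ (by fun_prop)
      (Eventually.of_forall fun _ => ENNReal.ofReal_lt_top)]
  refine lintegral_congr fun w => ?_
  rw [Pi.mul_apply, ← ofReal_norm, ← ENNReal.ofReal_pow (by positivity),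
    ← ENNReal.ofReal_mul (by positivity), mul_comm]

/-- The image of `∂/∂ζ̄` on test functions is dense in every weighted `L²`. -/
lemma exists_wNorm_sub_dzb_le {m : ℂ → ℝ} (hm : IsWeight m) {g : ℂ → Cn n}
    (hg : AEStronglyMeasurable g) (hgm : wNorm m g < ⊤) {ε : ℝ} (hε : 0 < ε) :
    ∃ F : ℂ → Cn n, IsTest F ∧ wNorm m (g - dzb F) ≤ ENNReal.ofReal ε := by
  set μ := (volume : Measure ℂ).withDensity fun w => ENNReal.ofReal (m w ^ 2) with hμ
  have hfin : IsFiniteMeasureOnCompacts μ := by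
    refine ⟨fun K hK => ?_⟩
    obtain ⟨R, hR⟩ := hK.isBounded.subset_closedBall 0
    refine (measure_mono hR).trans_lt ?_
    rw [hμ, withDensity_apply _ Metric.isClosed_closedBall.measurableSet]
    exact hm.loc R
  have hgL : MemLp g 2 μ := ⟨hg.mono_ac (withDensity_absolutelyContinuous _ _), by
    rw [eLpNorm_withDensity hm.meas]; exact hgm⟩
  obtain ⟨g', hg'c, hg's, hle⟩ := hgL.exist_eLpNorm_sub_le (by norm_num) (by norm_num)
    (half_pos hε)
  rw [eLpNorm_withDensity hm.meas] at hle
  obtain ⟨F, hF, hFle⟩ := exists_wNorm_sub_dzb_le_of_test hm ⟨hg's, hg'c⟩ (half_pos hε)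
  refine ⟨F, hF, ?_⟩
  have : g - dzb F = (g - g') + (g' - dzb F) := by abel
  rw [this]
  refine (wNorm_add_le hm.meas (hg.sub hg's.continuous.aestronglyMeasurable)
    (hg's.continuous.aestronglyMeasurable.sub hF.continuous_dzb.aestronglyMeasurable)).trans ?_
  calc _ ≤ ENNReal.ofReal (ε / 2) + ENNReal.ofReal (ε / 2) := add_le_add hle hFle
    _ = _ := by rw [← ENNReal.ofReal_add (by positivity) (by positivity), add_halves]

lemma exists_seq_wNorm_sub_dzb {m : ℂ → ℝ} (hm : IsWeight m) {g : ℂ → Cn n}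
    (hg : AEStronglyMeasurable g) (hgm : wNorm m g < ⊤) :
    ∃ F : ℕ → ℂ → Cn n, (∀ k, IsTest (F k)) ∧
      Tendsto (fun k => wNorm m (g - dzb (F k))) atTop (𝓝 0) := by
  choose F hF hle using fun k : ℕ => exists_wNorm_sub_dzb_le hm hg hgm
    (ε := 1 / ((k : ℝ) + 1)) (by positivity)
  refine ⟨F, hF, ?_⟩
  have h : Tendsto (fun k : ℕ => ENNReal.ofReal (1 / ((k : ℝ) + 1))) atTop (𝓝 0) := by
    have h := (ENNReal.continuous_ofReal.tendsto _).comp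
      (tendsto_one_div_add_atTop_nhds_zero_nat (𝕜 := ℝ))
    rwa [ENNReal.ofReal_zero] at h
  exact tendsto_of_tendsto_of_tendsto_of_le_of_le tendsto_const_nhds h (fun _ => zero_le) hle

lemma isWeight_one : IsWeight (fun _ => 1) where
  meas := measurable_const
  loc R := by
    simp only [one_pow, ENNReal.ofReal_one, setLIntegral_const, one_mul]
    exact measure_closedBall_lt_top
  growth := ⟨1, 1, fun w hw => by simpa using hw⟩

/-- The Hilbert space of square integrable maps. -/
abbrev L2 (n : ℕ) : Type := Lp (Cn n) 2 (volume : Measure ℂ)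

lemma dz_add {f g : ℂ → Cn n} (hf : Differentiable ℝ f) (hg : Differentiable ℝ g) :
    dz (f + g) = dz f + dz g := by
  funext z
  simp only [dz, fderiv_add (hf z) (hg z), _root_.add_apply, Pi.add_apply]
  module

lemma dzb_add {f g : ℂ → Cn n} (hf : Differentiable ℝ f) (hg : Differentiable ℝ g) :
    dzb (f + g) = dzb f + dzb g := by
  funext z
  simp only [dzb, fderiv_add (hf z) (hg z), _root_.add_apply, Pi.add_apply]
  module

lemma dz_const_smul {f : ℂ → Cn n} (hf : Differentiable ℝ f) (c : ℝ) :
    dz (c • f) = c • dz f := by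
  funext z
  simp only [dz, fderiv_const_smul (hf z), _root_.smul_apply, Pi.smul_apply, smul_sub]
  simp only [smul_comm c]

lemma dzb_const_smul {f : ℂ → Cn n} (hf : Differentiable ℝ f) (c : ℝ) :
    dzb (c • f) = c • dzb f := by
  funext z
  simp only [dzb, fderiv_const_smul (hf z), _root_.smul_apply, Pi.smul_apply, smul_add]
  simp only [smul_comm c]

lemma IsTest.add {f g : ℂ → Cn n} (hf : IsTest f) (hg : IsTest g) : IsTest (f + g) :=
  ⟨hf.1.add hg.1, hf.2.add hg.2⟩

lemma IsTest.const_smul {f : ℂ → Cn n} (hf : IsTest f) (c : ℝ) : IsTest (c • f) :=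
  ⟨hf.1.const_smul c, hf.2.comp_left (g := fun x => c • x) (smul_zero c)⟩

lemma IsTest.sub {f g : ℂ → Cn n} (hf : IsTest f) (hg : IsTest g) : IsTest (f - g) := by
  have := hf.add (hg.const_smul (-1))
  rwa [neg_one_smul, ← sub_eq_add_neg] at this

/-- The space of test functions. -/
def testFn (n : ℕ) : Submodule ℝ (ℂ → Cn n) where
  carrier := {f | IsTest f}
  add_mem' := IsTest.add
  zero_mem' := ⟨contDiff_const, HasCompactSupport.zero⟩
  smul_mem' c _ hf := hf.const_smul c

/-- `∂` on test functions. -/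
noncomputable def dzL (n : ℕ) : testFn n →ₗ[ℝ] L2 n where
  toFun f := (IsTest.memLp_dz f.2).toLp _
  map_add' f g := by
    rw [← MemLp.toLp_add]
    exact MemLp.toLp_congr _ _ (by
      rw [← dz_add (IsTest.differentiable f.2) (IsTest.differentiable g.2)]; rfl)
  map_smul' c f := by
    rw [RingHom.id_apply, ← MemLp.toLp_const_smul]
    exact MemLp.toLp_congr _ _ (by
      rw [← dz_const_smul (IsTest.differentiable f.2)]; rfl)

/-- `∂/∂ζ̄` on test functions. -/
noncomputable def dzbL (n : ℕ) : testFn n →ₗ[ℝ] L2 n where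
  toFun f := (IsTest.memLp_dzb f.2).toLp _
  map_add' f g := by
    rw [← MemLp.toLp_add]
    exact MemLp.toLp_congr _ _ (by
      rw [← dzb_add (IsTest.differentiable f.2) (IsTest.differentiable g.2)]; rfl)
  map_smul' c f := by
    rw [RingHom.id_apply, ← MemLp.toLp_const_smul]
    exact MemLp.toLp_congr _ _ (by
      rw [← dzb_const_smul (IsTest.differentiable f.2)]; rfl)

lemma denseRange_dzbL : DenseRange (dzbL n) := by
  intro g
  rw [Metric.mem_closure_range_iff]
  intro ε hε
  obtain ⟨F, hF, hle⟩ := exists_wNorm_sub_dzb_le isWeight_one (Lp.aestronglyMeasurable g)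
    (by rw [wNorm_one]; exact Lp.eLpNorm_lt_top g) (half_pos hε)
  refine ⟨⟨F, hF⟩, ?_⟩
  rw [wNorm_one] at hle
  have h2 : ENNReal.ofReal (dist g (dzbL n ⟨F, hF⟩)) ≤ ENNReal.ofReal (ε / 2) := by
    rw [← edist_dist, Lp.edist_def]
    refine le_trans (le_of_eq (eLpNorm_congr_ae ?_)) hle
    exact (ae_eq_refl _).sub (MemLp.coeFn_toLp (IsTest.memLp_dzb hF))
  have := (ENNReal.ofReal_le_ofReal_iff (by positivity)).1 h2
  linarith

/-- This contraction bound, with the density of the range of `∂̄`, lets the map `∂̄f ↦ ∂f` extend to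
all of `L²`. -/
lemma norm_dzL_le (f : testFn n) : ‖dzL n f‖ ≤ 1 * ‖dzbL n f‖ := by
  rw [one_mul]
  have h := lintegral_dz_sq_eq f.2.1 f.2.2
  have e : ∀ g : ℂ → Cn n, ∫⁻ z, ENNReal.ofReal (‖g z‖ ^ 2) = eLpNorm g 2 volume ^ 2 := by
    intro g
    rw [eLpNorm_two_sq]
    refine lintegral_congr fun w => ?_
    rw [← ofReal_norm, ENNReal.ofReal_pow (norm_nonneg _)]
  rw [e, e, ENNReal.pow_le_pow_left_iff two_ne_zero] at h
  change ‖(IsTest.memLp_dz f.2).toLp _‖ ≤ ‖(IsTest.memLp_dzb f.2).toLp _‖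
  rw [Lp.norm_toLp, Lp.norm_toLp]
  exact ENNReal.toReal_mono (IsTest.memLp_dzb f.2).eLpNorm_ne_top h

/-- The Beurling transform on `L²`. -/
noncomputable def beurling (n : ℕ) : L2 n →L[ℝ] L2 n := (dzL n).extendOfNorm (dzbL n)

lemma beurling_dzb {f : ℂ → Cn n} (hf : IsTest f) :
    beurling n (hf.memLp_dzb.toLp _) = hf.memLp_dz.toLp _ :=
  LinearMap.extendOfNorm_eq denseRange_dzbL ⟨1, norm_dzL_le⟩ (⟨f, hf⟩ : testFn n)

lemma norm_beurling_le (g : L2 n) : ‖beurling n g‖ ≤ 1 * ‖g‖ :=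
  LinearMap.norm_extendOfNorm_apply_le denseRange_dzbL 1 norm_dzL_le g

end JLines

/-! ### Japanese brackets, weak derivatives and local bounds for the Cauchy transform. -/

namespace JLines

variable {n : ℕ}

/-- Powers of the Japanese bracket. -/
noncomputable def jap (α : ℝ) (w : ℂ) : ℝ := (1 + ‖w‖ ^ 2) ^ α

lemma jap_pos (α : ℝ) (w : ℂ) : 0 < jap α w := by unfold jap; positivity

lemma jap_mul (α β : ℝ) (w : ℂ) : jap α w * jap β w = jap (α + β) w := by
  rw [jap, jap, jap, Real.rpow_add (by positivity)]

lemma jap_sq (α : ℝ) (w : ℂ) : jap α w ^ 2 = jap (2 * α) w := by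
  rw [sq, jap_mul, two_mul]

lemma one_le_jap {α : ℝ} (hα : 0 ≤ α) (w : ℂ) : 1 ≤ jap α w :=
  Real.one_le_rpow (by nlinarith [sq_nonneg ‖w‖]) hα

lemma jap_le_one {α : ℝ} (hα : α ≤ 0) (w : ℂ) : jap α w ≤ 1 :=
  Real.rpow_le_one_of_one_le_of_nonpos (by nlinarith [sq_nonneg ‖w‖]) hα

lemma jap_mono {α β : ℝ} (h : α ≤ β) (w : ℂ) : jap α w ≤ jap β w :=
  Real.rpow_le_rpow_of_exponent_le (by nlinarith [sq_nonneg ‖w‖]) h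

lemma jap_half_le (w : ℂ) : jap (1 / 2) w ≤ 1 + ‖w‖ := by
  rw [jap, ← Real.sqrt_eq_rpow]
  exact Real.sqrt_le_iff.2 ⟨by positivity, by nlinarith [norm_nonneg w]⟩

lemma continuous_jap (α : ℝ) : Continuous (jap α) := by
  unfold jap
  exact Continuous.rpow_const (by fun_prop) fun w => Or.inl (by positivity)

@[fun_prop] lemma measurable_jap (α : ℝ) : Measurable (jap α) := (continuous_jap α).measurable

lemma jap_le_of_norm_le {α R : ℝ} (hα : 0 ≤ α) {w : ℂ} (hw : ‖w‖ ≤ R) :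
    jap α w ≤ (1 + R ^ 2) ^ α := by
  unfold jap; gcongr

lemma isWeight_jap {τ : ℝ} (hτ0 : 0 ≤ τ) (hτ : τ ≤ 1 / 2) : IsWeight (jap (τ / 2)) where
  meas := measurable_jap _
  loc R := by
    refine lt_of_le_of_lt (setLIntegral_mono' (g := fun _ => ENNReal.ofReal ((1 + R ^ 2) ^ τ))
      Metric.isClosed_closedBall.measurableSet fun w hw => ?_) ?_
    · rw [jap_sq]
      refine ENNReal.ofReal_le_ofReal ?_
      rw [mul_div_cancel₀ _ two_ne_zero]
      exact jap_le_of_norm_le hτ0 (by simpa using hw)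
    · rw [setLIntegral_const]
      exact ENNReal.mul_lt_top ENNReal.ofReal_lt_top measure_closedBall_lt_top
  growth := by
    refine ⟨2, 1, fun w hw => ?_⟩
    rw [jap_sq]
    refine (jap_mono (by linarith) w).trans ((jap_half_le w).trans ?_)
    linarith

/-- For `|z| ≤ R` one has `⟨w⟩ ≤ 1 + R + |z - w|`. Multiplying by `|w - z|⁻¹` leaves a locally
integrable singularity plus a constant, so the integral decays like `⟨w⟩⁻¹`. -/
lemma exists_setLIntegral_ball_inv_le (R : ℝ) (hR : 0 ≤ R) : ∃ C : ℝ≥0∞, C < ⊤ ∧ ∀ w : ℂ,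
    ∫⁻ z in Metric.closedBall (0 : ℂ) R, ENNReal.ofReal (‖w - z‖ ^ (-1 : ℝ)) ≤
      C * ENNReal.ofReal (jap (-(1 / 2)) w) := by
  obtain ⟨C, hC, hb⟩ := exists_lintegral_two_centre_le (α := 2) (γ := 1) (by norm_num)
    (by norm_num) (by norm_num) (by norm_num)
  refine ⟨ENNReal.ofReal ((1 + R) * (1 + R ^ 2)) * C + volume (Metric.closedBall (0 : ℂ) R),
    ENNReal.add_lt_top.2 ⟨ENNReal.mul_lt_top ENNReal.ofReal_lt_top hC, measure_closedBall_lt_top⟩,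
    fun w => ?_⟩
  have hpt : ∀ᵐ z : ℂ, z ∈ Metric.closedBall (0 : ℂ) R → ENNReal.ofReal (‖w - z‖ ^ (-1 : ℝ)) ≤
      (ENNReal.ofReal ((1 + R) * (1 + R ^ 2)) *
        ENNReal.ofReal ((1 + ‖z‖ ^ 2) ^ (-2 / 2 : ℝ) * ‖z - w‖ ^ (-1 : ℝ)) + 1) *
        ENNReal.ofReal (jap (-(1 / 2)) w) := by
    filter_upwards [ae_ne_const w] with z hzw hz
    have hz' : ‖z‖ ≤ R := by simpa using hz
    have hzw' : 0 < ‖z - w‖ := norm_pos_iff.2 (sub_ne_zero.2 hzw)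
    rw [← ENNReal.ofReal_one, ← ENNReal.ofReal_mul (by positivity),
      ← ENNReal.ofReal_add (by positivity) (by positivity),
      ← ENNReal.ofReal_mul (by positivity)]
    refine ENNReal.ofReal_le_ofReal ?_
    have h1 : jap (1 / 2) w ≤ 1 + R + ‖z - w‖ := by
      have h2 := norm_sub_norm_le w z
      have h3 := jap_half_le w
      rw [norm_sub_rev] at h2; linarith
    have h2 : jap (1 / 2) w * jap (-(1 / 2)) w = 1 := by rw [jap_mul]; simp [jap]
    have hJ := jap_pos (-(1 / 2)) w
    have h4 : 1 ≤ (1 + R ^ 2) * (1 + ‖z‖ ^ 2) ^ (-2 / 2 : ℝ) := by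
      rw [show (-2 / 2 : ℝ) = -1 by norm_num, Real.rpow_neg_one, ← div_eq_mul_inv,
        one_le_div (by positivity)]
      gcongr
    rw [norm_sub_rev w z, Real.rpow_neg_one]
    set d := ‖z - w‖
    calc d⁻¹ = d⁻¹ * (jap (1 / 2) w * jap (-(1 / 2)) w) := by rw [h2, mul_one]
      _ ≤ d⁻¹ * ((1 + R + d) * jap (-(1 / 2)) w) := by gcongr
      _ = ((1 + R) * 1 * d⁻¹ + 1) * jap (-(1 / 2)) w := by field_simp
      _ ≤ ((1 + R) * ((1 + R ^ 2) * (1 + ‖z‖ ^ 2) ^ (-2 / 2 : ℝ)) * d⁻¹ + 1) *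
          jap (-(1 / 2)) w := by gcongr
      _ = _ := by ring
  refine (setLIntegral_mono_ae' Metric.isClosed_closedBall.measurableSet hpt).trans ?_
  rw [lintegral_mul_const' _ _ ENNReal.ofReal_ne_top]
  gcongr
  rw [lintegral_add_right _ measurable_const, setLIntegral_const, one_mul,
    lintegral_const_mul' _ _ ENNReal.ofReal_ne_top]
  gcongr
  exact (setLIntegral_le_lintegral _ _).trans (hb w)

/-- Plain `L²` control is not enough, since `|w|⁻¹` is not square integrable at infinity; the extra
weight `⟨w⟩^τ` with `τ > 0` repairs this. Cauchy–Schwarz against `⟨w⟩^{-(1+2τ)} |w - z|⁻¹`, then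
integration over the ball in `z`, which gains `⟨w⟩⁻¹`. -/
lemma exists_lintegral_cauchy_sq_le {τ : ℝ} (hτ : 0 < τ) (R : ℝ) (hR : 0 ≤ R) :
    ∃ C : ℝ≥0∞, C < ⊤ ∧ ∀ f : ℂ → Cn n, AEStronglyMeasurable f →
      ∫⁻ z in Metric.closedBall (0 : ℂ) R, (∫⁻ w, ‖f w‖ₑ * ENNReal.ofReal (‖w - z‖ ^ (-1 : ℝ))) ^ 2
        ≤ C * wNorm (jap (τ / 2)) f ^ 2 := by
  obtain ⟨C₁, hC₁, h₁⟩ := exists_lintegral_two_centre_le (α := 1 + 2 * τ) (γ := 1) (by linarith)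
    (by norm_num) (by norm_num) (by linarith)
  obtain ⟨C₂, hC₂, h₂⟩ := exists_setLIntegral_ball_inv_le R hR
  refine ⟨C₁ * C₂, ENNReal.mul_lt_top hC₁ hC₂, ?_⟩
  suffices H : ∀ f : ℂ → Cn n, Measurable f →
      ∫⁻ z in Metric.closedBall (0 : ℂ) R, (∫⁻ w, ‖f w‖ₑ * ENNReal.ofReal (‖w - z‖ ^ (-1 : ℝ))) ^ 2
        ≤ C₁ * C₂ * wNorm (jap (τ / 2)) f ^ 2 by
    intro f hf
    have h := H (hf.mk f) hf.stronglyMeasurable_mk.measurable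
    rw [wNorm_congr_ae hf.ae_eq_mk.symm] at h
    refine le_trans (le_of_eq ?_) h
    refine lintegral_congr fun z => ?_
    congr 1
    refine lintegral_congr_ae ?_
    filter_upwards [hf.ae_eq_mk] with w hw
    rw [hw]
  intro f hf
  let B : ℂ → ℂ → ℝ≥0∞ := fun z w =>
    ENNReal.ofReal (‖f w‖ ^ 2 * jap (1 / 2 + τ) w) * ENNReal.ofReal (‖w - z‖ ^ (-1 : ℝ))
  have hsq : ∀ {x : ℝ} (_ : 0 ≤ x), (x ^ (-1 / 2 : ℝ)) ^ 2 = x ^ (-1 : ℝ) := by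
    intro x hx
    rw [← Real.rpow_natCast, ← Real.rpow_mul hx]; congr 1; norm_num
  have hstep : ∀ z, (∫⁻ w, ‖f w‖ₑ * ENNReal.ofReal (‖w - z‖ ^ (-1 : ℝ))) ^ 2 ≤
      C₁ * ∫⁻ w, B z w := by
    intro z
    have e := lintegral_mul_sq_le (volume : Measure ℂ)
      (f := fun w => ENNReal.ofReal (jap (-(1 / 2 + τ) / 2) w * ‖w - z‖ ^ (-1 / 2 : ℝ)))
      (g := fun w => ENNReal.ofReal (‖f w‖ * jap ((1 / 2 + τ) / 2) w * ‖w - z‖ ^ (-1 / 2 : ℝ)))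
      (by fun_prop) (by fun_prop)
    have e1 : ∀ w, ENNReal.ofReal (jap (-(1 / 2 + τ) / 2) w * ‖w - z‖ ^ (-1 / 2 : ℝ)) *
        ENNReal.ofReal (‖f w‖ * jap ((1 / 2 + τ) / 2) w * ‖w - z‖ ^ (-1 / 2 : ℝ)) =
        ‖f w‖ₑ * ENNReal.ofReal (‖w - z‖ ^ (-1 : ℝ)) := by
      intro w
      have hp := jap_pos (-(1 / 2 + τ) / 2) w
      rw [← ENNReal.ofReal_mul (by positivity), ← ofReal_norm, ← ENNReal.ofReal_mul (norm_nonneg _)]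
      congr 1
      rw [← hsq (norm_nonneg _)]
      have : jap (-(1 / 2 + τ) / 2) w * jap ((1 / 2 + τ) / 2) w = 1 := by
        rw [jap_mul]; ring_nf; simp [jap]
      linear_combination (‖f w‖ * (‖w - z‖ ^ (-1 / 2 : ℝ)) ^ 2) * this
    have e2 : ∀ w, ENNReal.ofReal (jap (-(1 / 2 + τ) / 2) w * ‖w - z‖ ^ (-1 / 2 : ℝ)) ^ 2 =
        ENNReal.ofReal ((1 + ‖w‖ ^ 2) ^ (-(1 + 2 * τ) / 2) * ‖w - z‖ ^ (-1 : ℝ)) := by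
      intro w
      have hp := jap_pos (-(1 / 2 + τ) / 2) w
      rw [← ENNReal.ofReal_pow (by positivity), mul_pow, hsq (norm_nonneg _), jap_sq]
      congr 2
      rw [jap]; congr 1; ring
    have e3 : ∀ w, ENNReal.ofReal (‖f w‖ * jap ((1 / 2 + τ) / 2) w * ‖w - z‖ ^ (-1 / 2 : ℝ)) ^ 2 =
        B z w := by
      intro w
      have hp := jap_pos ((1 / 2 + τ) / 2) w
      have hp' := jap_pos (1 / 2 + τ) w
      simp only [B]
      rw [← ENNReal.ofReal_pow (by positivity), mul_pow, mul_pow, hsq (norm_nonneg _), jap_sq,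
        ← ENNReal.ofReal_mul (by positivity), mul_div_cancel₀ _ two_ne_zero]
    simp_rw [e1, e2, e3] at e
    exact e.trans (mul_le_mul_left (h₁ z) _)
  have hBm : Measurable (Function.uncurry B) := by simp only [B]; fun_prop
  calc _ ≤ ∫⁻ z in Metric.closedBall (0 : ℂ) R, C₁ * ∫⁻ w, B z w := lintegral_mono hstep
    _ = C₁ * ∫⁻ w, ∫⁻ z in Metric.closedBall (0 : ℂ) R, B z w := by
      rw [lintegral_const_mul' _ _ hC₁.ne, lintegral_lintegral_swap hBm.aemeasurable]
    _ ≤ C₁ * ∫⁻ w, C₂ * ENNReal.ofReal (‖f w‖ ^ 2 * jap (τ / 2) w ^ 2) := by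
      gcongr C₁ * ?_
      refine lintegral_mono fun w => ?_
      simp only [B]
      rw [lintegral_const_mul' _ _ ENNReal.ofReal_ne_top]
      have hp' := jap_pos (1 / 2 + τ) w
      calc _ ≤ ENNReal.ofReal (‖f w‖ ^ 2 * jap (1 / 2 + τ) w) *
            (C₂ * ENNReal.ofReal (jap (-(1 / 2)) w)) := by gcongr; exact h₂ w
        _ = C₂ * (ENNReal.ofReal (‖f w‖ ^ 2 * jap (1 / 2 + τ) w) *
            ENNReal.ofReal (jap (-(1 / 2)) w)) := by ring
        _ = _ := by
          rw [← ENNReal.ofReal_mul (by positivity), mul_assoc (‖f w‖ ^ 2), jap_mul, jap_sq]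
          congr 4; ring
    _ = _ := by rw [lintegral_const_mul' _ _ hC₂.ne, wNorm_sq, mul_assoc]

/-- `g` and `h` are the weak derivatives `∂u/∂ζ̄` and `∂u/∂ζ`, obtained as `L²` limits of the
derivatives of test functions which approximate `u` locally in `L²`. -/
structure WeakD (u g h : ℂ → Cn n) : Prop where
  meas_u : AEStronglyMeasurable u
  meas_g : AEStronglyMeasurable g
  meas_h : AEStronglyMeasurable h
  approx : ∀ R ε : ℝ, 0 < ε → ∃ F : ℂ → Cn n, IsTest F ∧
    eLpNorm (u - F) 2 (volume.restrict (Metric.closedBall 0 R)) ≤ ENNReal.ofReal ε ∧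
    eLpNorm (g - dzb F) 2 volume ≤ ENNReal.ofReal ε ∧
    eLpNorm (h - dz F) 2 volume ≤ ENNReal.ofReal ε

lemma enorm_cauchyT_le (g : ℂ → Cn n) (z : ℂ) :
    ‖cauchyT g z‖ₑ ≤ ∫⁻ w, ‖g w‖ₑ * ENNReal.ofReal (‖w - z‖ ^ (-1 : ℝ)) := by
  rw [cauchyT, enorm_smul]
  have hpi : ‖(Real.pi : ℂ)⁻¹‖ₑ ≤ 1 := by
    rw [← ofReal_norm, norm_inv, Complex.norm_real, Real.norm_of_nonneg Real.pi_pos.le]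
    refine ENNReal.ofReal_le_one.2 (inv_le_one_of_one_le₀ ?_)
    linarith [Real.pi_gt_three]
  refine (mul_le_mul_left hpi _).trans ?_
  rw [one_mul]
  refine (enorm_integral_le_lintegral_enorm _).trans (le_of_eq (lintegral_congr fun w => ?_))
  rw [enorm_smul, mul_comm, ← ofReal_norm (z - w)⁻¹, norm_inv, norm_sub_rev, Real.rpow_neg_one]

lemma cauchyT_sub {g g' : ℂ → Cn n} {z : ℂ} (hg : Integrable fun w => (z - w)⁻¹ • g w)
    (hg' : Integrable fun w => (z - w)⁻¹ • g' w) :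
    cauchyT (g - g') z = cauchyT g z - cauchyT g' z := by
  simp only [cauchyT, Pi.sub_apply, smul_sub]
  rw [integral_sub hg hg', smul_sub]

lemma enorm_cauchyT_sub_test_le {g F : ℂ → Cn n} (hF : IsTest F) (z : ℂ)
    (hg : Integrable fun w => (z - w)⁻¹ • g w) :
    ‖cauchyT g z - F z‖ₑ ≤ ∫⁻ w, ‖(g - dzb F) w‖ₑ * ENNReal.ofReal (‖w - z‖ ^ (-1 : ℝ)) := by
  have h := cauchyT_sub hg (integrable_inv_smul hF.continuous_dzb (hasCompactSupport_dzb hF.2) z)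
  rw [cauchyT_dzb hF.contDiff_one hF.2] at h
  rw [← h]
  exact enorm_cauchyT_le _ z

/-- A test function is the Cauchy transform of its own `∂̄`, so the difference is the transform of
`g - ∂̄F`. -/
lemma exists_eLpNorm_cauchyT_sub_test_le {τ : ℝ} (hτ : 0 < τ) (R : ℝ) (hR : 0 ≤ R) :
    ∃ C : ℝ≥0, ∀ g F : ℂ → Cn n, AEStronglyMeasurable g → IsTest F →
      (∀ z, Integrable fun w => (z - w)⁻¹ • g w) →
      eLpNorm (cauchyT g - F) 2 (volume.restrict (Metric.closedBall 0 R)) ≤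
        C * wNorm (jap (τ / 2)) (g - dzb F) := by
  obtain ⟨C, hC, h⟩ := exists_lintegral_cauchy_sq_le (n := n) hτ R hR
  lift C to ℝ≥0 using hC.ne
  refine ⟨NNReal.sqrt C, fun g F hg hF hi => ?_⟩
  rw [← ENNReal.pow_le_pow_left_iff two_ne_zero, eLpNorm_two_sq, mul_pow]
  have e : ((NNReal.sqrt C : ℝ≥0) : ℝ≥0∞) ^ 2 = C := by
    rw [← ENNReal.coe_pow, NNReal.sq_sqrt]
  rw [e]
  refine le_trans (lintegral_mono fun z => ?_)
    (h (g - dzb F) (hg.sub hF.continuous_dzb.aestronglyMeasurable))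
  exact pow_le_pow_left₀ (by positivity) (enorm_cauchyT_sub_test_le hF z (hi z)) 2

end JLines

/-! ### Weak derivatives of Cauchy transforms; cut-off errors. -/

namespace JLines

variable {n : ℕ}

lemma eLpNorm_le_wNorm_jap {τ : ℝ} (hτ : 0 ≤ τ) (f : ℂ → Cn n) :
    eLpNorm f 2 volume ≤ wNorm (jap τ) f := by
  rw [← wNorm_one]
  refine wNorm_mono (Eventually.of_forall fun w => ?_)
  rw [one_smul, norm_smul, Real.norm_of_nonneg (jap_pos _ _).le]
  exact le_mul_of_one_le_left (norm_nonneg _) (one_le_jap hτ w)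

lemma eLpNorm_beurling_sub_le (g : L2 n) {F : ℂ → Cn n} (hF : IsTest F) :
    eLpNorm ((beurling n g : ℂ → Cn n) - dz F) 2 volume ≤
      eLpNorm ((g : ℂ → Cn n) - dzb F) 2 volume := by
  have h := norm_beurling_le (g - hF.memLp_dzb.toLp _)
  rw [map_sub, beurling_dzb hF, one_mul, ← enorm_le_iff_norm_le, ← edist_eq_enorm_sub,
    ← edist_eq_enorm_sub, Lp.edist_def, Lp.edist_def] at h
  rwa [eLpNorm_congr_ae ((ae_eq_refl _).sub (MemLp.coeFn_toLp hF.memLp_dz)),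
    eLpNorm_congr_ae ((ae_eq_refl _).sub (MemLp.coeFn_toLp hF.memLp_dzb))] at h

/-- Approximate `g` by `∂̄F` in the norm with weight `⟨w⟩^τ`. The same `F` is then close to the
Cauchy transform of `g` locally in `L²`, and `∂F` is close to the Beurling transform of `g` in `L²`.
-/
lemma weakD_cauchyT {τ : ℝ} (hτ : 0 < τ) (hτ1 : τ ≤ 1 / 2) {g : ℂ → Cn n}
    (hg : AEStronglyMeasurable g) (hw : wNorm (jap (τ / 2)) g < ⊤)
    (hi : ∀ z, Integrable fun w => (z - w)⁻¹ • g w) (hcont : Continuous (cauchyT g))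
    {gL : L2 n} (hgL : (gL : ℂ → Cn n) =ᵐ[volume] g) :
    WeakD (cauchyT g) g (beurling n gL) := by
  refine ⟨hcont.aestronglyMeasurable, hg, Lp.aestronglyMeasurable _, fun R ε hε => ?_⟩
  obtain ⟨C, hC⟩ := exists_eLpNorm_cauchyT_sub_test_le (n := n) hτ (max R 0) (le_max_right _ _)
  have hδ : 0 < ε / (1 + C) := by positivity
  obtain ⟨F, hF, hFle⟩ := exists_wNorm_sub_dzb_le (isWeight_jap hτ.le hτ1) hg hw hδ
  have hle : ε / (1 + C) ≤ ε := div_le_self hε.le (by simp)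
  have hg2 : eLpNorm (g - dzb F) 2 volume ≤ ENNReal.ofReal ε :=
    (eLpNorm_le_wNorm_jap (by positivity) _).trans (hFle.trans (ENNReal.ofReal_le_ofReal hle))
  refine ⟨F, hF, ?_, hg2, ?_⟩
  · refine (eLpNorm_mono_measure _ (Measure.restrict_mono
      (Metric.closedBall_subset_closedBall (le_max_left R 0)) le_rfl)).trans
      ((hC g F hg hF hi).trans ?_)
    calc _ ≤ (C : ℝ≥0∞) * ENNReal.ofReal (ε / (1 + C)) := by gcongr
      _ = ENNReal.ofReal (C * (ε / (1 + C))) := by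
        rw [ENNReal.ofReal_mul (by positivity), ENNReal.ofReal_coe_nnreal]
      _ ≤ _ := by
        refine ENNReal.ofReal_le_ofReal ?_
        rw [← mul_div_assoc, div_le_iff₀ (by positivity)]
        nlinarith [C.coe_nonneg]
  · refine (eLpNorm_beurling_sub_le gL hF).trans (le_trans (le_of_eq ?_) hg2)
    exact eLpNorm_congr_ae (hgL.sub (ae_eq_refl _))

lemma eLpNorm_sub_test_restrict_of_cutoff {u F : ℂ → Cn n} {ρ R : ℝ} (hR : 0 < R) (hρ : ρ < R) :
    eLpNorm (u - fun z => cutoff R z • F z) 2 (volume.restrict (Metric.closedBall 0 ρ)) =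
      eLpNorm (u - F) 2 (volume.restrict (Metric.closedBall 0 ρ)) := by
  refine eLpNorm_congr_ae ?_
  filter_upwards [ae_restrict_mem Metric.isClosed_closedBall.measurableSet] with z hz
  have : ‖z‖ ≤ ρ := by simpa using hz
  simp [cutoff_eq_one hR (this.trans hρ.le)]

lemma eLpNorm_sub_dz_restrict_of_cutoff {h F : ℂ → Cn n} (hF : IsTest F) {ρ R : ℝ} (hR : 0 < R)
    (hρ : ρ < R) :
    eLpNorm (h - dz fun z => cutoff R z • F z) 2 (volume.restrict (Metric.closedBall 0 ρ)) =
      eLpNorm (h - dz F) 2 (volume.restrict (Metric.closedBall 0 ρ)) := by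
  refine eLpNorm_congr_ae ?_
  filter_upwards [ae_restrict_mem Metric.isClosed_closedBall.measurableSet] with z hz
  have hz' : ‖z‖ ≤ ρ := by simpa using hz
  rw [Pi.sub_apply, Pi.sub_apply,
    dz_smul ((contDiff_cutoff R).differentiable (by simp) z) (hF.differentiable z)]
  have : dz (cutoff R) z = 0 := by simp [dz, fderiv_cutoff_eq_zero hR (Or.inl (hz'.trans_lt hρ))]
  simp [this, cutoff_eq_one hR (hz'.trans hρ.le)]

lemma IsTest.cutoff_smul {F : ℂ → Cn n} (hF : ContDiff ℝ ∞ F) {R : ℝ} (hR : 0 < R) :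
    IsTest fun z => cutoff R z • F z :=
  ⟨(contDiff_cutoff R).smul hF, (hasCompactSupport_cutoff hR).smul_right⟩

lemma tendsto_wNorm_one_sub_cutoff {m : ℂ → ℝ} (hm : Measurable m) {g : ℂ → Cn n}
    (hg : AEStronglyMeasurable g) (hw : wNorm m g < ⊤) :
    Tendsto (fun k : ℕ => wNorm m (fun z => (1 - cutoff ((k : ℝ) + 1) z) • g z)) atTop (𝓝 0) := by
  suffices H : Tendsto (fun k : ℕ => wNorm m (fun z => (1 - cutoff ((k : ℝ) + 1) z) • g z) ^ 2)
      atTop (𝓝 0) by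
    have h2 := H.ennrpow_const (1 / 2 : ℝ)
    have e : ∀ x : ℝ≥0∞, (x ^ 2) ^ (1 / 2 : ℝ) = x := by
      intro x
      rw [← ENNReal.rpow_natCast, ← ENNReal.rpow_mul]; simp
    simp only [e] at h2
    rwa [ENNReal.zero_rpow_of_pos (by norm_num)] at h2
  simp_rw [wNorm_sq]
  have hc : ∀ k : ℕ, Measurable (cutoff ((k : ℝ) + 1)) := fun k =>
    (contDiff_cutoff _).continuous.measurable
  have h0 : (0 : ℝ≥0∞) = ∫⁻ _ : ℂ, 0 := by simp
  rw [h0]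
  refine tendsto_lintegral_of_dominated_convergence'
    (fun w => 4 * ENNReal.ofReal (‖g w‖ ^ 2 * m w ^ 2)) (fun k => ?_) (fun k => ?_) ?_ ?_
  · have := hc k
    have h1 : AEMeasurable fun w => ‖(1 - cutoff ((k : ℝ) + 1) w) • g w‖ :=
      (((measurable_const.sub this).aestronglyMeasurable).smul hg).norm.aemeasurable
    fun_prop
  · refine Eventually.of_forall fun w => ?_
    have : (4 : ℝ≥0∞) = ENNReal.ofReal 4 := by simp
    beta_reduce
    rw [this, ← ENNReal.ofReal_mul (by norm_num)]
    refine ENNReal.ofReal_le_ofReal ?_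
    have h1 : ‖1 - cutoff ((k : ℝ) + 1) w‖ ≤ 2 := by
      have := norm_sub_le (1 : ℂ) (cutoff ((k : ℝ) + 1) w)
      have := norm_cutoff_le ((k : ℝ) + 1) w
      rw [norm_one] at *; linarith
    rw [norm_smul, mul_pow, ← mul_assoc]
    gcongr
    nlinarith [norm_nonneg (1 - cutoff ((k : ℝ) + 1) w)]
  · rw [lintegral_const_mul' _ _ (by simp), ← wNorm_sq]
    exact ENNReal.mul_ne_top (by simp) (ENNReal.pow_ne_top hw.ne)
  · refine Eventually.of_forall fun w => ?_
    refine tendsto_const_nhds.congr' ?_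
    filter_upwards [eventually_ge_atTop ⌈‖w‖⌉₊] with k hk
    rw [cutoff_eq_one (by positivity)]
    · simp
    · exact (Nat.le_ceil _).trans (by exact_mod_cast (by omega : ⌈‖w‖⌉₊ ≤ k + 1))

/-- On the annulus of radius `R = k + 1` the factors are `R⁻²` from the gradient squared, `R^{-2s}`
from `u` squared, `R^s` from the squared weight and `R²` from the area. The product is `R^{-s}`, so
the weight `jap (s / 4)` uses only half of what the decay of `u` allows. -/
lemma tendsto_wNorm_dzb_cutoff_smul {s : ℝ} (hs : 0 < s) {u : ℂ → Cn n} {C : ℝ}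
    (hu : ∀ z, ‖u z‖ ≤ C * jap (-s / 2) z) :
    Tendsto (fun k : ℕ => wNorm (jap (s / 4)) (fun z => dzb (cutoff ((k : ℝ) + 1)) z • u z))
      atTop (𝓝 0) := by
  obtain ⟨C₂, hC₂, hcut⟩ := exists_norm_fderiv_cutoff_le
  have hb : ∀ k : ℕ, wNorm (jap (s / 4)) (fun z => dzb (cutoff ((k : ℝ) + 1)) z • u z) ^ 2 ≤
      ENNReal.ofReal (4 * C₂ ^ 2 * C ^ 2 * Real.pi * ((k : ℝ) + 1) ^ (-s)) := by
    intro k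
    have hR : (0 : ℝ) < (k : ℝ) + 1 := by positivity
    set R := (k : ℝ) + 1
    rw [wNorm_sq]
    have hpt : ∀ z, ENNReal.ofReal (‖dzb (cutoff R) z • u z‖ ^ 2 * jap (s / 4) z ^ 2) ≤
        (Metric.closedBall (0 : ℂ) (2 * R)).indicator
          (fun _ => ENNReal.ofReal ((C₂ / R) ^ 2 * (C ^ 2 * R ^ (-s)))) z := by
      intro z
      by_cases h1 : ‖z‖ < R ∨ 2 * R < ‖z‖
      · have : dzb (cutoff R) z = 0 := by simp [dzb, fderiv_cutoff_eq_zero hR h1]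
        simp [this]
      · push Not at h1
        rw [indicator_of_mem (by simpa using h1.2)]
        refine ENNReal.ofReal_le_ofReal ?_
        have b1 : ‖dzb (cutoff R) z‖ ≤ C₂ / R := (norm_dzb_le _ _).trans (hcut R hR z)
        have b2 := hu z
        rw [norm_smul, mul_pow, mul_assoc]
        have b3 : ‖u z‖ ^ 2 * jap (s / 4) z ^ 2 ≤ C ^ 2 * R ^ (-s) := by
          calc _ ≤ (C * jap (-s / 2) z) ^ 2 * jap (s / 4) z ^ 2 := by gcongr
            _ = C ^ 2 * jap (-s / 2) z := by
              rw [mul_pow, jap_sq, jap_sq, mul_assoc, jap_mul]; congr 2; ring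
            _ ≤ C ^ 2 * R ^ (-s) := by
              gcongr
              rw [jap]
              calc (1 + ‖z‖ ^ 2) ^ (-s / 2) ≤ (R ^ 2) ^ (-s / 2) :=
                    Real.rpow_le_rpow_of_nonpos (by positivity) (by nlinarith) (by linarith)
                _ = R ^ (-s) := by
                  rw [← Real.rpow_natCast, ← Real.rpow_mul hR.le]; congr 1; push_cast; ring
        gcongr
    refine (lintegral_mono hpt).trans ?_
    rw [lintegral_indicator Metric.isClosed_closedBall.measurableSet, setLIntegral_const,
      volume_closedBall_complex _ (by positivity), ← ENNReal.ofReal_mul (by positivity)]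
    refine ENNReal.ofReal_le_ofReal (le_of_eq ?_)
    field_simp
    ring
  have hlim : Tendsto (fun k : ℕ => ENNReal.ofReal (4 * C₂ ^ 2 * C ^ 2 * Real.pi *
      ((k : ℝ) + 1) ^ (-s))) atTop (𝓝 0) := by
    have h1 : Tendsto (fun k : ℕ => ((k : ℝ) + 1) ^ (-s)) atTop (𝓝 0) :=
      (tendsto_rpow_neg_atTop hs).comp
        (tendsto_atTop_add_const_right _ _ tendsto_natCast_atTop_atTop)
    have h2 := (ENNReal.continuous_ofReal.tendsto _).comp
      (h1.const_mul (4 * C₂ ^ 2 * C ^ 2 * Real.pi))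
    rwa [mul_zero, ENNReal.ofReal_zero] at h2
  have H := tendsto_of_tendsto_of_tendsto_of_le_of_le tendsto_const_nhds hlim
    (fun _ => zero_le) hb
  have h2 := H.ennrpow_const (1 / 2 : ℝ)
  have e : ∀ x : ℝ≥0∞, (x ^ 2) ^ (1 / 2 : ℝ) = x := by
    intro x
    rw [← ENNReal.rpow_natCast, ← ENNReal.rpow_mul]; simp
  simp only [e] at h2
  rwa [ENNReal.zero_rpow_of_pos (by norm_num)] at h2

end JLines

/-! ### A decaying map is the Cauchy transform of its weak `∂̄` derivative. -/

namespace JLines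

variable {n : ℕ}

/-- A decaying `u` with weak derivatives is approximated by test functions whose
`∂/∂ζ̄`-derivatives converge in weighted `L²`. -/
lemma WeakD.exists_test {s : ℝ} (hs : 0 < s) {u g h : ℂ → Cn n} (H : WeakD u g h) {C : ℝ}
    (hu : ∀ z, ‖u z‖ ≤ C * jap (-s / 2) z) (hw : wNorm (jap (s / 4)) g < ⊤) (ρ : ℝ) {ε : ℝ}
    (hε : 0 < ε) : ∃ F : ℂ → Cn n, IsTest F ∧
      wNorm (jap (s / 4)) (g - dzb F) ≤ ENNReal.ofReal ε ∧
      eLpNorm (u - F) 2 (volume.restrict (Metric.closedBall 0 ρ)) ≤ ENNReal.ofReal ε ∧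
      eLpNorm (h - dz F) 2 (volume.restrict (Metric.closedBall 0 ρ)) ≤ ENNReal.ofReal ε := by
  obtain ⟨C₂, hC₂, hcut⟩ := exists_norm_fderiv_cutoff_le
  have hm : Measurable (jap (s / 4)) := measurable_jap _
  have hε4 : (0 : ℝ≥0∞) < ENNReal.ofReal (ε / 4) := by positivity
  obtain ⟨k, hk1, hk2, hk3⟩ :=
    (((tendsto_wNorm_one_sub_cutoff hm H.meas_g hw).eventually (ge_mem_nhds hε4)).and
    (((tendsto_wNorm_dzb_cutoff_smul hs hu).eventually (ge_mem_nhds hε4)).and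
    (eventually_ge_atTop ⌈ρ⌉₊))).exists
  set R : ℝ := (k : ℝ) + 1 with hRdef
  have hR : 0 < R := by positivity
  have hρR : ρ < R := (Nat.le_ceil ρ).trans_lt (by rw [hRdef]; exact_mod_cast Nat.lt_succ_of_le hk3)
  set M : ℝ := (1 + (2 * R) ^ 2) ^ (s / 4) with hM
  have hM1 : 1 ≤ M := Real.one_le_rpow (by nlinarith [sq_nonneg (2 * R)]) (by positivity)
  set c : ℝ := M * (1 + C₂ / R) with hcdef
  have hc1 : 1 ≤ c := by
    have : 0 ≤ C₂ / R := by positivity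
    nlinarith
  have hδ : 0 < ε / 4 / c := by positivity
  -- The cut-off radius is fixed first; the accuracy of `F` then compensates for the weight `M` and
  -- the gradient of the cut-off on that fixed disc.
  obtain ⟨F, hF, hFu, hFg, hFh⟩ := H.approx (2 * R) (ε / 4 / c) hδ
  have hδle : ε / 4 / c ≤ ε := (div_le_self (by positivity) hc1).trans (by linarith)
  refine ⟨fun z => cutoff R z • F z, IsTest.cutoff_smul hF.1 hR, ?_, ?_, ?_⟩
  · have hcd : Differentiable ℝ (cutoff R) := (contDiff_cutoff R).differentiable (by simp)
    have hχm : Continuous (cutoff R) := (contDiff_cutoff R).continuous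
    have hdχm : Continuous (dzb (cutoff R)) :=
      continuous_dzb ((contDiff_cutoff R).of_le (by exact_mod_cast le_top))
    have hFm := hF.1.continuous.aestronglyMeasurable (μ := (volume : Measure ℂ))
    have hFbm := hF.continuous_dzb.aestronglyMeasurable (μ := (volume : Measure ℂ))
    let t₁ : ℂ → Cn n := fun z => (1 - cutoff R z) • g z
    let t₂ : ℂ → Cn n := fun z => dzb (cutoff R) z • u z
    let t₃ : ℂ → Cn n := fun z => cutoff R z • (g - dzb F) z
    let t₄ : ℂ → Cn n := fun z => dzb (cutoff R) z • (u - F) z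
    have m₁ : AEStronglyMeasurable t₁ :=
      (continuous_const.sub hχm).aestronglyMeasurable.smul H.meas_g
    have m₂ : AEStronglyMeasurable t₂ := hdχm.aestronglyMeasurable.smul H.meas_u
    have m₃ : AEStronglyMeasurable t₃ := hχm.aestronglyMeasurable.smul (H.meas_g.sub hFbm)
    have m₄ : AEStronglyMeasurable t₄ := hdχm.aestronglyMeasurable.smul (H.meas_u.sub hFm)
    -- The first two errors depend only on the cut-off radius and vanish as it grows, by
    -- integrability of `g` and decay of `u`. The last two are controlled by the quality of the
    -- local approximation.
    have e : (g - dzb fun z => cutoff R z • F z) = (t₁ - t₂) + (t₃ + t₄) := by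
      funext z
      simp only [Pi.sub_apply, Pi.add_apply, t₁, t₂, t₃, t₄, dzb_smul (hcd z) (hF.differentiable z)]
      module
    have b₃ : wNorm (jap (s / 4)) t₃ ≤ ENNReal.ofReal (ε / 4) := by
      have : ∀ z, ‖jap (s / 4) z • t₃ z‖ ≤ M * ‖(g - dzb F) z‖ := by
        intro z
        rw [norm_smul, norm_smul, Real.norm_of_nonneg (jap_pos _ _).le, ← mul_assoc]
        gcongr
        by_cases hz : ‖z‖ ≤ 2 * R
        · calc _ ≤ M * 1 := by
                gcongr
                · exact jap_le_of_norm_le (by positivity) hz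
                · exact norm_cutoff_le _ _
            _ = M := mul_one M
        · rw [cutoff_eq_zero hR (not_le.1 hz).le]; simp; positivity
      refine (eLpNorm_le_mul_eLpNorm_of_ae_le_mul (Eventually.of_forall this) 2).trans ?_
      calc _ ≤ ENNReal.ofReal M * ENNReal.ofReal (ε / 4 / c) := by gcongr
        _ ≤ _ := by
          rw [← ENNReal.ofReal_mul (by positivity)]
          refine ENNReal.ofReal_le_ofReal ?_
          have : M ≤ c := le_mul_of_one_le_right (by positivity) (by
            have : 0 ≤ C₂ / R := by positivity
            linarith)
          rw [← mul_div_assoc, div_le_iff₀ (by positivity), mul_comm]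
          gcongr
    have b₄ : wNorm (jap (s / 4)) t₄ ≤ ENNReal.ofReal (ε / 4) := by
      have : ∀ z, ‖jap (s / 4) z • t₄ z‖ ≤
          (M * (C₂ / R)) * ‖(Metric.closedBall 0 (2 * R)).indicator (u - F) z‖ := by
        intro z
        rw [norm_smul, norm_smul, Real.norm_of_nonneg (jap_pos _ _).le, ← mul_assoc]
        by_cases hz : ‖z‖ ≤ 2 * R
        · rw [indicator_of_mem (by simpa using hz)]
          gcongr
          · exact jap_le_of_norm_le (by positivity) hz
          · exact (norm_dzb_le _ _).trans (hcut R hR z)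
        · have : dzb (cutoff R) z = 0 := by
            simp [dzb, fderiv_cutoff_eq_zero hR (Or.inr (not_le.1 hz))]
          rw [this]; simp; positivity
      refine (eLpNorm_le_mul_eLpNorm_of_ae_le_mul (Eventually.of_forall this) 2).trans ?_
      rw [eLpNorm_indicator_eq_eLpNorm_restrict Metric.isClosed_closedBall.measurableSet]
      calc _ ≤ ENNReal.ofReal (M * (C₂ / R)) * ENNReal.ofReal (ε / 4 / c) := by gcongr
        _ ≤ _ := by
          rw [← ENNReal.ofReal_mul (by positivity)]
          refine ENNReal.ofReal_le_ofReal ?_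
          have : M * (C₂ / R) ≤ c := by rw [hcdef]; gcongr; linarith
          rw [← mul_div_assoc, div_le_iff₀ (by positivity), mul_comm]
          gcongr
    rw [e]
    calc _ ≤ wNorm (jap (s / 4)) (t₁ - t₂) + wNorm (jap (s / 4)) (t₃ + t₄) :=
          wNorm_add_le hm (m₁.sub m₂) (m₃.add m₄)
      _ ≤ (wNorm (jap (s / 4)) t₁ + wNorm (jap (s / 4)) t₂) +
          (wNorm (jap (s / 4)) t₃ + wNorm (jap (s / 4)) t₄) :=
          add_le_add (wNorm_sub_le hm m₁ m₂) (wNorm_add_le hm m₃ m₄)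
      _ ≤ (ENNReal.ofReal (ε / 4) + ENNReal.ofReal (ε / 4)) +
          (ENNReal.ofReal (ε / 4) + ENNReal.ofReal (ε / 4)) :=
          add_le_add (add_le_add hk1 hk2) (add_le_add b₃ b₄)
      _ = ENNReal.ofReal ε := by
          rw [← ENNReal.ofReal_add (by positivity) (by positivity),
            ← ENNReal.ofReal_add (by positivity) (by positivity)]
          congr 1; ring
  · rw [eLpNorm_sub_test_restrict_of_cutoff hR hρR]
    refine (eLpNorm_mono_measure _ (Measure.restrict_mono
      (Metric.closedBall_subset_closedBall (by linarith)) le_rfl)).trans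
      (hFu.trans (ENNReal.ofReal_le_ofReal hδle))
  · rw [eLpNorm_sub_dz_restrict_of_cutoff hF hR hρR]
    exact (eLpNorm_mono_measure _ Measure.restrict_le_self).trans
      (hFh.trans (ENNReal.ofReal_le_ofReal hδle))

lemma ae_eq_of_restrict_closedBall {f g : ℂ → Cn n}
    (h : ∀ k : ℕ, f =ᵐ[volume.restrict (Metric.closedBall 0 k)] g) : f =ᵐ[volume] g := by
  have h1 : ∀ k : ℕ, ∀ᵐ z : ℂ, z ∈ Metric.closedBall (0 : ℂ) k → f z = g z := fun k =>
    (ae_restrict_iff' Metric.isClosed_closedBall.measurableSet).1 (h k)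
  filter_upwards [ae_all_iff.2 h1] with z hz
  exact hz ⌈‖z‖⌉₊ (by simpa using Nat.le_ceil _)

lemma ae_eq_of_forall_eLpNorm_le {μ : Measure ℂ} {f g : ℂ → Cn n} (hf : AEStronglyMeasurable f μ)
    (hg : AEStronglyMeasurable g μ) {C : ℝ≥0}
    (h : ∀ ε : ℝ, 0 < ε → eLpNorm (f - g) 2 μ ≤ C * ENNReal.ofReal ε) : f =ᵐ[μ] g := by
  have h0 : eLpNorm (f - g) 2 μ = 0 := by
    have hlim : Tendsto (fun k : ℕ => (C : ℝ≥0∞) * ENNReal.ofReal (1 / ((k : ℝ) + 1))) atTop (𝓝 0) := by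
      have h1 := (ENNReal.continuous_ofReal.tendsto _).comp
        (tendsto_one_div_add_atTop_nhds_zero_nat (𝕜 := ℝ))
      have h2 := ENNReal.Tendsto.const_mul (a := (C : ℝ≥0∞)) h1 (Or.inr ENNReal.coe_ne_top)
      rwa [ENNReal.ofReal_zero, mul_zero] at h2
    exact le_antisymm (ge_of_tendsto' hlim fun k => h _ (by positivity)) zero_le
  have := (eLpNorm_eq_zero_iff (hf.sub hg) (by norm_num)).1 h0
  filter_upwards [this] with z hz
  exact sub_eq_zero.1 hz

/-- A decaying map is recovered from its weak `∂/∂ζ̄`-derivative by the Cauchy transform. -/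
lemma WeakD.eq_cauchyT {s : ℝ} (hs : 0 < s) {u g h : ℂ → Cn n} (H : WeakD u g h) {C : ℝ}
    (hu : ∀ z, ‖u z‖ ≤ C * jap (-s / 2) z) (hw : wNorm (jap (s / 4)) g < ⊤)
    (hi : ∀ z, Integrable fun w => (z - w)⁻¹ • g w) (hcont : Continuous (cauchyT g))
    {gL : L2 n} (hgL : (gL : ℂ → Cn n) =ᵐ[volume] g) :
    u =ᵐ[volume] cauchyT g ∧ h =ᵐ[volume] beurling n gL := by
  constructor
  · refine ae_eq_of_restrict_closedBall fun k => ?_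
    obtain ⟨C', hC'⟩ := exists_eLpNorm_cauchyT_sub_test_le (n := n) (τ := s / 2) (by positivity)
      (k : ℝ) (by positivity)
    refine ae_eq_of_forall_eLpNorm_le (C := 1 + C') H.meas_u.restrict
      hcont.aestronglyMeasurable fun ε hε => ?_
    obtain ⟨F, hF, h1, h2, -⟩ := H.exists_test hs hu hw k hε
    have h3 := hC' g F H.meas_g hF hi
    -- Both functions are approximated on the disc by one and the same test function, so no
    -- Liouville theorem is needed.
    have e : u - cauchyT g = (u - F) - (cauchyT g - F) := by abel
    have hFm := hF.1.continuous.aestronglyMeasurable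
      (μ := volume.restrict (Metric.closedBall (0 : ℂ) k))
    rw [e]
    refine (eLpNorm_sub_le (H.meas_u.restrict.sub hFm) (hcont.aestronglyMeasurable.sub hFm)
      (by norm_num)).trans ?_
    rw [ENNReal.coe_add, ENNReal.coe_one, add_mul, one_mul]
    have e4 : s / 2 / 2 = s / 4 := by ring
    rw [e4] at h3
    exact add_le_add h2 (h3.trans (by gcongr))
  · refine ae_eq_of_restrict_closedBall fun k => ?_
    refine ae_eq_of_forall_eLpNorm_le (C := 2) H.meas_h.restrict
      (Lp.aestronglyMeasurable _).restrict fun ε hε => ?_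
    obtain ⟨F, hF, h1, -, h2⟩ := H.exists_test hs hu hw k hε
    have e : h - (beurling n gL : ℂ → Cn n) = (h - dz F) - ((beurling n gL : ℂ → Cn n) - dz F) := by
      abel
    have hFm := hF.continuous_dz.aestronglyMeasurable
      (μ := volume.restrict (Metric.closedBall (0 : ℂ) k))
    rw [e]
    refine (eLpNorm_sub_le (H.meas_h.restrict.sub hFm)
      ((Lp.aestronglyMeasurable _).restrict.sub hFm) (by norm_num)).trans ?_
    have h4 : eLpNorm ((beurling n gL : ℂ → Cn n) - dz F) 2
        (volume.restrict (Metric.closedBall 0 k)) ≤ ENNReal.ofReal ε :=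
      (eLpNorm_mono_measure _ Measure.restrict_le_self).trans
        ((eLpNorm_beurling_sub_le gL hF).trans
        ((eLpNorm_congr_ae (hgL.sub (ae_eq_refl _))).le.trans
        ((eLpNorm_le_wNorm_jap (by positivity) _).trans h1)))
    calc _ ≤ ENNReal.ofReal ε + ENNReal.ofReal ε := add_le_add h2 h4
      _ = _ := by push_cast; rw [two_mul]

end JLines

/-! ### Reparametrisations of the plane and the chain rule. -/

namespace JLines

variable {n : ℕ}

/-- A smooth bi-Lipschitz reparametrisation of the plane. -/
structure Repar (φ : ℂ → ℂ) : Prop where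
  smooth : ContDiff ℝ ∞ φ
  surj : Function.Surjective φ
  lip : ∀ a b, ‖φ a - φ b‖ ≤ 2 * ‖a - b‖
  anti : ∀ a b, ‖a - b‖ ≤ 2 * ‖φ a - φ b‖
  det : ∀ z, 1 / 4 ≤ |(fderiv ℝ φ z).det|

namespace Repar

variable {φ : ℂ → ℂ}

lemma differentiable (hφ : Repar φ) : Differentiable ℝ φ := hφ.smooth.differentiable (by simp)

lemma inj (hφ : Repar φ) : Function.Injective φ := by
  intro a b h
  have := hφ.anti a b
  rw [h, sub_self, norm_zero, mul_zero] at this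
  exact sub_eq_zero.1 (norm_le_zero_iff.1 this)

lemma lintegral_comp_le (hφ : Repar φ) (G : ℂ → ℝ≥0∞) : ∫⁻ z, G (φ z) ≤ 4 * ∫⁻ z, G z := by
  have h := lintegral_image_eq_lintegral_abs_det_fderiv_mul (volume : Measure ℂ) MeasurableSet.univ
    (fun z _ => (hφ.differentiable z).hasFDerivAt.hasFDerivWithinAt) hφ.inj.injOn G
  rw [image_univ, hφ.surj.range_eq, Measure.restrict_univ] at h
  rw [h, ← lintegral_const_mul' _ _ (by simp)]
  refine lintegral_mono fun z => ?_
  rw [← mul_assoc]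
  refine le_mul_of_one_le_left zero_le ?_
  have : (4 : ℝ≥0∞) = ENNReal.ofReal 4 := by simp
  rw [this, ← ENNReal.ofReal_mul (by norm_num)]
  refine ENNReal.one_le_ofReal.2 ?_
  have := hφ.det z
  linarith

/-- Null sets pull back to null sets, so composition with `φ` is well defined on almost-everywhere
classes. -/
lemma quasi (hφ : Repar φ) : Measure.QuasiMeasurePreserving φ volume volume := by
  refine ⟨hφ.smooth.continuous.measurable, Measure.AbsolutelyContinuous.mk fun s hs h0 => ?_⟩
  rw [Measure.map_apply hφ.smooth.continuous.measurable hs]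
  have h := hφ.lintegral_comp_le (s.indicator 1)
  rw [lintegral_indicator_one hs, h0, mul_zero] at h
  have e : ∀ z, s.indicator (1 : ℂ → ℝ≥0∞) (φ z) = (φ ⁻¹' s).indicator 1 z := fun z => rfl
  simp_rw [e] at h
  rw [lintegral_indicator_one (hφ.smooth.continuous.measurable hs)] at h
  exact le_antisymm h zero_le

lemma eLpNorm_comp_le (hφ : Repar φ) (f : ℂ → Cn n) :
    eLpNorm (f ∘ φ) 2 volume ≤ 2 * eLpNorm f 2 volume := by
  rw [← ENNReal.pow_le_pow_left_iff two_ne_zero, eLpNorm_two_sq, mul_pow, eLpNorm_two_sq]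
  refine (hφ.lintegral_comp_le (fun z => ‖f z‖ₑ ^ 2)).trans (le_of_eq ?_)
  norm_num

lemma norm_fderiv_le (hφ : Repar φ) (z : ℂ) : ‖fderiv ℝ φ z‖ ≤ 2 :=
  norm_fderiv_le_of_lip' ℝ (by norm_num) (Eventually.of_forall fun x => hφ.lip x z)

lemma comp_test (hφ : Repar φ) {F : ℂ → Cn n} (hF : IsTest F) : IsTest (F ∘ φ) := by
  refine ⟨hF.1.comp hφ.smooth, ?_⟩
  obtain ⟨R, hR, h⟩ := hF.2.isCompact.isBounded.exists_pos_norm_le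
  refine HasCompactSupport.intro (isCompact_closedBall (0 : ℂ) (2 * (R + ‖φ 0‖))) fun z hz => ?_
  show F (φ z) = 0
  refine image_eq_zero_of_notMem_tsupport (f := F) fun h' => hz ?_
  have h1 := h _ h'
  have h2 := hφ.anti z 0
  have h3 := norm_sub_le (φ z) (φ 0)
  rw [mem_closedBall_zero_iff]
  rw [sub_zero] at h2
  linarith

end Repar

lemma dz_comp {F : ℂ → Cn n} {φ : ℂ → ℂ} {z : ℂ} (hF : DifferentiableAt ℝ F (φ z))
    (hφ : DifferentiableAt ℝ φ z) : dz (F ∘ φ) z =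
      dz φ z • dz F (φ z) + (starRingEnd ℂ) (dzb φ z) • dzb F (φ z) := by
  conv_lhs => rw [dz]
  rw [fderiv_comp z hF hφ, ContinuousLinearMap.comp_apply, ContinuousLinearMap.comp_apply,
    fderiv_eq_dz_dzb, fderiv_eq_dz_dzb]
  have e1 : dz φ z = 2⁻¹ * (fderiv ℝ φ z 1 - Complex.I * fderiv ℝ φ z Complex.I) := rfl
  have e2 : dzb φ z = 2⁻¹ * (fderiv ℝ φ z 1 + Complex.I * fderiv ℝ φ z Complex.I) := rfl
  rw [e1, e2]
  simp only [map_mul, map_add, Complex.conj_I, map_inv₀, Complex.conj_ofNat]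
  module

lemma dzb_comp {F : ℂ → Cn n} {φ : ℂ → ℂ} {z : ℂ} (hF : DifferentiableAt ℝ F (φ z))
    (hφ : DifferentiableAt ℝ φ z) : dzb (F ∘ φ) z =
      dzb φ z • dz F (φ z) + (starRingEnd ℂ) (dz φ z) • dzb F (φ z) := by
  conv_lhs => rw [dzb]
  rw [fderiv_comp z hF hφ, ContinuousLinearMap.comp_apply, ContinuousLinearMap.comp_apply,
    fderiv_eq_dz_dzb, fderiv_eq_dz_dzb]
  have e1 : dz φ z = 2⁻¹ * (fderiv ℝ φ z 1 - Complex.I * fderiv ℝ φ z Complex.I) := rfl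
  have e2 : dzb φ z = 2⁻¹ * (fderiv ℝ φ z 1 + Complex.I * fderiv ℝ φ z Complex.I) := rfl
  rw [e1, e2]
  simp only [map_mul, map_sub, Complex.conj_I, map_inv₀, Complex.conj_ofNat]
  module

lemma eLpNorm_smul_comp_add_le {φ p q : ℂ → ℂ} (hφ : Repar φ) (hp : ∀ z, ‖p z‖ ≤ 2)
    (hq : ∀ z, ‖q z‖ ≤ 2) (hpc : Continuous p) (hqc : Continuous q) {a b : ℂ → Cn n}
    (ha : AEStronglyMeasurable a) (hb : AEStronglyMeasurable b) {ε : ℝ} (hε : 0 ≤ ε)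
    (hae : eLpNorm a 2 volume ≤ ENNReal.ofReal (ε / 8))
    (hbe : eLpNorm b 2 volume ≤ ENNReal.ofReal (ε / 8)) :
    eLpNorm (fun z => p z • a (φ z) + q z • b (φ z)) 2 volume ≤ ENNReal.ofReal ε := by
  have key : ∀ (r : ℂ → ℂ) (c : ℂ → Cn n), (∀ z, ‖r z‖ ≤ 2) →
      eLpNorm c 2 volume ≤ ENNReal.ofReal (ε / 8) →
      eLpNorm (fun z => r z • c (φ z)) 2 volume ≤ ENNReal.ofReal (ε / 2) := by
    intro r c hr hc
    refine (eLpNorm_le_mul_eLpNorm_of_ae_le_mul (c := 2) (g := c ∘ φ)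
      (Eventually.of_forall fun z => ?_) 2).trans ?_
    · rw [norm_smul]; exact mul_le_mul_of_nonneg_right (hr z) (norm_nonneg _)
    · calc _ ≤ ENNReal.ofReal 2 * (2 * ENNReal.ofReal (ε / 8)) := by
            gcongr; exact (hφ.eLpNorm_comp_le c).trans (by gcongr)
        _ = _ := by
          have : (2 : ℝ≥0∞) = ENNReal.ofReal 2 := by simp
          rw [this, ← ENNReal.ofReal_mul (by norm_num), ← ENNReal.ofReal_mul (by norm_num)]
          congr 1; ring
  have m1 : AEStronglyMeasurable (fun z => p z • a (φ z)) volume :=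
    hpc.aestronglyMeasurable.smul (ha.comp_quasiMeasurePreserving hφ.quasi)
  have m2 : AEStronglyMeasurable (fun z => q z • b (φ z)) volume :=
    hqc.aestronglyMeasurable.smul (hb.comp_quasiMeasurePreserving hφ.quasi)
  refine (eLpNorm_add_le m1 m2 (by norm_num)).trans ?_
  calc _ ≤ ENNReal.ofReal (ε / 2) + ENNReal.ofReal (ε / 2) :=
        add_le_add (key p a hp hae) (key q b hq hbe)
    _ = _ := by rw [← ENNReal.ofReal_add (by positivity) (by positivity), add_halves]

/-- Chain rule for weak derivatives. -/
lemma WeakD.comp {u g h : ℂ → Cn n} (H : WeakD u g h) {φ : ℂ → ℂ} (hφ : Repar φ) :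
    WeakD (u ∘ φ) (fun z => dzb φ z • h (φ z) + (starRingEnd ℂ) (dz φ z) • g (φ z))
      (fun z => dz φ z • h (φ z) + (starRingEnd ℂ) (dzb φ z) • g (φ z)) := by
  have hφ1 : ContDiff ℝ 1 φ := hφ.smooth.of_le (by exact_mod_cast le_top)
  have c1 := continuous_dz hφ1
  have c2 := continuous_dzb hφ1
  have c3 : Continuous fun z => (starRingEnd ℂ) (dz φ z) := Complex.continuous_conj.comp c1
  have c4 : Continuous fun z => (starRingEnd ℂ) (dzb φ z) := Complex.continuous_conj.comp c2
  have b1 : ∀ z, ‖dz φ z‖ ≤ 2 := fun z => (norm_dz_le _ _).trans (hφ.norm_fderiv_le z)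
  have b2 : ∀ z, ‖dzb φ z‖ ≤ 2 := fun z => (norm_dzb_le _ _).trans (hφ.norm_fderiv_le z)
  have b3 : ∀ z, ‖(starRingEnd ℂ) (dz φ z)‖ ≤ 2 := fun z => by rw [RCLike.norm_conj]; exact b1 z
  have b4 : ∀ z, ‖(starRingEnd ℂ) (dzb φ z)‖ ≤ 2 := fun z => by rw [RCLike.norm_conj]; exact b2 z
  have mg := H.meas_g.comp_quasiMeasurePreserving hφ.quasi
  have mh := H.meas_h.comp_quasiMeasurePreserving hφ.quasi
  refine ⟨H.meas_u.comp_quasiMeasurePreserving hφ.quasi,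
    (c2.aestronglyMeasurable.smul mh).add (c3.aestronglyMeasurable.smul mg),
    (c1.aestronglyMeasurable.smul mh).add (c4.aestronglyMeasurable.smul mg), fun R ε hε => ?_⟩
  obtain ⟨F, hF, h1, h2, h3⟩ := H.approx (2 * R + ‖φ 0‖) (ε / 8) (by positivity)
  refine ⟨F ∘ φ, hφ.comp_test hF, ?_, ?_, ?_⟩
  · set B := Metric.closedBall (0 : ℂ) (2 * R + ‖φ 0‖)
    have e : ∀ z ∈ Metric.closedBall (0 : ℂ) R, φ z ∈ B := by
      intro z hz
      rw [mem_closedBall_zero_iff] at *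
      have := hφ.lip z 0
      have := norm_le_norm_add_norm_sub' (φ z) (φ 0)
      rw [sub_zero] at *
      linarith
    calc eLpNorm (u ∘ φ - F ∘ φ) 2 (volume.restrict (Metric.closedBall 0 R))
        = eLpNorm ((B.indicator (u - F)) ∘ φ) 2 (volume.restrict (Metric.closedBall 0 R)) := by
          refine eLpNorm_congr_ae ?_
          filter_upwards [ae_restrict_mem Metric.isClosed_closedBall.measurableSet] with z hz
          rw [Function.comp_apply, indicator_of_mem (e z hz)]; rfl
      _ ≤ eLpNorm ((B.indicator (u - F)) ∘ φ) 2 volume :=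
          eLpNorm_mono_measure _ Measure.restrict_le_self
      _ ≤ 2 * eLpNorm (B.indicator (u - F)) 2 volume := hφ.eLpNorm_comp_le _
      _ ≤ 2 * ENNReal.ofReal (ε / 8) := by
          rw [eLpNorm_indicator_eq_eLpNorm_restrict Metric.isClosed_closedBall.measurableSet]
          gcongr
      _ ≤ _ := by
          have : (2 : ℝ≥0∞) = ENNReal.ofReal 2 := by simp
          rw [this, ← ENNReal.ofReal_mul (by norm_num)]
          exact ENNReal.ofReal_le_ofReal (by linarith)
  · refine le_trans (le_of_eq (congrArg (fun f => eLpNorm f 2 volume) ?_))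
      (eLpNorm_smul_comp_add_le hφ b2 b3 c2 c3
      (H.meas_h.sub hF.continuous_dz.aestronglyMeasurable)
      (H.meas_g.sub hF.continuous_dzb.aestronglyMeasurable) hε.le h3 h2)
    funext z
    rw [Pi.sub_apply, dzb_comp (hF.differentiable _) (hφ.differentiable z)]
    simp only [Pi.sub_apply]
    module
  · refine le_trans (le_of_eq (congrArg (fun f => eLpNorm f 2 volume) ?_))
      (eLpNorm_smul_comp_add_le hφ b1 b4 c1 c4
      (H.meas_h.sub hF.continuous_dz.aestronglyMeasurable)
      (H.meas_g.sub hF.continuous_dzb.aestronglyMeasurable) hε.le h3 h2)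
    funext z
    rw [Pi.sub_apply, dz_comp (hF.differentiable _) (hφ.differentiable z)]
    simp only [Pi.sub_apply]
    module

lemma IsTest.weakD {F : ℂ → Cn n} (hF : IsTest F) : WeakD F (dzb F) (dz F) :=
  ⟨hF.1.continuous.aestronglyMeasurable, hF.continuous_dzb.aestronglyMeasurable,
    hF.continuous_dz.aestronglyMeasurable, fun R ε hε => ⟨F, hF, by simp⟩⟩

lemma dz_sub {f g : ℂ → Cn n} (hf : Differentiable ℝ f) (hg : Differentiable ℝ g) :
    dz (f - g) = dz f - dz g := by
  funext z
  simp only [dz, fderiv_sub (hf z) (hg z), _root_.sub_apply, Pi.sub_apply]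
  module

lemma dzb_sub {f g : ℂ → Cn n} (hf : Differentiable ℝ f) (hg : Differentiable ℝ g) :
    dzb (f - g) = dzb f - dzb g := by
  funext z
  simp only [dzb, fderiv_sub (hf z) (hg z), _root_.sub_apply, Pi.sub_apply]
  module

lemma eLpNorm_sub_sub_le {μ : Measure ℂ} {a b c d : ℂ → Cn n} (ha : AEStronglyMeasurable a μ)
    (hb : AEStronglyMeasurable b μ) (hc : AEStronglyMeasurable c μ)
    (hd : AEStronglyMeasurable d μ) {ε : ℝ} (hε : 0 ≤ ε)
    (h1 : eLpNorm (a - c) 2 μ ≤ ENNReal.ofReal (ε / 2))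
    (h2 : eLpNorm (b - d) 2 μ ≤ ENNReal.ofReal (ε / 2)) :
    eLpNorm ((a - b) - (c - d)) 2 μ ≤ ENNReal.ofReal ε := by
  have e : (a - b) - (c - d) = (a - c) - (b - d) := by abel
  rw [e]
  refine (eLpNorm_sub_le (ha.sub hc) (hb.sub hd) (by norm_num)).trans ((add_le_add h1 h2).trans ?_)
  rw [← ENNReal.ofReal_add (by positivity) (by positivity), add_halves]

lemma WeakD.sub {u g h u' g' h' : ℂ → Cn n} (H : WeakD u g h) (H' : WeakD u' g' h') :
    WeakD (u - u') (g - g') (h - h') := by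
  refine ⟨H.meas_u.sub H'.meas_u, H.meas_g.sub H'.meas_g, H.meas_h.sub H'.meas_h,
    fun R ε hε => ?_⟩
  obtain ⟨F, hF, h1, h2, h3⟩ := H.approx R (ε / 2) (by positivity)
  obtain ⟨F', hF', h1', h2', h3'⟩ := H'.approx R (ε / 2) (by positivity)
  refine ⟨F - F', hF.sub hF', ?_, ?_, ?_⟩
  · exact eLpNorm_sub_sub_le H.meas_u.restrict H'.meas_u.restrict
      hF.1.continuous.aestronglyMeasurable hF'.1.continuous.aestronglyMeasurable hε.le h1 h1'
  · rw [dzb_sub hF.differentiable hF'.differentiable]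
    exact eLpNorm_sub_sub_le H.meas_g H'.meas_g hF.continuous_dzb.aestronglyMeasurable
      hF'.continuous_dzb.aestronglyMeasurable hε.le h2 h2'
  · rw [dz_sub hF.differentiable hF'.differentiable]
    exact eLpNorm_sub_sub_le H.meas_h H'.meas_h hF.continuous_dz.aestronglyMeasurable
      hF'.continuous_dz.aestronglyMeasurable hε.le h3 h3'

lemma WeakD.congr {u g h g' h' : ℂ → Cn n} (H : WeakD u g h) (hg : g =ᵐ[volume] g')
    (hh : h =ᵐ[volume] h') : WeakD u g' h' := by
  refine ⟨H.meas_u, H.meas_g.congr hg, H.meas_h.congr hh, fun R ε hε => ?_⟩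
  obtain ⟨F, hF, h1, h2, h3⟩ := H.approx R ε hε
  refine ⟨F, hF, h1, ?_, ?_⟩
  · rwa [eLpNorm_congr_ae (hg.symm.sub (ae_eq_refl _))]
  · rwa [eLpNorm_congr_ae (hh.symm.sub (ae_eq_refl _))]

end JLines

/-! ### Weak and classical derivatives agree for smooth maps. -/

namespace JLines

variable {n : ℕ}

lemma integral_fderiv_apply_eq_zero' {g : ℂ → Cn n} (hg : ContDiff ℝ 1 g)
    (hc : HasCompactSupport g) (v : ℂ) : ∫ z, fderiv ℝ g z v = 0 := by
  have hcont := hg.continuous_fderiv (by norm_num)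
  have h1 : Integrable (fun z => fderiv ℝ g z v) :=
    (by fun_prop : Continuous fun z => fderiv ℝ g z v).integrable_of_hasCompactSupport
      ((hc.fderiv (𝕜 := ℝ)).comp_left (g := fun A : ℂ →L[ℝ] Cn n => A v) rfl)
  have h2 : Integrable g := hg.continuous.integrable_of_hasCompactSupport hc
  have := integral_smul_fderiv_eq_neg_fderiv_smul_of_integrable (μ := (volume : Measure ℂ))
    (f := fun _ : ℂ => (1 : ℝ)) (g := g) (v := v) (by simp) (by simpa using h1) (by simpa using h2)
    (by simp) (fun x _ => (hg.differentiable (by norm_num)) x)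
  simpa using this

/-- A common form of `dz` (`c = -I`) and `dzb` (`c = I`). -/
lemma integral_wirtinger_eq_zero {g : ℂ → Cn n} (hg : ContDiff ℝ 1 g) (hc : HasCompactSupport g)
    (c : ℂ) : ∫ z, (2⁻¹ : ℂ) • (fderiv ℝ g z 1 + c • fderiv ℝ g z Complex.I) = 0 := by
  have hcont := hg.continuous_fderiv (by norm_num)
  have h1 : ∀ v, Integrable (fun z => fderiv ℝ g z v) := fun v =>
    (by fun_prop : Continuous fun z => fderiv ℝ g z v).integrable_of_hasCompactSupport
      ((hc.fderiv (𝕜 := ℝ)).comp_left (g := fun A : ℂ →L[ℝ] Cn n => A v) rfl)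
  have h2 : Integrable (fun z => c • fderiv ℝ g z Complex.I) := (h1 _).smul c
  rw [integral_smul, integral_add (h1 _) h2, integral_smul,
    integral_fderiv_apply_eq_zero' hg hc, integral_fderiv_apply_eq_zero' hg hc]
  simp

lemma integral_dz_eq_zero {g : ℂ → Cn n} (hg : ContDiff ℝ 1 g) (hc : HasCompactSupport g) :
    ∫ z, dz g z = 0 := by
  have := integral_wirtinger_eq_zero hg hc (-Complex.I)
  simp only [neg_smul, ← sub_eq_add_neg] at this
  exact this

lemma integral_dzb_eq_zero {g : ℂ → Cn n} (hg : ContDiff ℝ 1 g) (hc : HasCompactSupport g) :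
    ∫ z, dzb g z = 0 := integral_wirtinger_eq_zero hg hc Complex.I

lemma norm_integral_smul_le {ψ : ℂ → ℂ} {f : ℂ → Cn n} (hψ : Continuous ψ)
    {B : ℝ} (hf : AEStronglyMeasurable f) {R : ℝ} (hψR : ∀ z, R < ‖z‖ → ψ z = 0)
    (hB : eLpNorm ψ 2 volume ≤ ENNReal.ofReal B) {ε : ℝ} (hB0 : 0 ≤ B)
    (hε : eLpNorm f 2 (volume.restrict (Metric.closedBall 0 R)) ≤ ENNReal.ofReal ε) :
    ‖∫ z, ψ z • f z‖ ≤ B * max ε 0 := by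
  have e : ∀ z, ψ z • f z = ψ z • (Metric.closedBall (0 : ℂ) R).indicator f z := by
    intro z
    by_cases hz : z ∈ Metric.closedBall (0 : ℂ) R
    · rw [indicator_of_mem hz]
    · rw [mem_closedBall_zero_iff, not_le] at hz
      rw [hψR z hz, zero_smul, zero_smul]
  simp_rw [e]
  rw [← eLpNorm_indicator_eq_eLpNorm_restrict Metric.isClosed_closedBall.measurableSet] at hε
  have h2 : eLpNorm (fun z => ψ z • (Metric.closedBall (0 : ℂ) R).indicator f z) 1 volume ≤
      ENNReal.ofReal (B * max ε 0) := by
    refine (eLpNorm_smul_le_mul_eLpNorm (p := 2) (q := 2)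
      (hf.indicator Metric.isClosed_closedBall.measurableSet) hψ.aestronglyMeasurable).trans ?_
    rw [ENNReal.ofReal_mul hB0]
    gcongr
    exact hε.trans (ENNReal.ofReal_le_ofReal (le_max_left _ _))
  have h3 := enorm_integral_le_lintegral_enorm
    (μ := volume) (fun z => ψ z • (Metric.closedBall (0 : ℂ) R).indicator f z)
  rw [← eLpNorm_one_eq_lintegral_enorm] at h3
  have h4 := h3.trans h2
  rw [← ofReal_norm] at h4
  exact (ENNReal.ofReal_le_ofReal_iff (by positivity)).1 h4

/-- Uniqueness of weak derivatives, for an abstract first-order operator `D` (`dz` or `dzb`). -/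
lemma ae_eq_of_wirtinger {u g : ℂ → Cn n} (hu : ContDiff ℝ ∞ u) (hg : AEStronglyMeasurable g)
    (D : (ℂ → Cn n) → ℂ → Cn n) (D' : (ℂ → ℂ) → ℂ → ℂ)
    (D_cont : ∀ f, ContDiff ℝ 1 f → Continuous (D f))
    (D'_cont : ∀ f, ContDiff ℝ 1 f → Continuous (D' f))
    (D_supp : ∀ f z, z ∉ tsupport f → D f z = 0)
    (D'_supp : ∀ f z, z ∉ tsupport f → D' f z = 0)
    (D_sub : ∀ f g, Differentiable ℝ f → Differentiable ℝ g → D (f - g) = D f - D g)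
    (D_smul : ∀ (ψ : ℂ → ℂ) (f : ℂ → Cn n), Differentiable ℝ ψ → Differentiable ℝ f → ∀ z,
      D (fun w => ψ w • f w) z = ψ z • D f z + D' ψ z • f z)
    (D_int : ∀ f, ContDiff ℝ 1 f → HasCompactSupport f → ∫ z, D f z = 0)
    (happ : ∀ R ε : ℝ, 0 < ε → ∃ F : ℂ → Cn n, IsTest F ∧
      eLpNorm (u - F) 2 (volume.restrict (Metric.closedBall 0 R)) ≤ ENNReal.ofReal ε ∧
      eLpNorm (g - D F) 2 volume ≤ ENNReal.ofReal ε) : g =ᵐ[volume] D u := by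
  have hu1 : ContDiff ℝ 1 u := hu.of_le (by exact_mod_cast le_top)
  have hgl : LocallyIntegrable g := by
    obtain ⟨F, hF, -, h⟩ := happ 0 1 one_pos
    have h1 : MemLp (g - D F) 2 volume :=
      ⟨hg.sub (D_cont F hF.contDiff_one).aestronglyMeasurable, h.trans_lt ENNReal.ofReal_lt_top⟩
    have h2 := (h1.locallyIntegrable (by norm_num)).add
      ((D_cont F hF.contDiff_one).locallyIntegrable (μ := volume))
    rwa [sub_add_cancel] at h2
  have key := ae_eq_zero_of_integral_contDiff_smul_eq_zero (f := g - D u)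
    (μ := (volume : Measure ℂ)) (hgl.sub (D_cont u hu1).locallyIntegrable) fun ψ hψ hψc => ?_
  · filter_upwards [key] with z hz
    exact sub_eq_zero.1 hz
  let χ : ℂ → ℂ := fun z => (ψ z : ℂ)
  have hχ : ContDiff ℝ 1 χ :=
    Complex.ofRealCLM.contDiff.comp (hψ.of_le (by exact_mod_cast le_top))
  have hχc : HasCompactSupport χ := hψc.comp_left (g := Complex.ofReal) rfl
  obtain ⟨R, hR⟩ := hχc.isCompact.isBounded.subset_closedBall 0
  have hout : ∀ z, R < ‖z‖ → z ∉ tsupport χ := fun z hz h => by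
    have := hR h
    rw [mem_closedBall_zero_iff] at this
    linarith
  have hχR : ∀ z, R < ‖z‖ → χ z = 0 := fun z hz => image_eq_zero_of_notMem_tsupport (hout z hz)
  have hDR : ∀ z, R < ‖z‖ → D' χ z = 0 := fun z hz => D'_supp χ z (hout z hz)
  have hDc : HasCompactSupport (D' χ) := HasCompactSupport.intro hχc.isCompact (D'_supp χ)
  have hm1 := hχ.continuous.memLp_of_hasCompactSupport (p := 2) (μ := volume) hχc
  have hm2 := (D'_cont χ hχ).memLp_of_hasCompactSupport (p := 2) (μ := volume) hDc
  set B₁ := (eLpNorm χ 2 volume).toReal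
  set B₂ := (eLpNorm (D' χ) 2 volume).toReal
  have hB₁ : eLpNorm χ 2 volume ≤ ENNReal.ofReal B₁ := (ENNReal.ofReal_toReal hm1.2.ne).ge
  have hB₂ : eLpNorm (D' χ) 2 volume ≤ ENNReal.ofReal B₂ := (ENNReal.ofReal_toReal hm2.2.ne).ge
  have e0 : ∀ z, ψ z • (g - D u) z = χ z • (g - D u) z := fun z => (Complex.coe_smul _ _).symm
  simp_rw [e0]
  have bound : ∀ ε : ℝ, 0 < ε → ‖∫ z, χ z • (g - D u) z‖ ≤ (B₁ + B₂) * ε := by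
    intro ε hε
    obtain ⟨F, hF, h1, h2⟩ := happ R ε hε
    have hd : ContDiff ℝ 1 (u - F) := hu1.sub hF.contDiff_one
    have hI1 : Integrable fun z => χ z • (g - D F) z :=
      (((hgl.sub (D_cont F hF.contDiff_one).locallyIntegrable)).integrable_smul_left_of_hasCompactSupport
        hχ.continuous hχc)
    have hI2 : Integrable fun z => D (fun w => χ w • (u - F) w) z := by
      refine (D_cont _ (hχ.smul hd)).integrable_of_hasCompactSupport ?_
      refine HasCompactSupport.intro (hχc.smul_right (f' := u - F)).isCompact (D_supp _)
    have hI3 : Integrable fun z => D' χ z • (u - F) z :=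
      ((D'_cont χ hχ).smul hd.continuous).integrable_of_hasCompactSupport hDc.smul_right
    -- Integration by parts: the middle term has integral zero, and the two outer terms are `O(ε)`
    -- by the choice of `F`. Hence `g - D u` annihilates every test function.
    have e1 : ∀ z, χ z • (g - D u) z = χ z • (g - D F) z - D (fun w => χ w • (u - F) w) z +
        D' χ z • (u - F) z := by
      intro z
      rw [D_smul χ (u - F) (hχ.differentiable (by norm_num)) (hd.differentiable (by norm_num)),
        D_sub u F (hu1.differentiable (by norm_num)) hF.differentiable]
      simp only [Pi.sub_apply, smul_sub]
      abel
    simp_rw [e1]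
    have i1 := integral_add (hI1.sub hI2) hI3
    have i2 := integral_sub hI1 hI2
    simp only [Pi.sub_apply] at i1 i2 ⊢
    rw [i1, i2]
    have h0 := D_int (fun w => χ w • (u - F) w) (hχ.smul hd) (hχc.smul_right (f' := u - F))
    simp only [Pi.sub_apply] at h0
    rw [h0, sub_zero]
    refine (norm_add_le _ _).trans ?_
    have j1 := norm_integral_smul_le hχ.continuous
      (hg.sub (D_cont F hF.contDiff_one).aestronglyMeasurable) hχR hB₁ ENNReal.toReal_nonneg
      ((eLpNorm_mono_measure _ Measure.restrict_le_self).trans h2)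
    have j2 := norm_integral_smul_le (D'_cont χ hχ) hd.continuous.aestronglyMeasurable hDR hB₂
      ENNReal.toReal_nonneg h1
    simp only [Pi.sub_apply] at j1 j2
    rw [max_eq_left hε.le] at j1 j2
    linarith
  rw [← norm_le_zero_iff]
  refine le_of_forall_pos_le_add fun ε hε => ?_
  have hp : 0 < B₁ + B₂ + 1 := by
    have : 0 ≤ B₁ := ENNReal.toReal_nonneg
    have : 0 ≤ B₂ := ENNReal.toReal_nonneg
    linarith
  refine (bound (ε / (B₁ + B₂ + 1)) (by positivity)).trans ?_
  rw [zero_add, mul_div_assoc', div_le_iff₀ hp]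
  nlinarith

lemma dz_eq_zero_of_notMem_tsupport {E : Type*} [NormedAddCommGroup E] [NormedSpace ℝ E]
    [NormedSpace ℂ E] {f : ℂ → E} {z : ℂ} (hz : z ∉ tsupport f) : dz f z = 0 := by
  rw [dz, fderiv_of_notMem_tsupport ℝ hz]; simp

lemma dzb_eq_zero_of_notMem_tsupport {E : Type*} [NormedAddCommGroup E] [NormedSpace ℝ E]
    [NormedSpace ℂ E] {f : ℂ → E} {z : ℂ} (hz : z ∉ tsupport f) : dzb f z = 0 := by
  rw [dzb, fderiv_of_notMem_tsupport ℝ hz]; simp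

/-- The weak derivatives of a smooth map are its derivatives. -/
lemma WeakD.ae_eq {u g h : ℂ → Cn n} (H : WeakD u g h) (hu : ContDiff ℝ ∞ u) :
    g =ᵐ[volume] dzb u ∧ h =ᵐ[volume] dz u := by
  constructor
  · refine ae_eq_of_wirtinger hu H.meas_g dzb dzb (fun f hf => continuous_dzb hf)
      (fun f hf => continuous_dzb hf) (fun f z => dzb_eq_zero_of_notMem_tsupport)
      (fun f z => dzb_eq_zero_of_notMem_tsupport) (fun f g hf hg => dzb_sub hf hg)
      (fun ψ f hψ hf z => by rw [dzb_smul (hψ z) (hf z)])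
      (fun f hf hc => integral_dzb_eq_zero hf hc) fun R ε hε => ?_
    obtain ⟨F, hF, h1, h2, -⟩ := H.approx R ε hε
    exact ⟨F, hF, h1, h2⟩
  · refine ae_eq_of_wirtinger hu H.meas_h dz dz (fun f hf => continuous_dz hf)
      (fun f hf => continuous_dz hf) (fun f z => dz_eq_zero_of_notMem_tsupport)
      (fun f z => dz_eq_zero_of_notMem_tsupport) (fun f g hf hg => dz_sub hf hg)
      (fun ψ f hψ hf z => by rw [dz_smul (hψ z) (hf z)])
      (fun f hf hc => integral_dz_eq_zero hf hc) fun R ε hε => ?_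
    obtain ⟨F, hF, h1, -, h3⟩ := H.approx R ε hε
    exact ⟨F, hF, h1, h3⟩

end JLines

/-! ### The weights `1 + |w - a|^{-s}` and the Beurling transform. -/

namespace JLines

variable {n : ℕ}

/-- The weight `1 + |w - a|^{-s}`. -/
noncomputable def mw (s : ℝ) (a w : ℂ) : ℝ := 1 + ‖w - a‖ ^ (-s)

lemma one_le_mw (s : ℝ) (a w : ℂ) : 1 ≤ mw s a w := by unfold mw; simp; positivity

lemma mw_pos (s : ℝ) (a w : ℂ) : 0 < mw s a w := one_pos.trans_le (one_le_mw s a w)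

@[fun_prop] lemma measurable_mw (s : ℝ) (a : ℂ) : Measurable (mw s a) := by unfold mw; fun_prop

lemma sq_rpow_neg (s x : ℝ) (hx : 0 ≤ x) : (x ^ (-s)) ^ 2 = x ^ (-2 * s) := by
  rw [← Real.rpow_natCast, ← Real.rpow_mul hx]; congr 1; push_cast; ring

lemma mw_sq_le (s : ℝ) (a w : ℂ) : mw s a w ^ 2 ≤ 2 + 2 * ‖w - a‖ ^ (-2 * s) := by
  rw [← sq_rpow_neg _ _ (norm_nonneg _), mw]
  nlinarith [sq_nonneg (1 - ‖w - a‖ ^ (-s))]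

lemma isWeight_mw {s : ℝ} (hs : 0 < s) (hs1 : s < 1) (a : ℂ) : IsWeight (mw s a) where
  meas := measurable_mw s a
  loc R := by
    have hb : ∫⁻ w in Metric.closedBall (0 : ℂ) R, ENNReal.ofReal (‖w - a‖ ^ (-2 * s)) < ⊤ := by
      have e : ∫⁻ w in Metric.ball a 1, ENNReal.ofReal (‖w - a‖ ^ (-2 * s)) < ⊤ := by
        have h := lintegral_ball_norm_rpow_lt_top (γ := 2 * s) (by linarith)
        rw [← lintegral_indicator Metric.isOpen_ball.measurableSet] at h ⊢
        rw [← lintegral_sub_right_eq_self _ a] at h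
        refine lt_of_le_of_lt (le_of_eq ?_) h
        refine lintegral_congr fun w => ?_
        by_cases hw : w ∈ Metric.ball a 1
        · rw [indicator_of_mem hw, indicator_of_mem, neg_mul]
          rwa [mem_ball_zero_iff, ← dist_eq_norm]
        · rw [indicator_of_notMem hw, indicator_of_notMem]
          rwa [mem_ball_zero_iff, ← dist_eq_norm]
      have hsub : Metric.closedBall (0 : ℂ) R ⊆ Metric.ball a 1 ∪
          (Metric.closedBall (0 : ℂ) R \ Metric.ball a 1) := by
        rw [union_sdiff_self]; exact subset_union_right
      refine (lintegral_mono_set hsub).trans_lt ((lintegral_union_le _ _ _).trans_lt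
        (ENNReal.add_lt_top.2 ⟨e, ?_⟩))
      refine lt_of_le_of_lt (setLIntegral_mono' (g := fun _ => 1)
        (Metric.isClosed_closedBall.measurableSet.diff Metric.isOpen_ball.measurableSet)
        fun w hw => ?_) ?_
      · have : 1 ≤ ‖w - a‖ := by
          rw [← dist_eq_norm]; simpa using hw.2
        exact ENNReal.ofReal_le_one.2 (Real.rpow_le_one_of_one_le_of_nonpos this (by linarith))
      · rw [setLIntegral_const, one_mul]
        exact (measure_mono sdiff_subset).trans_lt measure_closedBall_lt_top
    refine lt_of_le_of_lt (lintegral_mono (g := fun w => 2 + 2 * ENNReal.ofReal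
      (‖w - a‖ ^ (-2 * s))) fun w => ?_) ?_
    · refine (ENNReal.ofReal_le_ofReal (mw_sq_le s a w)).trans (le_of_eq ?_)
      rw [ENNReal.ofReal_add (by norm_num) (by positivity), ENNReal.ofReal_mul (by norm_num)]
      simp
    · rw [lintegral_add_left measurable_const, setLIntegral_const, lintegral_const_mul' _ _ (by simp)]
      exact ENNReal.add_lt_top.2 ⟨ENNReal.mul_lt_top (by simp) measure_closedBall_lt_top,
        ENNReal.mul_lt_top (by simp) hb⟩
  growth := by
    refine ⟨4, ‖a‖ + 1, fun w hw => ?_⟩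
    have h1 : 1 ≤ ‖w - a‖ := by linarith [norm_sub_norm_le w a]
    have h2 := Real.rpow_le_one_of_one_le_of_nonpos h1 (by linarith : -2 * s ≤ 0)
    have h3 := mw_sq_le s a w
    linarith [norm_nonneg a]

lemma eLpNorm_le_wNorm_mw (s : ℝ) (a : ℂ) (f : ℂ → Cn n) :
    eLpNorm f 2 volume ≤ wNorm (mw s a) f := by
  rw [← wNorm_one]
  refine wNorm_mono (Eventually.of_forall fun w => ?_)
  rw [one_smul, norm_smul, Real.norm_of_nonneg (mw_pos _ _ _).le]
  exact le_mul_of_one_le_left (norm_nonneg _) (one_le_mw s a w)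

lemma lintegral_norm_sq (g : ℂ → Cn n) :
    ∫⁻ z, ENNReal.ofReal (‖g z‖ ^ 2) = eLpNorm g 2 volume ^ 2 := by
  rw [eLpNorm_two_sq]
  refine lintegral_congr fun w => ?_
  rw [← ofReal_norm, ENNReal.ofReal_pow (norm_nonneg _)]

lemma two_mul_ofReal (x : ℝ) : 2 * ENNReal.ofReal x = ENNReal.ofReal (2 * x) := by
  rw [ENNReal.ofReal_mul (by norm_num)]; simp

/-- The squared weight is at most `2 + 2|w - a|^{-2s}`; the constant part is the unweighted energy
bound and the singular part the Hardy-based one. The constant does not depend on `a`. -/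
lemma exists_wNorm_mw_dz_le {s : ℝ} (hs : 0 < s) (hs1 : s < 1) : ∃ C : ℝ≥0, ∀ f : ℂ → Cn n,
    IsTest f → ∀ a, wNorm (mw s a) (dz f) ≤ C * wNorm (mw s a) (dzb f) := by
  obtain ⟨C, hC, h⟩ := exists_lintegral_weighted_dz_le (n := n) hs hs1
  lift C to ℝ≥0 using hC.ne
  refine ⟨2 + 2 * C, fun f hf a => ?_⟩
  rw [← ENNReal.pow_le_pow_left_iff two_ne_zero]
  have hm : Measurable (dz f) := hf.continuous_dz.measurable
  have h1 : ∫⁻ z, ENNReal.ofReal (‖dzb f z‖ ^ 2) ≤ wNorm (mw s a) (dzb f) ^ 2 := by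
    rw [lintegral_norm_sq]; gcongr; exact eLpNorm_le_wNorm_mw s a _
  have h2 : ∫⁻ z, ENNReal.ofReal (‖dzb f z‖ ^ 2 * ‖z - a‖ ^ (-2 * s)) ≤
      wNorm (mw s a) (dzb f) ^ 2 := by
    rw [wNorm_sq]
    refine lintegral_mono fun w => ENNReal.ofReal_le_ofReal ?_
    rw [← sq_rpow_neg _ _ (norm_nonneg _), mw]
    gcongr; linarith
  calc wNorm (mw s a) (dz f) ^ 2
      ≤ ∫⁻ z, (2 * ENNReal.ofReal (‖dz f z‖ ^ 2) +
          2 * ENNReal.ofReal (‖dz f z‖ ^ 2 * ‖z - a‖ ^ (-2 * s))) := by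
        rw [wNorm_sq]
        refine lintegral_mono fun w => ?_
        rw [two_mul_ofReal, two_mul_ofReal, ← ENNReal.ofReal_add (by positivity) (by positivity)]
        refine ENNReal.ofReal_le_ofReal ?_
        have := mul_le_mul_of_nonneg_left (mw_sq_le s a w) (sq_nonneg ‖dz f w‖)
        linarith
    _ = (2 * ∫⁻ z, ENNReal.ofReal (‖dz f z‖ ^ 2)) +
          2 * ∫⁻ z, ENNReal.ofReal (‖dz f z‖ ^ 2 * ‖z - a‖ ^ (-2 * s)) := by
        rw [lintegral_add_left (by fun_prop), lintegral_const_mul' _ _ (by simp),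
          lintegral_const_mul' _ _ (by simp)]
    _ ≤ (2 * wNorm (mw s a) (dzb f) ^ 2) + 2 * (C * wNorm (mw s a) (dzb f) ^ 2) := by
        gcongr
        · exact (lintegral_dz_sq_eq hf.1 hf.2).trans h1
        · exact (h f hf.1 hf.2 a).trans (by gcongr)
    _ = ((2 + 2 * C : ℝ≥0) : ℝ≥0∞) * wNorm (mw s a) (dzb f) ^ 2 := by push_cast; ring
    _ ≤ _ := by
        rw [mul_pow]
        gcongr
        exact_mod_cast le_self_pow₀ (show 1 ≤ 2 + 2 * C by
          have : (0 : ℝ≥0) ≤ C := zero_le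
          calc (1 : ℝ≥0) ≤ 2 := by norm_num
            _ ≤ 2 + 2 * C := le_self_add) two_ne_zero

/-- Choose test functions whose `∂̄` tend to `g` in the weighted norm. Their `∂` tend to the
Beurling transform in plain `L²`, hence almost everywhere along a subsequence, and the weighted norm
is lower semicontinuous under such convergence. -/
lemma exists_wNorm_mw_beurling_le {s : ℝ} (hs : 0 < s) (hs1 : s < 1) : ∃ C : ℝ≥0, ∀ g : L2 n,
    ∀ a, wNorm (mw s a) (beurling n g) ≤ C * wNorm (mw s a) g := by
  obtain ⟨C, hC⟩ := exists_wNorm_mw_dz_le (n := n) hs hs1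
  -- A constant that is not zero: it multiplies an infinite norm in the first case and serves as a
  -- divisor later.
  refine ⟨C + 1, fun g a => ?_⟩
  by_cases hfin : wNorm (mw s a) g = ⊤
  · rw [hfin, ENNReal.mul_top (by simp)]; exact le_top
  have hg := Lp.aestronglyMeasurable g
  obtain ⟨F, hF, hlim⟩ := exists_seq_wNorm_sub_dzb (isWeight_mw hs hs1 a) hg
    (lt_top_iff_ne_top.2 hfin)
  have hlim2 : Tendsto (fun k => eLpNorm (dz (F k) - (beurling n g : ℂ → Cn n)) 2 volume) atTop
      (𝓝 0) := by
    refine tendsto_of_tendsto_of_tendsto_of_le_of_le tendsto_const_nhds hlim (fun _ => zero_le)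
      fun k => ?_
    simp only []
    rw [eLpNorm_sub_comm]
    exact (eLpNorm_beurling_sub_le g (hF k)).trans (eLpNorm_le_wNorm_mw s a _)
  obtain ⟨ns, hns, hae⟩ := (tendstoInMeasure_of_tendsto_eLpNorm two_ne_zero
    (fun k => (hF k).continuous_dz.aestronglyMeasurable) (Lp.aestronglyMeasurable _)
    hlim2).exists_seq_tendsto_ae
  refine ENNReal.le_of_forall_pos_le_add fun ε hε _ => ?_
  have hδ : (0 : ℝ≥0∞) < (ε / (C + 1) : ℝ≥0) := by
    rw [ENNReal.coe_pos]; positivity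
  have hev := (hlim.comp hns.tendsto_atTop).eventually (gt_mem_nhds hδ)
  refine Lp.eLpNorm_le_of_ae_tendsto (u := atTop) (f := fun k w => mw s a w • dz (F (ns k)) w)
    ?_ (fun k => (measurable_mw s a).aestronglyMeasurable.smul
      (hF (ns k)).continuous_dz.aestronglyMeasurable) ?_
  · filter_upwards [hev] with k hk
    have e1 : dzb (F (ns k)) = g - (g - dzb (F (ns k))) := by abel
    calc wNorm (mw s a) (dz (F (ns k))) ≤ C * wNorm (mw s a) (dzb (F (ns k))) := hC _ (hF _) a
      _ ≤ (C + 1 : ℝ≥0) * (wNorm (mw s a) g + (ε / (C + 1) : ℝ≥0)) := by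
        gcongr
        · exact le_self_add
        · rw [e1]
          refine (wNorm_sub_le (measurable_mw s a) hg
            (hg.sub (hF (ns k)).continuous_dzb.aestronglyMeasurable)).trans ?_
          gcongr
          exact hk.le
      _ = _ := by
        rw [mul_add, ← ENNReal.coe_mul, mul_div_cancel₀ _ (by positivity)]
  · filter_upwards [hae] with w hw
    exact hw.const_smul _

end JLines

/-! ### The Morrey space and multiplication operators on it. -/

namespace JLines

variable {n : ℕ} {s : ℝ}

lemma norm_inv_mw_smul_le (s : ℝ) (a w : ℂ) (x : Cn n) : ‖(mw s a w)⁻¹ • x‖ ≤ ‖x‖ := by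
  rw [norm_smul, Real.norm_of_nonneg (inv_nonneg.2 (mw_pos s a w).le)]
  exact mul_le_of_le_one_left (norm_nonneg _) (inv_le_one_of_one_le₀ (one_le_mw s a w))

lemma memLp_inv_mw_smul (s : ℝ) (a : ℂ) (k : L2 n) :
    MemLp (fun w => (mw s a w)⁻¹ • k w) 2 volume :=
  (Lp.memLp k).mono ((measurable_mw s a).inv.aestronglyMeasurable.smul (Lp.aestronglyMeasurable k))
    (Eventually.of_forall fun w => norm_inv_mw_smul_le s a w (k w))

/-- Multiplication by the bounded function `1 / mw s a`. -/
noncomputable def invMw (n : ℕ) (s : ℝ) (a : ℂ) : L2 n →L[ℝ] L2 n :=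
  LinearMap.mkContinuous
    { toFun := fun k => (memLp_inv_mw_smul s a k).toLp _
      map_add' := fun k k' => by
        rw [← MemLp.toLp_add]
        refine MemLp.toLp_congr _ _ ?_
        filter_upwards [Lp.coeFn_add k k'] with w hw
        rw [hw, Pi.add_apply, smul_add]; rfl
      map_smul' := fun c k => by
        rw [RingHom.id_apply, ← MemLp.toLp_const_smul]
        refine MemLp.toLp_congr _ _ ?_
        filter_upwards [Lp.coeFn_smul c k] with w hw
        rw [hw, Pi.smul_apply, smul_comm]; rfl } 1 fun k => by
    rw [one_mul]
    change ‖(memLp_inv_mw_smul s a k).toLp _‖ ≤ ‖k‖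
    rw [Lp.norm_toLp, Lp.norm_def]
    exact ENNReal.toReal_mono (Lp.eLpNorm_ne_top k)
      (eLpNorm_mono fun w => norm_inv_mw_smul_le s a w (k w))

lemma invMw_ae (s : ℝ) (a : ℂ) (k : L2 n) :
    invMw n s a k =ᵐ[volume] fun w => (mw s a w)⁻¹ • k w :=
  MemLp.coeFn_toLp (memLp_inv_mw_smul s a k)

/-- Evaluation on bounded families. -/
noncomputable def evalL (n : ℕ) (a : ℂ) : lp (fun _ : ℂ => L2 n) ∞ →L[ℝ] L2 n :=
  LinearMap.mkContinuous
    { toFun := fun f => f a, map_add' := fun _ _ => rfl, map_smul' := fun _ _ => rfl } 1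
    fun f => by rw [one_mul]; exact lp.norm_apply_le_norm ENNReal.top_ne_zero f a

/-- The families of the form `(mw s a • k)_a`. -/
noncomputable def morreySubmodule (s : ℝ) (n : ℕ) : Submodule ℝ (lp (fun _ : ℂ => L2 n) ∞) :=
  ⨅ a : ℂ, LinearMap.ker ((invMw n s a ∘L evalL n a - invMw n s 0 ∘L evalL n 0).toLinearMap)

lemma mem_morreySubmodule {f : lp (fun _ : ℂ => L2 n) ∞} :
    f ∈ morreySubmodule s n ↔ ∀ a, invMw n s a (f a) = invMw n s 0 (f 0) := by
  simp only [morreySubmodule, Submodule.mem_iInf, LinearMap.mem_ker]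
  exact forall_congr' fun a => sub_eq_zero

/-- The compatibility conditions are kernels of continuous maps. Completeness of the Morrey space is
thereby inherited from bounded families in `L²`. -/
lemma isClosed_morreySubmodule :
    IsClosed (morreySubmodule s n : Set (lp (fun _ : ℂ => L2 n) ∞)) := by
  rw [morreySubmodule, Submodule.coe_iInf]
  exact isClosed_iInter fun a =>
    (invMw n s a ∘L evalL n a - invMw n s 0 ∘L evalL n 0).isClosed_ker

/-- The Morrey-type space of all `k ∈ L²` with `sup_a ‖(1 + |w - a|^{-s}) k‖₂ < ∞`, realised as
the space of families `(mw s a • k)_a`. -/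
def Morrey (s : ℝ) (n : ℕ) : Type := morreySubmodule s n

noncomputable instance : NormedAddCommGroup (Morrey s n) :=
  inferInstanceAs (NormedAddCommGroup (morreySubmodule s n))

noncomputable instance : NormedSpace ℝ (Morrey s n) :=
  inferInstanceAs (NormedSpace ℝ (morreySubmodule s n))

instance : CompleteSpace (Morrey s n) :=
  haveI := (isClosed_morreySubmodule (s := s) (n := n)).completeSpace_coe
  inferInstanceAs (CompleteSpace (morreySubmodule s n))

namespace Morrey

/-- The underlying `L²` function. -/
noncomputable def toL2 (s : ℝ) (n : ℕ) : Morrey s n →L[ℝ] L2 n :=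
  (invMw n s 0 ∘L evalL n 0) ∘L (morreySubmodule s n).subtypeL

/-- The underlying function. -/
noncomputable def fn (x : Morrey s n) : ℂ → Cn n := toL2 s n x

lemma aesm (x : Morrey s n) : AEStronglyMeasurable x.fn := Lp.aestronglyMeasurable _

lemma coe_ae (x : Morrey s n) (a : ℂ) :
    (x.1 a : ℂ → Cn n) =ᵐ[volume] fun w => mw s a w • x.fn w := by
  have h1 : toL2 s n x = invMw n s a (x.1 a) := (mem_morreySubmodule.1 x.2 a).symm
  have h2 := invMw_ae s a (x.1 a)
  rw [← h1] at h2
  filter_upwards [h2] with w hw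
  rw [fn, hw, smul_smul, mul_inv_cancel₀ (mw_pos s a w).ne', one_smul]

lemma wNorm_le (x : Morrey s n) (a : ℂ) : wNorm (mw s a) x.fn ≤ ENNReal.ofReal ‖x‖ := by
  rw [wNorm, ← eLpNorm_congr_ae (x.coe_ae a), ← ENNReal.ofReal_toReal (Lp.eLpNorm_ne_top (x.1 a)),
    ← Lp.norm_def]
  exact ENNReal.ofReal_le_ofReal (lp.norm_apply_le_norm ENNReal.top_ne_zero x.1 a)

lemma norm_le {x : Morrey s n} {C : ℝ} (hC : 0 ≤ C)
    (h : ∀ a, wNorm (mw s a) x.fn ≤ ENNReal.ofReal C) : ‖x‖ ≤ C := by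
  refine lp.norm_le_of_forall_le hC fun a => ?_
  change ‖x.1 a‖ ≤ C
  rw [Lp.norm_def, eLpNorm_congr_ae (x.coe_ae a)]
  exact ENNReal.toReal_le_of_le_ofReal hC (h a)

lemma ext_ae {x y : Morrey s n} (h : x.fn =ᵐ[volume] y.fn) : x = y := by
  refine Subtype.ext (lp.ext (funext fun a => Lp.ext ?_))
  filter_upwards [x.coe_ae a, y.coe_ae a, h] with w h1 h2 h3
  rw [h1, h2, h3]

lemma fn_add (x y : Morrey s n) : (x + y).fn =ᵐ[volume] x.fn + y.fn := by
  unfold fn; rw [map_add]; exact Lp.coeFn_add _ _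

lemma fn_sub (x y : Morrey s n) : (x - y).fn =ᵐ[volume] x.fn - y.fn := by
  unfold fn; rw [map_sub]; exact Lp.coeFn_sub _ _

lemma fn_smul (c : ℝ) (x : Morrey s n) : (c • x).fn =ᵐ[volume] c • x.fn := by
  unfold fn; rw [map_smul]; exact Lp.coeFn_smul _ _

section ofFun

variable {k : ℂ → Cn n}

lemma memLp_mw_smul (hk : AEStronglyMeasurable k) {C : ℝ}
    (h : ∀ a, wNorm (mw s a) k ≤ ENNReal.ofReal C) (a : ℂ) :
    MemLp (fun w => mw s a w • k w) 2 volume :=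
  ⟨(measurable_mw s a).aestronglyMeasurable.smul hk, (h a).trans_lt ENNReal.ofReal_lt_top⟩

lemma ofFun_aux (hk : AEStronglyMeasurable k) {C : ℝ}
    (h : ∀ a, wNorm (mw s a) k ≤ ENNReal.ofReal C) (a : ℂ) :
    invMw n s a ((memLp_mw_smul hk h a).toLp _) =ᵐ[volume] k := by
  filter_upwards [invMw_ae s a ((memLp_mw_smul hk h a).toLp _),
    (memLp_mw_smul hk h a).coeFn_toLp] with w h1 h2
  rw [h1, h2, smul_smul, inv_mul_cancel₀ (mw_pos s a w).ne', one_smul]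

/-- The element given by a function with finite norm. -/
noncomputable def ofFun (k : ℂ → Cn n) (hk : AEStronglyMeasurable k) (C : ℝ)
    (h : ∀ a, wNorm (mw s a) k ≤ ENNReal.ofReal C) : Morrey s n :=
  ⟨⟨fun a => (memLp_mw_smul hk h a).toLp _, memℓp_infty ⟨max C 0, by
    rintro _ ⟨a, rfl⟩
    dsimp only
    rw [Lp.norm_toLp]
    exact ENNReal.toReal_le_of_le_ofReal (le_max_right _ _)
      ((h a).trans (ENNReal.ofReal_le_ofReal (le_max_left _ _)))⟩⟩,
    mem_morreySubmodule.2 fun a => Lp.ext ((ofFun_aux hk h a).trans (ofFun_aux hk h 0).symm)⟩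

lemma fn_ofFun (hk : AEStronglyMeasurable k) (C : ℝ)
    (h : ∀ a, wNorm (mw s a) k ≤ ENNReal.ofReal C) : (ofFun k hk C h).fn =ᵐ[volume] k :=
  ofFun_aux hk h 0

end ofFun

section mkCLM

variable {V : Type*} [NormedAddCommGroup V] [NormedSpace ℝ V]

/-- A continuous linear map into the Morrey space given by functions. -/
noncomputable def mkCLM (A : V → ℂ → Cn n) (hA : ∀ v, AEStronglyMeasurable (A v))
    (hadd : ∀ v w, A (v + w) =ᵐ[volume] A v + A w) (hsmul : ∀ (c : ℝ) v, A (c • v) =ᵐ[volume] c • A v)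
    (C : ℝ) (hC : 0 ≤ C) (h : ∀ v a, wNorm (mw s a) (A v) ≤ ENNReal.ofReal (C * ‖v‖)) :
    V →L[ℝ] Morrey s n :=
  LinearMap.mkContinuous
    { toFun := fun v => ofFun (A v) (hA v) (C * ‖v‖) (h v)
      map_add' := fun v w => ext_ae (by
        filter_upwards [fn_ofFun (hA v) _ (h v), fn_ofFun (hA w) _ (h w),
          fn_ofFun (hA (v + w)) _ (h (v + w)), hadd v w,
          fn_add (ofFun (A v) (hA v) _ (h v)) (ofFun (A w) (hA w) _ (h w))] with z h1 h2 h3 h4 h5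
        rw [h3, h4, h5, Pi.add_apply, Pi.add_apply, h1, h2])
      map_smul' := fun c v => ext_ae (by
        filter_upwards [fn_ofFun (hA v) _ (h v), fn_ofFun (hA (c • v)) _ (h (c • v)), hsmul c v,
          fn_smul c (ofFun (A v) (hA v) _ (h v))] with z h1 h3 h4 h5
        rw [h3, h4, RingHom.id_apply, h5, Pi.smul_apply, Pi.smul_apply, h1]) } C fun v => by
    refine norm_le (by positivity) fun a => ?_
    exact (wNorm_congr_ae (fn_ofFun (hA v) _ (h v))).trans_le (h v a)

variable {A : V → ℂ → Cn n} {hA : ∀ v, AEStronglyMeasurable (A v)}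
    {hadd : ∀ v w, A (v + w) =ᵐ[volume] A v + A w}
    {hsmul : ∀ (c : ℝ) v, A (c • v) =ᵐ[volume] c • A v} {C : ℝ} {hC : 0 ≤ C}
    {h : ∀ v a, wNorm (mw s a) (A v) ≤ ENNReal.ofReal (C * ‖v‖)}

lemma fn_mkCLM (v : V) : (mkCLM A hA hadd hsmul C hC h v).fn =ᵐ[volume] A v :=
  fn_ofFun (hA v) _ (h v)

end mkCLM

lemma wNorm_le_of_norm_le {k k' : ℂ → Cn n} {m : ℂ → ℝ} {C : ℝ}
    (h : ∀ᵐ w, ‖k' w‖ ≤ C * ‖k w‖) : wNorm m k' ≤ ENNReal.ofReal C * wNorm m k := by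
  refine eLpNorm_le_mul_eLpNorm_of_ae_le_mul ?_ 2
  filter_upwards [h] with w hw
  rw [norm_smul, norm_smul, mul_left_comm]
  exact mul_le_mul_of_nonneg_left hw (norm_nonneg _)

open BoundedContinuousFunction

lemma aesm_mul (b : ℂ →ᵇ EndR n) (x : Morrey s n) :
    AEStronglyMeasurable fun w => b w (x.fn w) := by
  have h : Continuous fun p : EndR n × Cn n => p.1 p.2 := by fun_prop
  exact h.comp_aestronglyMeasurable (b.continuous.aestronglyMeasurable.prodMk x.aesm)

lemma wNorm_mul_le (b : ℂ →ᵇ EndR n) (x : Morrey s n) (a : ℂ) :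
    wNorm (mw s a) (fun w => b w (x.fn w)) ≤ ENNReal.ofReal (‖b‖ * ‖x‖) := by
  refine (wNorm_le_of_norm_le (C := ‖b‖) (k := x.fn) (Eventually.of_forall fun w => ?_)).trans ?_
  · exact ((b w).le_opNorm _).trans (by gcongr; exact b.norm_coe_le_norm w)
  · rw [ENNReal.ofReal_mul (norm_nonneg b)]
    gcongr
    exact x.wNorm_le a

/-- Multiplication by a bounded continuous matrix-valued function. -/
noncomputable def mul (b : ℂ →ᵇ EndR n) : Morrey s n →L[ℝ] Morrey s n :=
  mkCLM (fun x w => b w (x.fn w)) (aesm_mul b)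
    (fun x y => by
      filter_upwards [fn_add x y] with w hw
      simp only [hw, Pi.add_apply, map_add])
    (fun c x => by
      filter_upwards [fn_smul c x] with w hw
      simp only [hw, Pi.smul_apply, map_smul])
    ‖b‖ (norm_nonneg b) (wNorm_mul_le b)

lemma fn_mul (b : ℂ →ᵇ EndR n) (x : Morrey s n) :
    (mul b x).fn =ᵐ[volume] fun w => b w (x.fn w) := fn_mkCLM x

lemma norm_mul_le (b : ℂ →ᵇ EndR n) (x : Morrey s n) : ‖mul b x‖ ≤ ‖b‖ * ‖x‖ := by
  refine norm_le (by positivity) fun a => ?_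
  rw [wNorm_congr_ae (fn_mul b x)]
  exact wNorm_mul_le b x a

/-- `mul` as a bilinear map. -/
noncomputable def mulB (s : ℝ) (n : ℕ) :
    (ℂ →ᵇ EndR n) →L[ℝ] Morrey s n →L[ℝ] Morrey s n :=
  LinearMap.mkContinuous₂
    (LinearMap.mk₂ ℝ (fun b x => mul b x)
      (fun b b' x => ext_ae (by
        filter_upwards [fn_mul (b + b') x, fn_add (mul b x) (mul b' x), fn_mul b x, fn_mul b' x]
          with w h1 h2 h3 h4
        rw [h1, h2, Pi.add_apply, h3, h4]; rfl))
      (fun c b x => ext_ae (by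
        filter_upwards [fn_mul (c • b) x, fn_smul c (mul b x), fn_mul b x] with w h1 h2 h3
        rw [h1, h2, Pi.smul_apply, h3]; rfl))
      (fun b x y => map_add _ _ _) (fun c b x => map_smul _ _ _)) 1
    (fun b x => by rw [one_mul]; exact norm_mul_le b x)

end Morrey

end JLines

/-! ### Cauchy and Beurling transforms on the Morrey space. -/

namespace JLines

variable {n : ℕ} {s : ℝ}

open BoundedContinuousFunction

namespace Morrey

/-- This is what the Morrey norm is for. In Cauchy–Schwarz the factor `|w - a|^{-s}` goes to `x`,
and the rest of the kernel has squared singularity of order `2(β - s) < 2` and total squared decay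
`2(α + β - s) > 2`. -/
lemma exists_lintegral_kernel_le (n : ℕ) {α β : ℝ} (hα : 0 ≤ α) (hβ : s ≤ β) (hβ1 : β < 1 + s)
    (hαβ : 1 + s < α + β) : ∃ C : ℝ≥0, ∀ (x : Morrey s n) (a : ℂ),
      ∫⁻ w, ‖x.fn w‖ₑ * ENNReal.ofReal (jap (-α / 2) w * ‖w - a‖ ^ (-β)) ≤
        C * ENNReal.ofReal ‖x‖ := by
  obtain ⟨C, hC, h⟩ := exists_lintegral_two_centre_le (α := 2 * α) (γ := 2 * (β - s))
    (by linarith) (by linarith) (by linarith) (by linarith)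
  lift C to ℝ≥0 using hC.ne
  refine ⟨C + 1, fun x a => ?_⟩
  rw [← ENNReal.pow_le_pow_left_iff two_ne_zero]
  have hx := x.aesm.enorm
  have h1 : ∫⁻ w, (‖x.fn w‖ₑ * ENNReal.ofReal (‖w - a‖ ^ (-s))) ^ 2 ≤
      ENNReal.ofReal ‖x‖ ^ 2 := by
    refine le_trans ?_ (pow_le_pow_left' (x.wNorm_le a) 2)
    rw [wNorm_sq]
    refine lintegral_mono fun w => ?_
    rw [← ofReal_norm, ← ENNReal.ofReal_mul (norm_nonneg _), ← ENNReal.ofReal_pow (by positivity),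
      mul_pow]
    refine ENNReal.ofReal_le_ofReal ?_
    rw [mw]
    gcongr; linarith
  have h2 : ∫⁻ w, ENNReal.ofReal (jap (-α / 2) w * ‖w - a‖ ^ (-(β - s))) ^ 2 ≤ C := by
    refine (lintegral_mono fun w => ?_).trans (h a)
    rw [← ENNReal.ofReal_pow (mul_nonneg (jap_pos _ _).le (by positivity)), mul_pow, jap_sq,
      sq_rpow_neg _ _ (norm_nonneg _), jap]
    rw [show -(2 * α) / 2 = 2 * (-α / 2) by ring, show -(2 * (β - s)) = -2 * (β - s) by ring]
  have hpt : ∀ᵐ w, ‖x.fn w‖ₑ * ENNReal.ofReal (jap (-α / 2) w * ‖w - a‖ ^ (-β)) =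
      (‖x.fn w‖ₑ * ENNReal.ofReal (‖w - a‖ ^ (-s))) *
        ENNReal.ofReal (jap (-α / 2) w * ‖w - a‖ ^ (-(β - s))) := by
    filter_upwards [ae_ne_const a] with w hw
    have hp : 0 < ‖w - a‖ := norm_pos_iff.2 (sub_ne_zero.2 hw)
    rw [mul_assoc, ← ENNReal.ofReal_mul (by positivity), mul_left_comm, ← Real.rpow_add hp]
    congr 5; ring
  rw [lintegral_congr_ae hpt]
  refine (lintegral_mul_sq_le _ (hx.mul (by fun_prop)) ?_).trans ?_
  · exact (((measurable_jap _).mul (by fun_prop)).ennreal_ofReal).aemeasurable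
  · calc _ ≤ ENNReal.ofReal ‖x‖ ^ 2 * C := mul_le_mul' h1 h2
      _ ≤ ENNReal.ofReal ‖x‖ ^ 2 * ((C + 1 : ℝ≥0) : ℝ≥0∞) ^ 2 := by
        gcongr
        have : C ≤ (C + 1) ^ 2 := (le_self_add).trans (le_self_pow₀ (by simp) two_ne_zero)
        exact_mod_cast this
      _ = _ := by rw [mul_pow, mul_comm]

/-- The scalar function `jap α`, `α ≤ 0`, as a matrix-valued function. -/
noncomputable def japB (n : ℕ) (α : ℝ) (hα : α ≤ 0) : ℂ →ᵇ EndR n :=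
  BoundedContinuousFunction.ofNormedAddCommGroup
    (fun w => jap α w • ContinuousLinearMap.id ℝ (Cn n))
    ((continuous_jap α).smul continuous_const) 1 fun w => by
      rw [norm_smul, Real.norm_of_nonneg (jap_pos _ _).le]
      exact mul_le_one₀ (jap_le_one hα w) (norm_nonneg _) ContinuousLinearMap.norm_id_le

/-- Multiplication by `jap α`, `α ≤ 0`. -/
noncomputable def japMul (s : ℝ) (n : ℕ) (α : ℝ) (hα : α ≤ 0) : Morrey s n →L[ℝ] Morrey s n :=
  mul (japB n α hα)

lemma fn_japMul {α : ℝ} (hα : α ≤ 0) (x : Morrey s n) :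
    (japMul s n α hα x).fn =ᵐ[volume] fun w => jap α w • x.fn w := fn_mul _ x

/-- Multiplication by the weight `(1 + |w|²)^{-3 s / 2}`. -/
noncomputable def wt (n : ℕ) (hs : 0 < s) : Morrey s n →L[ℝ] Morrey s n :=
  japMul s n (-(3 * s) / 2) (by linarith)

lemma fn_wt (hs : 0 < s) (x : Morrey s n) :
    (wt n hs x).fn =ᵐ[volume] fun w => jap (-(3 * s) / 2) w • x.fn w := fn_japMul _ x

lemma lintegral_wt_mul (hs : 0 < s) (x : Morrey s n) (ρ : ℂ → ℝ) :
    ∫⁻ w, ‖(wt n hs x).fn w‖ₑ * ENNReal.ofReal (ρ w) =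
      ∫⁻ w, ‖x.fn w‖ₑ * ENNReal.ofReal (jap (-(3 * s) / 2) w * ρ w) := by
  refine lintegral_congr_ae ?_
  filter_upwards [fn_wt hs x] with w hw
  rw [hw, enorm_smul, Real.enorm_of_nonneg (jap_pos _ _).le, ENNReal.ofReal_mul (jap_pos _ _).le]
  ring

lemma jap_le_add (hs1 : s ≤ 1 / 4) (hs : 0 < s) (z w : ℂ) :
    jap (s / 2) z ≤ 2 * (jap (s / 2) w + ‖w - z‖ ^ s) := by
  have h0 : ‖z‖ ≤ ‖w‖ + ‖w - z‖ := by
    have := norm_sub_norm_le z w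
    rw [norm_sub_rev] at this; linarith
  have h1 : 1 + ‖z‖ ^ 2 ≤ 4 * max (1 + ‖w‖ ^ 2) (‖w - z‖ ^ 2) := by
    have h2 : ‖z‖ ^ 2 ≤ (‖w‖ + ‖w - z‖) ^ 2 := by gcongr
    have := le_max_left (1 + ‖w‖ ^ 2) (‖w - z‖ ^ 2)
    have := le_max_right (1 + ‖w‖ ^ 2) (‖w - z‖ ^ 2)
    nlinarith [sq_nonneg (‖w‖ - ‖w - z‖)]
  have h3 : jap (s / 2) z ≤ (4 * max (1 + ‖w‖ ^ 2) (‖w - z‖ ^ 2)) ^ (s / 2) := by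
    unfold jap; gcongr
  have h4 : (4 : ℝ) ^ (s / 2) ≤ 2 := by
    calc (4 : ℝ) ^ (s / 2) ≤ 4 ^ (1 / 2 : ℝ) :=
          Real.rpow_le_rpow_of_exponent_le (by norm_num) (by linarith)
      _ = 2 := by
        rw [show (4 : ℝ) = 2 ^ (2 : ℝ) by norm_num, ← Real.rpow_mul (by norm_num)]; norm_num
  have h5 : (max (1 + ‖w‖ ^ 2) (‖w - z‖ ^ 2)) ^ (s / 2) ≤ jap (s / 2) w + ‖w - z‖ ^ s := by
    have e : (‖w - z‖ ^ 2) ^ (s / 2) = ‖w - z‖ ^ s := by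
      rw [← Real.rpow_natCast, ← Real.rpow_mul (norm_nonneg _)]; congr 1; push_cast; ring
    rcases max_cases (1 + ‖w‖ ^ 2) (‖w - z‖ ^ 2) with ⟨h, -⟩ | ⟨h, -⟩ <;> rw [h]
    · exact le_add_of_nonneg_right (by positivity)
    · rw [e]; exact le_add_of_nonneg_left (jap_pos _ _).le
  refine h3.trans ?_
  rw [Real.mul_rpow (by norm_num) (by positivity)]
  gcongr

/-- Since `⟨z⟩^s ≤ 2(⟨w⟩^s + |w - z|^s)`, extracting a decay `⟨z⟩^{-s}` costs either a power of the
weight or a power of the kernel. The pairs `(2s, 1)` and `(3s, 1 - s)` of exponents are both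
admissible, and this is why the weight is `⟨w⟩^{-3s}`. -/
lemma exists_lintegral_cauchy_decay (n : ℕ) (hs : 0 < s) (hs1 : s ≤ 1 / 4) :
    ∃ C : ℝ≥0, ∀ (x : Morrey s n) (z : ℂ),
      ∫⁻ w, ‖(wt n hs x).fn w‖ₑ * ENNReal.ofReal (‖w - z‖ ^ (-1 : ℝ)) ≤
        ENNReal.ofReal (C * ‖x‖ * jap (-s / 2) z) := by
  obtain ⟨C₁, h₁⟩ := exists_lintegral_kernel_le (s := s) n (α := 2 * s) (β := 1) (by linarith)
    (by linarith) (by linarith) (by linarith)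
  obtain ⟨C₂, h₂⟩ := exists_lintegral_kernel_le (s := s) n (α := 3 * s) (β := 1 - s) (by linarith)
    (by linarith) (by linarith) (by linarith)
  refine ⟨2 * C₁ + 2 * C₂, fun x z => ?_⟩
  have hx := x.aesm.enorm
  have hpt : ∀ᵐ w, ‖x.fn w‖ₑ * ENNReal.ofReal (jap (-(3 * s) / 2) w * ‖w - z‖ ^ (-1 : ℝ)) ≤
      ENNReal.ofReal (jap (-s / 2) z) *
      (2 * (‖x.fn w‖ₑ * ENNReal.ofReal (jap (-(2 * s) / 2) w * ‖w - z‖ ^ (-1 : ℝ))) +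
      2 * (‖x.fn w‖ₑ * ENNReal.ofReal (jap (-(3 * s) / 2) w * ‖w - z‖ ^ (-(1 - s))))) := by
    filter_upwards [ae_ne_const z] with w hw
    have hp : 0 < ‖w - z‖ := norm_pos_iff.2 (sub_ne_zero.2 hw)
    have e1 : ‖w - z‖ ^ (-(1 - s)) = ‖w - z‖ ^ s * ‖w - z‖ ^ (-1 : ℝ) := by
      rw [← Real.rpow_add hp]; congr 1; ring
    have e2 : jap (-(2 * s) / 2) w = jap (s / 2) w * jap (-(3 * s) / 2) w := by
      rw [jap_mul]; congr 1; ring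
    have e3 : jap (-s / 2) z * jap (s / 2) z = 1 := by
      rw [jap_mul, jap]; ring_nf; exact Real.rpow_zero _
    have hp1 := jap_pos (-(3 * s) / 2) w
    have hp2 := jap_pos (-s / 2) z
    have hp3 := jap_pos (-(2 * s) / 2) w
    rw [mul_left_comm 2, mul_left_comm 2, two_mul_ofReal, two_mul_ofReal, ← mul_add,
      ← ENNReal.ofReal_add (by positivity) (by positivity), mul_left_comm,
      ← ENNReal.ofReal_mul hp2.le]
    refine mul_le_mul_right (ENNReal.ofReal_le_ofReal ?_) _
    calc jap (-(3 * s) / 2) w * ‖w - z‖ ^ (-1 : ℝ)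
        = jap (-s / 2) z * (jap (-(3 * s) / 2) w * ‖w - z‖ ^ (-1 : ℝ) * jap (s / 2) z) := by
          rw [mul_left_comm, e3, mul_one]
      _ ≤ jap (-s / 2) z * (jap (-(3 * s) / 2) w * ‖w - z‖ ^ (-1 : ℝ) *
            (2 * (jap (s / 2) w + ‖w - z‖ ^ s))) := by
          gcongr; exact jap_le_add hs1 hs z w
      _ = _ := by rw [e1, e2]; ring
  rw [lintegral_wt_mul]
  refine (lintegral_mono_ae hpt).trans ?_
  have mj : AEMeasurable (fun w : ℂ => 2 * (‖x.fn w‖ₑ *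
      ENNReal.ofReal (jap (-(2 * s) / 2) w * ‖w - z‖ ^ (-1 : ℝ)))) volume :=
    (hx.mul (((measurable_jap _).mul (by fun_prop)).ennreal_ofReal).aemeasurable).const_mul 2
  rw [lintegral_const_mul' _ _ ENNReal.ofReal_ne_top, lintegral_add_left' mj,
    lintegral_const_mul' _ _ (by simp),
    lintegral_const_mul' _ _ (by simp)]
  calc _ ≤ ENNReal.ofReal (jap (-s / 2) z) * ((2 * (C₁ * ENNReal.ofReal ‖x‖)) +
        2 * (C₂ * ENNReal.ofReal ‖x‖)) := by
        gcongr
        · exact h₁ x z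
        · exact h₂ x z
    _ = _ := by
      rw [mul_comm, ENNReal.ofReal_mul (by positivity), ENNReal.ofReal_mul (by positivity),
        ENNReal.ofReal_coe_nnreal]
      push_cast
      ring

lemma integrable_inv_smul_wt (hs : 0 < s) (hs1 : s ≤ 1 / 4) (x : Morrey s n) (z : ℂ) :
    Integrable fun w => (z - w)⁻¹ • (wt n hs x).fn w := by
  obtain ⟨C, hC⟩ := exists_lintegral_cauchy_decay n hs hs1
  refine ⟨(by fun_prop : Measurable fun w : ℂ => (z - w)⁻¹).aestronglyMeasurable.smul
    (wt n hs x).aesm, ?_⟩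
  refine lt_of_le_of_lt (le_of_eq ?_) ((hC x z).trans_lt ENNReal.ofReal_lt_top)
  refine lintegral_congr fun w => ?_
  rw [enorm_smul, mul_comm, ← ofReal_norm (z - w)⁻¹, norm_inv, norm_sub_rev, Real.rpow_neg_one]

lemma exists_norm_cauchyT_wt_le (n : ℕ) (hs : 0 < s) (hs1 : s ≤ 1 / 4) :
    ∃ C : ℝ≥0, ∀ (x : Morrey s n) (z : ℂ),
      ‖cauchyT (wt n hs x).fn z‖ ≤ C * ‖x‖ * jap (-s / 2) z := by
  obtain ⟨C, hC⟩ := exists_lintegral_cauchy_decay n hs hs1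
  refine ⟨C, fun x z => ?_⟩
  have h := (enorm_cauchyT_le (wt n hs x).fn z).trans (hC x z)
  rw [← ofReal_norm] at h
  exact (ENNReal.ofReal_le_ofReal_iff
    (mul_nonneg (by positivity) (jap_pos _ _).le)).1 h

/-- The difference of kernels is `|z - z'|` over a product. The part `|z - z'|^{1-σ}` is spent, by
the triangle inequality, on lowering one of the two singularities, and the remaining product is
dominated by the sum of single singularities of order `1 + σ`. -/
lemma norm_inv_sub_inv_le {σ : ℝ} (hσ : 0 < σ) (hσ1 : σ < 1) {z z' w : ℂ} (h : w ≠ z)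
    (h' : w ≠ z') : ‖(z - w)⁻¹ - (z' - w)⁻¹‖ ≤
      ‖z - z'‖ ^ σ * (4 * (‖w - z‖ ^ (-(1 + σ)) + ‖w - z'‖ ^ (-(1 + σ)))) := by
  have hA : 0 < ‖w - z‖ := norm_pos_iff.2 (sub_ne_zero.2 h)
  have hB : 0 < ‖w - z'‖ := norm_pos_iff.2 (sub_ne_zero.2 h')
  have h1 : (z - w) ≠ 0 := sub_ne_zero.2 h.symm
  have h2 : (z' - w) ≠ 0 := sub_ne_zero.2 h'.symm
  have e : ‖(z - w)⁻¹ - (z' - w)⁻¹‖ = ‖z - z'‖ * (‖w - z‖ ^ (-1 : ℝ) * ‖w - z'‖ ^ (-1 : ℝ)) := by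
    rw [inv_sub_inv h1 h2, norm_div, norm_mul, norm_sub_rev z w, norm_sub_rev z' w,
      Real.rpow_neg_one, Real.rpow_neg_one, sub_sub_sub_cancel_right, norm_sub_rev z' z,
      div_eq_mul_inv, mul_inv]
  by_cases hz : z = z'
  · rw [e, hz, sub_self, norm_zero, zero_mul]; positivity
  have hD : 0 < ‖z - z'‖ := norm_pos_iff.2 (sub_ne_zero.2 hz)
  have hD1 : ‖z - z'‖ ^ (1 - σ) ≤ ‖w - z‖ ^ (1 - σ) * 2 + ‖w - z'‖ ^ (1 - σ) * 2 := by
    have ht : ‖z - z'‖ ≤ ‖w - z‖ + ‖w - z'‖ := by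
      rw [norm_sub_rev w z]; simpa using norm_add_le (z - w) (w - z')
    have h2' : (2 : ℝ) ^ (1 - σ) ≤ 2 := by
      calc (2 : ℝ) ^ (1 - σ) ≤ 2 ^ (1 : ℝ) :=
            Real.rpow_le_rpow_of_exponent_le (by norm_num) (by linarith)
        _ = 2 := Real.rpow_one _
    rcases le_total ‖w - z‖ ‖w - z'‖ with hl | hl
    · calc ‖z - z'‖ ^ (1 - σ) ≤ (‖w - z'‖ * 2) ^ (1 - σ) :=
            Real.rpow_le_rpow hD.le (by linarith) (by linarith)
        _ = ‖w - z'‖ ^ (1 - σ) * 2 ^ (1 - σ) := Real.mul_rpow hB.le (by norm_num)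
        _ ≤ ‖w - z'‖ ^ (1 - σ) * 2 := by gcongr
        _ ≤ _ := le_add_of_nonneg_left (by positivity)
    · calc ‖z - z'‖ ^ (1 - σ) ≤ (‖w - z‖ * 2) ^ (1 - σ) :=
            Real.rpow_le_rpow hD.le (by linarith) (by linarith)
        _ = ‖w - z‖ ^ (1 - σ) * 2 ^ (1 - σ) := Real.mul_rpow hA.le (by norm_num)
        _ ≤ ‖w - z‖ ^ (1 - σ) * 2 := by gcongr
        _ ≤ _ := le_add_of_nonneg_right (by positivity)
  have k1 : ‖w - z‖ ^ (1 - σ) * ‖w - z‖ ^ (-1 : ℝ) = ‖w - z‖ ^ (-σ) := by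
    rw [← Real.rpow_add hA]; congr 1; ring
  have k2 : ‖w - z'‖ ^ (1 - σ) * ‖w - z'‖ ^ (-1 : ℝ) = ‖w - z'‖ ^ (-σ) := by
    rw [← Real.rpow_add hB]; congr 1; ring
  have j1 := rpow_neg_mul_rpow_neg_le hA hB hσ.le zero_le_one
  have j2 := rpow_neg_mul_rpow_neg_le hA hB zero_le_one hσ.le
  rw [add_comm σ 1] at j1
  have hDe : ‖z - z'‖ = ‖z - z'‖ ^ σ * ‖z - z'‖ ^ (1 - σ) := by
    rw [← Real.rpow_add hD, add_sub_cancel, Real.rpow_one]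
  rw [e]
  calc ‖z - z'‖ * (‖w - z‖ ^ (-1 : ℝ) * ‖w - z'‖ ^ (-1 : ℝ))
      = ‖z - z'‖ ^ σ * (‖z - z'‖ ^ (1 - σ) * (‖w - z‖ ^ (-1 : ℝ) * ‖w - z'‖ ^ (-1 : ℝ))) := by
        rw [← mul_assoc (‖z - z'‖ ^ σ), ← hDe]
    _ ≤ ‖z - z'‖ ^ σ * ((‖w - z‖ ^ (1 - σ) * 2 + ‖w - z'‖ ^ (1 - σ) * 2) *
          (‖w - z‖ ^ (-1 : ℝ) * ‖w - z'‖ ^ (-1 : ℝ))) := by gcongr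
    _ = ‖z - z'‖ ^ σ * (2 * ((‖w - z‖ ^ (1 - σ) * ‖w - z‖ ^ (-1 : ℝ)) * ‖w - z'‖ ^ (-1 : ℝ)) +
          2 * (‖w - z‖ ^ (-1 : ℝ) * (‖w - z'‖ ^ (1 - σ) * ‖w - z'‖ ^ (-1 : ℝ)))) := by ring
    _ ≤ _ := by
        rw [k1, k2]
        gcongr
        linarith

/-- Hölder continuity of exponent `s/2`: the kernel of order `1 + s/2` is still below the threshold
`1 + s` of the Morrey norm. -/
lemma continuous_cauchyT_wt (hs : 0 < s) (hs1 : s ≤ 1 / 4) (x : Morrey s n) :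
    Continuous (cauchyT (wt n hs x).fn) := by
  obtain ⟨C, hC⟩ := exists_lintegral_kernel_le (s := s) n (α := 3 * s) (β := 1 + s / 2)
    (by linarith) (by linarith) (by linarith) (by linarith)
  set g := (wt n hs x).fn with hg
  have mk : ∀ z : ℂ, AEMeasurable (fun w => ‖g w‖ₑ * ENNReal.ofReal (‖w - z‖ ^ (-(1 + s / 2)))) :=
    fun z => (wt n hs x).aesm.enorm.mul (by fun_prop)
  have key : ∀ z z', ‖cauchyT g z - cauchyT g z'‖ ≤
      ‖z - z'‖ ^ (s / 2) * (4 * (2 * (C * ‖x‖))) := by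
    intro z z'
    have e : cauchyT g z - cauchyT g z' = (Real.pi : ℂ)⁻¹ •
        ∫ w, ((z - w)⁻¹ - (z' - w)⁻¹) • g w := by
      simp only [cauchyT, sub_smul]
      rw [integral_sub (integrable_inv_smul_wt hs hs1 x z) (integrable_inv_smul_wt hs hs1 x z'),
        smul_sub]
    have hpi : ‖(Real.pi : ℂ)⁻¹‖ ≤ 1 := by
      rw [norm_inv, Complex.norm_real, Real.norm_of_nonneg Real.pi_pos.le]
      exact inv_le_one_of_one_le₀ (by linarith [Real.pi_gt_three])
    have h1 : ‖∫ w, ((z - w)⁻¹ - (z' - w)⁻¹) • g w‖ₑ ≤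
        ENNReal.ofReal (‖z - z'‖ ^ (s / 2) * (4 * (2 * (C * ‖x‖)))) := by
      refine (enorm_integral_le_lintegral_enorm _).trans ?_
      have hpt : ∀ᵐ w, ‖((z - w)⁻¹ - (z' - w)⁻¹) • g w‖ₑ ≤
          ENNReal.ofReal (‖z - z'‖ ^ (s / 2) * 4) *
          (‖g w‖ₑ * ENNReal.ofReal (‖w - z‖ ^ (-(1 + s / 2))) +
            ‖g w‖ₑ * ENNReal.ofReal (‖w - z'‖ ^ (-(1 + s / 2)))) := by
        filter_upwards [ae_ne_const z, ae_ne_const z'] with w h h'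
        rw [enorm_smul, ← mul_add, mul_left_comm, ← ENNReal.ofReal_add (by positivity)
          (by positivity), ← ENNReal.ofReal_mul (by positivity), mul_comm, ← ofReal_norm (_ - _)]
        gcongr
        rw [mul_assoc]
        exact norm_inv_sub_inv_le (by linarith) (by linarith) h h'
      refine (lintegral_mono_ae hpt).trans ?_
      rw [lintegral_const_mul' _ _ ENNReal.ofReal_ne_top, lintegral_add_left' (mk z), hg,
        lintegral_wt_mul, lintegral_wt_mul]
      calc _ ≤ ENNReal.ofReal (‖z - z'‖ ^ (s / 2) * 4) *
            (C * ENNReal.ofReal ‖x‖ + C * ENNReal.ofReal ‖x‖) := by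
            gcongr
            · exact hC x z
            · exact hC x z'
        _ = _ := by
          rw [← mul_assoc (‖z - z'‖ ^ (s / 2)), ← two_mul,
            ENNReal.ofReal_mul (p := _ * _) (by positivity), ENNReal.ofReal_mul (p := 2) (by norm_num),
            ENNReal.ofReal_mul C.coe_nonneg, ENNReal.ofReal_coe_nnreal]
          simp
    rw [← ofReal_norm] at h1
    have h2 := (ENNReal.ofReal_le_ofReal_iff (by positivity)).1 h1
    rw [e, norm_smul]
    exact (mul_le_of_le_one_left (norm_nonneg _) hpi).trans h2
  refine continuous_iff_continuousAt.2 fun z => ?_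
  rw [ContinuousAt, tendsto_iff_norm_sub_tendsto_zero]
  refine squeeze_zero (fun _ => norm_nonneg _) (fun z' => key z' z) ?_
  have hc : Continuous fun z' : ℂ => ‖z' - z‖ ^ (s / 2) * (4 * (2 * (C * ‖x‖))) :=
    (Continuous.rpow_const (by fun_prop) fun _ => Or.inr (by positivity)).mul continuous_const
  have := hc.tendsto z
  rwa [sub_self, norm_zero, Real.zero_rpow (by positivity), zero_mul] at this

/-- The Cauchy transform of the weighted function `wt x`, as a bounded continuous function. -/
noncomputable def cauchyL (n : ℕ) (hs : 0 < s) (hs1 : s ≤ 1 / 4) :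
    Morrey s n →L[ℝ] (ℂ →ᵇ Cn n) :=
  have hC := fun x : Morrey s n => (exists_norm_cauchyT_wt_le n hs hs1).choose_spec x
  have hle : ∀ (x : Morrey s n) (z : ℂ), ‖cauchyT (wt n hs x).fn z‖ ≤
      (exists_norm_cauchyT_wt_le n hs hs1).choose * ‖x‖ := fun x z =>
    (hC x z).trans (mul_le_of_le_one_right (by positivity) (jap_le_one (by linarith) z))
  LinearMap.mkContinuous
    { toFun := fun x => BoundedContinuousFunction.ofNormedAddCommGroup
        (cauchyT (wt n hs x).fn) (continuous_cauchyT_wt hs hs1 x) _ (hle x)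
      map_add' := fun x y => by
        ext1 z
        change cauchyT (wt n hs (x + y)).fn z = cauchyT (wt n hs x).fn z + cauchyT (wt n hs y).fn z
        simp only [cauchyT]
        rw [← smul_add, ← integral_add (integrable_inv_smul_wt hs hs1 x z)
          (integrable_inv_smul_wt hs hs1 y z)]
        congr 1
        refine integral_congr_ae ?_
        rw [map_add]
        filter_upwards [fn_add (wt n hs x) (wt n hs y)] with w hw
        rw [hw, Pi.add_apply, smul_add]
      map_smul' := fun c x => by
        ext1 z
        change cauchyT (wt n hs (c • x)).fn z = c • cauchyT (wt n hs x).fn z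
        simp only [cauchyT]
        rw [smul_comm c, ← integral_smul c]
        congr 1
        refine integral_congr_ae ?_
        rw [map_smul]
        filter_upwards [fn_smul c (wt n hs x)] with w hw
        rw [hw, Pi.smul_apply, smul_comm] }
    ((exists_norm_cauchyT_wt_le n hs hs1).choose : ℝ)
    fun x => BoundedContinuousFunction.norm_ofNormedAddCommGroup_le _ (by positivity) (hle x)

/-- The Beurling transform on the Morrey space. -/
noncomputable def beurlingM (n : ℕ) (hs : 0 < s) (hs1 : s ≤ 1 / 4) :
    Morrey s n →L[ℝ] Morrey s n :=
  mkCLM (fun x => beurling n (toL2 s n x)) (fun x => Lp.aestronglyMeasurable _)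
    (fun x y => by rw [map_add, map_add]; exact Lp.coeFn_add _ _)
    (fun c x => by rw [map_smul, map_smul]; exact Lp.coeFn_smul _ _)
    ((exists_wNorm_mw_beurling_le (n := n) hs (by linarith)).choose : ℝ) (by positivity)
    fun x a => by
      refine ((exists_wNorm_mw_beurling_le (n := n) hs (by linarith)).choose_spec _ a).trans ?_
      rw [ENNReal.ofReal_mul (by positivity), ENNReal.ofReal_coe_nnreal]
      gcongr
      exact x.wNorm_le a

lemma fn_beurlingM (hs : 0 < s) (hs1 : s ≤ 1 / 4) (x : Morrey s n) :
    (beurlingM n hs hs1 x).fn =ᵐ[volume] beurling n (toL2 s n x) := fn_mkCLM x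

lemma wNorm_jap_wt_lt_top (hs : 0 < s) (x : Morrey s n) : wNorm (jap (s / 4)) (wt n hs x).fn < ⊤ := by
  refine lt_of_le_of_lt (wNorm_mono (m' := mw s 0) (g := x.fn) ?_)
    ((x.wNorm_le 0).trans_lt ENNReal.ofReal_lt_top)
  filter_upwards [fn_wt hs x] with w hw
  rw [hw, smul_smul, jap_mul, norm_smul, norm_smul]
  gcongr
  rw [Real.norm_of_nonneg (jap_pos _ _).le, Real.norm_of_nonneg (mw_pos _ _ _).le]
  exact (jap_le_one (by linarith) w).trans (one_le_mw s 0 w)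

/-- The weighted function lies in `L²` with the growing weight `jap (s / 4)`, which the local theory
of the Cauchy transform requires. -/
lemma weakD (hs : 0 < s) (hs1 : s ≤ 1 / 4) (x : Morrey s n) : WeakD (cauchyL n hs hs1 x) (wt n hs x).fn
    (beurlingM n hs hs1 (wt n hs x)).fn :=
  (weakD_cauchyT (τ := s / 2) (by linarith) (by linarith) (wt n hs x).aesm
    (by have := wNorm_jap_wt_lt_top hs x; rwa [show s / 4 = s / 2 / 2 by ring] at this)
    (integrable_inv_smul_wt hs hs1 x) (continuous_cauchyT_wt hs hs1 x)
    (gL := toL2 s n (wt n hs x)) (ae_eq_refl _)).congr (ae_eq_refl _) (fn_beurlingM hs hs1 _).symm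

/-- The converse direction: a continuous decaying map whose weak `∂̄` derivative has the weighted
form is given by the integral operators. It turns differential identities back into fixed point
equations. -/
lemma eq_of_weakD (hs : 0 < s) (hs1 : s ≤ 1 / 4) {x : Morrey s n} {u g h : ℂ → Cn n} (H : WeakD u g h)
    (hg : g =ᵐ[volume] (wt n hs x).fn) (hu : Continuous u) {C : ℝ}
    (hd : ∀ z, ‖u z‖ ≤ C * jap (-s / 2) z) :
    u = cauchyL n hs hs1 x ∧ h =ᵐ[volume] (beurlingM n hs hs1 (wt n hs x)).fn := by
  have h1 := (H.congr hg (ae_eq_refl _)).eq_cauchyT hs hd (wNorm_jap_wt_lt_top hs x)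
    (integrable_inv_smul_wt hs hs1 x) (continuous_cauchyT_wt hs hs1 x)
    (gL := toL2 s n (wt n hs x)) (ae_eq_refl _)
  refine ⟨?_, h1.2.trans (fn_beurlingM hs hs1 _).symm⟩
  exact (Continuous.ae_eq_iff_eq volume hu (continuous_cauchyT_wt hs hs1 x)).1 h1.1

end Morrey

end JLines

/-! ### Weighted coefficients along perturbed lines. -/

namespace JLines

variable {n : ℕ} {s : ℝ}

open BoundedContinuousFunction

namespace Morrey

/-- Constants are not square integrable, but `⟨w⟩^{-2(1+s)}` is integrable, uniformly in `a`, both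
alone and against `|w - a|^{-2s}`. -/
lemma exists_wNorm_mw_jap_le (n : ℕ) (hs : 0 < s) (hs1 : s ≤ 1 / 4) : ∃ C : ℝ≥0,
    ∀ (v : Cn n) (a : ℂ), wNorm (mw s a) (fun w => jap (-(1 + s) / 2) w • v) ≤
      ENNReal.ofReal (C * ‖v‖) := by
  obtain ⟨C₁, hC₁, h₁⟩ := exists_lintegral_two_centre_le (α := 2 * (1 + s)) (γ := 0) (by linarith)
    (by norm_num) (by norm_num) (by linarith)
  obtain ⟨C₂, hC₂, h₂⟩ := exists_lintegral_two_centre_le (α := 2 * (1 + s)) (γ := 2 * s) (by linarith)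
    (by linarith) (by linarith) (by linarith)
  lift C₁ to ℝ≥0 using hC₁.ne
  lift C₂ to ℝ≥0 using hC₂.ne
  refine ⟨1 + 2 * C₁ + 2 * C₂, fun v a => ?_⟩
  rw [← ENNReal.pow_le_pow_left_iff two_ne_zero, wNorm_sq]
  have hpt : ∀ w, ENNReal.ofReal (‖jap (-(1 + s) / 2) w • v‖ ^ 2 * mw s a w ^ 2) ≤
      ENNReal.ofReal (‖v‖ ^ 2) *
      (2 * ENNReal.ofReal ((1 + ‖w‖ ^ 2) ^ (-(2 * (1 + s)) / 2) * ‖w - a‖ ^ (-(0 : ℝ))) +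
      2 * ENNReal.ofReal ((1 + ‖w‖ ^ 2) ^ (-(2 * (1 + s)) / 2) * ‖w - a‖ ^ (-(2 * s)))) := by
    intro w
    rw [two_mul_ofReal, two_mul_ofReal, ← ENNReal.ofReal_add (by positivity) (by positivity),
      ← ENNReal.ofReal_mul (by positivity)]
    refine ENNReal.ofReal_le_ofReal ?_
    have e : (1 + ‖w‖ ^ 2) ^ (-(2 * (1 + s)) / 2) = jap (-(1 + s) / 2) w ^ 2 := by
      rw [jap_sq, jap]; congr 1; ring
    rw [norm_smul, mul_pow, Real.norm_eq_abs, sq_abs, e, neg_zero, Real.rpow_zero]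
    have := mul_le_mul_of_nonneg_left (mw_sq_le s a w)
      (by positivity : 0 ≤ jap (-(1 + s) / 2) w ^ 2 * ‖v‖ ^ 2)
    rw [show -(2 * s) = -2 * s by ring]
    linarith
  refine (lintegral_mono hpt).trans ?_
  rw [lintegral_const_mul' _ _ ENNReal.ofReal_ne_top, lintegral_add_left (by fun_prop),
    lintegral_const_mul' _ _ (by simp), lintegral_const_mul' _ _ (by simp)]
  calc _ ≤ ENNReal.ofReal (‖v‖ ^ 2) * (2 * (C₁ : ℝ≥0∞) + 2 * C₂) := by
        gcongr
        · exact h₁ a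
        · exact h₂ a
    _ = ENNReal.ofReal (‖v‖ ^ 2) * ((2 * C₁ + 2 * C₂ : ℝ≥0) : ℝ≥0∞) := by push_cast; rfl
    _ ≤ ENNReal.ofReal (‖v‖ ^ 2) * ((1 + 2 * C₁ + 2 * C₂ : ℝ≥0) : ℝ≥0∞) ^ 2 := by
        gcongr
        have h : 2 * C₁ + 2 * C₂ ≤ 1 + 2 * C₁ + 2 * C₂ := by
          rw [add_assoc]; exact le_add_self
        have h1 : 1 ≤ 1 + 2 * C₁ + 2 * C₂ := by rw [add_assoc]; exact le_self_add
        exact_mod_cast h.trans (le_self_pow₀ h1 two_ne_zero)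
    _ = _ := by
        rw [ENNReal.ofReal_mul (by positivity), mul_pow, ENNReal.ofReal_coe_nnreal,
          ENNReal.ofReal_pow (norm_nonneg _), mul_comm]

/-- The map `v ↦ (1 + |w|²)^{-(1+s)/2} v`. -/
noncomputable def constL (n : ℕ) (hs : 0 < s) (hs1 : s ≤ 1 / 4) : Cn n →L[ℝ] Morrey s n :=
  mkCLM (fun v w => jap (-(1 + s) / 2) w • v)
    (fun v => ((continuous_jap _).smul continuous_const).aestronglyMeasurable)
    (fun v v' => Eventually.of_forall fun w => smul_add _ _ _)
    (fun c v => Eventually.of_forall fun w => smul_comm _ _ _)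
    (exists_wNorm_mw_jap_le n hs hs1).choose (by positivity)
    (exists_wNorm_mw_jap_le n hs hs1).choose_spec

/-- The map `(v, h) ↦ (1 + |w|²)^{-(1+s)/2} (v + h)`. -/
noncomputable def affL (n : ℕ) (hs : 0 < s) (hs1 : s ≤ 1 / 4) :
    Cn n × Morrey s n →L[ℝ] Morrey s n :=
  (constL n hs hs1).coprod (japMul s n (-(1 + s) / 2) (by linarith))

lemma fn_affL (hs : 0 < s) (hs1 : s ≤ 1 / 4) (v : Cn n) (h : Morrey s n) :
    (affL n hs hs1 (v, h)).fn =ᵐ[volume] fun w => jap (-(1 + s) / 2) w • (v + h.fn w) := by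
  rw [affL, ContinuousLinearMap.coprod_apply]
  have h1 : (constL n hs hs1 v).fn =ᵐ[volume] fun w => jap (-(1 + s) / 2) w • v := fn_mkCLM v
  filter_upwards [fn_add (constL n hs hs1 v) (japMul s n (-(1 + s) / 2) (by linarith) h),
    h1, fn_japMul (α := -(1 + s) / 2) (by linarith) h] with w h1 h2 h3
  rw [h1, Pi.add_apply, h2, h3, smul_add]

/-- `x ↦ (T x, S x)`. -/
noncomputable def solL (n : ℕ) (hs : 0 < s) (hs1 : s ≤ 1 / 4) :
    Morrey s n →L[ℝ] (ℂ →ᵇ Cn n) × Morrey s n :=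
  (cauchyL n hs hs1).prod (beurlingM n hs hs1 ∘L wt n hs)

end Morrey

/-- A function as a bounded continuous function (zero if it is not one). -/
noncomputable def toB {E : Type*} [NormedAddCommGroup E] (f : ℂ → E) : ℂ →ᵇ E :=
  open Classical in
  if h : Continuous f ∧ ∃ C, ∀ z, ‖f z‖ ≤ C then
    BoundedContinuousFunction.ofNormedAddCommGroup f h.1 h.2.choose h.2.choose_spec else 0

lemma toB_apply {E : Type*} [NormedAddCommGroup E] {f : ℂ → E} (hf : Continuous f) {C : ℝ}
    (h : ∀ z, ‖f z‖ ≤ C) (z : ℂ) : toB f z = f z := by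
  rw [toB, dif_pos ⟨hf, C, h⟩]; rfl

/-- Smooth antilinear coefficients with decay. -/
structure Coeff (s M : ℝ) (Q : Cn n → EndR n) : Prop where
  smooth : ContDiff ℝ ∞ Q
  anti : ∀ z (c : ℂ) x, Q z (c • x) = (starRingEnd ℂ) c • Q z x
  bound : ∀ z, ‖Q z‖ ≤ M * (1 + ‖z‖) ^ (-(1 + 4 * s))
  deriv_bound : ∀ z, ‖fderiv ℝ Q z‖ ≤ M * (1 + ‖z‖) ^ (-(2 + 4 * s))

/-- A point within `|ζ|/2 + 8` of `ζv₀` has norm comparable to `|ζ|` at infinity, so decay of `Q` in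
`z` becomes decay in `ζ`. The ball holds every `ζv + u` with `‖v - v₀‖ ≤ 1/2` and `‖u‖ ≤ 8`. -/
lemma one_add_norm_le {v₀ z : Cn n} (hv₀ : ‖v₀‖ = 1) {ζ : ℂ}
    (hz : z ∈ Metric.closedBall (ζ • v₀) (‖ζ‖ / 2 + 8)) : 1 + ‖ζ‖ ≤ 33 * (1 + ‖z‖) := by
  rw [mem_closedBall_iff_norm, norm_sub_rev] at hz
  have h := norm_sub_norm_le (ζ • v₀) z
  rw [norm_smul, hv₀, mul_one] at h
  nlinarith [norm_nonneg z, norm_nonneg ζ]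

lemma rpow_neg_le_of_le {p x y : ℝ} (hp : 0 ≤ p) (hp3 : p ≤ 3) (hx : 0 ≤ x)
    (h : 1 + x ≤ 33 * y) : y ^ (-p) ≤ 33 ^ 3 * (1 + x) ^ (-p) := by
  have hy : 0 < y := by linarith
  have h1 : (33 * y) ^ (-p) ≤ (1 + x) ^ (-p) :=
    Real.rpow_le_rpow_of_nonpos (by linarith) h (by linarith)
  rw [Real.mul_rpow (by norm_num) hy.le] at h1
  have h2 : (33 : ℝ) ^ p ≤ 33 ^ 3 := by
    calc (33 : ℝ) ^ p ≤ 33 ^ (3 : ℝ) := Real.rpow_le_rpow_of_exponent_le (by norm_num) hp3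
      _ = _ := by norm_cast
  have h3 : (33 : ℝ) ^ p * 33 ^ (-p) = 1 := by
    rw [← Real.rpow_add (by norm_num), add_neg_cancel, Real.rpow_zero]
  calc y ^ (-p) = 33 ^ p * (33 ^ (-p) * y ^ (-p)) := by rw [← mul_assoc, h3, one_mul]
    _ ≤ 33 ^ 3 * (1 + x) ^ (-p) := by gcongr

lemma jap_mul_rpow_le {p : ℝ} (hp : 0 ≤ p) (ζ : ℂ) : jap (p / 2) ζ * (1 + ‖ζ‖) ^ (-p) ≤ 1 := by
  have h : jap (p / 2) ζ ≤ (1 + ‖ζ‖) ^ p := by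
    have e : (1 + ‖ζ‖) ^ p = ((1 + ‖ζ‖) ^ 2) ^ (p / 2) := by
      rw [← Real.rpow_natCast, ← Real.rpow_mul (by positivity)]; congr 1; push_cast; ring
    rw [e, jap]
    gcongr
    nlinarith [norm_nonneg ζ]
  calc _ ≤ (1 + ‖ζ‖) ^ p * (1 + ‖ζ‖) ^ (-p) := by gcongr
    _ = 1 := by rw [← Real.rpow_add (by positivity), add_neg_cancel, Real.rpow_zero]

section
variable {M : ℝ} {Q : Cn n → EndR n}

lemma Coeff.nonneg (hQ : Coeff s M Q) : 0 ≤ M := by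
  have := (norm_nonneg _).trans (hQ.bound 0)
  simpa using this

lemma Coeff.norm_le (hQ : Coeff s M Q) (hs : 0 < s) (hs1 : s ≤ 1 / 4) {v₀ z : Cn n}
    (hv₀ : ‖v₀‖ = 1) {ζ : ℂ} (hz : z ∈ Metric.closedBall (ζ • v₀) (‖ζ‖ / 2 + 8)) :
    jap ((1 + 4 * s) / 2) ζ * ‖Q z‖ ≤ 33 ^ 3 * M := by
  have hM := hQ.nonneg
  have h1 := rpow_neg_le_of_le (p := 1 + 4 * s) (by linarith) (by linarith) (norm_nonneg ζ)
    (one_add_norm_le hv₀ hz)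
  have hj := jap_pos ((1 + 4 * s) / 2) ζ
  calc _ ≤ jap ((1 + 4 * s) / 2) ζ * (M * (33 ^ 3 * (1 + ‖ζ‖) ^ (-(1 + 4 * s)))) := by
        gcongr
        exact (hQ.bound z).trans (by gcongr)
    _ = 33 ^ 3 * M * (jap ((1 + 4 * s) / 2) ζ * (1 + ‖ζ‖) ^ (-(1 + 4 * s))) := by ring
    _ ≤ 33 ^ 3 * M * 1 := by gcongr; exact jap_mul_rpow_le (by linarith) ζ
    _ = _ := mul_one _

/-- Mean value inequality on the convex ball, where the derivative of `Q` decays one order faster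
than `Q`. -/
lemma Coeff.norm_sub_le (hQ : Coeff s M Q) (hs : 0 < s) (hs1 : s ≤ 1 / 4) {v₀ z z' : Cn n}
    (hv₀ : ‖v₀‖ = 1) {ζ : ℂ} (hz : z ∈ Metric.closedBall (ζ • v₀) (‖ζ‖ / 2 + 8))
    (hz' : z' ∈ Metric.closedBall (ζ • v₀) (‖ζ‖ / 2 + 8)) :
    jap ((1 + 4 * s) / 2) ζ * ‖Q z - Q z'‖ ≤ 33 ^ 3 * M * ((1 + ‖ζ‖)⁻¹ * ‖z - z'‖) := by
  have hM := hQ.nonneg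
  have hj := jap_pos ((1 + 4 * s) / 2) ζ
  have h1 : ‖Q z - Q z'‖ ≤ M * (33 ^ 3 * (1 + ‖ζ‖) ^ (-(2 + 4 * s))) * ‖z - z'‖ := by
    refine (convex_closedBall (ζ • v₀) _).norm_image_sub_le_of_norm_fderiv_le
      (fun x _ => hQ.smooth.differentiable (by simp) x) (fun x hx => ?_) hz' hz
    refine (hQ.deriv_bound x).trans ?_
    gcongr
    exact rpow_neg_le_of_le (by linarith) (by linarith) (norm_nonneg ζ) (one_add_norm_le hv₀ hx)
  have e : (1 + ‖ζ‖) ^ (-(2 + 4 * s)) = (1 + ‖ζ‖) ^ (-(1 + 4 * s)) * (1 + ‖ζ‖)⁻¹ := by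
    rw [← Real.rpow_neg_one, ← Real.rpow_add (by positivity)]; congr 1; ring
  calc _ ≤ jap ((1 + 4 * s) / 2) ζ * (M * (33 ^ 3 * (1 + ‖ζ‖) ^ (-(2 + 4 * s))) * ‖z - z'‖) := by
        gcongr
    _ = 33 ^ 3 * M * ((1 + ‖ζ‖)⁻¹ * ‖z - z'‖) *
          (jap ((1 + 4 * s) / 2) ζ * (1 + ‖ζ‖) ^ (-(1 + 4 * s))) := by rw [e]; ring
    _ ≤ 33 ^ 3 * M * ((1 + ‖ζ‖)⁻¹ * ‖z - z'‖) * 1 := by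
        gcongr; exact jap_mul_rpow_le (by linarith) ζ
    _ = _ := mul_one _

lemma mem_closedBall_line {v₀ v u : Cn n} (hv : v ∈ Metric.closedBall v₀ (1 / 2)) (hu : ‖u‖ ≤ 8)
    (ζ : ℂ) : ζ • v + u ∈ Metric.closedBall (ζ • v₀) (‖ζ‖ / 2 + 8) := by
  rw [mem_closedBall_iff_norm] at *
  rw [show ζ • v + u - ζ • v₀ = ζ • (v - v₀) + u by module]
  refine (norm_add_le _ _).trans ?_
  rw [norm_smul]
  nlinarith [norm_nonneg ζ]

/-- The coefficient along the perturbed line `ζ v + u(ζ)`. -/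
noncomputable def coefB (s : ℝ) (Q : Cn n → EndR n) (v : Cn n) (u : ℂ →ᵇ Cn n) : ℂ →ᵇ EndR n :=
  toB fun ζ => jap ((1 + 4 * s) / 2) ζ • Q (ζ • v + u ζ)

lemma norm_jap_smul (α : ℝ) (ζ : ℂ) (x : EndR n) : ‖jap α ζ • x‖ = jap α ζ * ‖x‖ :=
  (norm_smul (jap α ζ) x).trans (by rw [Real.norm_of_nonneg (jap_pos _ _).le])

lemma norm_jap_smul_sub (α : ℝ) (ζ : ℂ) (x y : EndR n) :
    ‖jap α ζ • x - jap α ζ • y‖ = jap α ζ * ‖x - y‖ :=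
  (congrArg norm (smul_sub (jap α ζ) x y).symm).trans (norm_jap_smul α ζ (x - y))

lemma coefB_apply (hQ : Coeff s M Q) (hs : 0 < s) (hs1 : s ≤ 1 / 4) {v₀ v : Cn n} (hv₀ : ‖v₀‖ = 1)
    (hv : v ∈ Metric.closedBall v₀ (1 / 2)) {u : ℂ →ᵇ Cn n} (hu : ‖u‖ ≤ 8) (ζ : ℂ) :
    coefB s Q v u ζ = jap ((1 + 4 * s) / 2) ζ • Q (ζ • v + u ζ) := by
  have := hQ.smooth.continuous
  refine toB_apply (C := 33 ^ 3 * M) ?_ (fun ζ => ?_) ζ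
  · exact (continuous_jap _).smul (this.comp (by fun_prop))
  · rw [norm_jap_smul]
    exact hQ.norm_le hs hs1 hv₀ (mem_closedBall_line hv ((u.norm_coe_le_norm ζ).trans hu) ζ)

lemma norm_coefB_le (hQ : Coeff s M Q) (hs : 0 < s) (hs1 : s ≤ 1 / 4) {v₀ v : Cn n}
    (hv₀ : ‖v₀‖ = 1) (hv : v ∈ Metric.closedBall v₀ (1 / 2)) {u : ℂ →ᵇ Cn n} (hu : ‖u‖ ≤ 8) :
    ‖coefB s Q v u‖ ≤ 33 ^ 3 * M := by
  have hM := hQ.nonneg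
  refine (BoundedContinuousFunction.norm_le (by positivity)).2 fun ζ => ?_
  rw [coefB_apply hQ hs hs1 hv₀ hv hu, norm_jap_smul]
  exact hQ.norm_le hs hs1 hv₀ (mem_closedBall_line hv ((u.norm_coe_le_norm ζ).trans hu) ζ)

/-- Changing the direction displaces the line by `|ζ| ‖v - v'‖`, which is unbounded. The factor `(1
+ |ζ|)⁻¹` gained from the derivative of `Q` compensates it exactly. -/
lemma norm_coefB_sub_le (hQ : Coeff s M Q) (hs : 0 < s) (hs1 : s ≤ 1 / 4) {v₀ v v' : Cn n}
    (hv₀ : ‖v₀‖ = 1) (hv : v ∈ Metric.closedBall v₀ (1 / 2))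
    (hv' : v' ∈ Metric.closedBall v₀ (1 / 2)) {u u' : ℂ →ᵇ Cn n} (hu : ‖u‖ ≤ 8) (hu' : ‖u'‖ ≤ 8) :
    ‖coefB s Q v u - coefB s Q v' u'‖ ≤ 33 ^ 3 * M * (‖v - v'‖ + ‖u - u'‖) := by
  have hM := hQ.nonneg
  refine (BoundedContinuousFunction.norm_le (by positivity)).2 fun ζ => ?_
  rw [BoundedContinuousFunction.sub_apply, coefB_apply hQ hs hs1 hv₀ hv hu,
    coefB_apply hQ hs hs1 hv₀ hv' hu', norm_jap_smul_sub]
  refine (hQ.norm_sub_le hs hs1 hv₀ (mem_closedBall_line hv ((u.norm_coe_le_norm ζ).trans hu) ζ)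
    (mem_closedBall_line hv' ((u'.norm_coe_le_norm ζ).trans hu') ζ)).trans ?_
  have h1 : ‖ζ • v + u ζ - (ζ • v' + u' ζ)‖ ≤ (1 + ‖ζ‖) * (‖v - v'‖ + ‖u - u'‖) := by
    rw [show ζ • v + u ζ - (ζ • v' + u' ζ) = ζ • (v - v') + (u ζ - u' ζ) by module]
    refine (norm_add_le _ _).trans ?_
    have h2 : ‖u ζ - u' ζ‖ ≤ ‖u - u'‖ := (u - u').norm_coe_le_norm ζ
    rw [norm_smul]
    nlinarith [norm_nonneg ζ, norm_nonneg (v - v'), norm_nonneg (u - u'),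
      mul_nonneg (norm_nonneg ζ) (norm_nonneg (u - u'))]
  gcongr
  rw [inv_mul_le_iff₀ (by positivity)]
  exact h1

end

end JLines

/-! ### The fixed point problem for a perturbed line. -/

namespace JLines

variable {n : ℕ} {s : ℝ}

open BoundedContinuousFunction Morrey

lemma Morrey.sub_mul (b b' : ℂ →ᵇ EndR n) (x : Morrey s n) :
    Morrey.mul (b - b') x = Morrey.mul b x - Morrey.mul b' x := ext_ae (by
  filter_upwards [fn_mul (b - b') x, fn_sub (Morrey.mul b x) (Morrey.mul b' x), fn_mul b x,
    fn_mul b' x] with w h1 h2 h3 h4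
  rw [h1, h2, Pi.sub_apply, h3, h4]; rfl)

lemma exists_fixedPoint_of_lipschitz {E : Type*} [NormedAddCommGroup E] [CompleteSpace E]
    {f : E → E} {c : E} {r : ℝ} (hr : 0 ≤ r)
    (hmaps : ∀ x ∈ Metric.closedBall c r, f x ∈ Metric.closedBall c r)
    (hlip : ∀ x ∈ Metric.closedBall c r, ∀ y ∈ Metric.closedBall c r,
      ‖f x - f y‖ ≤ 1 / 2 * ‖x - y‖) :
    ∃ x ∈ Metric.closedBall c r, f x = x := by
  have hm : MapsTo f (Metric.closedBall c r) (Metric.closedBall c r) := hmaps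
  have hc : ContractingWith (1 / 2) (hm.restrict f _ _) := by
    refine ⟨by norm_num, LipschitzWith.of_dist_le_mul fun x y => ?_⟩
    have := hlip x x.2 y y.2
    rw [Subtype.dist_eq, Subtype.dist_eq, dist_eq_norm, dist_eq_norm]
    simpa using this
  obtain ⟨y, hy, hfy, -⟩ := ContractingWith.exists_fixedPoint' Metric.isClosed_closedBall.isComplete
    hm hc (Metric.mem_closedBall_self hr) (edist_ne_top c (f c))
  exact ⟨y, hy, hfy⟩

lemma eq_of_fixedPoint_of_lipschitz {E : Type*} [NormedAddCommGroup E] {f : E → E} {x y : E}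
    (hx : f x = x) (hy : f y = y) (h : ‖f x - f y‖ ≤ 1 / 2 * ‖x - y‖) : x = y := by
  rw [hx, hy] at h
  exact sub_eq_zero.1 (norm_le_zero_iff.1 (by linarith))

/-- The right-hand side `Q(ζv + u)(v + h)/ω` of the Cauchy–Riemann equation. -/
noncomputable def rhs (hs : 0 < s) (hs1 : s ≤ 1 / 4) (Q : Cn n → EndR n) (v : Cn n)
    (y : (ℂ →ᵇ Cn n) × Morrey s n) : Morrey s n :=
  Morrey.mul (coefB s Q v y.1) (affL n hs hs1 (v, y.2))

/-- The fixed point map. -/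
noncomputable def phi (hs : 0 < s) (hs1 : s ≤ 1 / 4) (Q : Cn n → EndR n) (v : Cn n)
    (y : (ℂ →ᵇ Cn n) × Morrey s n) : (ℂ →ᵇ Cn n) × Morrey s n :=
  solL n hs hs1 (rhs hs hs1 Q v y)

/-- The Lipschitz constant of `phi` for `M = 1`. -/
noncomputable def kap (n : ℕ) (hs : 0 < s) (hs1 : s ≤ 1 / 4) : ℝ :=
  5 * 33 ^ 3 * ‖solL n hs hs1‖ * ‖affL n hs hs1‖

lemma kap_nonneg (n : ℕ) (hs : 0 < s) (hs1 : s ≤ 1 / 4) : 0 ≤ kap n hs hs1 := by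
  unfold kap; positivity

section
variable {M : ℝ} {Q : Cn n → EndR n}

lemma norm_le_of_mem {v₀ v : Cn n} (hv₀ : ‖v₀‖ = 1) (hv : v ∈ Metric.closedBall v₀ (1 / 2)) :
    ‖v‖ ≤ 4 := by
  rw [mem_closedBall_iff_norm] at hv
  have := norm_sub_norm_le v v₀
  linarith

lemma norm_affL_le (hs : 0 < s) (hs1 : s ≤ 1 / 4) {v : Cn n} {h : Morrey s n} {r : ℝ}
    (hv : ‖v‖ ≤ r) (hh : ‖h‖ ≤ r) : ‖affL n hs hs1 (v, h)‖ ≤ ‖affL n hs hs1‖ * r :=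
  ((affL n hs hs1).le_opNorm _).trans (by gcongr; exact max_le hv hh)

lemma norm_phi_le (hQ : Coeff s M Q) (hs : 0 < s) (hs1 : s ≤ 1 / 4) {v₀ v : Cn n}
    (hv₀ : ‖v₀‖ = 1) (hv : v ∈ Metric.closedBall v₀ (1 / 2)) {y : (ℂ →ᵇ Cn n) × Morrey s n}
    (hy : ‖y‖ ≤ 4) : ‖phi hs hs1 Q v y‖ ≤ kap n hs hs1 * M := by
  have hM := hQ.nonneg
  have h1 : ‖y.1‖ ≤ 8 := (norm_fst_le y).trans (by linarith)
  have h2 : ‖y.2‖ ≤ 4 := (norm_snd_le y).trans hy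
  calc _ ≤ ‖solL n hs hs1‖ * ‖rhs hs hs1 Q v y‖ := (solL n hs hs1).le_opNorm _
    _ ≤ ‖solL n hs hs1‖ * (33 ^ 3 * M * (‖affL n hs hs1‖ * 4)) := by
      gcongr
      refine (Morrey.norm_mul_le _ _).trans ?_
      gcongr
      · exact norm_coefB_le hQ hs hs1 hv₀ hv h1
      · exact norm_affL_le hs hs1 (norm_le_of_mem hv₀ hv) h2
    _ = 4 * (33 ^ 3 * ‖solL n hs hs1‖ * ‖affL n hs hs1‖ * M) := by ring
    _ ≤ 5 * (33 ^ 3 * ‖solL n hs hs1‖ * ‖affL n hs hs1‖ * M) := by gcongr; norm_num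
    _ = _ := by rw [kap]; ring

/-- The right-hand side is a product. Varying the coefficient costs 4 times the common factor, as
`v` and `y.2` are bounded by 4; varying the argument costs it once more. This is the 5 in `kap`. -/
lemma norm_phi_sub_le (hQ : Coeff s M Q) (hs : 0 < s) (hs1 : s ≤ 1 / 4) {v₀ v v' : Cn n}
    (hv₀ : ‖v₀‖ = 1) (hv : v ∈ Metric.closedBall v₀ (1 / 2))
    (hv' : v' ∈ Metric.closedBall v₀ (1 / 2)) {y y' : (ℂ →ᵇ Cn n) × Morrey s n}
    (hy : ‖y‖ ≤ 4) (hy' : ‖y'‖ ≤ 4) : ‖phi hs hs1 Q v y - phi hs hs1 Q v' y'‖ ≤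
      kap n hs hs1 * M * (‖v - v'‖ + ‖y - y'‖) := by
  have hM := hQ.nonneg
  have h1 : ‖y.1‖ ≤ 8 := (norm_fst_le y).trans (by linarith)
  have h1' : ‖y'.1‖ ≤ 8 := (norm_fst_le y').trans (by linarith)
  have h2 : ‖y.2‖ ≤ 4 := (norm_snd_le y).trans hy
  have e : rhs hs hs1 Q v y - rhs hs hs1 Q v' y' =
      Morrey.mul (coefB s Q v y.1 - coefB s Q v' y'.1) (affL n hs hs1 (v, y.2)) +
      Morrey.mul (coefB s Q v' y'.1) (affL n hs hs1 (v - v', y.2 - y'.2)) := by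
    have e1 : affL n hs hs1 (v - v', y.2 - y'.2) =
      affL n hs hs1 (v, y.2) - affL n hs hs1 (v', y'.2) := by rw [← map_sub]; rfl
    have e2 : Morrey.mul (coefB s Q v y.1 - coefB s Q v' y'.1) (affL n hs hs1 (v, y.2)) =
        Morrey.mul (coefB s Q v y.1) (affL n hs hs1 (v, y.2)) -
        Morrey.mul (coefB s Q v' y'.1) (affL n hs hs1 (v, y.2)) :=
      Morrey.sub_mul _ _ _
    rw [e1, e2, map_sub, rhs, rhs]
    abel
  have hd1 : ‖y.1 - y'.1‖ ≤ ‖y - y'‖ := norm_fst_le (y - y')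
  have hd2 : ‖y.2 - y'.2‖ ≤ ‖y - y'‖ := norm_snd_le (y - y')
  calc _ = ‖solL n hs hs1 (rhs hs hs1 Q v y - rhs hs hs1 Q v' y')‖ := by rw [map_sub]; rfl
    _ ≤ ‖solL n hs hs1‖ * ‖rhs hs hs1 Q v y - rhs hs hs1 Q v' y'‖ := (solL n hs hs1).le_opNorm _
    _ ≤ ‖solL n hs hs1‖ * (33 ^ 3 * M * (‖v - v'‖ + ‖y - y'‖) * (‖affL n hs hs1‖ * 4) +
          33 ^ 3 * M * (‖affL n hs hs1‖ * (‖v - v'‖ + ‖y - y'‖))) := by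
      rw [e]
      gcongr
      refine (norm_add_le _ _).trans (add_le_add ?_ ?_)
      · refine (Morrey.norm_mul_le _ _).trans ?_
        gcongr
        · exact (norm_coefB_sub_le hQ hs hs1 hv₀ hv hv' h1 h1').trans (by gcongr)
        · exact norm_affL_le hs hs1 (norm_le_of_mem hv₀ hv) h2
      · refine (Morrey.norm_mul_le _ _).trans ?_
        gcongr
        · exact norm_coefB_le hQ hs hs1 hv₀ hv' h1'
        · exact norm_affL_le hs hs1 (le_add_of_nonneg_right (norm_nonneg _))
            (hd2.trans (le_add_of_nonneg_left (norm_nonneg _)))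
    _ = _ := by rw [kap]; ring

/-- Solutions of the fixed point equation. -/
structure IsSol (hs : 0 < s) (hs1 : s ≤ 1 / 4) (Q : Cn n → EndR n) (v : Cn n)
    (y : (ℂ →ᵇ Cn n) × Morrey s n) : Prop where
  norm_le : ‖y‖ ≤ 4
  eq : phi hs hs1 Q v y = y

lemma exists_isSol (hQ : Coeff s M Q) (hs : 0 < s) (hs1 : s ≤ 1 / 4)
    (hκ : kap n hs hs1 * M ≤ 1 / 64) {v₀ v : Cn n} (hv₀ : ‖v₀‖ = 1)
    (hv : v ∈ Metric.closedBall v₀ (1 / 2)) : ∃ y, IsSol hs hs1 Q v y := by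
  have h1 : ∀ y ∈ Metric.closedBall (0 : (ℂ →ᵇ Cn n) × Morrey s n) 4,
      phi hs hs1 Q v y ∈ Metric.closedBall (0 : (ℂ →ᵇ Cn n) × Morrey s n) 4 := by
    intro y hy
    rw [mem_closedBall_zero_iff] at hy ⊢
    linarith [norm_phi_le hQ hs hs1 hv₀ hv hy]
  have h2 : ∀ y ∈ Metric.closedBall (0 : (ℂ →ᵇ Cn n) × Morrey s n) 4,
      ∀ y' ∈ Metric.closedBall (0 : (ℂ →ᵇ Cn n) × Morrey s n) 4,
      ‖phi hs hs1 Q v y - phi hs hs1 Q v y'‖ ≤ 1 / 2 * ‖y - y'‖ := by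
    intro y hy y' hy'
    rw [mem_closedBall_zero_iff] at hy hy'
    have := norm_phi_sub_le hQ hs hs1 hv₀ hv hv hy hy'
    rw [sub_self, norm_zero, zero_add] at this
    exact this.trans (by gcongr; linarith)
  obtain ⟨y, hy, hfy⟩ := exists_fixedPoint_of_lipschitz (by norm_num) h1 h2
  exact ⟨y, by simpa using hy, hfy⟩

lemma IsSol.norm_le' (hQ : Coeff s M Q) {hs : 0 < s} {hs1 : s ≤ 1 / 4}
    {v₀ v : Cn n} (hv₀ : ‖v₀‖ = 1)
    (hv : v ∈ Metric.closedBall v₀ (1 / 2)) {y : (ℂ →ᵇ Cn n) × Morrey s n}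
    (H : IsSol hs hs1 Q v y) : ‖y‖ ≤ kap n hs hs1 * M := by
  have := norm_phi_le hQ hs hs1 hv₀ hv H.norm_le
  rwa [H.eq] at this

/-- Absorb the term with `‖y - y'‖` in the Lipschitz estimate. The smallness 1/64 leaves more than
enough room for the constant 1/2; taking equal directions gives uniqueness. -/
lemma IsSol.norm_sub_le (hQ : Coeff s M Q) {hs : 0 < s} {hs1 : s ≤ 1 / 4}
    (hκ : kap n hs hs1 * M ≤ 1 / 64) {v₀ v v' : Cn n} (hv₀ : ‖v₀‖ = 1)
    (hv : v ∈ Metric.closedBall v₀ (1 / 2)) (hv' : v' ∈ Metric.closedBall v₀ (1 / 2))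
    {y y' : (ℂ →ᵇ Cn n) × Morrey s n} (H : IsSol hs hs1 Q v y) (H' : IsSol hs hs1 Q v' y') :
    ‖y - y'‖ ≤ 1 / 2 * ‖v - v'‖ := by
  have h := norm_phi_sub_le hQ hs hs1 hv₀ hv hv' H.norm_le H'.norm_le
  rw [H.eq, H'.eq] at h
  have h1 : kap n hs hs1 * M * (‖v - v'‖ + ‖y - y'‖) ≤ 1 / 64 * (‖v - v'‖ + ‖y - y'‖) := by gcongr
  linarith [norm_nonneg (v - v')]

lemma IsSol.unique (hQ : Coeff s M Q) {hs : 0 < s} {hs1 : s ≤ 1 / 4}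
    (hκ : kap n hs hs1 * M ≤ 1 / 64) {v₀ v : Cn n} (hv₀ : ‖v₀‖ = 1)
    (hv : v ∈ Metric.closedBall v₀ (1 / 2))
    {y y' : (ℂ →ᵇ Cn n) × Morrey s n} (H : IsSol hs hs1 Q v y) (H' : IsSol hs hs1 Q v y') :
    y = y' := by
  have := H.norm_sub_le hQ hκ hv₀ hv hv H'
  rw [sub_self, norm_zero, mul_zero] at this
  exact sub_eq_zero.1 (norm_le_zero_iff.1 this)

/-- The right-hand side of the Cauchy–Riemann equation. -/
noncomputable def crRhs (Q : Cn n → EndR n) (v : Cn n) (y : (ℂ →ᵇ Cn n) × Morrey s n) (ζ : ℂ) :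
    Cn n := Q (ζ • v + y.1 ζ) (v + y.2.fn ζ)

lemma jap_smul_smul_cancel (s : ℝ) (ζ : ℂ) (A : EndR n) (x : Cn n) :
    jap (-(3 * s) / 2) ζ • ((jap ((1 + 4 * s) / 2) ζ • A) (jap (-(1 + s) / 2) ζ • x)) = A x := by
  rw [_root_.smul_apply, map_smul, smul_smul, smul_smul, jap_mul, jap_mul,
    show -(3 * s) / 2 + (1 + 4 * s) / 2 + -(1 + s) / 2 = 0 by ring, jap, Real.rpow_zero, one_smul]

/-- The three weights have exponents `-3s`, `1 + 4s` and `-(1 + s)`, which add up to zero. So the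
weighted right-hand side is the original one, `Q(L)(v + h)`. -/
lemma fn_wt_rhs (hQ : Coeff s M Q) (hs : 0 < s) (hs1 : s ≤ 1 / 4) {v₀ v : Cn n}
    (hv₀ : ‖v₀‖ = 1) (hv : v ∈ Metric.closedBall v₀ (1 / 2)) {y : (ℂ →ᵇ Cn n) × Morrey s n}
    (hy : ‖y‖ ≤ 4) : (wt n hs (rhs hs hs1 Q v y)).fn =ᵐ[volume] crRhs Q v y := by
  have h1 : ‖y.1‖ ≤ 8 := (norm_fst_le y).trans (by linarith)
  filter_upwards [fn_wt hs (rhs hs hs1 Q v y), fn_mul (coefB s Q v y.1) (affL n hs hs1 (v, y.2)),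
    fn_affL hs hs1 v y.2] with ζ e1 e2 e3
  rw [e1, rhs, e2, e3, coefB_apply hQ hs hs1 hv₀ hv h1, jap_smul_smul_cancel s]; rfl

lemma IsSol.weakD (hQ : Coeff s M Q) {hs : 0 < s} {hs1 : s ≤ 1 / 4} {v₀ v : Cn n}
    (hv₀ : ‖v₀‖ = 1) (hv : v ∈ Metric.closedBall v₀ (1 / 2)) {y : (ℂ →ᵇ Cn n) × Morrey s n}
    (H : IsSol hs hs1 Q v y) : WeakD y.1 (crRhs Q v y) y.2.fn := by
  have h := (Morrey.weakD hs hs1 (rhs hs hs1 Q v y)).congr (fn_wt_rhs hQ hs hs1 hv₀ hv H.norm_le)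
    (ae_eq_refl _)
  have e1 : cauchyL n hs hs1 (rhs hs hs1 Q v y) = y.1 := congrArg Prod.fst H.eq
  have e2 : beurlingM n hs hs1 (wt n hs (rhs hs hs1 Q v y)) = y.2 := congrArg Prod.snd H.eq
  rwa [e1, e2] at h

lemma IsSol.decay {hs : 0 < s} {hs1 : s ≤ 1 / 4} {v : Cn n} {y : (ℂ →ᵇ Cn n) × Morrey s n}
    (H : IsSol hs hs1 Q v y) : ∃ C : ℝ, 0 ≤ C ∧ ∀ z, ‖y.1 z‖ ≤ C * jap (-s / 2) z := by
  obtain ⟨C, hC⟩ := exists_norm_cauchyT_wt_le n hs hs1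
  refine ⟨C * ‖rhs hs hs1 Q v y‖, by positivity, fun z => ?_⟩
  have e1 : cauchyL n hs hs1 (rhs hs hs1 Q v y) = y.1 := congrArg Prod.fst H.eq
  rw [← e1]
  exact hC _ z

/-- Together with `IsSol.weakD` this makes solutions recognisable by their differential equation and
decay, so that uniqueness applies to transformed solutions. -/
lemma IsSol.of_weakD (hQ : Coeff s M Q) {hs : 0 < s} {hs1 : s ≤ 1 / 4} {v₀ v : Cn n}
    (hv₀ : ‖v₀‖ = 1) (hv : v ∈ Metric.closedBall v₀ (1 / 2)) {y : (ℂ →ᵇ Cn n) × Morrey s n}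
    (hy : ‖y‖ ≤ 4) (h : WeakD y.1 (crRhs Q v y) y.2.fn) {C : ℝ}
    (hC : ∀ z, ‖y.1 z‖ ≤ C * jap (-s / 2) z) : IsSol hs hs1 Q v y := by
  obtain ⟨e1, e2⟩ := eq_of_weakD hs hs1 (x := rhs hs hs1 Q v y) h
    (fn_wt_rhs hQ hs hs1 hv₀ hv hy).symm y.1.continuous hC
  refine ⟨hy, Prod.ext ?_ ?_⟩
  · exact DFunLike.coe_injective e1.symm
  · exact ext_ae e2.symm

end

/-! Composition with reparametrisations. -/

/-- The bi-Lipschitz bound changes the weight by a factor of at most 2, and the Jacobian contributes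
another 2 after square roots. Taking the supremum over all centres makes the shift from `a` to `φ a`
harmless. -/
lemma Repar.wNorm_comp_le {φ : ℂ → ℂ} (hφ : Repar φ) (hs : 0 < s) (hs1 : s ≤ 1 / 4)
    (f : ℂ → Cn n) (a : ℂ) : wNorm (mw s a) (f ∘ φ) ≤ 4 * wNorm (mw s (φ a)) f := by
  rw [← ENNReal.pow_le_pow_left_iff two_ne_zero, mul_pow, wNorm_sq, wNorm_sq]
  calc ∫⁻ w, ENNReal.ofReal (‖(f ∘ φ) w‖ ^ 2 * mw s a w ^ 2)
      ≤ ∫⁻ w, 4 * ENNReal.ofReal (‖f (φ w)‖ ^ 2 * mw s (φ a) (φ w) ^ 2) := by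
        refine lintegral_mono fun w => ?_
        have e4 : (4 : ℝ≥0∞) = ENNReal.ofReal 4 := by simp
        rw [e4, ← ENNReal.ofReal_mul (by norm_num)]
        refine ENNReal.ofReal_le_ofReal ?_
        have h1 : mw s a w ≤ 2 * mw s (φ a) (φ w) := by
          unfold mw
          have h2 : ‖w - a‖ ^ (-s) ≤ 2 * ‖φ w - φ a‖ ^ (-s) := by
            -- At `w = a` both powers are `0 ^ (-s)`, which is 0 by convention.
            by_cases hw : w = a
            · simp [hw, Real.zero_rpow (neg_ne_zero.2 hs.ne')]
            have hp : 0 < ‖w - a‖ := norm_pos_iff.2 (sub_ne_zero.2 hw)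
            have hp' : 0 < ‖φ w - φ a‖ :=
              norm_pos_iff.2 (sub_ne_zero.2 fun h => hw (hφ.inj h))
            have h3 : (2 * ‖w - a‖) ^ (-s) ≤ ‖φ w - φ a‖ ^ (-s) :=
              Real.rpow_le_rpow_of_nonpos hp' (hφ.lip w a) (by linarith)
            rw [Real.mul_rpow (by norm_num) hp.le] at h3
            have h4 : (1 : ℝ) ≤ 2 * 2 ^ (-s) := by
              calc (1 : ℝ) = 2 * 2 ^ (-1 : ℝ) := by rw [Real.rpow_neg_one]; norm_num
                _ ≤ 2 * 2 ^ (-s) := by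
                  gcongr
                  · norm_num
                  · linarith
            calc ‖w - a‖ ^ (-s) ≤ 2 * 2 ^ (-s) * ‖w - a‖ ^ (-s) :=
                  le_mul_of_one_le_left (by positivity) h4
              _ ≤ _ := by rw [mul_assoc]; gcongr
          linarith
        have h5 := mw_pos s a w
        have h6 : mw s a w ^ 2 ≤ (2 * mw s (φ a) (φ w)) ^ 2 := by gcongr
        have := mul_le_mul_of_nonneg_left h6 (sq_nonneg ‖f (φ w)‖)
        rw [Function.comp_apply]
        linarith
    _ = 4 * ∫⁻ w, ENNReal.ofReal (‖f (φ w)‖ ^ 2 * mw s (φ a) (φ w) ^ 2) :=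
        lintegral_const_mul' _ _ (by simp)
    _ ≤ 4 * (4 * ∫⁻ w, ENNReal.ofReal (‖f w‖ ^ 2 * mw s (φ a) w ^ 2)) := by
        gcongr
        exact hφ.lintegral_comp_le fun w => ENNReal.ofReal (‖f w‖ ^ 2 * mw s (φ a) w ^ 2)
    _ = _ := by rw [← mul_assoc]; norm_num

lemma Repar.wNorm_comp_fn_le {φ : ℂ → ℂ} (hφ : Repar φ) (hs : 0 < s) (hs1 : s ≤ 1 / 4)
    (h : Morrey s n) (a : ℂ) : wNorm (mw s a) (h.fn ∘ φ) ≤ ENNReal.ofReal (4 * ‖h‖) := by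
  refine (hφ.wNorm_comp_le hs hs1 _ a).trans ?_
  rw [ENNReal.ofReal_mul (by norm_num)]
  have : ENNReal.ofReal 4 = 4 := by simp
  rw [this]
  gcongr
  exact h.wNorm_le _

namespace Morrey

/-- Composition with a reparametrisation. -/
noncomputable def comp {φ : ℂ → ℂ} (hφ : Repar φ) (hs : 0 < s) (hs1 : s ≤ 1 / 4)
    (h : Morrey s n) : Morrey s n :=
  ofFun (h.fn ∘ φ) (h.aesm.comp_quasiMeasurePreserving hφ.quasi) (4 * ‖h‖)
    (hφ.wNorm_comp_fn_le hs hs1 h)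

lemma fn_comp {φ : ℂ → ℂ} (hφ : Repar φ) (hs : 0 < s) (hs1 : s ≤ 1 / 4) (h : Morrey s n) :
    (comp hφ hs hs1 h).fn =ᵐ[volume] h.fn ∘ φ := fn_ofFun _ _ _

lemma norm_comp_le {φ : ℂ → ℂ} (hφ : Repar φ) (hs : 0 < s) (hs1 : s ≤ 1 / 4) (h : Morrey s n) :
    ‖comp hφ hs hs1 h‖ ≤ 4 * ‖h‖ := by
  refine norm_le (by positivity) fun a => ?_
  rw [wNorm_congr_ae (fn_comp hφ hs hs1 h)]
  exact hφ.wNorm_comp_fn_le hs hs1 h a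

end Morrey

end JLines

/-! ### Rescaling of lines, and lines through a prescribed point. -/

namespace JLines

variable {n : ℕ} {s : ℝ}

open BoundedContinuousFunction Morrey

lemma Repar.exists_jap_comp_le {φ : ℂ → ℂ} (hφ : Repar φ) (hs : 0 < s) :
    ∃ C : ℝ, 0 ≤ C ∧ ∀ z, jap (-s / 2) (φ z) ≤ C * jap (-s / 2) z := by
  set A : ℝ := 9 + 8 * ‖φ 0‖ ^ 2 with hA
  have hA0 : 0 < A := by positivity
  refine ⟨A ^ (s / 2), by positivity, fun z => ?_⟩
  have h1 : ‖z‖ ≤ 2 * (‖φ z‖ + ‖φ 0‖) := by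
    have := hφ.anti z 0
    rw [sub_zero] at this
    linarith [norm_sub_le (φ z) (φ 0)]
  have h2 : 1 + ‖z‖ ^ 2 ≤ A * (1 + ‖φ z‖ ^ 2) := by
    have h3 : ‖z‖ ^ 2 ≤ (2 * (‖φ z‖ + ‖φ 0‖)) ^ 2 := by gcongr
    have h4 : 0 ≤ ‖φ 0‖ ^ 2 * ‖φ z‖ ^ 2 := by positivity
    rw [hA]
    nlinarith [sq_nonneg (‖φ z‖ - ‖φ 0‖), sq_nonneg ‖φ z‖]
  have h3 : (A * (1 + ‖φ z‖ ^ 2)) ^ (-s / 2) ≤ jap (-s / 2) z :=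
    Real.rpow_le_rpow_of_nonpos (by positivity) h2 (by linarith)
  rw [Real.mul_rpow hA0.le (by positivity)] at h3
  calc jap (-s / 2) (φ z) = A ^ (s / 2) * (A ^ (-s / 2) * (1 + ‖φ z‖ ^ 2) ^ (-s / 2)) := by
        rw [← mul_assoc, ← Real.rpow_add hA0, show s / 2 + -s / 2 = 0 by ring, Real.rpow_zero,
          one_mul, jap]
    _ ≤ _ := by gcongr

lemma hasFDerivAt_const_mul (c z : ℂ) :
    HasFDerivAt (fun w : ℂ => c * w) (ContinuousLinearMap.mul ℝ ℂ c) z :=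
  (ContinuousLinearMap.mul ℝ ℂ c).hasFDerivAt

lemma repar_const_mul {c : ℝ} (h1 : 1 / 2 ≤ c) (h2 : c ≤ 2) : Repar fun w : ℂ => (c : ℂ) * w where
  smooth := contDiff_const.mul contDiff_id
  surj := fun w => ⟨(c : ℂ)⁻¹ * w, by
    have : (c : ℂ) ≠ 0 := by exact_mod_cast (by linarith : c ≠ 0)
    field_simp⟩
  lip := fun a b => by
    rw [← mul_sub, norm_mul, Complex.norm_real, Real.norm_of_nonneg (by linarith)]
    gcongr
  anti := fun a b => by
    rw [← mul_sub, norm_mul, Complex.norm_real, Real.norm_of_nonneg (by linarith), ← mul_assoc]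
    exact le_mul_of_one_le_left (norm_nonneg _) (by linarith)
  det := fun z => by
    have e : fderiv ℝ (fun w : ℂ => (c : ℂ) * w) z = c • ContinuousLinearMap.id ℝ ℂ := by
      rw [(hasFDerivAt_const_mul (c : ℂ) z).fderiv]
      ext
      simp
    rw [e, ContinuousLinearMap.det]
    have : ((c • ContinuousLinearMap.id ℝ ℂ : ℂ →L[ℝ] ℂ) : ℂ →ₗ[ℝ] ℂ) = c • LinearMap.id := rfl
    rw [this, LinearMap.det_smul, LinearMap.det_id, Complex.finrank_real_complex, mul_one,
      abs_of_nonneg (by positivity)]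
    nlinarith

lemma dz_const_mul (c z : ℂ) : dz (fun w : ℂ => c * w) z = c := by
  rw [dz, (hasFDerivAt_const_mul c z).fderiv]
  simp only [ContinuousLinearMap.mul_apply', smul_eq_mul]
  linear_combination (-(c / 2)) * Complex.I_sq

lemma dzb_const_mul (c z : ℂ) : dzb (fun w : ℂ => c * w) z = 0 := by
  rw [dzb, (hasFDerivAt_const_mul c z).fderiv]
  simp only [ContinuousLinearMap.mul_apply', smul_eq_mul]
  linear_combination (c / 2) * Complex.I_sq

section
variable {M : ℝ} {Q : Cn n → EndR n}

/-- The equation is invariant under `ζ ↦ cζ` for real `c`, with the direction and the derivative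
multiplied by `c`. The rescaled pair is a decaying solution for `cv₀`, hence the solution. -/
lemma IsSol.scale (hQ : Coeff s M Q) {hs : 0 < s} {hs1 : s ≤ 1 / 4}
    (hκ : kap n hs hs1 * M ≤ 1 / 64) {v₀ : Cn n} (hv₀ : ‖v₀‖ = 1) {c : ℝ} (h1 : 1 / 2 ≤ c)
    (h2 : c ≤ 3 / 2) {y y' : (ℂ →ᵇ Cn n) × Morrey s n} (H : IsSol hs hs1 Q v₀ y)
    (H' : IsSol hs hs1 Q (c • v₀) y') (ζ : ℂ) : y'.1 ζ = y.1 (c * ζ) := by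
  have hφ := repar_const_mul h1 (h2.trans (by norm_num))
  set φ : ℂ → ℂ := fun w => (c : ℂ) * w with hφd
  have hb : v₀ ∈ Metric.closedBall v₀ (1 / 2) := Metric.mem_closedBall_self (by norm_num)
  have hb' : c • v₀ ∈ Metric.closedBall v₀ (1 / 2) := by
    rw [mem_closedBall_iff_norm, show c • v₀ - v₀ = (c - 1) • v₀ by module, norm_smul, hv₀, mul_one,
      Real.norm_eq_abs, abs_le]
    constructor <;> linarith
  have hn := (H.norm_le' hQ hv₀ hb).trans hκ
  let φc : C(ℂ, ℂ) := ⟨φ, hφ.smooth.continuous⟩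
  let y'' : (ℂ →ᵇ Cn n) × Morrey s n := (y.1.compContinuous φc, c • Morrey.comp hφ hs hs1 y.2)
  have hy1 : ‖y.1‖ ≤ 1 / 64 := (norm_fst_le y).trans hn
  have hy2 : ‖y.2‖ ≤ 1 / 64 := (norm_snd_le y).trans hn
  have hn'' : ‖y''‖ ≤ 4 := by
    refine max_le ?_ ?_
    · refine (BoundedContinuousFunction.norm_le (by norm_num)).2 fun z => ?_
      exact (y.1.norm_coe_le_norm (φ z)).trans (by linarith)
    · change ‖c • Morrey.comp hφ hs hs1 y.2‖ ≤ 4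
      rw [norm_smul, Real.norm_of_nonneg (by linarith)]
      have := Morrey.norm_comp_le hφ hs hs1 y.2
      nlinarith [norm_nonneg (Morrey.comp hφ hs hs1 y.2)]
  have hfn : y''.2.fn =ᵐ[volume] fun z => c • y.2.fn (φ z) := by
    filter_upwards [fn_smul c (Morrey.comp hφ hs hs1 y.2), Morrey.fn_comp hφ hs hs1 y.2] with z e1 e2
    change (c • Morrey.comp hφ hs hs1 y.2).fn z = _
    rw [e1, Pi.smul_apply, e2]; rfl
  have hW := (H.weakD hQ hv₀ hb).comp hφ
  have hW' : WeakD y''.1 (crRhs Q (c • v₀) y'') y''.2.fn := by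
    refine WeakD.congr hW ?_ ?_
    · filter_upwards [hfn] with z e1
      rw [dz_const_mul, dzb_const_mul, zero_smul, zero_add, Complex.conj_ofReal, crRhs, crRhs, e1,
        ← smul_add, map_smul, smul_comm z c v₀]
      have e2 : φ z • v₀ = c • z • v₀ := by
        rw [hφd]; simp only []; rw [mul_smul, Complex.coe_smul]
      rw [e2, Complex.coe_smul]; rfl
    · filter_upwards [hfn] with z e1
      rw [dz_const_mul, dzb_const_mul, map_zero, zero_smul, add_zero, e1, Complex.coe_smul]
  obtain ⟨C, hC, hd⟩ := H.decay
  obtain ⟨C', hC', hd'⟩ := hφ.exists_jap_comp_le hs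
  have hS : IsSol hs hs1 Q (c • v₀) y'' := IsSol.of_weakD hQ hv₀ hb' hn'' hW' (C := C * C')
    fun z => (hd (φ z)).trans (by rw [mul_assoc]; exact mul_le_mul_of_nonneg_left (hd' z) hC)
  rw [H'.unique hQ hκ hv₀ hb' hS]
  rfl

/-- Auxiliary solutions are taken for all directions `w` near `p/‖p‖`, not only unit ones. This
gives the freedom to hit `p` at the fixed parameter `r`; the norm of `w` is corrected afterwards by
rescaling. -/
lemma exists_line_through (hQ : Coeff s M Q) {hs : 0 < s} {hs1 : s ≤ 1 / 4}
    (hκ : kap n hs hs1 * M ≤ 1 / 64) {Y : Cn n → (ℂ →ᵇ Cn n) × Morrey s n}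
    (hY : ∀ v, ‖v‖ = 1 → IsSol hs hs1 Q v (Y v)) {p : Cn n} (hp : 1 ≤ ‖p‖) :
    ∃ v, ‖v‖ = 1 ∧ ∃ ζ : ℂ, ζ • v + (Y v).1 ζ = p := by
  set r := ‖p‖ with hr
  have hr0 : 0 < r := by linarith
  set v₀ := r⁻¹ • p with hv₀d
  have hv₀ : ‖v₀‖ = 1 := by
    rw [hv₀d, norm_smul, norm_inv, norm_norm, inv_mul_cancel₀ hr0.ne']
  choose! Z hZ using fun w (hw : w ∈ Metric.closedBall v₀ (1 / 2)) =>
    exists_isSol hQ hs hs1 hκ hv₀ hw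
  have hri : r⁻¹ ≤ 1 := inv_le_one_of_one_le₀ hp
  have m1 : ∀ w ∈ Metric.closedBall v₀ (1 / 2),
      v₀ - r⁻¹ • (Z w).1 r ∈ Metric.closedBall v₀ (1 / 2) := by
    intro w hw
    have h1 := ((hZ w hw).norm_le' hQ hv₀ hw).trans hκ
    have h2 := ((Z w).1.norm_coe_le_norm r).trans ((norm_fst_le (Z w)).trans h1)
    rw [mem_closedBall_iff_norm, sub_sub_cancel_left, norm_neg, norm_smul, norm_inv, norm_norm]
    nlinarith [norm_nonneg ((Z w).1 r), inv_pos.2 hr0]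
  -- The map contracts because the solution has Lipschitz constant 1/2 in the direction and `r⁻¹ ≤
  -- 1`. It is here that `‖p‖ ≥ 1` is needed.
  have m2 : ∀ w ∈ Metric.closedBall v₀ (1 / 2), ∀ w' ∈ Metric.closedBall v₀ (1 / 2),
      ‖(v₀ - r⁻¹ • (Z w).1 r) - (v₀ - r⁻¹ • (Z w').1 r)‖ ≤ 1 / 2 * ‖w - w'‖ := by
    intro w hw w' hw'
    have h1 := (hZ w hw).norm_sub_le hQ hκ hv₀ hw hw' (hZ w' hw')
    have h2 : ‖(Z w').1 r - (Z w).1 r‖ ≤ ‖Z w - Z w'‖ := by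
      rw [norm_sub_rev]
      exact (((Z w).1 - (Z w').1).norm_coe_le_norm r).trans (norm_fst_le (Z w - Z w'))
    rw [sub_sub_sub_cancel_left, ← smul_sub, norm_smul, norm_inv, norm_norm]
    nlinarith [norm_nonneg ((Z w').1 r - (Z w).1 r), inv_pos.2 hr0]
  obtain ⟨w, hw, hfix⟩ := exists_fixedPoint_of_lipschitz (by norm_num) m1 m2
  have hw' := hw
  rw [mem_closedBall_iff_norm] at hw'
  have hc1 : 1 / 2 ≤ ‖w‖ := by
    have := norm_sub_norm_le v₀ w
    rw [norm_sub_rev] at this; linarith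
  have hc2 : ‖w‖ ≤ 3 / 2 := by linarith [norm_sub_norm_le w v₀]
  set c := ‖w‖ with hc
  have hc0 : c ≠ 0 := by linarith
  have hv : ‖c⁻¹ • w‖ = 1 := by
    rw [norm_smul, norm_inv, norm_norm, inv_mul_cancel₀ hc0]
  -- The parameter `cr` on the line of direction `w/c` corresponds to the parameter `r` on the line
  -- of direction `w`.
  refine ⟨c⁻¹ • w, hv, (c : ℂ) * r, ?_⟩
  have e1 : c • c⁻¹ • w = w := by rw [smul_smul, mul_inv_cancel₀ hc0, one_smul]
  have hsc := (hY _ hv).scale hQ hκ hv hc1 hc2 (y' := Z w) (by rw [e1]; exact hZ w hw) r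
  rw [← hsc, mul_comm, mul_smul, Complex.coe_smul c, e1, Complex.coe_smul]
  have e2 : r • v₀ = p := by rw [hv₀d, smul_smul, mul_inv_cancel₀ hr0.ne', one_smul]
  rw [← e2]
  nth_rewrite 1 [← hfix]
  rw [smul_sub, e2, smul_smul, mul_inv_cancel₀ hr0.ne', one_smul, sub_add_cancel]

end

end JLines

/-! ### Smoothness of superposition operators; local deformations of the plane. -/

namespace JLines

variable {n : ℕ} {s : ℝ}

open BoundedContinuousFunction Morrey

lemma toB_apply_of_hasCompactSupport {E : Type*} [NormedAddCommGroup E] {f : ℂ → E}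
    (hf : Continuous f) (hc : HasCompactSupport f) (z : ℂ) : toB f z = f z := by
  obtain ⟨C, hC⟩ := hf.bounded_above_of_compact_support hc
  exact toB_apply hf hC z

/-! Nemytskii operators. -/

section Nemytskii

variable {G : Type} [NormedAddCommGroup G] [NormedSpace ℝ G]

/-- The superposition operator `w ↦ ρ F(L + w)`. -/
noncomputable def nem (ρ : ℂ → ℝ) (L : ℂ → Cn n) (F : Cn n → G) (w : ℂ →ᵇ Cn n) : ℂ →ᵇ G :=
  toB fun ζ => ρ ζ • F (L ζ + w ζ)

variable {ρ : ℂ → ℝ} {L : ℂ → Cn n} {F : Cn n → G}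

lemma nem_apply (hρ : Continuous ρ) (hc : HasCompactSupport ρ) (hL : Continuous L)
    (hF : Continuous F) (w : ℂ →ᵇ Cn n) (ζ : ℂ) : nem ρ L F w ζ = ρ ζ • F (L ζ + w ζ) :=
  toB_apply_of_hasCompactSupport (by fun_prop) hc.smul_right ζ

/-- Pointwise application of operators. -/
noncomputable def appB (n : ℕ) (G : Type) [NormedAddCommGroup G] [NormedSpace ℝ G] :
    (ℂ →ᵇ (Cn n →L[ℝ] G)) →L[ℝ] (ℂ →ᵇ Cn n) →L[ℝ] (ℂ →ᵇ G) :=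
  have hb : ∀ (A : ℂ →ᵇ (Cn n →L[ℝ] G)) (w : ℂ →ᵇ Cn n) (z : ℂ), ‖A z (w z)‖ ≤ ‖A‖ * ‖w‖ :=
    fun A w z => ((A z).le_opNorm _).trans (mul_le_mul (A.norm_coe_le_norm z)
      (w.norm_coe_le_norm z) (norm_nonneg _) (norm_nonneg A))
  LinearMap.mkContinuous₂
    (LinearMap.mk₂ ℝ (fun A w => BoundedContinuousFunction.ofNormedAddCommGroup
        (fun z => A z (w z)) (A.continuous.clm_apply w.continuous) (‖A‖ * ‖w‖) (hb A w))
      (fun A A' w => by ext1 z; rfl) (fun c A w => by ext1 z; rfl)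
      (fun A w w' => by ext1 z; exact map_add (A z) _ _)
      (fun c A w => by ext1 z; exact map_smul (A z) _ _)) 1
    (fun A w => by
      rw [one_mul]
      exact BoundedContinuousFunction.norm_ofNormedAddCommGroup_le _ (by positivity) (hb A w))

lemma appB_apply (A : ℂ →ᵇ (Cn n →L[ℝ] G)) (w : ℂ →ᵇ Cn n) (z : ℂ) :
    appB n G A w z = A z (w z) := rfl

lemma contDiff_appB (G : Type) [NormedAddCommGroup G] [NormedSpace ℝ G] (m : ℕ) :
    ContDiff ℝ m (appB n G) := ContinuousLinearMap.contDiff _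

/-- The compact support of `ρ` confines the arguments of `F` to a fixed ball, where the second
derivative is bounded. The Taylor remainder is therefore `O(‖δ‖²)` in the supremum norm. -/
lemma hasFDerivAt_nem (hρ : Continuous ρ) (hc : HasCompactSupport ρ) (hL : Continuous L)
    (hF : ContDiff ℝ ∞ F) (w : ℂ →ᵇ Cn n) :
    HasFDerivAt (nem ρ L F) (appB n G (nem ρ L (fderiv ℝ F) w)) w := by
  have hF' : ContDiff ℝ ∞ (fderiv ℝ F) := hF.fderiv_right (by norm_cast)
  obtain ⟨B, hB⟩ := hρ.bounded_above_of_compact_support hc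
  obtain ⟨R, hR⟩ := (hc.isCompact.image hL).isBounded.subset_closedBall 0
  have hLR : ∀ ζ, ρ ζ ≠ 0 → ‖L ζ‖ ≤ R := fun ζ h => by
    simpa using hR (mem_image_of_mem L (subset_tsupport _ h))
  set R' := R + ‖w‖ + 1
  obtain ⟨C, hC⟩ := (isCompact_closedBall (0 : Cn n) R').exists_bound_of_continuousOn
    ((hF'.continuous_fderiv (by simp)).continuousOn)
  have hB0 : 0 ≤ B := (norm_nonneg _).trans (hB 0)
  have key : ∀ δ : ℂ →ᵇ Cn n, ‖δ‖ ≤ 1 →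
      ‖nem ρ L F (w + δ) - nem ρ L F w - appB n G (nem ρ L (fderiv ℝ F) w) δ‖ ≤
        B * |C| * ‖δ‖ ^ 2 := by
    intro δ hδ
    refine (BoundedContinuousFunction.norm_le (by positivity)).2 fun ζ => ?_
    rw [BoundedContinuousFunction.sub_apply, BoundedContinuousFunction.sub_apply, appB_apply,
      nem_apply hρ hc hL hF.continuous, nem_apply hρ hc hL hF.continuous,
      nem_apply hρ hc hL hF'.continuous, BoundedContinuousFunction.add_apply]
    by_cases h0 : ρ ζ = 0
    · simp only [h0, zero_smul, sub_self, _root_.zero_apply, norm_zero]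
      positivity
    have e : ρ ζ • F (L ζ + (w ζ + δ ζ)) - ρ ζ • F (L ζ + w ζ) -
        (ρ ζ • fderiv ℝ F (L ζ + w ζ)) (δ ζ) =
        ρ ζ • (F (L ζ + w ζ + δ ζ) - F (L ζ + w ζ) - fderiv ℝ F (L ζ + w ζ) (δ ζ)) := by
      rw [_root_.smul_apply, smul_sub, smul_sub, add_assoc]
    have hwζ := w.norm_coe_le_norm ζ
    have hδζ := δ.norm_coe_le_norm ζ
    set x := L ζ + w ζ with hx
    have hxn : ‖x‖ ≤ R + ‖w‖ := (norm_add_le _ _).trans (add_le_add (hLR ζ h0) hwζ)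
    have hsub : Metric.closedBall x ‖δ ζ‖ ⊆ Metric.closedBall (0 : Cn n) R' := by
      refine Metric.closedBall_subset_closedBall' ?_
      rw [dist_zero_right]
      have : R' = R + ‖w‖ + 1 := rfl
      linarith
    have hfd : ∀ y ∈ Metric.closedBall x ‖δ ζ‖, ‖fderiv ℝ F y - fderiv ℝ F x‖ ≤ |C| * ‖δ ζ‖ := by
      intro y hy
      refine ((convex_closedBall x ‖δ ζ‖).norm_image_sub_le_of_norm_fderiv_le
        (fun z _ => hF'.differentiable (by simp) z)
        (fun z hz => (hC z (hsub hz)).trans (le_abs_self C))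
        (Metric.mem_closedBall_self (norm_nonneg _)) hy).trans ?_
      gcongr
      exact mem_closedBall_iff_norm.1 hy
    have h1 := (convex_closedBall x ‖δ ζ‖).norm_image_sub_le_of_norm_fderiv_le'
      (fun z _ => hF.differentiable (by simp) z) hfd
      (Metric.mem_closedBall_self (norm_nonneg _)) (y := x + δ ζ) (by simp)
    rw [add_sub_cancel_left] at h1
    rw [e, norm_smul]
    calc ‖ρ ζ‖ * _ ≤ B * (|C| * ‖δ ζ‖ * ‖δ ζ‖) := by
          gcongr
          exact hB ζ
      _ ≤ B * (|C| * ‖δ‖ * ‖δ‖) := by gcongr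
      _ = _ := by ring
  rw [hasFDerivAt_iff_isLittleO_nhds_zero]
  refine Asymptotics.IsBigO.trans_isLittleO (g := fun δ : ℂ →ᵇ Cn n => ‖δ‖ ^ 2) ?_ ?_
  · refine Asymptotics.IsBigO.of_bound (B * |C|) ?_
    filter_upwards [Metric.closedBall_mem_nhds (0 : ℂ →ᵇ Cn n) one_pos] with δ hδ
    rw [norm_pow, norm_norm]
    exact key δ (by simpa using hδ)
  · exact (Asymptotics.isLittleO_norm_pow_id one_lt_two)

end Nemytskii

/-- The derivative is again a superposition operator, built from `fderiv ℝ F`, followed by the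
bilinear map `appB`. The induction must therefore range over all target spaces. -/
lemma contDiff_nat_nem {ρ : ℂ → ℝ} {L : ℂ → Cn n} (hρ : Continuous ρ) (hc : HasCompactSupport ρ)
    (hL : Continuous L) (m : ℕ) : ∀ (G : Type) [NormedAddCommGroup G] [NormedSpace ℝ G]
    (F : Cn n → G), ContDiff ℝ ∞ F → ContDiff ℝ m (nem ρ L F) := by
  induction m with
  | zero =>
    intro G _ _ F hF
    exact contDiff_zero.2 (continuous_iff_continuousAt.2 fun w =>
      (hasFDerivAt_nem hρ hc hL hF w).continuousAt)
  | succ m ih =>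
    intro G _ _ F hF
    have hF' : ContDiff ℝ ∞ (fderiv ℝ F) := hF.fderiv_right (by norm_cast)
    refine contDiff_succ_iff_hasFDerivAt.2 ⟨_, ?_, hasFDerivAt_nem hρ hc hL hF⟩
    exact (contDiff_appB G m).comp (ih _ _ hF')

lemma contDiff_nem {ρ : ℂ → ℝ} {L : ℂ → Cn n} (hρ : Continuous ρ) (hc : HasCompactSupport ρ)
    (hL : Continuous L) {F : Cn n → EndR n} (hF : ContDiff ℝ ∞ F) : ContDiff ℝ ∞ (nem ρ L F) :=
  contDiff_infty.2 fun m => contDiff_nat_nem hρ hc hL m _ F hF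

/-- Multiplication by a complex number, as a matrix. -/
noncomputable def mulC (n : ℕ) : ℂ →L[ℝ] EndR n := ContinuousLinearMap.lsmul ℝ ℂ

lemma mulC_apply (c : ℂ) (x : Cn n) : mulC n c x = c • x := rfl

/-- The family `t ↦ t c(ζ)` of matrix-valued functions. -/
noncomputable def opB (n : ℕ) (c : ℂ → ℂ) (hc : Continuous c) (hcs : HasCompactSupport c) :
    ℂ →L[ℝ] (ℂ →ᵇ EndR n) :=
  have hcont : ∀ t, Continuous fun ζ => mulC n (t * c ζ) := fun t =>
    (mulC n).continuous.comp (continuous_const.mul hc)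
  have hcomp : ∀ t, HasCompactSupport fun ζ => mulC n (t * c ζ) := fun t =>
    (hcs.mul_left (f := fun _ => t)).comp_left (g := mulC n) (map_zero _)
  LinearMap.toContinuousLinearMap
    { toFun := fun t => toB fun ζ => mulC n (t * c ζ)
      map_add' := fun t t' => by
        ext1 ζ
        rw [BoundedContinuousFunction.add_apply,
          toB_apply_of_hasCompactSupport (hcont _) (hcomp _),
          toB_apply_of_hasCompactSupport (hcont _) (hcomp _),
          toB_apply_of_hasCompactSupport (hcont _) (hcomp _), add_mul, map_add]
      map_smul' := fun r t => by
        ext1 ζ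
        rw [RingHom.id_apply, BoundedContinuousFunction.smul_apply,
          toB_apply_of_hasCompactSupport (hcont _) (hcomp _),
          toB_apply_of_hasCompactSupport (hcont _) (hcomp _), smul_mul_assoc, map_smul] }

lemma opB_apply {c : ℂ → ℂ} (hc : Continuous c) (hcs : HasCompactSupport c) (t ζ : ℂ) (x : Cn n) :
    opB n c hc hcs t ζ x = (t * c ζ) • x := by
  have : opB n c hc hcs t ζ = mulC n (t * c ζ) :=
    toB_apply_of_hasCompactSupport ((mulC n).continuous.comp (continuous_const.mul hc))
      ((hcs.mul_left (f := fun _ => t)).comp_left (g := mulC n) (map_zero _)) ζ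
  rw [this, mulC_apply]

/-! Local reparametrisations. -/

lemma det_clm_complex (A : ℂ →L[ℝ] ℂ) :
    A.det = (A 1).re * (A Complex.I).im - (A Complex.I).re * (A 1).im := by
  rw [ContinuousLinearMap.det, ← LinearMap.det_toMatrix Complex.basisOneI, Matrix.det_fin_two]
  simp [LinearMap.toMatrix_apply]

/-- For small `t` the perturbation `tχ` has Lipschitz constant at most 1/4: a contraction gives
surjectivity, and the bi-Lipschitz and Jacobian bounds are perturbations of those of the identity.
The parameter `t` is complex, so that it moves `ζ₀` in every direction. -/
lemma exists_repar_bump {χ : ℂ → ℂ} (hχ : ContDiff ℝ ∞ χ) (hc : HasCompactSupport χ) :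
    ∃ t₀ : ℝ, 0 < t₀ ∧ ∀ t : ℂ, ‖t‖ ≤ t₀ → Repar fun ζ => ζ + t * χ ζ := by
  have hd : Differentiable ℝ χ := hχ.differentiable (by simp)
  obtain ⟨C, hC⟩ := (hχ.continuous_fderiv (by simp)).bounded_above_of_compact_support
    (hc.fderiv (𝕜 := ℝ))
  have hC0 : 0 ≤ C := (norm_nonneg _).trans (hC 0)
  have hLip : ∀ a b, ‖χ a - χ b‖ ≤ C * ‖a - b‖ := fun a b =>
    convex_univ.norm_image_sub_le_of_norm_fderiv_le (fun x _ => hd x) (fun x _ => hC x)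
      (mem_univ b) (mem_univ a)
  refine ⟨1 / (4 * (C + 1)), by positivity, fun t ht => ?_⟩
  have htC : ‖t‖ * C ≤ 1 / 4 := by
    calc ‖t‖ * C ≤ 1 / (4 * (C + 1)) * C := by gcongr
      _ ≤ 1 / 4 := by rw [div_mul_eq_mul_div, div_le_div_iff₀ (by positivity) (by norm_num)]; linarith
  have hL2 : ∀ a b, ‖t * χ a - t * χ b‖ ≤ 1 / 4 * ‖a - b‖ := fun a b => by
    rw [← mul_sub, norm_mul]
    calc _ ≤ ‖t‖ * (C * ‖a - b‖) := by gcongr; exact hLip a b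
      _ ≤ _ := by rw [← mul_assoc]; gcongr
  have hsub : ∀ a b : ℂ, (a + t * χ a) - (b + t * χ b) = (a - b) + (t * χ a - t * χ b) := by
    intros; ring
  refine ⟨contDiff_id.add (contDiff_const.mul hχ), fun w => ?_, fun a b => ?_, fun a b => ?_,
    fun z => ?_⟩
  · have hcw : ContractingWith (1 / 4) fun z => w - t * χ z := by
      refine ⟨by norm_num, LipschitzWith.of_dist_le_mul fun x y => ?_⟩
      rw [dist_eq_norm, dist_eq_norm, sub_sub_sub_cancel_left, norm_sub_rev]
      simpa using hL2 x y
    refine ⟨hcw.fixedPoint, ?_⟩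
    have := hcw.fixedPoint_isFixedPt
    have h2 : w - t * χ hcw.fixedPoint = hcw.fixedPoint := this
    linear_combination -h2
  · rw [hsub]
    have := norm_add_le (a - b) (t * χ a - t * χ b)
    linarith [hL2 a b, norm_nonneg (a - b)]
  · rw [hsub]
    have := norm_sub_le ((a - b) + (t * χ a - t * χ b)) (t * χ a - t * χ b)
    rw [add_sub_cancel_right] at this
    linarith [hL2 a b, norm_nonneg (a - b)]
  · have hf : HasFDerivAt (fun ζ => ζ + t * χ ζ)
        (ContinuousLinearMap.id ℝ ℂ + t • fderiv ℝ χ z) z :=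
      (hasFDerivAt_id z).add ((hd z).hasFDerivAt.const_mul t)
    rw [hf.fderiv, det_clm_complex]
    have hb : ∀ x : ℂ, ‖x‖ = 1 → ‖t * fderiv ℝ χ z x‖ ≤ 1 / 4 := fun x hx => by
      rw [norm_mul]
      have := (fderiv ℝ χ z).le_opNorm x
      rw [hx, mul_one] at this
      calc _ ≤ ‖t‖ * C := by gcongr; exact this.trans (hC z)
        _ ≤ _ := htC
    have h1 := hb 1 norm_one
    have h2 := hb Complex.I Complex.norm_I
    set p := t * fderiv ℝ χ z 1
    set q := t * fderiv ℝ χ z Complex.I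
    have e1 : (ContinuousLinearMap.id ℝ ℂ + t • fderiv ℝ χ z) 1 = 1 + p := rfl
    have e2 : (ContinuousLinearMap.id ℝ ℂ + t • fderiv ℝ χ z) Complex.I = Complex.I + q := rfl
    rw [e1, e2]
    have p1 := abs_le.1 ((Complex.abs_re_le_norm p).trans h1)
    have p2 := abs_le.1 ((Complex.abs_im_le_norm p).trans h1)
    have q1 := abs_le.1 ((Complex.abs_re_le_norm q).trans h2)
    have q2 := abs_le.1 ((Complex.abs_im_le_norm q).trans h2)
    simp only [Complex.add_re, Complex.add_im, Complex.one_re, Complex.one_im, Complex.I_re,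
      Complex.I_im, zero_add]
    refine le_trans ?_ (le_abs_self _)
    nlinarith [p1.1, p1.2, p2.1, p2.2, q1.1, q1.2, q2.1, q2.2,
      mul_nonneg (sub_nonneg.2 p1.2) (sub_nonneg.2 q2.2)]

end JLines

/-! ### Smooth dependence of fixed points, and the equation for increments. -/

namespace JLines

variable {n : ℕ} {s : ℝ}

open BoundedContinuousFunction Morrey

/-- Smooth dependence of the fixed points of a smooth family of contractions. -/
lemma contDiffAt_of_fixedPoint {T X : Type*} [NormedAddCommGroup T] [NormedSpace ℝ T]
    [CompleteSpace T] [NormedAddCommGroup X] [NormedSpace ℝ X] [CompleteSpace X]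
    {Ψ : T × X → X} (hΨ : ContDiff ℝ ∞ Ψ) (h0 : Ψ (0, 0) = 0)
    (hlip : ∀ᶠ t in 𝓝 (0 : T), ∀ y ∈ Metric.closedBall (0 : X) 1, ∀ y' ∈ Metric.closedBall (0 : X) 1,
      ‖Ψ (t, y) - Ψ (t, y')‖ ≤ 1 / 2 * ‖y - y'‖)
    {x : T → X} (hx : ∀ᶠ t in 𝓝 (0 : T), x t ∈ Metric.closedBall (0 : X) 1 ∧ Ψ (t, x t) = x t) :
    ContDiffAt ℝ ∞ x 0 := by
  set f : T × X → X := fun p => p.2 - Ψ p with hf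
  have cdf : ContDiffAt ℝ ∞ f 0 := (contDiff_snd.sub hΨ).contDiffAt
  have f0 : f 0 = 0 := by
    show (0 : X) - Ψ (0, 0) = 0
    rw [h0, sub_zero]
  have hdΨ : DifferentiableAt ℝ Ψ 0 := hΨ.differentiable (by simp) 0
  -- The contraction constant bounds the partial derivative, so `1 - ∂Ψ/∂y` is invertible by a
  -- Neumann series and the implicit function theorem applies.
  have hD : ‖fderiv ℝ Ψ 0 ∘L .inr ℝ T X‖ ≤ 1 / 2 := by
    have hd : HasFDerivAt (fun y : X => Ψ (0, y)) (fderiv ℝ Ψ 0 ∘L .inr ℝ T X) 0 :=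
      hdΨ.hasFDerivAt.comp (0 : X) (hasFDerivAt_prodMk_right (0 : T) (0 : X))
    refine hd.le_of_lip' (by norm_num) ?_
    filter_upwards [Metric.closedBall_mem_nhds (0 : X) one_pos] with y hy
    exact hlip.self_of_nhds y hy 0 (Metric.mem_closedBall_self zero_le_one)
  have e : fderiv ℝ f 0 ∘L .inr ℝ T X = 1 - fderiv ℝ Ψ 0 ∘L .inr ℝ T X := by
    rw [show fderiv ℝ f 0 = .snd ℝ T X - fderiv ℝ Ψ 0 from (hasFDerivAt_snd.sub hdΨ.hasFDerivAt).fderiv,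
      ContinuousLinearMap.sub_comp]
    rfl
  have if₂ : (fderiv ℝ f 0 ∘L .inr ℝ T X).IsInvertible := by
    rw [e]
    have hu : IsUnit (1 - fderiv ℝ Ψ 0 ∘L .inr ℝ T X : X →L[ℝ] X) :=
      isUnit_one_sub_of_norm_lt_one (hD.trans_lt (by norm_num))
    obtain ⟨u, hu⟩ := hu
    exact ⟨ContinuousLinearEquiv.ofUnit u, hu⟩
  have pn : (∞ : ℕ∞ω) ≠ 0 := by simp
  have hψ := cdf.contDiffAt_implicitFunction pn if₂
  have hψ0 : cdf.implicitFunction pn if₂ 0 = 0 := cdf.implicitFunction_apply_self pn if₂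
  refine hψ.congr_of_eventuallyEq ?_
  have hball : ∀ᶠ t in 𝓝 (0 : T), cdf.implicitFunction pn if₂ t ∈ Metric.closedBall (0 : X) 1 := by
    refine hψ.continuousAt ?_
    show Metric.closedBall (0 : X) 1 ∈ 𝓝 (cdf.implicitFunction pn if₂ 0)
    rw [hψ0]
    exact Metric.closedBall_mem_nhds _ one_pos
  -- Both the implicit function and `x` are fixed points in the unit ball, so the contraction
  -- identifies them. No continuity of `x` is presupposed.
  filter_upwards [hlip, hx, hball, cdf.eventually_apply_implicitFunction pn if₂] with t h1 h2 h3 h4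
  rw [f0] at h4
  exact eq_of_fixedPoint_of_lipschitz (f := fun y => Ψ (t, y)) h2.2 (sub_eq_zero.1 h4).symm
    (h1 _ h2.1 _ h3)

section
variable (hs : 0 < s) (hs1 : s ≤ 1 / 4)

lemma norm_mul_sub_mul_le {b b' : ℂ →ᵇ EndR n} {x x' : Morrey s n} {K Z d : ℝ} (hb : ‖b‖ ≤ K)
    (hb' : ‖b'‖ ≤ K) (hbb : ‖b - b'‖ ≤ K * d) (hx : ‖x‖ ≤ Z) (hxx : ‖x - x'‖ ≤ Z * d) :
    ‖Morrey.mul b x - Morrey.mul b' x'‖ ≤ 2 * K * Z * d := by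
  have e : Morrey.mul b x - Morrey.mul b' x' = Morrey.mul (b - b') x + Morrey.mul b' (x - x') := by
    rw [map_sub, show Morrey.mul (b - b') x = Morrey.mul b x - Morrey.mul b' x from
      Morrey.sub_mul _ _ _]
    abel
  have hK : 0 ≤ K := (norm_nonneg b).trans hb
  have hZ : 0 ≤ Z := (norm_nonneg _).trans hx
  rw [e]
  calc _ ≤ ‖b - b'‖ * ‖x‖ + ‖b'‖ * ‖x - x'‖ :=
        (norm_add_le _ _).trans (add_le_add (norm_mul_le _ _) (norm_mul_le _ _))
    _ ≤ K * d * Z + K * (Z * d) := by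
        gcongr
        exact (norm_nonneg (b - b')).trans hbb
    _ = _ := by ring

/-- The increment `v + h + k`, with its weight. -/
noncomputable def incr (v : Cn n) (h : Morrey s n) (q : ℂ × (ℂ →ᵇ Cn n) × Morrey s n) :
    Morrey s n := affL n hs hs1 (v, h + q.2.2)

/-- The fixed point map satisfied by the increments of a solution under reparametrisation. -/
noncomputable def psi (Nω N : (ℂ →ᵇ Cn n) → (ℂ →ᵇ EndR n))
    (E₁ E₂ E₃ E₄ : ℂ →L[ℝ] (ℂ →ᵇ EndR n)) (v : Cn n) (h : Morrey s n)
    (q : ℂ × (ℂ →ᵇ Cn n) × Morrey s n) : (ℂ →ᵇ Cn n) × Morrey s n :=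
  solL n hs hs1 (mulB s n (E₁ q.1) (incr hs hs1 v h q) + mulB s n (Nω q.2.1) (incr hs hs1 v h q) +
      mulB s n (N q.2.1) (mulB s n (E₂ q.1) (incr hs hs1 v h q)) -
      mulB s n (Nω 0) (incr hs hs1 v h 0)) -
    (0, mulB s n (E₃ q.1) (incr hs hs1 v h q) +
      mulB s n (N q.2.1) (mulB s n (E₄ q.1) (incr hs hs1 v h q)))

lemma psi_zero (Nω N : (ℂ →ᵇ Cn n) → (ℂ →ᵇ EndR n))
    (E₁ E₂ E₃ E₄ : ℂ →L[ℝ] (ℂ →ᵇ EndR n)) (v : Cn n) (h : Morrey s n) :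
    psi hs hs1 Nω N E₁ E₂ E₃ E₄ v h (0, 0) = 0 := by
  have e : ((0 : ℂ), (0 : (ℂ →ᵇ Cn n) × Morrey s n)) = 0 := rfl
  have hE : ∀ (E : ℂ →L[ℝ] (ℂ →ᵇ EndR n)) (x : Morrey s n), mulB s n (E 0) x = 0 := fun E x => by
    have h1 : E 0 = 0 := E.map_zero
    rw [h1, (mulB s n).map_zero]; rfl
  have e1 : ((0 : ℂ × (ℂ →ᵇ Cn n) × Morrey s n)).1 = 0 := rfl
  have e2 : ((0 : ℂ × (ℂ →ᵇ Cn n) × Morrey s n)).2.1 = 0 := rfl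
  rw [psi, e, e1, e2, hE, hE, hE, hE, map_zero, zero_add, add_zero, sub_self, map_zero,
    add_zero, sub_eq_zero]
  rfl

lemma contDiff_mulB {T : Type*} [NormedAddCommGroup T] [NormedSpace ℝ T] {b : T → (ℂ →ᵇ EndR n)}
    {x : T → Morrey s n} (hb : ContDiff ℝ ∞ b) (hx : ContDiff ℝ ∞ x) :
    ContDiff ℝ ∞ fun q => mulB s n (b q) (x q) :=
  have h : ContDiff ℝ ∞ (mulB s n) := ContinuousLinearMap.contDiff _
  ContDiff.clm_apply (h.comp hb) hx

lemma contDiff_incr (v : Cn n) (h : Morrey s n) : ContDiff ℝ ∞ (incr hs hs1 v h) :=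
  (affL n hs hs1).contDiff.comp (contDiff_const.prodMk
    (contDiff_const.add (contDiff_snd.comp contDiff_snd)))

lemma contDiff_psi {Nω N : (ℂ →ᵇ Cn n) → (ℂ →ᵇ EndR n)} (hNω : ContDiff ℝ ∞ Nω)
    (hN : ContDiff ℝ ∞ N) (E₁ E₂ E₃ E₄ : ℂ →L[ℝ] (ℂ →ᵇ EndR n)) (v : Cn n) (h : Morrey s n) :
    ContDiff ℝ ∞ (psi hs hs1 Nω N E₁ E₂ E₃ E₄ v h) := by
  have hi := contDiff_incr hs hs1 v h
  have hE : ∀ E : ℂ →L[ℝ] (ℂ →ᵇ EndR n),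
      ContDiff ℝ ∞ fun q : ℂ × (ℂ →ᵇ Cn n) × Morrey s n => E q.1 :=
    fun E => by
      have h : ContDiff ℝ ∞ E := ContinuousLinearMap.contDiff _
      exact h.comp contDiff_fst
  have hp : ContDiff ℝ ∞ fun q : ℂ × (ℂ →ᵇ Cn n) × Morrey s n => q.2.1 :=
    contDiff_fst.comp contDiff_snd
  refine ContDiff.sub ((solL n hs hs1).contDiff.comp (((ContDiff.add ?_ ?_).add ?_).sub
    contDiff_const)) (contDiff_const.prodMk (ContDiff.add ?_ ?_))
  · exact contDiff_mulB (hE E₁) hi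
  · exact contDiff_mulB (hNω.comp hp) hi
  · exact contDiff_mulB (hN.comp hp) (contDiff_mulB (hE E₂) hi)
  · exact contDiff_mulB (hE E₃) hi
  · exact contDiff_mulB (hN.comp hp) (contDiff_mulB (hE E₄) hi)

lemma norm_bcf_sub_self {G : Type*} [NormedAddCommGroup G] (b : ℂ →ᵇ G) : ‖b - b‖ = 0 := by
  rw [sub_self, norm_zero]

lemma exists_bound_clm {G : Type*} [NormedAddCommGroup G] [NormedSpace ℝ G]
    (E : ℂ →L[ℝ] (ℂ →ᵇ G)) : ∃ c : ℝ, 0 ≤ c ∧ ∀ t, ‖E t‖ ≤ c * ‖t‖ := ⟨‖E‖, norm_nonneg _, E.le_opNorm⟩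

lemma map_sub_prod_sub {U V W : Type*} [AddCommGroup U] [AddCommGroup V] [AddCommGroup W]
    (S : U →+ V × W) (a a' : U) (b b' : W) :
    (S a - (0, b)) - (S a' - (0, b')) = S (a - a') - (0, b - b') := by
  rw [sub_sub_sub_comm, ← map_sub, show ((0, b) : V × W) - (0, b') = (0, b - b') by
    rw [Prod.mk_sub_mk, sub_zero]]

/-- Every term containing some `Eᵢ t` is `O(|t|)` and contributes at most 1/4 near `t = 0`. The only
term left at `t = 0` is the weighted one, whose constant is at most 1/4 by smallness of the
coefficient. -/
lemma psi_lipschitz {Nω N : (ℂ →ᵇ Cn n) → (ℂ →ᵇ EndR n)} {K : ℝ}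
    (hNω : ∀ w : ℂ →ᵇ Cn n, ‖w‖ ≤ 1 → ‖Nω w‖ ≤ K)
    (hNω' : ∀ w w' : ℂ →ᵇ Cn n, ‖w‖ ≤ 1 → ‖w'‖ ≤ 1 → ‖Nω w - Nω w'‖ ≤ K * ‖w - w'‖)
    (hN : ∀ w : ℂ →ᵇ Cn n, ‖w‖ ≤ 1 → ‖N w‖ ≤ K)
    (hN' : ∀ w w' : ℂ →ᵇ Cn n, ‖w‖ ≤ 1 → ‖w'‖ ≤ 1 → ‖N w - N w'‖ ≤ K * ‖w - w'‖)
    (hK : 4 * ‖solL n hs hs1‖ * K * ‖affL n hs hs1‖ ≤ 1 / 4)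
    (E₁ E₂ E₃ E₄ : ℂ →L[ℝ] (ℂ →ᵇ EndR n)) {v : Cn n} (hv : ‖v‖ ≤ 2) {h : Morrey s n}
    (hh : ‖h‖ ≤ 1) :
    ∀ᶠ t in 𝓝 (0 : ℂ), ∀ y ∈ Metric.closedBall (0 : (ℂ →ᵇ Cn n) × Morrey s n) 1,
      ∀ y' ∈ Metric.closedBall (0 : (ℂ →ᵇ Cn n) × Morrey s n) 1,
      ‖psi hs hs1 Nω N E₁ E₂ E₃ E₄ v h (t, y) - psi hs hs1 Nω N E₁ E₂ E₃ E₄ v h (t, y')‖ ≤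
        1 / 2 * ‖y - y'‖ := by
  set S := ‖solL n hs hs1‖ with hS
  set A := ‖affL n hs hs1‖ with hA
  have hS0 : 0 ≤ S := norm_nonneg (solL n hs hs1)
  have hA0 : 0 ≤ A := norm_nonneg (affL n hs hs1)
  have hK0 : 0 ≤ K := (norm_nonneg (N 0)).trans (hN 0 (by simp))
  obtain ⟨c₁, c₁0, h₁⟩ := exists_bound_clm E₁
  obtain ⟨c₂, c₂0, h₂⟩ := exists_bound_clm E₂
  obtain ⟨c₃, c₃0, h₃⟩ := exists_bound_clm E₃
  obtain ⟨c₄, c₄0, h₄⟩ := exists_bound_clm E₄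
  set C : ℝ := S * (4 * c₁ * A + 8 * K * c₂ * A) + (4 * c₃ * A + 8 * K * c₄ * A) with hC
  have hC0 : 0 ≤ C := by positivity
  have hev : ∀ᶠ t in 𝓝 (0 : ℂ), C * ‖t‖ < 1 / 4 := by
    have : Tendsto (fun t : ℂ => C * ‖t‖) (𝓝 0) (𝓝 0) := by
      have h : Continuous fun t : ℂ => C * ‖t‖ := by fun_prop
      simpa using h.tendsto 0
    exact this.eventually_lt_const (by norm_num)
  filter_upwards [hev] with t ht y hy y' hy'
  rw [mem_closedBall_zero_iff] at hy hy'
  have y1 := (norm_fst_le y).trans hy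
  have y2 := (norm_snd_le y).trans hy
  have y1' := (norm_fst_le y').trans hy'
  set d := ‖y - y'‖ with hd
  have d0 : 0 ≤ d := norm_nonneg _
  have d1 : ‖y.1 - y'.1‖ ≤ d := norm_fst_le (y - y')
  have d2 : ‖y.2 - y'.2‖ ≤ d := norm_snd_le (y - y')
  set z := incr hs hs1 v h (t, y) with hz
  set z' := incr hs hs1 v h (t, y') with hz'
  have zn : ‖z‖ ≤ 2 * A := by
    have := norm_affL_le hs hs1 hv (h := h + y.2) ((norm_add_le _ _).trans (by linarith : _ ≤ (2 : ℝ)))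
    rw [mul_comm]; exact this
  have zd : ‖z - z'‖ ≤ 2 * A * d := by
    have e : z - z' = affL n hs hs1 (0, y.2 - y'.2) := by
      rw [hz, hz', incr, incr, ← map_sub, Prod.mk_sub_mk, sub_self, add_sub_add_left_eq_sub]
    rw [e]
    have := norm_affL_le hs hs1 (v := (0 : Cn n)) (by simpa using d0) d2
    refine this.trans ?_
    nlinarith [mul_nonneg hA0 d0]
  have hE : ∀ (E : ℂ →L[ℝ] (ℂ →ᵇ EndR n)) (c : ℝ), 0 ≤ c → (∀ t, ‖E t‖ ≤ c * ‖t‖) →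
      ‖mulB s n (E t) z‖ ≤ 2 * c * ‖t‖ * (2 * A) ∧
      ‖mulB s n (E t) z - mulB s n (E t) z'‖ ≤ 2 * c * ‖t‖ * (2 * A) * d := by
    intro E c hc0 hc
    have hEt := hc t
    refine ⟨(norm_mul_le _ _).trans ?_, ?_⟩
    · have : ‖E t‖ * ‖z‖ ≤ c * ‖t‖ * (2 * A) := by gcongr
      refine this.trans ?_
      have : 0 ≤ c * ‖t‖ * (2 * A) := by positivity
      linarith
    · have := norm_mul_sub_mul_le hEt hEt
        ((norm_bcf_sub_self (E t)).le.trans (by positivity)) zn zd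
      refine this.trans (le_of_eq (by ring))
  have hG : ∀ (E : ℂ →L[ℝ] (ℂ →ᵇ EndR n)) (c : ℝ), 0 ≤ c → (∀ t, ‖E t‖ ≤ c * ‖t‖) →
      ‖mulB s n (N y.1) (mulB s n (E t) z) -
      mulB s n (N y'.1) (mulB s n (E t) z')‖ ≤ 2 * K * (2 * c * ‖t‖ * (2 * A)) * d := fun E c hc0 hc =>
    norm_mul_sub_mul_le (hN _ y1) (hN _ y1')
      ((hN' _ _ y1 y1').trans (mul_le_mul_of_nonneg_left d1 hK0)) (hE E c hc0 hc).1 (hE E c hc0 hc).2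
  have hM : ‖mulB s n (Nω y.1) z - mulB s n (Nω y'.1) z'‖ ≤ 2 * K * (2 * A) * d :=
    norm_mul_sub_mul_le (hNω _ y1) (hNω _ y1')
      ((hNω' _ _ y1 y1').trans (mul_le_mul_of_nonneg_left d1 hK0)) zn zd
  have e : psi hs hs1 Nω N E₁ E₂ E₃ E₄ v h (t, y) - psi hs hs1 Nω N E₁ E₂ E₃ E₄ v h (t, y') =
      solL n hs hs1 ((mulB s n (E₁ t) z - mulB s n (E₁ t) z') +
        (mulB s n (Nω y.1) z - mulB s n (Nω y'.1) z') +
        (mulB s n (N y.1) (mulB s n (E₂ t) z) - mulB s n (N y'.1) (mulB s n (E₂ t) z'))) -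
      (0, (mulB s n (E₃ t) z - mulB s n (E₃ t) z') +
        (mulB s n (N y.1) (mulB s n (E₄ t) z) - mulB s n (N y'.1) (mulB s n (E₄ t) z'))) := by
    refine (map_sub_prod_sub (solL n hs hs1 : Morrey s n →+ (ℂ →ᵇ Cn n) × Morrey s n) _ _ _ _).trans
      (congrArg₂ _ (congrArg _ ?_) (congrArg _ ?_))
    · rw [sub_sub_sub_cancel_right, add_sub_add_comm, add_sub_add_comm]
    · rw [add_sub_add_comm]
  rw [e]
  refine (_root_.norm_sub_le _ _).trans ?_
  have b1 : ‖solL n hs hs1 ((mulB s n (E₁ t) z - mulB s n (E₁ t) z') +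
        (mulB s n (Nω y.1) z - mulB s n (Nω y'.1) z') +
        (mulB s n (N y.1) (mulB s n (E₂ t) z) - mulB s n (N y'.1) (mulB s n (E₂ t) z')))‖ ≤
      S * (2 * c₁ * ‖t‖ * (2 * A) * d + 2 * K * (2 * A) * d +
        2 * K * (2 * c₂ * ‖t‖ * (2 * A)) * d) :=
    ((solL n hs hs1).le_opNorm _).trans (mul_le_mul_of_nonneg_left
      ((norm_add₃_le).trans (add_le_add (add_le_add (hE E₁ c₁ c₁0 h₁).2 hM) (hG E₂ c₂ c₂0 h₂))) hS0)
  have b2 : ‖((0 : ℂ →ᵇ Cn n), (mulB s n (E₃ t) z - mulB s n (E₃ t) z') +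
        (mulB s n (N y.1) (mulB s n (E₄ t) z) - mulB s n (N y'.1) (mulB s n (E₄ t) z')))‖ ≤
      2 * c₃ * ‖t‖ * (2 * A) * d + 2 * K * (2 * c₄ * ‖t‖ * (2 * A)) * d := by
    refine max_le (by rw [norm_zero]; positivity) ?_
    exact (norm_add_le _ _).trans (add_le_add (hE E₃ c₃ c₃0 h₃).2 (hG E₄ c₄ c₄0 h₄))
  calc _ ≤ _ := add_le_add b1 b2
    _ = (4 * S * K * A) * d + C * ‖t‖ * d := by rw [hC]; ring
    _ ≤ 1 / 4 * d + 1 / 4 * d := by gcongr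
    _ = _ := by ring

end

end JLines

/-! ### Reparametrised solutions and smoothness of the lines. -/

namespace JLines

variable {n : ℕ} {s : ℝ}

open BoundedContinuousFunction Morrey

/-- The perturbed line `ζ ↦ ζ v + u(ζ)`. -/
noncomputable def line (v : Cn n) (y : (ℂ →ᵇ Cn n) × Morrey s n) (ζ : ℂ) : Cn n := ζ • v + y.1 ζ

lemma continuous_line (v : Cn n) (y : (ℂ →ᵇ Cn n) × Morrey s n) : Continuous (line v y) := by
  unfold line; fun_prop

section nem
variable {M : ℝ} {Q : Cn n → EndR n}

lemma norm_nonneg_smul {r : ℝ} (hr : 0 ≤ r) (x : EndR n) : ‖r • x‖ = r * ‖x‖ :=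
  (norm_smul r x).trans (by rw [Real.norm_of_nonneg hr])

lemma norm_nonneg_smul_sub {r : ℝ} (hr : 0 ≤ r) (x y : EndR n) :
    ‖r • x - r • y‖ = r * ‖x - y‖ :=
  (congrArg norm (smul_sub r x y).symm).trans (norm_nonneg_smul hr (x - y))

lemma line_add_mem {v : Cn n} (y : (ℂ →ᵇ Cn n) × Morrey s n)
    (hy : ‖y‖ ≤ 4) {w : ℂ →ᵇ Cn n} (hw : ‖w‖ ≤ 1) (ζ : ℂ) :
    line v y ζ + w ζ ∈ Metric.closedBall (ζ • v) (‖ζ‖ / 2 + 8) := by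
  rw [line, add_assoc]
  refine mem_closedBall_line (Metric.mem_closedBall_self (by norm_num)) ?_ ζ
  have h1 := (y.1.norm_coe_le_norm ζ).trans ((norm_fst_le y).trans hy)
  have h2 := (w.norm_coe_le_norm ζ).trans hw
  exact (norm_add_le _ _).trans (by linarith)

lemma norm_nem_le (hQ : Coeff s M Q) (hs : 0 < s) (hs1 : s ≤ 1 / 4) {v : Cn n} (hv : ‖v‖ = 1)
    {y : (ℂ →ᵇ Cn n) × Morrey s n} (hy : ‖y‖ ≤ 4) {ρ : ℂ → ℝ} (hρ : Continuous ρ)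
    (hc : HasCompactSupport ρ) (h0 : ∀ ζ, 0 ≤ ρ ζ) (h1 : ∀ ζ, ρ ζ ≤ jap ((1 + 4 * s) / 2) ζ)
    {w : ℂ →ᵇ Cn n} (hw : ‖w‖ ≤ 1) : ‖nem ρ (line v y) Q w‖ ≤ 33 ^ 3 * M := by
  have hM := hQ.nonneg
  refine (BoundedContinuousFunction.norm_le (by positivity)).2 fun ζ => ?_
  rw [nem_apply hρ hc (continuous_line v y) hQ.smooth.continuous, norm_nonneg_smul (h0 ζ)]
  exact (mul_le_mul_of_nonneg_right (h1 ζ) (norm_nonneg _)).trans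
    (hQ.norm_le hs hs1 hv (line_add_mem y hy hw ζ))

lemma norm_nem_sub_le (hQ : Coeff s M Q) (hs : 0 < s) (hs1 : s ≤ 1 / 4) {v : Cn n} (hv : ‖v‖ = 1)
    {y : (ℂ →ᵇ Cn n) × Morrey s n} (hy : ‖y‖ ≤ 4) {ρ : ℂ → ℝ} (hρ : Continuous ρ)
    (hc : HasCompactSupport ρ) (h0 : ∀ ζ, 0 ≤ ρ ζ) (h1 : ∀ ζ, ρ ζ ≤ jap ((1 + 4 * s) / 2) ζ)
    {w w' : ℂ →ᵇ Cn n} (hw : ‖w‖ ≤ 1) (hw' : ‖w'‖ ≤ 1) :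
    ‖nem ρ (line v y) Q w - nem ρ (line v y) Q w'‖ ≤ 33 ^ 3 * M * ‖w - w'‖ := by
  have hM := hQ.nonneg
  refine (BoundedContinuousFunction.norm_le (by positivity)).2 fun ζ => ?_
  rw [BoundedContinuousFunction.sub_apply,
    nem_apply hρ hc (continuous_line v y) hQ.smooth.continuous,
    nem_apply hρ hc (continuous_line v y) hQ.smooth.continuous, norm_nonneg_smul_sub (h0 ζ)]
  refine (mul_le_mul_of_nonneg_right (h1 ζ) (norm_nonneg _)).trans
    ((hQ.norm_sub_le hs hs1 hv (line_add_mem y hy hw ζ) (line_add_mem y hy hw' ζ)).trans ?_)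
  gcongr
  rw [add_sub_add_left_eq_sub]
  have h2 : ‖w ζ - w' ζ‖ ≤ ‖w - w'‖ := (w - w').norm_coe_le_norm ζ
  refine (mul_le_of_le_one_left (norm_nonneg _) ?_).trans h2
  exact inv_le_one_of_one_le₀ (by linarith [norm_nonneg ζ])

end nem

lemma hasFDerivAt_bump {χ : ℂ → ℂ} {z : ℂ} (hχ : DifferentiableAt ℝ χ z) (t : ℂ) :
    HasFDerivAt (fun ζ => ζ + t * χ ζ) (ContinuousLinearMap.id ℝ ℂ + t • fderiv ℝ χ z) z :=
  (hasFDerivAt_id z).add (hχ.hasFDerivAt.const_mul t)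

lemma dz_bump {χ : ℂ → ℂ} {z : ℂ} (hχ : DifferentiableAt ℝ χ z) (t : ℂ) :
    dz (fun ζ => ζ + t * χ ζ) z = 1 + t * dz χ z := by
  rw [dz, dz, (hasFDerivAt_bump hχ t).fderiv]
  simp only [_root_.add_apply, _root_.smul_apply, ContinuousLinearMap.id_apply, smul_eq_mul]
  linear_combination (-(1 / 2) : ℂ) * Complex.I_sq

lemma dzb_bump {χ : ℂ → ℂ} {z : ℂ} (hχ : DifferentiableAt ℝ χ z) (t : ℂ) :
    dzb (fun ζ => ζ + t * χ ζ) z = t * dzb χ z := by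
  rw [dzb, dzb, (hasFDerivAt_bump hχ t).fderiv]
  simp only [_root_.add_apply, _root_.smul_apply, ContinuousLinearMap.id_apply, smul_eq_mul]
  linear_combination ((1 / 2) : ℂ) * Complex.I_sq

lemma hasFDerivAt_mul_smul {χ : ℂ → ℂ} {z : ℂ} (hχ : DifferentiableAt ℝ χ z) (t : ℂ) (v : Cn n) :
    HasFDerivAt (fun ζ => (t * χ ζ) • v) ((t • fderiv ℝ χ z).smulRight v) z :=
  (hχ.hasFDerivAt.const_mul t).smul_const v

lemma dz_mul_smul {χ : ℂ → ℂ} {z : ℂ} (hχ : DifferentiableAt ℝ χ z) (t : ℂ) (v : Cn n) :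
    dz (fun ζ => (t * χ ζ) • v) z = (t * dz χ z) • v := by
  rw [dz, dz, (hasFDerivAt_mul_smul hχ t v).fderiv]
  simp only [ContinuousLinearMap.smulRight_apply, _root_.smul_apply, smul_eq_mul]
  module

lemma dzb_mul_smul {χ : ℂ → ℂ} {z : ℂ} (hχ : DifferentiableAt ℝ χ z) (t : ℂ) (v : Cn n) :
    dzb (fun ζ => (t * χ ζ) • v) z = (t * dzb χ z) • v := by
  rw [dzb, dzb, (hasFDerivAt_mul_smul hχ t v).fderiv]
  simp only [ContinuousLinearMap.smulRight_apply, _root_.smul_apply, smul_eq_mul]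
  module

/-- Matrix-valued multipliers `t jap(α) d`. -/
noncomputable def opJ (n : ℕ) (α : ℝ) {d : ℂ → ℂ} (hd : Continuous d) (hc : HasCompactSupport d) :
    ℂ →L[ℝ] (ℂ →ᵇ EndR n) :=
  opB n (fun ζ => (jap α ζ : ℂ) * d ζ)
    ((Complex.continuous_ofReal.comp (continuous_jap α)).mul hd) (hc.mul_left)

lemma opJ_apply {α : ℝ} {d : ℂ → ℂ} (hd : Continuous d) (hc : HasCompactSupport d) (t ζ : ℂ)
    (x : Cn n) : opJ n α hd hc t ζ x = jap α ζ • (t * d ζ) • x := by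
  rw [opJ, opB_apply, ← Complex.coe_smul, smul_smul]
  congr 1
  ring

section bump

variable {χ : ℂ → ℂ}

/-- The fixed point map for the increments of a solution `y` under `ζ ↦ ζ + t χ(ζ)`. -/
noncomputable def bumpPsi (hs : 0 < s) (hs1 : s ≤ 1 / 4) (Q : Cn n → EndR n) (v : Cn n)
    (y : (ℂ →ᵇ Cn n) × Morrey s n) (hχ : ContDiff ℝ 1 χ) (hc : HasCompactSupport χ) (η : ℂ → ℝ) :
    ℂ × (ℂ →ᵇ Cn n) × Morrey s n → (ℂ →ᵇ Cn n) × Morrey s n :=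
  psi hs hs1 (nem (fun ζ => η ζ * jap ((1 + 4 * s) / 2) ζ) (line v y) Q) (nem η (line v y) Q)
    (opJ n ((1 + 4 * s) / 2) (continuous_dzb hχ) (hasCompactSupport_dzb hc))
    (opJ n ((1 + 4 * s) / 2) (continuous_dz hχ) (hasCompactSupport_dz hc))
    (opJ n ((1 + s) / 2) (continuous_dz hχ) (hasCompactSupport_dz hc))
    (opJ n ((1 + s) / 2) (continuous_dzb hχ) (hasCompactSupport_dzb hc)) v y.2

lemma jap_smul_cancel₁ {α β γ : ℝ} (h : α + (β + γ) = 0) (ζ c : ℂ) (x : Cn n) :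
    jap α ζ • jap β ζ • c • jap γ ζ • x = c • x := by
  rw [smul_comm c, smul_smul, smul_smul, jap_mul, jap_mul, add_assoc, h, jap, Real.rpow_zero,
    one_smul]

lemma jap_smul_cancel₂ {α β γ : ℝ} (h : α + (β + γ) = 0) (ζ : ℂ) (r : ℝ) (A : EndR n) (x : Cn n) :
    jap α ζ • ((r * jap β ζ) • A) (jap γ ζ • x) = r • A x := by
  rw [_root_.smul_apply, map_smul, smul_smul, smul_smul,
    show jap α ζ * (r * jap β ζ) * jap γ ζ = r * (jap α ζ * jap β ζ * jap γ ζ) by ring,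
    jap_mul, jap_mul, add_assoc, h, jap, Real.rpow_zero, mul_one]

lemma jap_smul_cancel₃ {α β γ : ℝ} (h : α + (β + γ) = 0) (ζ c : ℂ) (r : ℝ) (A : EndR n) (x : Cn n) :
    jap α ζ • (r • A) (jap β ζ • c • jap γ ζ • x) = r • A (c • x) := by
  rw [← map_smul, jap_smul_cancel₁ h, _root_.smul_apply]

lemma jap_smul_cancel₄ {β γ : ℝ} (h : β + γ = 0) (ζ c : ℂ) (x : Cn n) :
    jap β ζ • c • jap γ ζ • x = c • x := by
  rw [smul_comm c, smul_smul, jap_mul, h, jap, Real.rpow_zero, one_smul]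

variable {M : ℝ} {Q : Cn n → EndR n} {hs : 0 < s} {hs1 : s ≤ 1 / 4}

/-- With `H = v + h∘φ`, the chain rule and the antilinearity of `Q` give `∂̄(L∘φ) = (∂̄φ)H +
Q(L∘φ)((∂φ)H)` and `∂(L∘φ) = (∂φ)H + Q(L∘φ)((∂̄φ)H)`. Substituting `∂φ = 1 + t∂χ` and `∂̄φ = t∂̄χ`
and subtracting the equation of `L`, one finds the arguments of the four operators in `psi`. The
increment `w` decays, so `eq_of_weakD` applies. Where `η` is not 1 the bump vanishes with its
derivatives, so the truncated terms cancel. -/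
lemma IsSol.bumpPsi_eq (hQ : Coeff s M Q) {v : Cn n} (hv : ‖v‖ = 1)
    {y : (ℂ →ᵇ Cn n) × Morrey s n} (H : IsSol hs hs1 Q v y) (hχ : ContDiff ℝ ∞ χ)
    (hχ1 : ContDiff ℝ 1 χ) (hc : HasCompactSupport χ) {η : ℂ → ℝ} (hη : Continuous η)
    (hηc : HasCompactSupport η)
    (hηχ : ∀ ζ, η ζ = 1 ∨ χ ζ = 0 ∧ dz χ ζ = 0 ∧ dzb χ ζ = 0) {t : ℂ}
    (hφ : Repar fun ζ => ζ + t * χ ζ) {w : ℂ →ᵇ Cn n}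
    (hw : ∀ ζ, w ζ = line v y (ζ + t * χ ζ) - line v y ζ) :
    bumpPsi hs hs1 Q v y hχ1 hc η (t, w, Morrey.comp hφ hs hs1 y.2 - y.2) =
      (w, Morrey.comp hφ hs hs1 y.2 - y.2) := by
  have hd : Differentiable ℝ χ := hχ.differentiable (by simp)
  have hL := continuous_line v y
  have hQc := hQ.smooth.continuous
  have hρ : Continuous fun ζ => η ζ * jap ((1 + 4 * s) / 2) ζ := hη.mul (continuous_jap _)
  have hρc : HasCompactSupport fun ζ => η ζ * jap ((1 + 4 * s) / 2) ζ := hηc.mul_right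
  have hb1 : v ∈ Metric.closedBall v (1 / 2) := Metric.mem_closedBall_self (by norm_num)
  have hj : -(3 * s) / 2 + ((1 + 4 * s) / 2 + -(1 + s) / 2) = 0 := by ring
  have hj' : (1 + s) / 2 + -(1 + s) / 2 = 0 := by ring
  set k := Morrey.comp hφ hs hs1 y.2 - y.2 with hk
  set z := incr hs hs1 v y.2 (t, w, k) with hz
  set z₀ := incr hs hs1 v y.2 0 with hz₀
  set E₁ := opJ n ((1 + 4 * s) / 2) (continuous_dzb hχ1) (hasCompactSupport_dzb hc)
  set E₂ := opJ n ((1 + 4 * s) / 2) (continuous_dz hχ1) (hasCompactSupport_dz hc)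
  set E₃ := opJ n ((1 + s) / 2) (continuous_dz hχ1) (hasCompactSupport_dz hc)
  set E₄ := opJ n ((1 + s) / 2) (continuous_dzb hχ1) (hasCompactSupport_dzb hc)
  set Nω := nem (fun ζ => η ζ * jap ((1 + 4 * s) / 2) ζ) (line v y) Q
  set N := nem η (line v y) Q
  set x := Morrey.mul (E₁ t) z + Morrey.mul (Nω w) z + Morrey.mul (N w) (Morrey.mul (E₂ t) z) -
    Morrey.mul (Nω 0) z₀ with hx
  set b := Morrey.mul (E₃ t) z + Morrey.mul (N w) (Morrey.mul (E₄ t) z) with hb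
  have hpsi : bumpPsi hs hs1 Q v y hχ1 hc η (t, w, k) =
      (cauchyL n hs hs1 x, beurlingM n hs hs1 (wt n hs x)) - (0, b) := rfl
  have fz : z.fn =ᵐ[volume] fun ζ => jap (-(1 + s) / 2) ζ • (v + y.2.fn (ζ + t * χ ζ)) := by
    have e : z = affL n hs hs1 (v, Morrey.comp hφ hs hs1 y.2) := by
      rw [hz, incr, hk, add_sub_cancel]
    rw [e]
    filter_upwards [fn_affL hs hs1 v (Morrey.comp hφ hs hs1 y.2), fn_comp hφ hs hs1 y.2]
      with ζ h1 h2
    rw [h1, h2]; rfl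
  have fz₀ : z₀.fn =ᵐ[volume] fun ζ => jap (-(1 + s) / 2) ζ • (v + y.2.fn ζ) := by
    have e : z₀ = affL n hs hs1 (v, y.2) := by
      rw [hz₀, incr]; congr 2; exact add_zero y.2
    rw [e]
    exact fn_affL hs hs1 v y.2
  have hM : ∀ ζ, line v y ζ + w ζ = line v y (ζ + t * χ ζ) := fun ζ => by
    rw [hw, add_sub_cancel]
  have fwx : (wt n hs x).fn =ᵐ[volume] fun ζ => (t * dzb χ ζ) • (v + y.2.fn (ζ + t * χ ζ)) +
      η ζ • Q (line v y (ζ + t * χ ζ)) (v + y.2.fn (ζ + t * χ ζ)) +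
      η ζ • Q (line v y (ζ + t * χ ζ)) ((t * dz χ ζ) • (v + y.2.fn (ζ + t * χ ζ))) -
      η ζ • Q (line v y ζ) (v + y.2.fn ζ) := by
    filter_upwards [fn_wt hs x, fn_sub (Morrey.mul (E₁ t) z + Morrey.mul (Nω w) z +
      Morrey.mul (N w) (Morrey.mul (E₂ t) z)) (Morrey.mul (Nω 0) z₀),
      fn_add (Morrey.mul (E₁ t) z + Morrey.mul (Nω w) z) (Morrey.mul (N w) (Morrey.mul (E₂ t) z)),
      fn_add (Morrey.mul (E₁ t) z) (Morrey.mul (Nω w) z), fn_mul (E₁ t) z, fn_mul (Nω w) z,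
      fn_mul (N w) (Morrey.mul (E₂ t) z), fn_mul (E₂ t) z, fn_mul (Nω 0) z₀, fz, fz₀]
      with ζ h1 h2 h3 h4 h5 h6 h7 h8 h9 h10 h11
    rw [h1, hx, h2, Pi.sub_apply, h3, Pi.add_apply, h4, Pi.add_apply, h5, h6, h7, h8, h9, h10, h11,
      opJ_apply, opJ_apply, nem_apply hρ hρc hL hQc, nem_apply hρ hρc hL hQc,
      nem_apply hη hηc hL hQc, hM, show (0 : ℂ →ᵇ Cn n) ζ = 0 from rfl, add_zero, smul_sub,
      smul_add, smul_add, jap_smul_cancel₁ hj, jap_smul_cancel₂ hj, jap_smul_cancel₂ hj,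
      jap_smul_cancel₃ hj]
  have fb : (k + b).fn =ᵐ[volume] fun ζ => y.2.fn (ζ + t * χ ζ) - y.2.fn ζ +
      ((t * dz χ ζ) • (v + y.2.fn (ζ + t * χ ζ)) +
      η ζ • Q (line v y (ζ + t * χ ζ)) ((t * dzb χ ζ) • (v + y.2.fn (ζ + t * χ ζ)))) := by
    filter_upwards [fn_add k b, fn_sub (Morrey.comp hφ hs hs1 y.2) y.2, fn_comp hφ hs hs1 y.2,
      fn_add (Morrey.mul (E₃ t) z) (Morrey.mul (N w) (Morrey.mul (E₄ t) z)), fn_mul (E₃ t) z,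
      fn_mul (N w) (Morrey.mul (E₄ t) z), fn_mul (E₄ t) z, fz] with ζ h1 h2 h3 h4 h5 h6 h7 h8
    rw [h1, Pi.add_apply, hk, h2, Pi.sub_apply, h3, hb, h4, Pi.add_apply, h5, h6, h7, h8,
      opJ_apply, opJ_apply, nem_apply hη hηc hL hQc, hM, jap_smul_cancel₄ hj',
      jap_smul_cancel₄ hj', _root_.smul_apply, Function.comp_apply]
  -- The increment of the line is that of `u` plus the compactly supported term `tχv`.
  have hF : IsTest fun ζ => (-t * χ ζ) • v :=
    ⟨(contDiff_const.mul hχ).smul contDiff_const, (hc.mul_left (f := fun _ => -t)).smul_right⟩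
  have hW := (((H.weakD hQ hv hb1).comp hφ).sub (H.weakD hQ hv hb1)).sub hF.weakD
  have ew : (y.1 ∘ fun ζ => ζ + t * χ ζ) - y.1 - (fun ζ => (-t * χ ζ) • v) = w := by
    funext ζ
    rw [hw, line, line]
    simp only [Pi.sub_apply, Function.comp_apply]
    module
  rw [ew] at hW
  have hcr : ∀ ζ, crRhs Q v y ζ = Q (line v y ζ) (v + y.2.fn ζ) := fun ζ => rfl
  have hfar : ∀ ζ, χ ζ = 0 → ζ + t * χ ζ = ζ := fun ζ h => by rw [h, mul_zero, add_zero]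
  have hWD : WeakD w (wt n hs x).fn (k + b).fn := by
    refine hW.congr ?_ ?_
    · filter_upwards [fwx] with ζ h1
      rw [h1]
      simp only [Pi.sub_apply]
      rw [dz_bump (hd ζ), dzb_bump (hd ζ), dzb_mul_smul (hd ζ), hcr, hcr]
      rcases hηχ ζ with h | ⟨h2, h3, h4⟩
      · rw [h, hQ.anti, map_add, map_one]
        module
      · rw [hfar ζ h2, h3, h4]
        simp only [mul_zero, zero_smul, add_zero, map_one, one_smul, map_zero, smul_zero, zero_add]
        module
    · filter_upwards [fb] with ζ h1
      rw [h1]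
      simp only [Pi.sub_apply]
      rw [dz_bump (hd ζ), dzb_bump (hd ζ), dz_mul_smul (hd ζ), hcr]
      rcases hηχ ζ with h | ⟨h2, h3, h4⟩
      · rw [h, hQ.anti]
        module
      · rw [hfar ζ h2, h3, h4]
        simp only [mul_zero, zero_smul, add_zero, one_smul, map_zero, smul_zero]
        module
  obtain ⟨C, hC, hdec⟩ := H.decay
  obtain ⟨C', hC', hdec'⟩ := hφ.exists_jap_comp_le hs
  obtain ⟨B, hB⟩ := (show Continuous fun ζ => (jap (s / 2) ζ : ℂ) * (t * χ ζ) from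
    (Complex.continuous_ofReal.comp (continuous_jap _)).mul
      (continuous_const.mul hχ.continuous)).bounded_above_of_compact_support
      ((hc.mul_left (f := fun _ => t)).mul_left)
  have hwd : ∀ ζ, ‖w ζ‖ ≤ (C * C' + C + B) * jap (-s / 2) ζ := by
    intro ζ
    have e : w ζ = y.1 (ζ + t * χ ζ) - y.1 ζ + (t * χ ζ) • v := by
      rw [hw, line, line]; module
    have h1 : ‖y.1 (ζ + t * χ ζ)‖ ≤ C * (C' * jap (-s / 2) ζ) :=
      (hdec _).trans (mul_le_mul_of_nonneg_left (hdec' ζ) hC)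
    have h2 : ‖(t * χ ζ) • v‖ ≤ B * jap (-s / 2) ζ := by
      rw [norm_smul, hv, mul_one]
      have h3 := hB ζ
      have hj : jap (s / 2) ζ * jap (-s / 2) ζ = 1 := by
        rw [jap_mul, show s / 2 + -s / 2 = 0 by ring, jap, Real.rpow_zero]
      rw [norm_mul, Complex.norm_real, Real.norm_of_nonneg (jap_pos _ _).le] at h3
      calc ‖t * χ ζ‖ = jap (s / 2) ζ * ‖t * χ ζ‖ * jap (-s / 2) ζ := by
            rw [mul_right_comm, hj, one_mul]
        _ ≤ _ := by have := jap_pos (-s / 2) ζ; gcongr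
    rw [e]
    refine (norm_add_le _ _).trans ((add_le_add (_root_.norm_sub_le _ _) le_rfl).trans ?_)
    linarith [hdec ζ]
  obtain ⟨e1, e2⟩ := eq_of_weakD hs hs1 hWD (ae_eq_refl _) w.continuous hwd
  rw [hpsi, Prod.mk_sub_mk, sub_zero]
  refine Prod.ext (DFunLike.coe_injective e1.symm) ?_
  exact sub_eq_of_eq_add (ext_ae e2.symm)

lemma contDiff_bumpPsi (hQ : Coeff s M Q) (hs : 0 < s) (hs1 : s ≤ 1 / 4) (v : Cn n)
    (y : (ℂ →ᵇ Cn n) × Morrey s n) (hχ : ContDiff ℝ 1 χ) (hc : HasCompactSupport χ) {η : ℂ → ℝ}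
    (hη : Continuous η) (hηc : HasCompactSupport η) :
    ContDiff ℝ ∞ (bumpPsi hs hs1 Q v y hχ hc η) :=
  contDiff_psi hs hs1
    (contDiff_nem (hη.mul (continuous_jap _)) hηc.mul_right (continuous_line v y) hQ.smooth)
    (contDiff_nem hη hηc (continuous_line v y) hQ.smooth) _ _ _ _ v y.2

lemma bumpPsi_zero (hs : 0 < s) (hs1 : s ≤ 1 / 4) (Q : Cn n → EndR n) (v : Cn n)
    (y : (ℂ →ᵇ Cn n) × Morrey s n) (hχ : ContDiff ℝ 1 χ) (hc : HasCompactSupport χ) (η : ℂ → ℝ) :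
    bumpPsi hs hs1 Q v y hχ hc η (0, 0) = 0 := psi_zero hs hs1 _ _ _ _ _ _ v y.2

lemma bumpPsi_lipschitz (hQ : Coeff s M Q) (hs : 0 < s) (hs1 : s ≤ 1 / 4)
    (hκ : kap n hs hs1 * M ≤ 1 / 64) {v : Cn n} (hv : ‖v‖ = 1) {y : (ℂ →ᵇ Cn n) × Morrey s n}
    (hy : ‖y‖ ≤ 1) (hχ : ContDiff ℝ 1 χ) (hc : HasCompactSupport χ) {η : ℂ → ℝ}
    (hη : Continuous η) (hηc : HasCompactSupport η) (hη0 : ∀ ζ, 0 ≤ η ζ) (hη1 : ∀ ζ, η ζ ≤ 1) :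
    ∀ᶠ t in 𝓝 (0 : ℂ), ∀ p ∈ Metric.closedBall (0 : (ℂ →ᵇ Cn n) × Morrey s n) 1,
      ∀ p' ∈ Metric.closedBall (0 : (ℂ →ᵇ Cn n) × Morrey s n) 1,
      ‖bumpPsi hs hs1 Q v y hχ hc η (t, p) - bumpPsi hs hs1 Q v y hχ hc η (t, p')‖ ≤
        1 / 2 * ‖p - p'‖ := by
  have hy4 : ‖y‖ ≤ 4 := by linarith
  have hK : 4 * ‖solL n hs hs1‖ * (33 ^ 3 * M) * ‖affL n hs hs1‖ ≤ 1 / 4 := by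
    have h1 : 4 / 5 * (kap n hs hs1 * M) ≤ 4 / 5 * (1 / 64) := by gcongr
    rw [kap] at h1
    linarith
  have hj1 : ∀ ζ, 1 ≤ jap ((1 + 4 * s) / 2) ζ := one_le_jap (by linarith)
  have hρ : Continuous fun ζ => η ζ * jap ((1 + 4 * s) / 2) ζ := hη.mul (continuous_jap _)
  have hρc : HasCompactSupport fun ζ => η ζ * jap ((1 + 4 * s) / 2) ζ := hηc.mul_right
  have hρ0 : ∀ ζ, 0 ≤ η ζ * jap ((1 + 4 * s) / 2) ζ := fun ζ =>
    mul_nonneg (hη0 ζ) (jap_pos _ _).le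
  have hρ1 : ∀ ζ, η ζ * jap ((1 + 4 * s) / 2) ζ ≤ jap ((1 + 4 * s) / 2) ζ :=
    fun ζ => mul_le_of_le_one_left (jap_pos _ _).le (hη1 ζ)
  have hη1' : ∀ ζ, η ζ ≤ jap ((1 + 4 * s) / 2) ζ := fun ζ => (hη1 ζ).trans (hj1 ζ)
  exact psi_lipschitz hs hs1 (K := 33 ^ 3 * M)
    (fun w hw => norm_nem_le hQ hs hs1 hv hy4 hρ hρc hρ0 hρ1 hw)
    (fun w w' hw hw' => norm_nem_sub_le hQ hs hs1 hv hy4 hρ hρc hρ0 hρ1 hw hw')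
    (fun w hw => norm_nem_le hQ hs hs1 hv hy4 hη hηc hη0 hη1' hw)
    (fun w w' hw hw' => norm_nem_sub_le hQ hs hs1 hv hy4 hη hηc hη0 hη1' hw hw')
    hK _ _ _ _ (by rw [hv]; norm_num) ((norm_snd_le y).trans hy)

lemma dz_cutoff_dichotomy {R : ℝ} (hR : 0 < R) (ζ : ℂ) : ‖cutoff (2 * R) ζ‖ = 1 ∨
    cutoff R ζ = 0 ∧ dz (cutoff R) ζ = 0 ∧ dzb (cutoff R) ζ = 0 := by
  rcases le_or_gt ‖ζ‖ (2 * R) with h | h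
  · left
    rw [cutoff_eq_one (by positivity) h, norm_one]
  · right
    refine ⟨cutoff_eq_zero hR h.le, ?_, ?_⟩
    · rw [dz, fderiv_cutoff_eq_zero hR (Or.inr h)]; simp
    · rw [dzb, fderiv_cutoff_eq_zero hR (Or.inr h)]; simp

lemma norm_line_bump_sub_le {v : Cn n} (hv : ‖v‖ = 1) {y : (ℂ →ᵇ Cn n) × Morrey s n}
    (hy : ‖y.1‖ ≤ 1 / 64) (R : ℝ) {t : ℂ} (ht : ‖t‖ ≤ 1 / 2) (ζ : ℂ) :
    ‖line v y (ζ + t * cutoff R ζ) - line v y ζ‖ ≤ 1 := by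
  have e : line v y (ζ + t * cutoff R ζ) - line v y ζ =
      y.1 (ζ + t * cutoff R ζ) - y.1 ζ + (t * cutoff R ζ) • v := by
    rw [line, line]; module
  have h1 := (y.1.norm_coe_le_norm (ζ + t * cutoff R ζ)).trans hy
  have h2 := (y.1.norm_coe_le_norm ζ).trans hy
  have h3 : ‖(t * cutoff R ζ) • v‖ ≤ 1 / 2 := by
    rw [norm_smul, hv, mul_one, norm_mul]
    exact (mul_le_of_le_one_right (norm_nonneg _) (norm_cutoff_le R ζ)).trans ht
  rw [e]
  refine (norm_add_le _ _).trans ((add_le_add (_root_.norm_sub_le _ _) le_rfl).trans ?_)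
  linarith

-- Composition with `φ_t` is not visibly smooth in `t` when `y` is merely a solution. The increments
-- are, however, the unique small fixed points of the smooth family `bumpPsi`, and therefore depend
-- smoothly on `t` near 0.
set_option maxHeartbeats 1000000 in
lemma IsSol.contDiff_line (hQ : Coeff s M Q) (hκ : kap n hs hs1 * M ≤ 1 / 64) {v : Cn n}
    (hv : ‖v‖ = 1) {y : (ℂ →ᵇ Cn n) × Morrey s n} (H : IsSol hs hs1 Q v y) :
    ContDiff ℝ ∞ (line v y) := by
  refine contDiff_iff_contDiffAt.2 fun ζ₀ => ?_
  have hb1 : v ∈ Metric.closedBall v (1 / 2) := Metric.mem_closedBall_self (by norm_num)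
  have hn := (H.norm_le' hQ hv hb1).trans hκ
  have hy1 : ‖y.1‖ ≤ 1 / 64 := (norm_fst_le y).trans hn
  have hy2 : ‖y.2‖ ≤ 1 / 64 := (norm_snd_le y).trans hn
  -- The bump equals 1 at `ζ₀`, so `φ_t(ζ₀) = ζ₀ + t`. The second cut-off, at radius `2R`, equals 1
  -- wherever the bump lives.
  set R : ℝ := ‖ζ₀‖ + 1 with hR
  have hR0 : 0 < R := by positivity
  have hχ := contDiff_cutoff R
  have hχ1 : ContDiff ℝ 1 (cutoff R) := hχ.of_le (by exact_mod_cast le_top)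
  have hc := hasCompactSupport_cutoff hR0
  have hη : Continuous fun ζ => ‖cutoff (2 * R) ζ‖ := (contDiff_cutoff (2 * R)).continuous.norm
  have hηc : HasCompactSupport fun ζ => ‖cutoff (2 * R) ζ‖ :=
    (hasCompactSupport_cutoff (by positivity)).norm
  obtain ⟨t₀, ht₀, hrep⟩ := exists_repar_bump hχ hc
  let W : ℂ → (ℂ →ᵇ Cn n) := fun t =>
    toB fun ζ => line v y (ζ + t * cutoff R ζ) - line v y ζ
  have hWa : ∀ t : ℂ, ‖t‖ ≤ 1 / 2 → ∀ ζ, W t ζ = line v y (ζ + t * cutoff R ζ) - line v y ζ := by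
    intro t ht ζ
    have hL := continuous_line v y
    have hχc := hχ.continuous
    exact toB_apply (by fun_prop) (norm_line_bump_sub_le hv hy1 R ht) ζ
  let x : ℂ → (ℂ →ᵇ Cn n) × Morrey s n := fun t =>
    open Classical in
    if h : ‖t‖ ≤ t₀ then (W t, Morrey.comp (hrep t h) hs hs1 y.2 - y.2) else 0
  have hev : ∀ᶠ t in 𝓝 (0 : ℂ), ‖t‖ ≤ 1 / 2 ∧
      ∃ h : ‖t‖ ≤ t₀, x t = (W t, Morrey.comp (hrep t h) hs hs1 y.2 - y.2) := by
    filter_upwards [Metric.closedBall_mem_nhds (0 : ℂ) ht₀,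
      Metric.closedBall_mem_nhds (0 : ℂ) (by norm_num : (0 : ℝ) < 1 / 2)] with t h1 h2
    rw [mem_closedBall_zero_iff] at h1 h2
    exact ⟨h2, h1, dif_pos h1⟩
  have hfix : ∀ᶠ t in 𝓝 (0 : ℂ), x t ∈ Metric.closedBall (0 : (ℂ →ᵇ Cn n) × Morrey s n) 1 ∧
      bumpPsi hs hs1 Q v y hχ1 hc (fun ζ => ‖cutoff (2 * R) ζ‖) (t, x t) = x t := by
    filter_upwards [hev] with t ht
    obtain ⟨h2, h1, e⟩ := ht
    rw [e]
    refine ⟨?_, H.bumpPsi_eq hQ hv hχ hχ1 hc hη hηc (dz_cutoff_dichotomy hR0) (hrep t h1)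
      (hWa t h2)⟩
    rw [mem_closedBall_zero_iff]
    refine max_le ?_ ?_
    · refine (BoundedContinuousFunction.norm_le zero_le_one).2 fun ζ => ?_
      rw [hWa t h2]
      exact norm_line_bump_sub_le hv hy1 R h2 ζ
    · refine (_root_.norm_sub_le _ _).trans ?_
      linarith [norm_comp_le (hrep t h1) hs hs1 y.2]
  have hsm : ContDiffAt ℝ ∞ x 0 :=
    contDiffAt_of_fixedPoint (contDiff_bumpPsi hQ hs hs1 v y hχ1 hc hη hηc)
      (bumpPsi_zero hs hs1 Q v y hχ1 hc _)
      (bumpPsi_lipschitz hQ hs hs1 hκ hv (hn.trans (by norm_num)) hχ1 hc hη hηc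
        (fun _ => norm_nonneg _) (norm_cutoff_le _)) hfix
  -- Evaluation at `ζ₀` is linear and continuous, so smoothness in `t` of the increment becomes
  -- smoothness of the line at `ζ₀`.
  have hev' : (fun t => line v y (ζ₀ + t)) =ᶠ[𝓝 0]
      fun t => BoundedContinuousFunction.evalCLM ℝ ζ₀ (x t).1 + line v y ζ₀ := by
    filter_upwards [hev] with t ht
    obtain ⟨h2, h1, e⟩ := ht
    have e2 : cutoff R ζ₀ = 1 := cutoff_eq_one hR0 (by linarith)
    rw [e, BoundedContinuousFunction.evalCLM_apply, hWa t h2, e2, mul_one, sub_add_cancel]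
  have h2 : ContDiffAt ℝ ∞ (fun t => line v y (ζ₀ + t)) 0 :=
    (((BoundedContinuousFunction.evalCLM ℝ ζ₀).contDiff.contDiffAt.comp 0 hsm.fst).add
      contDiffAt_const).congr_of_eventuallyEq hev'
  have h3 : ContDiffAt ℝ ∞ (fun ζ => line v y (ζ₀ + (ζ - ζ₀))) ζ₀ :=
    ContDiffAt.comp ζ₀ (g := fun t => line v y (ζ₀ + t)) (f := fun ζ => ζ - ζ₀)
      (by rw [sub_self]; exact h2) (by fun_prop)
  simpa using h3

end bump

end JLines

/-! ### The Beltrami coefficient of an almost complex structure. -/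

namespace JLines

variable {n : ℕ} {s : ℝ}

/-! The Beltrami coefficient of an almost complex structure. -/

lemma stdJ_apply (x : Cn n) : stdJ (Cn n) x = Complex.I • x := rfl

lemma stdJ_mul_stdJ : stdJ (Cn n) * stdJ (Cn n) = -1 := by
  ext1 x
  change Complex.I • Complex.I • x = -x
  rw [smul_smul, Complex.I_mul_I, neg_one_smul]

lemma norm_stdJ_le : ‖stdJ (Cn n)‖ ≤ 1 :=
  ContinuousLinearMap.opNorm_le_bound _ zero_le_one fun x => by
    rw [stdJ_apply, norm_smul, Complex.norm_I]

/-- The coefficient `(i + J)⁻¹(i - J)`. -/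
noncomputable def belt (A : EndR n) : EndR n :=
  Ring.inverse (stdJ (Cn n) + A) * (stdJ (Cn n) - A)

section
variable {A B : EndR n}

/-- `i + A` is `2i` plus a perturbation of norm at most 1. It is thus bounded below by 1, which
gives invertibility in finite dimension and an inverse of norm at most 1. -/
lemma le_norm_stdJ_add (hA : ‖A - stdJ (Cn n)‖ ≤ 1) (x : Cn n) :
    ‖x‖ ≤ ‖(stdJ (Cn n) + A) x‖ := by
  have e : (stdJ (Cn n) + A) x = (2 * Complex.I) • x + (A - stdJ (Cn n)) x := by
    simp only [_root_.add_apply, _root_.sub_apply, stdJ_apply]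
    module
  have h1 := norm_sub_le_norm_add ((2 * Complex.I) • x) ((A - stdJ (Cn n)) x)
  have h2 := (A - stdJ (Cn n)).le_of_opNorm_le hA x
  rw [norm_smul, norm_mul, Complex.norm_I, Complex.norm_two] at h1
  rw [e]
  linarith

lemma isUnit_stdJ_add (hA : ‖A - stdJ (Cn n)‖ ≤ 1) : IsUnit (stdJ (Cn n) + A) := by
  have hinj : LinearMap.ker (stdJ (Cn n) + A : EndR n).toLinearMap = ⊥ := by
    refine LinearMap.ker_eq_bot'.2 fun x hx => ?_
    have h := le_norm_stdJ_add hA x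
    rw [show (stdJ (Cn n) + A) x = 0 from hx, norm_zero] at h
    exact norm_le_zero_iff.1 h
  have hsurj : LinearMap.range (stdJ (Cn n) + A : EndR n).toLinearMap = ⊤ :=
    LinearMap.range_eq_top.2 (LinearMap.injective_iff_surjective.1 (LinearMap.ker_eq_bot.1 hinj))
  let e := ContinuousLinearEquiv.ofBijective (stdJ (Cn n) + A) hinj hsurj
  exact ⟨ContinuousLinearEquiv.toUnit e, by ext1 x; rfl⟩

lemma norm_inverse_le (hA : ‖A - stdJ (Cn n)‖ ≤ 1) : ‖Ring.inverse (stdJ (Cn n) + A)‖ ≤ 1 := by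
  refine ContinuousLinearMap.opNorm_le_bound _ zero_le_one fun x => ?_
  have h := le_norm_stdJ_add hA (Ring.inverse (stdJ (Cn n) + A) x)
  have e : (stdJ (Cn n) + A) (Ring.inverse (stdJ (Cn n) + A) x) = x :=
    DFunLike.congr_fun (Ring.mul_inverse_cancel _ (isUnit_stdJ_add hA)) x
  rw [one_mul]
  rwa [e] at h

lemma norm_belt_le (hA : ‖A - stdJ (Cn n)‖ ≤ 1) : ‖belt A‖ ≤ ‖A - stdJ (Cn n)‖ := by
  refine (norm_mul_le _ _).trans ?_
  rw [norm_sub_rev]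
  exact mul_le_of_le_one_left (norm_nonneg _) (norm_inverse_le hA)

lemma belt_eq (hA : ‖A - stdJ (Cn n)‖ ≤ 1) :
    belt A = 2 * Ring.inverse (stdJ (Cn n) + A) * stdJ (Cn n) - 1 := by
  have h := Ring.inverse_mul_cancel _ (isUnit_stdJ_add hA)
  rw [belt, ← h]
  noncomm_ring

/-- The resolvent identity applied to the form `2(i + A)⁻¹ i - 1` of the coefficient. -/
lemma norm_belt_sub_le (hA : ‖A - stdJ (Cn n)‖ ≤ 1) (hB : ‖B - stdJ (Cn n)‖ ≤ 1) :
    ‖belt A - belt B‖ ≤ 2 * ‖A - B‖ := by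
  set X := Ring.inverse (stdJ (Cn n) + A) with hX
  set Y := Ring.inverse (stdJ (Cn n) + B) with hY
  have h1 : X * (stdJ (Cn n) + A) = 1 := Ring.inverse_mul_cancel _ (isUnit_stdJ_add hA)
  have h2 : (stdJ (Cn n) + B) * Y = 1 := Ring.mul_inverse_cancel _ (isUnit_stdJ_add hB)
  have e : belt A - belt B = (2 : ℝ) • (X * (B - A) * Y * stdJ (Cn n)) := by
    have h3 : X * (B - A) * Y = X - Y := by
      calc X * (B - A) * Y = X * ((stdJ (Cn n) + B) * Y) - X * (stdJ (Cn n) + A) * Y := by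
            noncomm_ring
        _ = X - Y := by rw [h1, h2, mul_one, one_mul]
    rw [belt_eq hA, belt_eq hB, h3, two_smul]
    noncomm_ring
  have hXn : ‖X‖ ≤ 1 := norm_inverse_le hA
  have hYn : ‖Y‖ ≤ 1 := norm_inverse_le hB
  rw [e, norm_smul, Real.norm_of_nonneg (by norm_num)]
  gcongr
  calc _ ≤ ‖X‖ * ‖B - A‖ * ‖Y‖ * ‖stdJ (Cn n)‖ := by
        refine (norm_mul_le _ _).trans ?_
        gcongr
        refine (norm_mul_le _ _).trans ?_
        gcongr
        exact norm_mul_le _ _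
    _ ≤ 1 * ‖B - A‖ * 1 * 1 := by
        gcongr
        exact norm_stdJ_le
    _ = _ := by rw [one_mul, mul_one, mul_one, norm_sub_rev]

/-- From `A² = i² = -1` follow `A(i + A) = (i + A)i` and `(i - A)i = -A(i - A)`. Hence `(i + A)⁻¹`
intertwines `A` with `i`, and the coefficient anticommutes with `i`. -/
lemma belt_I_smul (hA : ‖A - stdJ (Cn n)‖ ≤ 1) (hsq : A * A = -1) (x : Cn n) :
    belt A (Complex.I • x) = -(Complex.I • belt A x) := by
  set X := Ring.inverse (stdJ (Cn n) + A) with hX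
  set i := stdJ (Cn n) with hi
  have h1 : X * (i + A) = 1 := Ring.inverse_mul_cancel _ (isUnit_stdJ_add hA)
  have h2 : (i + A) * X = 1 := Ring.mul_inverse_cancel _ (isUnit_stdJ_add hA)
  have hii : i * i = -1 := stdJ_mul_stdJ
  have h3 : X * A = i * X := by
    have h4 : A * (i + A) = (i + A) * i := by rw [mul_add, add_mul, hsq, hii, add_comm]
    calc X * A = X * (A * (i + A)) * X := by rw [mul_assoc, mul_assoc, h2, mul_one]
      _ = X * (i + A) * i * X := by rw [h4]; noncomm_ring
      _ = i * X := by rw [h1, one_mul]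
  have h5 : belt A * i = -(i * belt A) := by
    have h6 : (i - A) * i = -(A * (i - A)) := by rw [sub_mul, mul_sub, hsq, hii]; abel
    calc belt A * i = X * ((i - A) * i) := mul_assoc _ _ _
      _ = -(X * A * (i - A)) := by rw [h6, mul_neg, mul_assoc]
      _ = -(i * belt A) := by rw [h3, mul_assoc]; rfl
  exact DFunLike.congr_fun h5 x

lemma belt_smul (hA : ‖A - stdJ (Cn n)‖ ≤ 1) (hsq : A * A = -1) (c : ℂ) (x : Cn n) :
    belt A (c • x) = (starRingEnd ℂ) c • belt A x := by
  have e1 : c • x = c.re • x + c.im • (Complex.I • x) := by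
    conv_lhs => rw [← Complex.re_add_im c, add_smul, mul_smul, Complex.coe_smul, Complex.coe_smul]
  have e2 : (starRingEnd ℂ) c = (c.re : ℂ) + (c.im : ℂ) * (-Complex.I) := by
    apply Complex.ext <;> simp
  rw [e1, map_add, map_smul, map_smul, belt_I_smul hA hsq, e2, add_smul, mul_smul,
    Complex.coe_smul, Complex.coe_smul, neg_smul]

/-- Clearing the inverse gives `(i + A)b = (i - A)a`. With `a = ∂L` and `b = ∂̄L` the conclusion
reads `∂L/∂y = J ∂L/∂x`. -/
lemma belt_eq_iff (hA : ‖A - stdJ (Cn n)‖ ≤ 1) {a b : Cn n} (h : b = belt A a) :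
    Complex.I • (a - b) = A (a + b) := by
  have h1 : (stdJ (Cn n) + A) b = (stdJ (Cn n) - A) a := by
    rw [h]
    have := Ring.mul_inverse_cancel _ (isUnit_stdJ_add hA)
    change ((stdJ (Cn n) + A) * (Ring.inverse (stdJ (Cn n) + A) * (stdJ (Cn n) - A))) a = _
    rw [← mul_assoc, this, one_mul]
  simp only [_root_.add_apply, _root_.sub_apply, stdJ_apply] at h1
  rw [eq_sub_iff_add_eq] at h1
  rw [map_add, smul_sub, ← h1]
  abel

end

end JLines

/-! ### From the decay conditions to the complex lines. -/

namespace JLines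

variable {n : ℕ} {s : ℝ}

lemma exists_norm_le_seminorm {E : Type*} [NormedAddCommGroup E] [NormedSpace ℝ E]
    [FiniteDimensional ℝ E] (N : Seminorm ℝ E) (hN : ∀ x, N x = 0 → x = 0) :
    ∃ c : ℝ, 0 < c ∧ ∀ x, ‖x‖ ≤ c * N x := by
  have hcont : Continuous N := N.convexOn.locallyLipschitz.continuous
  have : ProperSpace E := FiniteDimensional.proper ℝ E
  -- The sphere is empty only for the zero space. Otherwise the definite seminorm attains a positive
  -- minimum on it by compactness.
  rcases (Metric.sphere (0 : E) 1).eq_empty_or_nonempty with h | h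
  · refine ⟨1, one_pos, fun x => ?_⟩
    have hx : x = 0 := by
      by_contra hx
      have : (‖x‖⁻¹ • x) ∈ Metric.sphere (0 : E) 1 := by
        rw [mem_sphere_zero_iff_norm, norm_smul, norm_inv, norm_norm,
          inv_mul_cancel₀ (norm_ne_zero_iff.2 hx)]
      rw [h] at this
      exact this
    simp [hx]
  · obtain ⟨x₀, hx₀, hmin⟩ := (isCompact_sphere (0 : E) 1).exists_isMinOn h hcont.continuousOn
    have hx₀' : ‖x₀‖ = 1 := by simpa using hx₀
    have hpos : 0 < N x₀ := lt_of_le_of_ne (apply_nonneg N x₀) fun h0 => by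
      rw [hN _ h0.symm, norm_zero] at hx₀'
      exact zero_ne_one hx₀'
    refine ⟨(N x₀)⁻¹, inv_pos.2 hpos, fun x => ?_⟩
    rw [le_inv_mul_iff₀ hpos]
    by_cases hx : x = 0
    · simp [hx]
    have hxn : 0 < ‖x‖ := norm_pos_iff.2 hx
    have h1 : N x₀ ≤ N (‖x‖⁻¹ • x) := hmin (by
      rw [mem_sphere_zero_iff_norm, norm_smul, norm_inv, norm_norm, inv_mul_cancel₀ hxn.ne'])
    rw [map_smul_eq_mul, norm_inv, norm_norm, le_inv_mul_iff₀ hxn] at h1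
    linarith

lemma sum_coordDir (x : Cn n) : x = ∑ j : Fin n,
    ((x j).re • coordDir (j, (0 : Fin 2)) + (x j).im • coordDir (j, (1 : Fin 2))) := by
  ext i
  rw [WithLp.ofLp_sum, Finset.sum_apply]
  simp [coordDir, Finset.sum_ite_eq, Finset.sum_add_distrib]

lemma opNorm_le_of_coordDir {F : Type*} [NormedAddCommGroup F] [NormedSpace ℝ F]
    (A : Cn n →L[ℝ] F) {b : ℝ} (hb : 0 ≤ b) (h : ∀ d, ‖A (coordDir d)‖ ≤ b) :
    ‖A‖ ≤ 2 * n * b := by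
  refine A.opNorm_le_bound (by positivity) fun x => ?_
  have hx : ∀ j, ‖x j‖ ≤ ‖x‖ := fun j => PiLp.norm_apply_le x j
  conv_lhs => rw [sum_coordDir x, map_sum]
  refine (norm_sum_le _ _).trans ((Finset.sum_le_card_nsmul _ _ (2 * b * ‖x‖) fun j _ => ?_).trans
    (le_of_eq ?_))
  · rw [map_add, map_smul, map_smul]
    refine (norm_add_le _ _).trans ?_
    rw [norm_smul, norm_smul]
    have h1 := (Complex.abs_re_le_norm (x j)).trans (hx j)
    have h2 := (Complex.abs_im_le_norm (x j)).trans (hx j)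
    have h3 := mul_le_mul h1 (h (j, 0)) (norm_nonneg _) (norm_nonneg x)
    have h4 := mul_le_mul h2 (h (j, 1)) (norm_nonneg _) (norm_nonneg x)
    rw [Real.norm_eq_abs, Real.norm_eq_abs]
    linarith
  · rw [Finset.card_univ, Fintype.card_fin, nsmul_eq_mul]; ring

lemma one_div_one_add_rpow_le {r q q' : ℝ} (hr : 0 ≤ r) (hq' : 0 ≤ q') (h : q' ≤ q) (h3 : q' ≤ 3) :
    1 / (1 + r ^ q) ≤ 8 * (1 + r) ^ (-q') := by
  have h2 : (2 : ℝ) ^ q' ≤ 8 := by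
    calc (2 : ℝ) ^ q' ≤ 2 ^ (3 : ℝ) := Real.rpow_le_rpow_of_exponent_le (by norm_num) h3
      _ = 8 := by norm_num
  have h1 : (1 + r) ^ q' ≤ 8 * (1 + r ^ q) := by
    have hrq : 0 ≤ r ^ q := by positivity
    rcases le_total r 1 with hr1 | hr1
    · calc (1 + r) ^ q' ≤ 2 ^ q' := by gcongr; linarith
        _ ≤ 8 * (1 + r ^ q) := by linarith
    · calc (1 + r) ^ q' ≤ (2 * r) ^ q' := by gcongr; linarith
        _ = 2 ^ q' * r ^ q' := Real.mul_rpow (by norm_num) hr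
        _ ≤ 8 * r ^ q := by gcongr
        _ ≤ _ := by linarith
  rw [Real.rpow_neg (by positivity), div_le_iff₀ (by positivity), mul_right_comm,
    ← div_eq_mul_inv, le_div_iff₀ (by positivity), one_mul]
  exact h1

section
variable {N : Seminorm ℝ (EndR n)} {θ lam : ℝ} {K : ℕ} {J : Cn n → EndR n}

lemma DecayConditions.norm_sub_le (H : DecayConditions N θ K lam J) {c : ℝ} (hc : 0 ≤ c)
    (hN : ∀ A, ‖A‖ ≤ c * N A) (z : Cn n) :
    ‖J z - stdJ (Cn n)‖ ≤ c * lam * (1 / (1 + ‖z‖ ^ θ)) := by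
  have h := H.low 0 zero_le_one Fin.elim0 z
  rw [partialD, partialD, iteratedFDeriv_zero_apply, iteratedFDeriv_zero_apply, Nat.cast_zero,
    zero_add] at h
  calc _ ≤ c * N (J z - stdJ (Cn n)) := hN _
    _ ≤ c * (lam / (1 + ‖z‖ ^ θ)) := by gcongr
    _ = _ := by ring

lemma DecayConditions.norm_fderiv_le (H : DecayConditions N θ K lam J) {c : ℝ} (hc : 0 ≤ c)
    (hlam : 0 ≤ lam) (hN : ∀ A, ‖A‖ ≤ c * N A) (z : Cn n) :
    ‖fderiv ℝ J z‖ ≤ 2 * n * (c * lam * (1 / (1 + ‖z‖ ^ (1 + θ)))) := by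
  refine opNorm_le_of_coordDir _ (by positivity) fun d => ?_
  have h := H.low 1 le_rfl (fun _ => d) z
  rw [partialD, partialD, iteratedFDeriv_one_apply, iteratedFDeriv_one_apply,
    fderiv_fun_const, Nat.cast_one] at h
  simp only [Pi.zero_apply, _root_.zero_apply, sub_zero] at h
  calc _ ≤ c * N (fderiv ℝ J z (coordDir d)) := hN _
    _ ≤ c * (lam / (1 + ‖z‖ ^ (1 + θ))) := by gcongr
    _ = _ := by ring

lemma contDiff_belt (hJ : ContDiff ℝ ∞ J) (h1 : ∀ z, ‖J z - stdJ (Cn n)‖ ≤ 1) :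
    ContDiff ℝ ∞ fun z => belt (J z) := by
  refine contDiff_iff_contDiffAt.2 fun z => ?_
  obtain ⟨u, hu⟩ := isUnit_stdJ_add (h1 z)
  have h2 : ContDiffAt ℝ ∞ (Ring.inverse : EndR n → EndR n) (stdJ (Cn n) + J z) := by
    rw [← hu]; exact contDiffAt_ringInverse ℝ u
  have h3 : ContDiffAt ℝ ∞ (fun z => Ring.inverse (stdJ (Cn n) + J z)) z :=
    ContDiffAt.comp (g := Ring.inverse) (f := fun z => stdJ (Cn n) + J z) z h2
      (contDiffAt_const.add hJ.contDiffAt)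
  exact h3.mul (contDiffAt_const.sub hJ.contDiffAt)

/-- The derivative inherits the Lipschitz constant 2 of `belt` on the unit ball around `i`. -/
lemma norm_fderiv_belt_le (hJ : ContDiff ℝ ∞ J) (h1 : ∀ z, ‖J z - stdJ (Cn n)‖ ≤ 1) (z : Cn n) :
    ‖fderiv ℝ (fun z => belt (J z)) z‖ ≤ 2 * ‖fderiv ℝ J z‖ := by
  have hd := (contDiff_belt hJ h1).differentiable (by simp) z
  refine le_of_forall_pos_le_add fun ε hε => ?_
  refine hd.hasFDerivAt.le_of_lip' (by positivity) ?_
  have ho := ((hJ.differentiable (by simp) z).hasFDerivAt.isLittleO).def (half_pos hε)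
  filter_upwards [ho] with x hx
  have h2 : ‖J x - J z‖ ≤ (‖fderiv ℝ J z‖ + ε / 2) * ‖x - z‖ := by
    have e : J x - J z = (J x - J z - fderiv ℝ J z (x - z)) + fderiv ℝ J z (x - z) := by abel
    rw [e]
    refine (norm_add_le _ _).trans ?_
    linarith [(fderiv ℝ J z).le_opNorm (x - z)]
  linarith [norm_belt_sub_le (h1 x) (h1 z)]

/-- The decay orders `θ` and `1 + θ` are weakened to `1 + 4s` and `2 + 4s`, both at most 3, at the
cost of a factor 8. The factor `32n` for the derivative is `2 · 2n · 8`: the Lipschitz constant of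
`belt`, the number of real directions, and this 8. -/
lemma DecayConditions.coeff (H : DecayConditions N θ K lam J) (hJ : IsAlmostComplex J) {c : ℝ}
    (hc : 0 < c) (hN : ∀ A, ‖A‖ ≤ c * N A) (hlam : 0 ≤ lam) (hs : 0 < s) (hs1 : s ≤ 1 / 4)
    (hsθ : 1 + 4 * s ≤ θ) (hcl : c * lam ≤ 1) :
    (∀ z, ‖J z - stdJ (Cn n)‖ ≤ 1) ∧ Coeff s (32 * c * (n + 1) * lam) fun z => belt (J z) := by
  have h0 := H.norm_sub_le hc.le hN
  have h1 : ∀ z, ‖J z - stdJ (Cn n)‖ ≤ 1 := fun z => by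
    refine (h0 z).trans (mul_le_one₀ hcl (by positivity) ?_)
    rw [div_le_one (by positivity)]
    linarith [Real.rpow_nonneg (norm_nonneg z) θ]
  refine ⟨h1, contDiff_belt hJ.smooth h1, fun z a x => belt_smul (h1 z) (hJ.sq z) a x,
    fun z => ?_, fun z => ?_⟩
  · have h2 := one_div_one_add_rpow_le (norm_nonneg z) (by linarith : (0 : ℝ) ≤ 1 + 4 * s) hsθ
      (by linarith)
    have hp : 0 ≤ (1 + ‖z‖) ^ (-(1 + 4 * s)) := by positivity
    calc _ ≤ c * lam * (1 / (1 + ‖z‖ ^ θ)) := (norm_belt_le (h1 z)).trans (h0 z)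
      _ ≤ c * lam * (8 * (1 + ‖z‖) ^ (-(1 + 4 * s))) := by gcongr
      _ = (8 * 1) * (c * lam * (1 + ‖z‖) ^ (-(1 + 4 * s))) := by ring
      _ ≤ (32 * (n + 1)) * (c * lam * (1 + ‖z‖) ^ (-(1 + 4 * s))) := by
        gcongr
        · norm_num
        · linarith [n.cast_nonneg (α := ℝ)]
      _ = _ := by ring
  · have h2 := one_div_one_add_rpow_le (norm_nonneg z) (by linarith : (0 : ℝ) ≤ 2 + 4 * s)
      (by linarith : 2 + 4 * s ≤ 1 + θ) (by linarith)
    have hp : 0 ≤ (1 + ‖z‖) ^ (-(2 + 4 * s)) := by positivity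
    calc _ ≤ 2 * (2 * n * (c * lam * (1 / (1 + ‖z‖ ^ (1 + θ))))) :=
          (norm_fderiv_belt_le hJ.smooth h1 z).trans
            (mul_le_mul_of_nonneg_left (H.norm_fderiv_le hc.le hlam hN z) (by norm_num))
      _ ≤ 2 * (2 * n * (c * lam * (8 * (1 + ‖z‖) ^ (-(2 + 4 * s))))) := by gcongr
      _ = (32 * n) * (c * lam * (1 + ‖z‖) ^ (-(2 + 4 * s))) := by ring
      _ ≤ (32 * (n + 1)) * (c * lam * (1 + ‖z‖) ^ (-(2 + 4 * s))) := by
        gcongr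
        linarith
      _ = _ := by ring

end

/-! The complex lines. -/

lemma fderiv_eq_add_dz_dzb (L : ℂ → Cn n) (ζ : ℂ) :
    fderiv ℝ L ζ 1 = dz L ζ + dzb L ζ ∧ fderiv ℝ L ζ Complex.I = Complex.I • (dz L ζ - dzb L ζ) := by
  constructor
  · rw [dz, dzb]; module
  · have e : fderiv ℝ L ζ 1 - Complex.I • fderiv ℝ L ζ Complex.I - (fderiv ℝ L ζ 1 +
      Complex.I • fderiv ℝ L ζ Complex.I) = (-2 * Complex.I) • fderiv ℝ L ζ Complex.I := by module
    rw [dz, dzb, ← smul_sub, e, smul_smul, smul_smul,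
      show Complex.I * 2⁻¹ * (-2 * Complex.I) = 1 by linear_combination (-1 : ℂ) * Complex.I_sq,
      one_smul]

lemma isComplexLine_of_dzb_eq {J : Cn n → EndR n} (hJ : IsAlmostComplex J)
    (h1 : ∀ z, ‖J z - stdJ (Cn n)‖ ≤ 1) {L : ℂ → Cn n} (hL : ContDiff ℝ ∞ L)
    (h : ∀ ζ, dzb L ζ = belt (J (L ζ)) (dz L ζ)) : IsComplexLine J L := by
  refine ⟨hL, fun ζ => ?_⟩
  obtain ⟨e1, e2⟩ := fderiv_eq_add_dz_dzb L ζ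
  have hI : fderiv ℝ L ζ Complex.I = J (L ζ) (fderiv ℝ L ζ 1) := by
    rw [e1, e2]; exact belt_eq_iff (h1 _) (h ζ)
  have hI' : J (L ζ) (fderiv ℝ L ζ Complex.I) = -fderiv ℝ L ζ 1 := by
    rw [hI]; exact DFunLike.congr_fun (hJ.sq (L ζ)) _
  refine ContinuousLinearMap.ext fun w => ?_
  have ew : w = w.re • (1 : ℂ) + w.im • Complex.I := by
    apply Complex.ext <;> simp
  have ew' : stdJ ℂ w = w.re • Complex.I - w.im • (1 : ℂ) := by
    change Complex.I * w = _
    apply Complex.ext <;> simp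
  rw [ContinuousLinearMap.comp_apply, ContinuousLinearMap.comp_apply, ew', map_sub, map_smul,
    map_smul, hI]
  conv_rhs => rw [ew, map_add, map_smul, map_smul, map_add, map_smul, map_smul, hI']
  rw [smul_neg, sub_eq_add_neg]

-- Once the line is known to be smooth, its weak derivatives are the classical ones, so the equation
-- holds almost everywhere, and everywhere by continuity.
open Morrey BoundedContinuousFunction in
lemma IsSol.dzb_line {M : ℝ} {Q : Cn n → EndR n} {hs : 0 < s} {hs1 : s ≤ 1 / 4}
    (hQ : Coeff s M Q) (hκ : kap n hs hs1 * M ≤ 1 / 64) {v : Cn n}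
    (hv : ‖v‖ = 1) {y : (ℂ →ᵇ Cn n) × Morrey s n} (H : IsSol hs hs1 Q v y) (ζ : ℂ) :
    dzb (line v y) ζ = Q (line v y ζ) (dz (line v y) ζ) := by
  have hL := H.contDiff_line hQ hκ hv
  have hb1 : v ∈ Metric.closedBall v (1 / 2) := Metric.mem_closedBall_self (by norm_num)
  have hlin : ContDiff ℝ ∞ fun ζ : ℂ => ζ • v := by fun_prop
  have hu : ContDiff ℝ ∞ y.1 := by
    have : (y.1 : ℂ → Cn n) = fun ζ => line v y ζ - ζ • v := by
      funext ζ; rw [line]; abel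
    rw [this]; exact hL.sub hlin
  have hL1 : ContDiff ℝ 1 (line v y) := hL.of_le (by exact_mod_cast le_top)
  obtain ⟨e1, e2⟩ := (H.weakD hQ hv hb1).ae_eq hu
  have hu' : Differentiable ℝ y.1 := hu.differentiable (by simp)
  have hf : ∀ ζ : ℂ, HasFDerivAt (fun ζ : ℂ => ζ • v) ((ContinuousLinearMap.id ℝ ℂ).smulRight v) ζ :=
    fun ζ => (hasFDerivAt_id ζ).smul_const v
  have hfl : ∀ ζ, fderiv ℝ (line v y) ζ =
      (ContinuousLinearMap.id ℝ ℂ).smulRight v + fderiv ℝ y.1 ζ := fun ζ =>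
    ((hf ζ).add (hu' ζ).hasFDerivAt).fderiv
  have d1 : ∀ ζ, dz (line v y) ζ = v + dz y.1 ζ := fun ζ => by
    rw [dz, dz, hfl]
    simp only [_root_.add_apply, ContinuousLinearMap.smulRight_apply, ContinuousLinearMap.id_apply,
      smul_add, smul_smul, Complex.I_mul_I]
    module
  have d2 : ∀ ζ, dzb (line v y) ζ = dzb y.1 ζ := fun ζ => by
    rw [dzb, dzb, hfl]
    simp only [_root_.add_apply, ContinuousLinearMap.smulRight_apply, ContinuousLinearMap.id_apply,
      smul_add, smul_smul, Complex.I_mul_I]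
    module
  have hae : dzb (line v y) =ᵐ[volume] fun ζ => Q (line v y ζ) (dz (line v y) ζ) := by
    filter_upwards [e1, e2] with ζ h1 h2
    rw [d2, d1, ← h1, ← h2]; rfl
  have := (Continuous.ae_eq_iff_eq volume (continuous_dzb hL1)
    ((hQ.smooth.continuous.comp hL.continuous).clm_apply (continuous_dz hL1))).1 hae
  exact congrFun this ζ

end JLines

theorem mainTheorem2 (n : ℕ) (N : Seminorm ℝ (JLines.EndR n)) (hN : ∀ M, N M = 0 → M = 0)
    (θ : ℝ) (hθ : 1 < θ) (K : ℕ) (hK : 1 ≤ K) :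
    ∃ lam₀ > 0, ∃ C > 0, ∀ lam : ℝ, 0 < lam → lam ≤ lam₀ →
      ∀ J : JLines.Cn n → JLines.EndR n,
        JLines.IsAlmostComplex J → JLines.DecayConditions N θ K lam J →
        ∃ L : JLines.Cn n → ℂ → JLines.Cn n,
          (∀ v, ‖v‖ = 1 →
            JLines.IsComplexLine J (L v) ∧ ∀ ζ : ℂ, ‖L v ζ - ζ • v‖ ≤ C * lam) ∧
          (Metric.ball 0 1)ᶜ ⊆ {p | ∃ v, ‖v‖ = 1 ∧ ∃ ζ : ℂ, L v ζ = p} := by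
  open JLines in
  obtain ⟨c, hc, hcN⟩ := exists_norm_le_seminorm N hN
  -- The excess `θ - 1` is shared out among the four powers of `s` in the weights; `s ≤ 1/4` is the
  -- range in which the estimates were made.
  obtain ⟨s, hs, hs1, hsθ⟩ : ∃ s : ℝ, 0 < s ∧ s ≤ 1 / 4 ∧ 1 + 4 * s ≤ θ :=
    ⟨min ((θ - 1) / 4) (1 / 4), lt_min (by linarith) (by norm_num), min_le_right _ _, by
      linarith [min_le_left ((θ - 1) / 4) (1 / 4 : ℝ)]⟩
  have hκ0 := kap_nonneg n hs hs1
  set B : ℝ := 32 * c * (n + 1) with hB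
  have hB0 : 0 < B := by positivity
  -- The coefficient has size `Bλ`, so the solution has norm at most `kap * Bλ`. Adding 1 to `kap`
  -- keeps both constants meaningful if `kap` is zero, and also yields `cλ ≤ 1`, since `B ≥ 32c`.
  refine ⟨1 / (64 * B * (kap n hs hs1 + 1)), by positivity, (kap n hs hs1 + 1) * B,
    by positivity, fun lam hlam hle J hJ H => ?_⟩
  have hsmall : (kap n hs hs1 + 1) * (B * lam) ≤ 1 / 64 := by
    rw [le_div_iff₀ (by positivity)] at hle
    linarith
  have hBl : 0 ≤ B * lam := by positivity
  have hκ : kap n hs hs1 * (B * lam) ≤ 1 / 64 := by linarith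
  have hcl : c * lam ≤ 1 := by
    have h1 : 0 ≤ kap n hs hs1 * (B * lam) := mul_nonneg hκ0 hBl
    have h2 : 0 ≤ (n : ℝ) * (c * lam) := by positivity
    have h3 : B * lam = 32 * (c * lam) + 32 * (n * (c * lam)) := by rw [hB]; ring
    linarith
  obtain ⟨hJ1, hQ⟩ := H.coeff hJ hc hcN hlam.le hs hs1 hsθ hcl
  choose! Y hY using fun (v : Cn n) (hv : ‖v‖ = 1) =>
    exists_isSol hQ hs hs1 hκ hv (Metric.mem_closedBall_self (by norm_num : (0 : ℝ) ≤ 1 / 2))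
  refine ⟨fun v => line v (Y v), fun v hv => ⟨?_, fun ζ => ?_⟩, fun p hp => ?_⟩
  · exact isComplexLine_of_dzb_eq hJ hJ1 ((hY v hv).contDiff_line hQ hκ hv)
      ((hY v hv).dzb_line hQ hκ hv)
  · have h1 := (hY v hv).norm_le' hQ hv (Metric.mem_closedBall_self (by norm_num))
    have h2 := ((Y v).1.norm_coe_le_norm ζ).trans ((norm_fst_le (Y v)).trans h1)
    have e : line v (Y v) ζ - ζ • v = (Y v).1 ζ := add_sub_cancel_left _ _
    change ‖line v (Y v) ζ - ζ • v‖ ≤ _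
    rw [e]
    linarith
  · have hp1 : 1 ≤ ‖p‖ := by simpa using hp
    exact exists_line_through hQ hκ hY hp1
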